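/- Let $K$ be a number field of degree $n$ with $r_2$ complex places, class number $h$, regulator $R$, unit rank $r$, $w$ roots of unity, absolute value of the discriminant $d_K$ and Dedekind zeta function $\zeta_K$. For a prime $\mathfrak p$ of local degree $n_{\mathfrak p}=e_{\mathfrak p}f_{\mathfrak p}$ put $|x|_{\mathfrak p}=\mathrm{Nm}\,\mathfrak p^{-\mathrm{ord}_{\mathfrak p}(x)/n_{\mathfrak p}}$; for an archimedean place $v$, given by an embedding $\sigma$, put $|x|_v=|\sigma(x)|$ and $n_v=1$ or $2$ according as $v$ is real or complex. Write $K_v$ for the completions and $|\cdot|_v$ also for the maximum of the absolute values of the entries of a tuple. Let $H$ be the absolute multiplicative height, $H(x)=\prod_v|x|_v^{n_v/n}$. Let $m\ge 1$, $d\ge 1$, and let $f:\mathbf P^m\to\mathbf P^M$ be a morphism of degree $d$ over $K$, with lift $F=(F_0,\dots,F_M)$: forms of degree $d$ over $K$ in $m+1$ variables without common nontrivial zero over $\overline K$. Let $|F|_v$ be the maximum of the absolute values of the coefficients $F_{j,\alpha}$ and $H(f)=H((F_{j,\alpha})_{j,\alpha})$. For archimedean $v$ put $D_{f,v}=\{z\in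 K_v^{m+1}:|F(z)|_v\le|F|_v\}$ and let $c_{K,v}(f)$ be its Lebesgue measure (with $K_v=\mathbf R$ or $\mathbf C\cong\mathbf R^2$). For nonarchimedean $v$ let $O_v^{m+1}=\{z\in K_v^{m+1}:|z|_v\le 1\}$, let $\mu_v$ be the Haar measure on $K_v^{m+1}$ with $\mu_v(O_v^{m+1})=1$, and put $$c_{K,v}(f)=\int_{O_v^{m+1}}\Big(\frac{|z|_v|F|_v^{1/d}}{|F(z)|_v^{1/d}}\Big)^{n_v(m+1)}d\mu_v(z).$$ Put $c_{K,\infty}(f)=\prod_{v\mid\infty}c_{K,v}(f)$, $c_{K,0}(f)=\prod_{v\nmid\infty}c_{K,v}(f)$ and $$c_K(f)=\frac{hR(m+1)^r}{w\,\zeta_K(m+1)}\Big(\frac{2^{r_2}}{\sqrt{d_K}}\Big)^{m+1}\frac{c_{K,\infty}(f)\,c_{K,0}(f)}{H(f)^{n(m+1)/d}}.$$ The volumes and integrals are finite, and $c_{K,v}(f)=1$ for all but finitely many nonarchimedean $v$. There exist real numbers $C_v$, one for each place $v$, such that $$\frac{|z|_v|F|_v^{1/d}}{|F(z)|_v^{1/d}}\le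 C_v\quad\text{for all nonzero }z\in K_v^{m+1},\qquad C_v=1\text{ for all but finitely many }v;$$ given any such constants put $C_f^0=\prod_{v\nmid\infty}C_v^{n_v}$ and $C_f^\infty=\max_{v\mid\infty}C_v$. There exist a positive integer $N_f$ and a real number $L_f$ such that for every $v\mid\infty$ the boundary $\partial D_{f,v}=\{z\in K_v^{m+1}:|F(z)|_v=|F|_v\}$ is covered by the images of at most $N_f$ maps $[0,1]^{n_v(m+1)-1}\to K_v^{m+1}$ with Lipschitz constant at most $L_f$ (for the Euclidean norms). For every $X\ge0$ the set of $P\in\mathbf P^m(K)$ with $H(f(P))\le X$ is finite. Moreover, there is a constant $A>0$ depending only on $m$ and $K$ such that for all $M$, $d$, $f$, all pairs $(N_f,L_f)$ and all families $(C_v)$ as above, and all $X\ge0$, $$\#\{P\in\mathbf P^m(K):H(f(P))\le X\}=c_K(f)X^{n(m+1)/d}+E(X)$$ with $$|E(X)|\le A\bigg(N_f^n\,c_{K,0}(f)(C_f^0)^{d/n}\Big(\frac{L_f+C_f^\infty}{H(f)^{1/d}}X^{1/d}\Big)^{n(m+1)-1}(1+\log^+X^{1/d})+\big(N_f^n(C_f^0)^{d(m+1)}+c_K(f)\big)X^{n/d}\bigg).$$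 Here $\log^+X^{1/d}$ may be replaced by $0$ if $nm>1$, and $C_f^\infty$ may be replaced by $0$ if $r=0$. -/

import Mathlib

open NumberField IsDedekindDomain MeasureTheory

noncomputable section

namespace SchanuelMorphism

/-! ### Compactness of the nonarchimedean unit polydisc -/

section Compactness

variable {K : Type*} [Field K] [NumberField K] (v : HeightOneSpectrum (𝓞 K))

theorem exists_integer_near (x : v.adicCompletion K) (hx : Valued.v x ≤ 1) :
    ∃ r : 𝓞 K, Valued.v (x - ((algebraMap (𝓞 K) K r : K) : v.adicCompletion K)) < 1 := by
  obtain ⟨k, hk⟩ : ∃ k : K, Valued.v (x - (k : v.adicCompletion K)) < 1 := by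
    have ho : IsOpen {y : v.adicCompletion K | Valued.v (x - y) < 1} := by
      have := (Valued.isOpen_ball (R := v.adicCompletion K) 1).preimage
        ((continuous_const (y := x)).sub continuous_id)
      simpa using this
    obtain ⟨k, hk⟩ :=
      (HeightOneSpectrum.denseRange_algebraMap (R := 𝓞 K) (K := K) v).exists_mem_open ho
        ⟨x, by simp⟩
    exact ⟨k, hk⟩
  have hk1 : v.valuation K k ≤ 1 := by
    rw [← HeightOneSpectrum.valuedAdicCompletion_eq_valuation' v k]
    have := Valuation.map_sub (Valued.v (R := v.adicCompletion K)) x (x - k)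
    rw [sub_sub_cancel] at this
    exact this.trans (max_le hx hk.le)
  obtain ⟨r, hr⟩ := v.exists_valuation_sub_lt_of_integer hk1 1
  refine ⟨r, ?_⟩
  have h2 : Valued.v ((k : v.adicCompletion K) -
      ((algebraMap (𝓞 K) K r : K) : v.adicCompletion K)) < 1 := by
    rw [Valuation.map_sub_swap]
    have : (((algebraMap (𝓞 K) K r : K) : v.adicCompletion K) - (k : v.adicCompletion K))
        = ((algebraMap (𝓞 K) K r - k : K) : v.adicCompletion K) :=
      ((algebraMap K (v.adicCompletion K)).map_sub _ _).symm
    rw [this, HeightOneSpectrum.valuedAdicCompletion_eq_valuation']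
    simpa using hr
  have := Valuation.map_add_lt (Valued.v (R := v.adicCompletion K)) hk h2
  simpa using this

open scoped Valued in
theorem finite_residueField : Finite 𝓀[v.adicCompletion K] := by
  have hfin : Finite (𝓞 K ⧸ v.asIdeal) := v.asIdeal.finiteQuotientOfFreeOfNeBot v.ne_bot
  let g : 𝓞 K →+* 𝒪[v.adicCompletion K] :=
    ((algebraMap K (v.adicCompletion K)).comp (algebraMap (𝓞 K) K)).codRestrict _ fun r => by
      exact v.coe_mem_adicCompletionIntegers (K := K) r
  have hmax : ∀ a : 𝒪[v.adicCompletion K], Valued.v (a : v.adicCompletion K) < 1 →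
      a ∈ IsLocalRing.maximalIdeal 𝒪[v.adicCompletion K] := fun a ha =>
    (Valuation.mem_maximalIdeal_iff (v := (Valued.v (R := v.adicCompletion K))) (a := a)).2 ha
  let φ : 𝓞 K →+* 𝓀[v.adicCompletion K] := (IsLocalRing.residue _).comp g
  have hker : ∀ r ∈ v.asIdeal, φ r = 0 := by
    intro r hr
    simp only [φ, RingHom.comp_apply]
    rw [IsLocalRing.residue_eq_zero_iff]
    apply hmax
    change Valued.v ((algebraMap (𝓞 K) K r : K) : v.adicCompletion K) < 1
    rw [HeightOneSpectrum.valuedAdicCompletion_eq_valuation']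
    exact (v.valuation_lt_one_iff_mem r).2 hr
  refine Finite.of_surjective (Ideal.Quotient.lift v.asIdeal φ hker) ?_
  intro y
  obtain ⟨x, rfl⟩ := IsLocalRing.residue_surjective y
  obtain ⟨r, hr⟩ := exists_integer_near v x x.2
  refine ⟨Ideal.Quotient.mk _ r, ?_⟩
  rw [Ideal.Quotient.lift_mk]
  simp only [φ, RingHom.comp_apply]
  rw [← sub_eq_zero, ← map_sub, IsLocalRing.residue_eq_zero_iff]
  apply hmax
  change Valued.v (((algebraMap (𝓞 K) K r : K) : v.adicCompletion K) - x) < 1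
  rwa [Valuation.map_sub_swap]

open scoped Valued in
theorem isCompact_integers :
    IsCompact (v.adicCompletionIntegers K : Set (v.adicCompletion K)) := by
  have h1 : IsDiscreteValuationRing 𝒪[v.adicCompletion K] :=
    inferInstanceAs (IsDiscreteValuationRing (v.adicCompletionIntegers K))
  have h2 : CompleteSpace 𝒪[v.adicCompletion K] :=
    (Valued.isClosed_integer (v.adicCompletion K)).completeSpace_coe
  have h3 := Valued.integer.compactSpace_iff_completeSpace_and_isDiscreteValuationRing_and_finite_residueField.2
    ⟨h2, h1, finite_residueField v⟩
  exact isCompact_iff_compactSpace.2 h3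

end Compactness

/-! ### Local absolute values and measures -/

section Local

variable {K : Type*} [Field K] [NumberField K]

/-- The maximum of `a (z i)` over the entries of a tuple, for an absolute value `a`. -/
def maxAbs {ι L : Type*} (a : L → ℝ) (z : ι → L) : ℝ := ⨆ i, a (z i)

/-- The standard absolute value at an archimedean place. -/
def archAbs (v : InfinitePlace K) (x : v.Completion) : ℝ := ‖x‖

/-- The local degree `e f` at a nonarchimedean place. -/
def localDegree (v : HeightOneSpectrum (𝓞 K)) : ℕ :=
  v.asIdeal.ramificationIdx ℤ * v.asIdeal.inertiaDeg ℤ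

/-- The standard absolute value at a nonarchimedean place, `Nm 𝔭 ^ (-ord x / n_𝔭)`; Mathlib's norm
on the completion is `Nm 𝔭 ^ (-ord x)`. -/
def finAbs (v : HeightOneSpectrum (𝓞 K)) (x : v.adicCompletion K) : ℝ :=
  ‖x‖ ^ (1 / (localDegree v : ℝ))

/-- The Lebesgue measure of a subset of `K_v ^ (m + 1)`, `v` archimedean, where `K_v` is identified
with `ℝ` or `ℂ`. -/
def archVolume {m : ℕ} (v : InfinitePlace K) (S : Set (Fin (m + 1) → v.Completion)) : ENNReal :=
  open scoped Classical in
  if h : v.IsReal then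
    volume {x : Fin (m + 1) → ℝ |
      (fun i => (InfinitePlace.Completion.ringEquivRealOfIsReal h).symm (x i)) ∈ S}
  else
    volume {x : Fin (m + 1) → ℂ |
      (fun i => (InfinitePlace.Completion.ringEquivComplexOfIsComplex
        (InfinitePlace.not_isReal_iff_isComplex.1 h)).symm (x i)) ∈ S}

instance (m : ℕ) (v : HeightOneSpectrum (𝓞 K)) :
    MeasurableSpace (Fin (m + 1) → v.adicCompletion K) := borel _

instance (m : ℕ) (v : HeightOneSpectrum (𝓞 K)) :
    BorelSpace (Fin (m + 1) → v.adicCompletion K) := ⟨rfl⟩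

/-- The unit polydisc `O_v ^ (m + 1)` at a nonarchimedean place. -/
def unitPolydisc (m : ℕ) (v : HeightOneSpectrum (𝓞 K)) :
    TopologicalSpace.PositiveCompacts (Fin (m + 1) → v.adicCompletion K) where
  carrier := {z | ∀ i, z i ∈ v.adicCompletionIntegers K}
  isCompact' := by
    have := isCompact_univ_pi (fun _ : Fin (m + 1) => isCompact_integers v)
    simpa [Set.pi] using this
  interior_nonempty' := by
    have h : IsOpen {z : Fin (m + 1) → v.adicCompletion K |
        ∀ i, z i ∈ v.adicCompletionIntegers K} := by
      have := isOpen_set_pi (Set.finite_univ (α := Fin (m + 1)))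
        (fun i _ => Valued.isOpen_integer (v.adicCompletion K))
      simp only [Set.pi, Set.mem_univ, true_imp_iff] at this
      exact this
    rw [h.interior_eq]
    exact ⟨0, fun _ => zero_mem _⟩

/-- The Haar measure on `K_v ^ (m + 1)`, `v` nonarchimedean, giving the unit polydisc mass `1`. -/
def finHaar (m : ℕ) (v : HeightOneSpectrum (𝓞 K)) :
    Measure (Fin (m + 1) → v.adicCompletion K) :=
  Measure.addHaarMeasure (unitPolydisc m v)

/-- The cube `[0, 1] ^ k`. -/
def unitCube (k : ℕ) : Set (EuclideanSpace ℝ (Fin k)) := {s | ∀ i, s i ∈ Set.Icc (0 : ℝ) 1}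

/-- `S ⊆ K_v ^ (m + 1)` is covered by the images of `N` maps
`[0, 1] ^ (n_v (m + 1) - 1) → K_v ^ (m + 1)` with Lipschitz constant at most `B`, with respect to
the Euclidean norms. -/
def IsLipschitzClass {m : ℕ} (v : InfinitePlace K) (S : Set (Fin (m + 1) → v.Completion))
    (N : ℕ) (B : ℝ) : Prop :=
  ∃ φ : Fin N → EuclideanSpace ℝ (Fin (v.mult * (m + 1) - 1)) →
      EuclideanSpace v.Completion (Fin (m + 1)),
    (∀ i, ∀ s ∈ unitCube (v.mult * (m + 1) - 1), ∀ t ∈ unitCube (v.mult * (m + 1) - 1),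
      dist (φ i s) (φ i t) ≤ B * dist s t) ∧
    ∀ z ∈ S, ∃ i, ∃ s ∈ unitCube (v.mult * (m + 1) - 1), φ i s = WithLp.toLp 2 z

end Local

/-! ### Morphisms of projective spaces -/

/-- A lift of a degree `d` morphism `ℙ^m → ℙ^M` over `K`: forms of degree `d` in `m + 1` variables
without common zero over the algebraic closure. -/
structure MorphismLift (K : Type*) [Field K] (m M d : ℕ) where
  form : Fin (M + 1) → MvPolynomial (Fin (m + 1)) K
  isHomogeneous : ∀ j, (form j).IsHomogeneous d
  eq_zero_of_common_zero : ∀ z : Fin (m + 1) → AlgebraicClosure K,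
    (∀ j, MvPolynomial.aeval z (form j) = 0) → z = 0

/-- Pairs of a form and a multiindex of degree `d` in `m + 1` variables. -/
abbrev CoeffIndex (m M d : ℕ) : Type :=
  Fin (M + 1) × {α // α ∈ Finset.finsuppAntidiag (Finset.univ : Finset (Fin (m + 1))) d}

namespace MorphismLift

section Field

variable {K : Type*} [Field K] {m M d : ℕ} (F : MorphismLift K m M d)

/-- The values of the forms at a point over an extension field. -/
def eval {L : Type*} [Field L] [Algebra K L] (z : Fin (m + 1) → L) : Fin (M + 1) → L :=
  fun j => MvPolynomial.aeval z (F.form j)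

theorem eval_smul {L : Type*} [Field L] [Algebra K L] (c : L) (z : Fin (m + 1) → L) :
    F.eval (c • z) = c ^ d • F.eval z := by
  funext j
  simp only [eval, Pi.smul_apply, smul_eq_mul, MvPolynomial.aeval_def, MvPolynomial.eval₂_eq',
    Finset.mul_sum, mul_pow, Finset.prod_mul_distrib, Finset.prod_pow_eq_pow_sum]
  refine Finset.sum_congr rfl fun α hα => ?_
  have h := F.isHomogeneous j (MvPolynomial.mem_support_iff.1 hα)
  have h' : ∑ i, α i = d := by
    rw [← h, Finsupp.weight_apply, Finsupp.sum_fintype] <;> simp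
  rw [h']
  ring

theorem eval_ne_zero {z : Fin (m + 1) → K} (hz : z ≠ 0) : F.eval z ≠ 0 := by
  intro h
  apply hz
  have := F.eq_zero_of_common_zero (fun i => algebraMap K (AlgebraicClosure K) (z i)) fun j => by
    have hj : MvPolynomial.aeval z (F.form j) = 0 := congrFun h j
    exact (MvPolynomial.aeval_algebraMap_apply (B := AlgebraicClosure K) z (F.form j)).trans
      (by rw [hj, map_zero])
  funext i
  exact (algebraMap K (AlgebraicClosure K)).injective (by simpa using congrFun this i)

/-- The map on `K`-rational points. -/
def map : Projectivization K (Fin (m + 1) → K) → Projectivization K (Fin (M + 1) → K) :=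
  Projectivization.lift (fun z => Projectivization.mk K (F.eval z.1) (F.eval_ne_zero z.2)) <| by
    rintro ⟨a, ha⟩ ⟨b, hb⟩ t h
    exact (Projectivization.mk_eq_mk_iff' K _ _ _ _).2 ⟨t ^ d, by
      rw [← F.eval_smul]; exact congrArg _ h.symm⟩

/-- The list of all coefficients. -/
def coeffs : CoeffIndex m M d → K := fun p => (F.form p.1).coeff p.2.1

/-- `|F| = max |F_{j,α}|`. -/
def coeffAbs {L : Type*} [Field L] [Algebra K L] (a : L → ℝ) : ℝ :=
  maxAbs a fun p => algebraMap K L (F.coeffs p)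

/-- `|z| |F|^(1/d) / |F(z)|^(1/d)`. -/
def ratio {L : Type*} [Field L] [Algebra K L] (a : L → ℝ) (z : Fin (m + 1) → L) : ℝ :=
  maxAbs a z * F.coeffAbs a ^ (1 / (d : ℝ)) / maxAbs a (F.eval z) ^ (1 / (d : ℝ))

end Field

end MorphismLift

/-! ### Heights and constants -/

section Global

variable {K : Type*} [Field K] [NumberField K] {m M d : ℕ}

/-- The absolute height of a point of projective space; Mathlib's height is its `n`-th power. -/
def absHeight {ι : Type*} [Finite ι] (P : Projectivization K (ι → K)) : ℝ :=
  P.mulHeight ^ (1 / (Module.finrank ℚ K : ℝ))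

variable (K) in
/-- `c_K(m)`. -/
def schanuelConstant (m : ℕ) : ℝ :=
  (classNumber K * Units.regulator K * (m + 1) ^ Units.rank K) /
      (Units.torsionOrder K * (dedekindZeta K (m + 1)).re) *
    (2 ^ InfinitePlace.nrComplexPlaces K / √|(discr K : ℝ)|) ^ (m + 1)

namespace MorphismLift

variable (F : MorphismLift K m M d)

/-- `H(f)`, the absolute height of the tuple of coefficients. -/
def height : ℝ := Height.mulHeight F.coeffs ^ (1 / (Module.finrank ℚ K : ℝ))

/-- The set of rational points `P` with `H(f(P)) ≤ X`. -/
def points (X : ℝ) : Set (Projectivization K (Fin (m + 1) → K)) :=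
  {P | absHeight (F.map P) ≤ X}

/-- The local fundamental domain `D_{f,v}` at an archimedean place. -/
def archDomain (v : InfinitePlace K) : Set (Fin (m + 1) → v.Completion) :=
  {z | maxAbs (archAbs v) (F.eval z) ≤ F.coeffAbs (archAbs v)}

/-- The level set `|F(z)|_v = |F|_v` at an archimedean place. -/
def archBoundary (v : InfinitePlace K) : Set (Fin (m + 1) → v.Completion) :=
  {z | maxAbs (archAbs v) (F.eval z) = F.coeffAbs (archAbs v)}

/-- `c_{K,v}(f)` for archimedean `v`. -/
def archFactor (v : InfinitePlace K) : ℝ := (archVolume v (F.archDomain v)).toReal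

/-- The integrand of `c_{K,v}(f)` for nonarchimedean `v`. -/
def finIntegrand (v : HeightOneSpectrum (𝓞 K)) (z : Fin (m + 1) → v.adicCompletion K) : ℝ :=
  F.ratio (finAbs v) z ^ (localDegree v * (m + 1))

/-- `c_{K,v}(f)` for nonarchimedean `v`. -/
def finFactor (v : HeightOneSpectrum (𝓞 K)) : ℝ :=
  ∫ z in (unitPolydisc m v : Set (Fin (m + 1) → v.adicCompletion K)),
    F.finIntegrand v z ∂(finHaar m v)

/-- `c_{K,∞}(f)`. -/
def cInfty : ℝ := ∏ v : InfinitePlace K, F.archFactor v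

/-- `c_{K,0}(f)`. -/
def cZero : ℝ := ∏ᶠ v : HeightOneSpectrum (𝓞 K), F.finFactor v

/-- `c_K(f)`. -/
def mainConstant : ℝ :=
  schanuelConstant K m * (F.cInfty * F.cZero /
    F.height ^ ((Module.finrank ℚ K * (m + 1) : ℝ) / d))

/-- Constants `C_v`, one for each place, with `|z|_v |F|_v^(1/d) / |F(z)|_v^(1/d) ≤ C_v` for all
nonzero `z` in `K_v ^ (m + 1)`, and `C_v = 1` for all but finitely many `v`. -/
structure ErrorConstants where
  arch : InfinitePlace K → ℝ
  fin : HeightOneSpectrum (𝓞 K) → ℝ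
  ratio_le_arch : ∀ (v : InfinitePlace K) (z : Fin (m + 1) → v.Completion), z ≠ 0 →
    F.ratio (archAbs v) z ≤ arch v
  ratio_le_fin : ∀ (v : HeightOneSpectrum (𝓞 K)) (z : Fin (m + 1) → v.adicCompletion K), z ≠ 0 →
    F.ratio (finAbs v) z ≤ fin v
  finite_fin_ne_one : {v | fin v ≠ 1}.Finite

variable {F}

/-- `C_f^0`. -/
def ErrorConstants.zero (C : F.ErrorConstants) : ℝ :=
  ∏ᶠ v : HeightOneSpectrum (𝓞 K), C.fin v ^ localDegree v

/-- `C_f^∞`. -/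
def ErrorConstants.infty (C : F.ErrorConstants) : ℝ := ⨆ v : InfinitePlace K, C.arch v

end MorphismLift

end Global

end SchanuelMorphism

end

open SchanuelMorphism

noncomputable section

namespace SchanuelMorphism

/-! ### Lattice points in sets with Lipschitz boundary -/

section LatticeCount

/-! The proof follows Schanuel's method, with the maximum norms replaced by the norms `|F(z)|_v ^
(1/d)`. For every ideal class fix an ideal `a`. A rational point is then represented by an integral
tuple `z` generating one of these ideals, uniquely up to units. If the vector of archimedean gauges
`(|F(z)|_v / |F|_v) ^ (1/d)` is also required to lie in a fundamental cone for the units, only roots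
of unity remain, so every point is counted `w` times (`card_repSet`).

The height of `f(P)` is governed by the product of the gauges, the norm of `a`, and the
nonarchimedean distortions `|z|^d |F| / |F(z)|` (`mulHeight_eval`). By the Nullstellensatz these
distortions are bounded at each prime, and they equal `1` outside finitely many bad primes
(`finite_distortion`). At a bad prime, the ultrametric inequality makes the distortion of a
primitive tuple depend only on its residue modulo a power of the prime
(`distortion_eq_of_norm_sub_le`). On a residue class modulo the product `q` of these prime powers,
bounding the height therefore means bounding the product of the gauges. With `a` prime to `q`,
Möbius inversion over squarefree ideals `s` prime to `q` replaces "`z` generates `a`" by "`z` lies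
in `a s`" (`ncard_span_eq`). What remains is to count points of translates of `(a s q)^(m+1)` in
dilates of a bounded cone.

The lattice points are counted by comparing unit cells with the boundary
(`abs_ncard_int_sub_volume_le`). The boundary of the cone is parametrized by products of unit
spheres of the gauges and faces of a logarithmic box (`Gauge.exists_frontier_param`). The constants
are uniform in the ideal because every ideal has a basis balanced by units
(`exists_balanced_basis`). The volume (`Gauge.volume_cone`) reduces to one variable: the law of the
`(m+1)`-st power of a gauge is a multiple of the law of an absolute value, and taking this power
stretches the logarithmic box by `m+1` in each unit direction, which produces `(m+1)^r`.

In the summation, the residue weights add up to `Nm q ^ (m+1)` times `c_{K,0}(f)` times the inverse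
Euler factors at the bad primes (`ResidueData.sum_weight`), and the Möbius sum over ideals prime to
`q` cancels these factors, leaving `1 / ζ_K(m+1)` (`tsum_moebius_compl_mul`). The number of
squarefree ideals grows at most linearly, which controls the error terms; the logarithm comes from
the exponent `m + 1 - 1/n`, which equals `1` only for `n = m = 1`. Choosing `q` with `Nm q ≤
(C_f^0)^d` (`ErrorConstants.exists_residueData`) expresses the result through the given constants.
-/

theorem inter_frontier_nonempty {X : Type*} [TopologicalSpace X] {s t : Set X}
    (hs : IsPreconnected s) (h₁ : (s ∩ t).Nonempty) (h₂ : (s ∩ tᶜ).Nonempty) :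
    (s ∩ frontier t).Nonempty := by
  by_contra h
  have hfr : ∀ y ∈ s, y ∉ frontier t := fun y hy hy' => h ⟨y, hy, hy'⟩
  have h1 : ∀ y ∈ s, y ∈ t → y ∈ interior t := fun y hy hyt => by
    by_contra hi
    exact hfr y hy ⟨subset_closure hyt, hi⟩
  have h2 : ∀ y ∈ s, y ∉ t → y ∈ interior tᶜ := fun y hy hyt => by
    rw [interior_compl]
    intro hc
    exact hfr y hy ⟨hc, fun hi => hyt (interior_subset hi)⟩
  obtain ⟨y, _, hy1, hy2⟩ := hs (interior t) (interior tᶜ) isOpen_interior isOpen_interior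
    (fun y hy => (em (y ∈ t)).imp (h1 y hy) (h2 y hy))
    (h₁.imp fun y hy => ⟨hy.1, h1 y hy.1 hy.2⟩) (h₂.imp fun y hy => ⟨hy.1, h2 y hy.1 hy.2⟩)
  exact interior_subset hy2 (interior_subset hy1)

variable {ι κ J : Type*} [Fintype ι] [Fintype κ] [Fintype J]

/-- Relative to one fixed point of `P`, moving inside `P` costs at most `1` and moving inside a
closed cell at most `1` more. This confines each coordinate of the index to four consecutive
integers. -/
theorem finite_cells_meeting_small (P : Set (ι → ℝ)) (x : ι → ℝ)
    (hP : ∀ p ∈ P, ∀ q ∈ P, dist p q ≤ 1) :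
    {a : ι → ℤ | ∃ p ∈ P, ∀ i, p i - x i - a i ∈ Set.Icc (0 : ℝ) 1}.Finite ∧
    {a : ι → ℤ | ∃ p ∈ P, ∀ i, p i - x i - a i ∈ Set.Icc (0 : ℝ) 1}.ncard ≤
      4 ^ Fintype.card ι := by
  classical
  rcases P.eq_empty_or_nonempty with rfl | ⟨p₀, hp₀⟩
  · simp
  let B : Finset (ι → ℤ) := Fintype.piFinset fun i =>
    Finset.Icc (⌊p₀ i - x i⌋ - 2) (⌊p₀ i - x i⌋ + 1)
  have hsub : {a : ι → ℤ | ∃ p ∈ P, ∀ i, p i - x i - a i ∈ Set.Icc (0 : ℝ) 1} ⊆ B := by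
    rintro a ⟨p, hp, h⟩
    simp only [B, Finset.mem_coe, Fintype.mem_piFinset, Finset.mem_Icc]
    intro i
    have h1 := (dist_le_pi_dist p p₀ i).trans (hP p hp p₀ hp₀)
    rw [Real.dist_eq, abs_le] at h1
    obtain ⟨h2, h3⟩ := h i
    constructor
    · have : ((⌊p₀ i - x i⌋ : ℤ) : ℝ) ≤ p₀ i - x i := Int.floor_le _
      have h4 : ((⌊p₀ i - x i⌋ - 2 : ℤ) : ℝ) ≤ a i := by push_cast; linarith
      exact_mod_cast h4
    · have : a i - 1 ≤ ⌊p₀ i - x i⌋ := Int.le_floor.2 (by push_cast; linarith)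
      linarith
  refine ⟨B.finite_toSet.subset hsub, ?_⟩
  calc _ ≤ (B : Set (ι → ℤ)).ncard := Set.ncard_le_ncard hsub B.finite_toSet
    _ = 4 ^ Fintype.card ι := by
      rw [Set.ncard_coe_finset, Fintype.card_piFinset]
      have : ∀ i, (Finset.Icc (⌊p₀ i - x i⌋ - 2) (⌊p₀ i - x i⌋ + 1)).card = 4 := by
        intro i
        rw [Int.card_Icc]
        have : ⌊p₀ i - x i⌋ + 1 + 1 - (⌊p₀ i - x i⌋ - 2) = 4 := by ring
        rw [this]; rfl
      simp [this]

/-- Cut the parameter cube into `k ^ card κ` subcubes of side `1/k`; since `L ≤ k`, each has an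
image of diameter at most `1`. -/
theorem finite_cells_meeting_image (ψ : (κ → ℝ) → ι → ℝ) (L : ℝ) (k : ℕ) (hk : 0 < k)
    (hLk : L ≤ k)
    (hψ : ∀ s ∈ Set.Icc (0 : κ → ℝ) 1, ∀ t ∈ Set.Icc (0 : κ → ℝ) 1,
      dist (ψ s) (ψ t) ≤ L * dist s t) (x : ι → ℝ) :
    {a : ι → ℤ | ∃ s ∈ Set.Icc (0 : κ → ℝ) 1, ∀ i, ψ s i - x i - a i ∈ Set.Icc (0 : ℝ) 1}.Finite ∧
    {a : ι → ℤ | ∃ s ∈ Set.Icc (0 : κ → ℝ) 1,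
      ∀ i, ψ s i - x i - a i ∈ Set.Icc (0 : ℝ) 1}.ncard ≤
      k ^ Fintype.card κ * 4 ^ Fintype.card ι := by
  classical
  have hk' : (0 : ℝ) < k := Nat.cast_pos.2 hk
  let P : (κ → Fin k) → Set (ι → ℝ) := fun j =>
    ψ '' {s | s ∈ Set.Icc (0 : κ → ℝ) 1 ∧ ∀ i, s i ∈ Set.Icc ((j i : ℝ) / k) (((j i : ℝ) + 1) / k)}
  have hP : ∀ j, ∀ p ∈ P j, ∀ q ∈ P j, dist p q ≤ 1 := by
    rintro j _ ⟨s, ⟨hs, hs'⟩, rfl⟩ _ ⟨t, ⟨ht, ht'⟩, rfl⟩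
    have hd : dist s t ≤ 1 / k := by
      refine (dist_pi_le_iff (by positivity)).2 fun i => ?_
      have := Real.dist_le_of_mem_Icc (hs' i) (ht' i)
      refine this.trans_eq ?_
      ring
    calc _ ≤ L * dist s t := hψ s hs t ht
      _ ≤ k * (1 / k) := mul_le_mul hLk hd dist_nonneg hk'.le
      _ = 1 := by field_simp
  have hsub : {a : ι → ℤ | ∃ s ∈ Set.Icc (0 : κ → ℝ) 1,
        ∀ i, ψ s i - x i - a i ∈ Set.Icc (0 : ℝ) 1} ⊆
      ⋃ j : κ → Fin k, {a : ι → ℤ | ∃ p ∈ P j, ∀ i, p i - x i - a i ∈ Set.Icc (0 : ℝ) 1} := by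
    rintro a ⟨s, hs, ha⟩
    have hj : ∀ i, ∃ j : Fin k, s i ∈ Set.Icc ((j : ℝ) / k) (((j : ℝ) + 1) / k) := by
      intro i
      have h0 : 0 ≤ s i := hs.1 i
      have h1 : s i ≤ 1 := hs.2 i
      -- At the right endpoint the floor of `s i * k` is `k`, which is out of range, so the last
      -- interval is taken.
      by_cases h : s i = 1
      · refine ⟨⟨k - 1, by omega⟩, ?_⟩
        have : ((k - 1 : ℕ) : ℝ) = k - 1 := by rw [Nat.cast_sub hk]; simp
        simp only [this, h, Set.mem_Icc]
        constructor
        · rw [div_le_one hk']; linarith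
        · rw [le_div_iff₀ hk']; linarith
      · have hlt : s i < 1 := lt_of_le_of_ne h1 h
        refine ⟨⟨⌊s i * k⌋₊, ?_⟩, ?_⟩
        · rw [Nat.floor_lt (by positivity)]
          nlinarith
        · simp only [Set.mem_Icc]
          constructor
          · rw [div_le_iff₀ hk']; exact Nat.floor_le (by positivity)
          · rw [le_div_iff₀ hk']; exact (Nat.lt_floor_add_one _).le
    choose j hj using hj
    exact Set.mem_iUnion.2 ⟨j, ψ s, ⟨s, ⟨hs, hj⟩, rfl⟩, ha⟩
  have hfin := fun j => finite_cells_meeting_small (P j) x (hP j)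
  refine ⟨(Set.finite_iUnion fun j => (hfin j).1).subset hsub, ?_⟩
  refine (Set.ncard_le_ncard hsub (Set.finite_iUnion fun j => (hfin j).1)).trans ?_
  refine (Set.ncard_iUnion_le_of_fintype _).trans ?_
  refine (Finset.sum_le_card_nsmul _ _ _ fun j _ => (hfin j).2).trans ?_
  simp

/-- A cell is connected, so if it misses the frontier it lies inside `S` or outside. The number of
points and the volume both lie between the number of inner cells and that number plus the number of
cells meeting the frontier. -/
theorem abs_ncard_int_sub_volume_le (S : Set (ι → ℝ)) (hS : Bornology.IsBounded S)
    (ψ : J → (κ → ℝ) → ι → ℝ) (L : ℝ) (hL : 0 ≤ L)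
    (hψ : ∀ j, ∀ s ∈ Set.Icc (0 : κ → ℝ) 1, ∀ t ∈ Set.Icc (0 : κ → ℝ) 1,
      dist (ψ j s) (ψ j t) ≤ L * dist s t)
    (hcov : ∀ z ∈ frontier S, ∃ j, ∃ s ∈ Set.Icc (0 : κ → ℝ) 1, ψ j s = z) (x : ι → ℝ) :
    {a : ι → ℤ | (fun i => x i + a i) ∈ S}.Finite ∧
    |({a : ι → ℤ | (fun i => x i + a i) ∈ S}.ncard : ℝ) - (volume S).toReal| ≤
      Fintype.card J * ((L + 2) ^ Fintype.card κ * 4 ^ Fintype.card ι) := by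
  classical
  -- The extra `1` keeps `k` positive when `L = 0`, at the price of `k ≤ L + 2`.
  set k : ℕ := ⌈L⌉₊ + 1 with hk
  have hLk : L ≤ k := (Nat.le_ceil L).trans (by rw [hk]; push_cast; linarith)
  have hkL : (k : ℝ) ≤ L + 2 := by
    rw [hk]; push_cast; linarith [Nat.ceil_lt_add_one hL]
  -- Closed cells serve for the connectedness argument, half-open cells for the disjoint
  -- decomposition of the volume.
  let ccell : (ι → ℤ) → Set (ι → ℝ) := fun a =>
    Set.Icc (fun i => x i + a i) (fun i => x i + a i + 1)
  let cell : (ι → ℤ) → Set (ι → ℝ) := fun a =>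
    Set.univ.pi fun i => Set.Ico (x i + a i) (x i + a i + 1)
  have hcc : ∀ a, cell a ⊆ ccell a := fun a y hy =>
    ⟨fun i => (hy i trivial).1, fun i => (hy i trivial).2.le⟩
  have hmem : ∀ a, (fun i => x i + a i) ∈ ccell a := fun a =>
    ⟨le_rfl, fun i => by simp⟩
  have hvol : ∀ a, volume (cell a) = 1 := fun a => by
    simp [cell, volume_pi_pi, Real.volume_Ico]
  have hmeas : ∀ a, MeasurableSet (cell a) := fun a =>
    MeasurableSet.univ_pi fun i => measurableSet_Ico
  have hdisj : Pairwise fun a b => Disjoint (cell a) (cell b) := by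
    intro a b hab
    rw [Set.disjoint_left]
    intro y ha hb
    apply hab
    funext i
    have h1 := ha i trivial
    have h2 := hb i trivial
    have h3 : (a i : ℝ) < b i + 1 := by linarith [h1.1, h2.2]
    have h4 : (b i : ℝ) < a i + 1 := by linarith [h2.1, h1.2]
    have h3' : a i < b i + 1 := by exact_mod_cast h3
    have h4' : b i < a i + 1 := by exact_mod_cast h4
    omega
  have hcover : ∀ y : ι → ℝ, ∃ a, y ∈ cell a := fun y =>
    ⟨fun i => ⌊y i - x i⌋, fun i _ => ⟨by linarith [Int.floor_le (y i - x i)],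
      by linarith [Int.lt_floor_add_one (y i - x i)]⟩⟩
  set Bd : Set (ι → ℤ) := {a | (frontier S ∩ ccell a).Nonempty} with hBd
  set pts : Set (ι → ℤ) := {a | (fun i => x i + a i) ∈ S} with hpts
  have hBdsub : Bd ⊆ ⋃ j, {a : ι → ℤ | ∃ s ∈ Set.Icc (0 : κ → ℝ) 1,
      ∀ i, ψ j s i - x i - a i ∈ Set.Icc (0 : ℝ) 1} := by
    rintro a ⟨z, hz, hza⟩
    obtain ⟨j, s, hs, rfl⟩ := hcov z hz
    refine Set.mem_iUnion.2 ⟨j, s, hs, fun i => ⟨?_, ?_⟩⟩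
    · have : x i + a i ≤ ψ j s i := hza.1 i
      linarith
    · have : ψ j s i ≤ x i + a i + 1 := hza.2 i
      linarith
  have himg := fun j => finite_cells_meeting_image (ψ j) L k (by omega) hLk (hψ j) x
  have hBdfin : Bd.Finite := (Set.finite_iUnion fun j => (himg j).1).subset hBdsub
  have hBdcard : (Bd.ncard : ℝ) ≤
      Fintype.card J * ((L + 2) ^ Fintype.card κ * 4 ^ Fintype.card ι) := by
    have h1 : Bd.ncard ≤ Fintype.card J * (k ^ Fintype.card κ * 4 ^ Fintype.card ι) := by
      refine (Set.ncard_le_ncard hBdsub (Set.finite_iUnion fun j => (himg j).1)).trans ?_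
      refine (Set.ncard_iUnion_le_of_fintype _).trans ?_
      refine (Finset.sum_le_card_nsmul _ _ _ fun j _ => (himg j).2).trans ?_
      simp
    calc (Bd.ncard : ℝ) ≤ ((Fintype.card J * (k ^ Fintype.card κ * 4 ^ Fintype.card ι) : ℕ) : ℝ) :=
          by exact_mod_cast h1
      _ ≤ _ := by push_cast; gcongr
  have hdich : ∀ a, a ∉ Bd → ccell a ⊆ S ∨ Disjoint (ccell a) S := by
    intro a ha
    by_contra! h
    obtain ⟨h1, h2⟩ := h
    apply ha
    have hpre : IsPreconnected (ccell a) := (convex_Icc _ _).isPreconnected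
    have h3 : (ccell a ∩ S).Nonempty := Set.not_disjoint_iff_nonempty_inter.1 h2
    have h4 : (ccell a ∩ Sᶜ).Nonempty := by
      obtain ⟨y, hy, hy'⟩ := Set.not_subset.1 h1
      exact ⟨y, hy, hy'⟩
    have := inter_frontier_nonempty hpre h3 h4
    rwa [Set.inter_comm] at this
  have hptsfin : pts.Finite := by
    obtain ⟨r, hr⟩ := hS.subset_closedBall 0
    let B : Finset (ι → ℤ) := Fintype.piFinset fun i =>
      Finset.Icc (⌊-r - x i⌋) (⌈r - x i⌉)
    refine B.finite_toSet.subset fun a ha => ?_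
    simp only [B, Finset.mem_coe, Fintype.mem_piFinset, Finset.mem_Icc]
    intro i
    have h1 := hr ha
    rw [mem_closedBall_zero_iff] at h1
    have h2 := (norm_le_pi_norm _ i).trans h1
    rw [Real.norm_eq_abs, abs_le] at h2
    exact ⟨Int.floor_le_iff.2 (by linarith [h2.1]), Int.le_ceil_iff.2 (by linarith [h2.2])⟩
  refine ⟨hptsfin, ?_⟩
  set In : Set (ι → ℤ) := pts \ Bd with hIn
  have hInfin : In.Finite := hptsfin.subset Set.sdiff_subset
  have hInsub : ∀ a ∈ In, ccell a ⊆ S := fun a ha =>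
    (hdich a ha.2).resolve_right fun h => Set.disjoint_left.1 h (hmem a) ha.1
  have hunion : (In ∪ Bd).Finite := hInfin.union hBdfin
  have hvS : volume S ≠ ⊤ := hS.measure_lt_top.ne
  have hub : (volume S).toReal ≤ In.ncard + Bd.ncard := by
    have h1 : S ⊆ ⋃ a ∈ hunion.toFinset, cell a := by
      intro y hy
      obtain ⟨a, ha⟩ := hcover y
      refine Set.mem_iUnion₂.2 ⟨a, ?_, ha⟩
      rw [Set.Finite.mem_toFinset]
      by_cases hb : a ∈ Bd
      · exact Or.inr hb
      · refine Or.inl ⟨?_, hb⟩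
        have := (hdich a hb).resolve_right fun h => Set.disjoint_left.1 h (hcc a ha) hy
        exact this (hmem a)
    have h2 : volume S ≤ hunion.toFinset.card := by
      refine (measure_mono h1).trans ((measure_biUnion_finset_le _ _).trans ?_)
      simp [hvol]
    have h3 : (volume S).toReal ≤ hunion.toFinset.card := by
      have := ENNReal.toReal_mono (by simp) h2
      simpa using this
    refine h3.trans ?_
    rw [← Set.ncard_eq_toFinset_card _ hunion]
    exact_mod_cast Set.ncard_union_le _ _
  have hlb : (In.ncard : ℝ) ≤ (volume S).toReal := by
    have h1 : (⋃ a ∈ hInfin.toFinset, cell a) ⊆ S := by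
      refine Set.iUnion₂_subset fun a ha => ?_
      rw [Set.Finite.mem_toFinset] at ha
      exact (hcc a).trans (hInsub a ha)
    have h2 := measure_mono (μ := volume) h1
    rw [measure_biUnion_finset (fun a _ b _ hab => hdisj hab) fun a _ => hmeas a] at h2
    simp only [hvol, Finset.sum_const, nsmul_eq_mul, mul_one] at h2
    have h3 := ENNReal.toReal_mono hvS h2
    rw [Set.ncard_eq_toFinset_card _ hInfin]
    simpa using h3
  have hp1 : (In.ncard : ℝ) ≤ pts.ncard := by
    exact_mod_cast Set.ncard_le_ncard Set.sdiff_subset hptsfin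
  have hp2 : (pts.ncard : ℝ) ≤ In.ncard + Bd.ncard := by
    have : pts ⊆ In ∪ Bd := fun a ha => by
      by_cases hb : a ∈ Bd
      · exact Or.inr hb
      · exact Or.inl ⟨ha, hb⟩
    exact_mod_cast (Set.ncard_le_ncard this hunion).trans (Set.ncard_union_le _ _)
  refine le_trans ?_ hBdcard
  rw [abs_le]
  constructor <;> linarith

/-- By uniqueness of Haar measure the two sides are proportional; the factor is read off on the
fundamental domain, whose image is the unit cube. -/
theorem volume_image_equivFun {E : Type*} [NormedAddCommGroup E] [NormedSpace ℝ E]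
    [MeasurableSpace E] [BorelSpace E] (b : Module.Basis ι ℝ E)
    (μ : Measure E) [μ.IsAddHaarMeasure] (S : Set E) :
    μ S = μ (ZSpan.fundamentalDomain b) * volume (b.equivFun '' S) := by
  classical
  have : FiniteDimensional ℝ E := b.finiteDimensional_of_finite
  let e : E ≃L[ℝ] (ι → ℝ) := b.equivFunL
  have : (μ.map e).IsAddHaarMeasure := e.isAddHaarMeasure_map μ
  have h := Measure.isAddLeftInvariant_eq_smul (μ.map e) (volume : Measure (ι → ℝ))
  set c := Measure.addHaarScalarFactor (μ.map e) (volume : Measure (ι → ℝ))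
  have hmap : ∀ A : Set E, μ A = c * volume (b.equivFun '' A) := by
    intro A
    have h1 : μ.map e (e '' A) = μ A := by
      have : (e : E → ι → ℝ) = e.toHomeomorph.toMeasurableEquiv := rfl
      rw [this, MeasurableEquiv.map_apply, Set.preimage_image_eq]
      exact e.injective
    rw [← h1]
    conv_lhs => rw [h]
    rfl
  have hfd : volume (b.equivFun '' (ZSpan.fundamentalDomain b)) = 1 := by
    have : b.equivFun '' (ZSpan.fundamentalDomain b) = Set.univ.pi fun _ => Set.Ico (0 : ℝ) 1 := by
      ext y
      constructor
      · rintro ⟨z, hz, rfl⟩ i _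
        exact (ZSpan.mem_fundamentalDomain b).1 hz i
      · intro hy
        refine ⟨b.equivFun.symm y, ?_, b.equivFun.apply_symm_apply y⟩
        rw [ZSpan.mem_fundamentalDomain]
        intro i
        have := hy i trivial
        rwa [← b.equivFun_apply, b.equivFun.apply_symm_apply]
    rw [this, volume_pi_pi]
    simp
  rw [hmap (ZSpan.fundamentalDomain b), hfd, mul_one, ← hmap]

/-- Passing to coordinates in the basis reduces this to integer points. The bound `M` for the
coordinate map is kept explicit because uniformity over all ideals depends on it. -/
theorem abs_ncard_lattice_sub_le {E : Type*} [NormedAddCommGroup E] [NormedSpace ℝ E]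
    [MeasurableSpace E] [BorelSpace E] (b : Module.Basis ι ℝ E)
    (μ : Measure E) [μ.IsAddHaarMeasure] (S : Set E) (hS : Bornology.IsBounded S)
    (M : ℝ) (hM : 0 ≤ M) (hb : ∀ x, ‖b.equivFun x‖ ≤ M * ‖x‖)
    (ψ : J → (κ → ℝ) → E) (L : ℝ) (hL : 0 ≤ L)
    (hψ : ∀ j, ∀ s ∈ Set.Icc (0 : κ → ℝ) 1, ∀ t ∈ Set.Icc (0 : κ → ℝ) 1,
      dist (ψ j s) (ψ j t) ≤ L * dist s t)
    (hcov : ∀ z ∈ frontier S, ∃ j, ∃ s ∈ Set.Icc (0 : κ → ℝ) 1, ψ j s = z) (x : E) :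
    {z | z - x ∈ Submodule.span ℤ (Set.range b) ∧ z ∈ S}.Finite ∧
    |({z | z - x ∈ Submodule.span ℤ (Set.range b) ∧ z ∈ S}.ncard : ℝ) -
        (μ S).toReal / (μ (ZSpan.fundamentalDomain b)).toReal| ≤
      Fintype.card J * ((M * L + 2) ^ Fintype.card κ * 4 ^ Fintype.card ι) := by
  classical
  have : FiniteDimensional ℝ E := b.finiteDimensional_of_finite
  let e : E ≃L[ℝ] (ι → ℝ) := b.equivFunL
  have he : ∀ z, e z = b.equivFun z := fun _ => rfl
  have hbd : Bornology.IsBounded (e '' S) := by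
    obtain ⟨r, hr⟩ := isBounded_iff_forall_norm_le.1 hS
    refine isBounded_iff_forall_norm_le.2 ⟨M * r, ?_⟩
    rintro _ ⟨z, hz, rfl⟩
    exact (hb z).trans (mul_le_mul_of_nonneg_left (hr z hz) hM)
  have hfr : frontier (e '' S) = e '' frontier S := (e.toHomeomorph.image_frontier S).symm
  obtain ⟨hfin, hle⟩ := abs_ncard_int_sub_volume_le (e '' S) hbd (fun j s => e (ψ j s)) (M * L)
    (by positivity) (fun j s hs t ht => by
      rw [dist_eq_norm, ← map_sub]
      refine (hb _).trans ?_
      rw [mul_assoc, ← dist_eq_norm]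
      exact mul_le_mul_of_nonneg_left (hψ j s hs t ht) hM)
    (fun z hz => by
      rw [hfr] at hz
      obtain ⟨z, hz, rfl⟩ := hz
      obtain ⟨j, s, hs, rfl⟩ := hcov z hz
      exact ⟨j, s, hs, rfl⟩) (e x)
  have hset : {z | z - x ∈ Submodule.span ℤ (Set.range b) ∧ z ∈ S} =
      (fun a : ι → ℤ => x + ∑ i, a i • b i) '' {a : ι → ℤ | (fun i => e x i + a i) ∈ e '' S} := by
    have key : ∀ a : ι → ℤ, e (x + ∑ i, a i • b i) = fun i => e x i + a i := by
      intro a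
      funext i
      simp only [he, map_add, map_sum, Pi.add_apply, Finset.sum_apply, map_zsmul]
      congr 1
      simp [Finsupp.single_apply]
    ext z
    constructor
    · rintro ⟨h1, h2⟩
      obtain ⟨a, ha⟩ := (Submodule.mem_span_range_iff_exists_fun ℤ).1 h1
      refine ⟨a, ?_, by simp [ha]⟩
      rw [Set.mem_ofPred_eq, ← key, ha]
      exact ⟨z, h2, by simp⟩
    · rintro ⟨a, ha, rfl⟩
      rw [Set.mem_ofPred_eq, ← key] at ha
      obtain ⟨y, hy, hye⟩ := ha
      have := e.injective hye
      subst this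
      refine ⟨?_, hy⟩
      rw [add_sub_cancel_left]
      exact Submodule.sum_mem _ fun i _ => Submodule.smul_mem _ _ (Submodule.subset_span ⟨i, rfl⟩)
  have hinj : Function.Injective (fun a : ι → ℤ => x + ∑ i, a i • b i) := by
    intro a a' h
    have h1 : ∑ i, (a i : ℝ) • b i = ∑ i, (a' i : ℝ) • b i := by
      simpa [Int.cast_smul_eq_zsmul] using h
    have h2 := b.linearIndependent
    rw [Fintype.linearIndependent_iff] at h2
    funext i
    have := h2 (fun i => (a i : ℝ) - a' i) (by simp [sub_smul, h1]) i
    exact_mod_cast sub_eq_zero.1 this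
  rw [hset]
  refine ⟨hfin.image _, ?_⟩
  rw [Set.ncard_image_of_injective _ hinj]
  have hv := volume_image_equivFun b μ S
  have hfd0 : (μ (ZSpan.fundamentalDomain b)).toReal ≠ 0 := by
    have h1 := ZSpan.measure_fundamentalDomain_ne_zero b (μ := μ)
    have h2 := (ZSpan.fundamentalDomain_isBounded b).measure_lt_top (μ := μ)
    exact (ENNReal.toReal_pos h1 h2.ne).ne'
  have : (μ S).toReal / (μ (ZSpan.fundamentalDomain b)).toReal = (volume (e '' S)).toReal := by
    rw [hv, ENNReal.toReal_mul, mul_div_cancel_left₀ _ hfd0]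
    rfl
  rw [this]
  exact hle

end LatticeCount

end SchanuelMorphism

namespace SchanuelMorphism

/-! ### Sums over sets of linear growth -/

section LinearGrowth

variable {α : Type*} {N : α → ℝ} {A : ℝ}

/-- `N ≥ 1` and there are at most `A Y` elements with `N ≤ Y`. -/
structure LinearGrowth (N : α → ℝ) (A : ℝ) : Prop where
  one_le : ∀ a, 1 ≤ N a
  card_le : ∀ (Y : ℝ), 1 ≤ Y → ∀ s : Finset α, (∀ a ∈ s, N a ≤ Y) → (s.card : ℝ) ≤ A * Y

theorem LinearGrowth.finite_le (h : LinearGrowth N A) (Y : ℝ) : {a | N a ≤ Y}.Finite := by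
  by_contra hinf
  obtain ⟨k, hk⟩ := exists_nat_gt (A * max 1 Y)
  obtain ⟨s, hs, hcard⟩ := Set.Infinite.exists_subset_card_eq hinf k
  have := h.card_le (max 1 Y) (le_max_left _ _) s fun a ha => (hs ha).trans (le_max_right _ _)
  rw [hcard] at this
  linarith

/-- A dyadic layer has at most `A 2^(j+1) Y` elements, and each term is at most `(2^j Y)^(-σ)`. -/
theorem LinearGrowth.sum_layer_le (h : LinearGrowth N A) {Y : ℝ} (hY : 1 ≤ Y) {σ : ℝ} (hσ : 0 ≤ σ)
    (j : ℕ) (s : Finset α) (hs : ∀ a ∈ s, 2 ^ j * Y ≤ N a ∧ N a < 2 ^ (j + 1) * Y) :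
    ∑ a ∈ s, N a ^ (-σ) ≤ 2 * A * Y ^ (1 - σ) * ((2 : ℝ) ^ (1 - σ)) ^ j := by
  have hY0 : 0 < Y := by linarith
  have h2 : (1 : ℝ) ≤ 2 ^ (j + 1) := one_le_pow₀ (by norm_num)
  have hc := h.card_le (2 ^ (j + 1) * Y) (by nlinarith) s fun a ha => (hs a ha).2.le
  calc ∑ a ∈ s, N a ^ (-σ) ≤ ∑ a ∈ s, (2 ^ j * Y) ^ (-σ) := by
        refine Finset.sum_le_sum fun a ha => ?_
        exact Real.rpow_le_rpow_of_nonpos (by positivity) (hs a ha).1 (by linarith)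
    _ = s.card * (2 ^ j * Y) ^ (-σ) := by simp
    _ ≤ (A * (2 ^ (j + 1) * Y)) * (2 ^ j * Y) ^ (-σ) := by gcongr
    _ = _ := by
      rw [Real.mul_rpow (by positivity) hY0.le, Real.rpow_sub hY0, Real.rpow_one,
        Real.rpow_sub (by norm_num), Real.rpow_one, div_pow, Real.rpow_neg hY0.le,
        Real.rpow_neg (by positivity), ← Real.rpow_pow_comm (by norm_num)]
      ring

theorem exists_layer {Y x : ℝ} (hY : 0 < Y) (hx : Y ≤ x) :
    ∃ j : ℕ, 2 ^ j * Y ≤ x ∧ x < 2 ^ (j + 1) * Y := by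
  obtain ⟨j, h1, h2⟩ := exists_nat_pow_near ((one_le_div hY).2 hx) (one_lt_two : (1 : ℝ) < 2)
  exact ⟨j, (le_div_iff₀ hY).1 h1, (div_lt_iff₀ hY).1 h2⟩

/-- The dyadic layers are dominated by a geometric series of ratio `2^(1-σ) < 1`. -/
theorem LinearGrowth.sum_tail_le (h : LinearGrowth N A) (hA : 0 ≤ A) {σ : ℝ} (hσ : 1 < σ) {Y : ℝ}
    (hY : 1 ≤ Y) (s : Finset α) (hs : ∀ a ∈ s, Y ≤ N a) :
    ∑ a ∈ s, N a ^ (-σ) ≤ 2 * A / (1 - (2 : ℝ) ^ (1 - σ)) * Y ^ (1 - σ) := by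
  classical
  have hY0 : 0 < Y := by linarith
  choose! j hj using fun a (ha : a ∈ s) => exists_layer hY0 (hs a ha)
  have hr1 : (2 : ℝ) ^ (1 - σ) < 1 := Real.rpow_lt_one_of_one_lt_of_neg (by norm_num) (by linarith)
  have hr0 : (0 : ℝ) ≤ (2 : ℝ) ^ (1 - σ) := by positivity
  calc ∑ a ∈ s, N a ^ (-σ) = ∑ i ∈ s.image j, ∑ a ∈ s with j a = i, N a ^ (-σ) :=
        (Finset.sum_fiberwise_of_maps_to (fun a ha => Finset.mem_image_of_mem j ha) _).symm
    _ ≤ ∑ i ∈ s.image j, 2 * A * Y ^ (1 - σ) * ((2 : ℝ) ^ (1 - σ)) ^ i := by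
        refine Finset.sum_le_sum fun i _ => h.sum_layer_le hY (by linarith) i _ fun a ha => ?_
        rw [Finset.mem_filter] at ha
        rw [← ha.2]
        exact hj a ha.1
    _ = 2 * A * Y ^ (1 - σ) * ∑ i ∈ s.image j, ((2 : ℝ) ^ (1 - σ)) ^ i := by
        rw [Finset.mul_sum]
    _ ≤ 2 * A * Y ^ (1 - σ) * (1 - (2 : ℝ) ^ (1 - σ))⁻¹ := by
        gcongr
        rw [← tsum_geometric_of_lt_one hr0 hr1]
        exact (summable_geometric_of_lt_one hr0 hr1).sum_le_tsum _ fun i _ => by positivity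
    _ = _ := by ring

theorem LinearGrowth.summable (h : LinearGrowth N A) (hA : 0 ≤ A) {σ : ℝ} (hσ : 1 < σ) :
    Summable fun a => N a ^ (-σ) :=
  summable_of_sum_le (fun a => Real.rpow_nonneg (by linarith [h.one_le a]) _)
    fun s => (h.sum_tail_le hA hσ le_rfl s fun a _ => h.one_le a)

/-- At the critical exponent every dyadic layer contributes at most `2A`, and there are about `log₂
Y` layers. This is the only source of the logarithm in the theorem. -/
theorem LinearGrowth.sum_inv_le (h : LinearGrowth N A) (hA : 0 ≤ A) {Y : ℝ} (hY : 1 ≤ Y)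
    (s : Finset α) (hs : ∀ a ∈ s, N a ≤ Y) :
    ∑ a ∈ s, (N a)⁻¹ ≤ 4 * A * (1 + Real.log Y) := by
  classical
  choose! j hj using fun a (_ : a ∈ s) => exists_layer one_pos (h.one_le a)
  have hjle : ∀ a ∈ s, j a < ⌊Real.log Y / Real.log 2⌋₊ + 1 := by
    intro a ha
    have h1 : (2 : ℝ) ^ j a ≤ Y := by have := (hj a ha).1; rw [mul_one] at this; exact this.trans (hs a ha)
    rw [Nat.lt_succ_iff, Nat.le_floor_iff (div_nonneg (Real.log_nonneg hY) (Real.log_nonneg (by norm_num))),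
      le_div_iff₀ (Real.log_pos (by norm_num)), ← Real.log_pow]
    exact Real.log_le_log (by positivity) h1
  calc ∑ a ∈ s, (N a)⁻¹ = ∑ i ∈ Finset.range (⌊Real.log Y / Real.log 2⌋₊ + 1),
          ∑ a ∈ s with j a = i, N a ^ (-1 : ℝ) := by
        rw [Finset.sum_fiberwise_of_maps_to (fun a ha => Finset.mem_range.2 (hjle a ha))]
        exact Finset.sum_congr rfl fun a _ => (Real.rpow_neg_one _).symm
    _ ≤ ∑ i ∈ Finset.range (⌊Real.log Y / Real.log 2⌋₊ + 1), 2 * A := by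
        refine Finset.sum_le_sum fun i _ => ?_
        refine (h.sum_layer_le le_rfl zero_le_one i _ fun a ha => ?_).trans_eq (by simp)
        rw [Finset.mem_filter] at ha
        rw [← ha.2]
        exact hj a ha.1
    _ = (⌊Real.log Y / Real.log 2⌋₊ + 1) * (2 * A) := by simp
    _ ≤ (Real.log Y / Real.log 2 + 1) * (2 * A) := by
        gcongr
        exact Nat.floor_le (div_nonneg (Real.log_nonneg hY) (Real.log_nonneg (by norm_num)))
    _ ≤ (2 * (1 + Real.log Y)) * (2 * A) := by
        gcongr
        have h2 : (1 : ℝ) / 2 ≤ Real.log 2 := by linarith [Real.log_two_gt_d9]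
        have : Real.log Y / Real.log 2 ≤ 2 * Real.log Y := by
          rw [div_le_iff₀ (by linarith)]
          nlinarith [Real.log_nonneg hY]
        linarith
    _ = _ := by ring

theorem LinearGrowth.comp {β : Type*} (h : LinearGrowth N A) (g : β → α)
    (hg : Function.Injective g) : LinearGrowth (fun b => N (g b)) A where
  one_le b := h.one_le _
  card_le Y hY s hs := by
    classical
    rw [← Finset.card_image_of_injective s hg]
    refine h.card_le Y hY _ fun a ha => ?_
    obtain ⟨b, hb, rfl⟩ := Finset.mem_image.1 ha
    exact hs b hb

end LinearGrowth

/-! ### Sums over ideals -/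

section IdealSums

variable (K : Type*) [Field K] [NumberField K]

open scoped nonZeroDivisors

/-- The asymptotic count of ideals gives the ratio bound `c + 1` beyond some `Y₁ ≥ 1`. Below `Y₁`
the count is bounded by its value at `Y₁`, which costs the factor `Y₁`. -/
theorem exists_linearGrowth_absNorm :
    ∃ A : ℝ, 0 ≤ A ∧ LinearGrowth (fun I : (Ideal (𝓞 K))⁰ => (Ideal.absNorm (I : Ideal (𝓞 K)) : ℝ)) A := by
  have hlim := Ideal.tendsto_norm_le_div_atTop₀ K
  set c := (2 ^ InfinitePlace.nrRealPlaces K * (2 * Real.pi) ^ InfinitePlace.nrComplexPlaces K *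
    Units.regulator K * classNumber K) / (Units.torsionOrder K * Real.sqrt |discr K|)
  have hev := hlim.eventually (gt_mem_nhds (lt_add_one c))
  obtain ⟨Y₀, hY₀⟩ := Filter.eventually_atTop.1 hev
  have hfin : ∀ Y : ℝ, Finite {I : (Ideal (𝓞 K))⁰ // (Ideal.absNorm (I : Ideal (𝓞 K)) : ℝ) ≤ Y} := by
    intro Y
    have h1 : Finite {I : Ideal (𝓞 K) | Ideal.absNorm I ≤ ⌊Y⌋₊} :=
      Ideal.finite_setOfPred_absNorm_le (S := 𝓞 K) ⌊Y⌋₊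
    refine Finite.of_injective (β := {I : Ideal (𝓞 K) | Ideal.absNorm I ≤ ⌊Y⌋₊})
      (fun I => ⟨I.1.1, Nat.le_floor I.2⟩) ?_
    intro I J h
    exact Subtype.ext (Subtype.ext (Subtype.mk.inj h))
  have hcard : ∀ (Y : ℝ) (s : Finset (Ideal (𝓞 K))⁰),
      (∀ I ∈ s, (Ideal.absNorm (I : Ideal (𝓞 K)) : ℝ) ≤ Y) →
      (s.card : ℝ) ≤ Nat.card {I : (Ideal (𝓞 K))⁰ // (Ideal.absNorm (I : Ideal (𝓞 K)) : ℝ) ≤ Y} := by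
    intro Y s hs
    have := hfin Y
    have h2 : Nat.card s ≤
        Nat.card {I : (Ideal (𝓞 K))⁰ // (Ideal.absNorm (I : Ideal (𝓞 K)) : ℝ) ≤ Y} :=
      Nat.card_le_card_of_injective (fun I : s => ⟨I.1, hs I.1 I.2⟩)
        fun I J h => Subtype.ext (Subtype.mk.inj h)
    rw [Nat.card_eq_fintype_card, Fintype.card_coe] at h2
    exact_mod_cast h2
  set Y₁ := max 1 Y₀
  have hc : 0 ≤ c := by
    have := Units.regulator_pos K
    positivity
  refine ⟨(c + 1) * Y₁, by positivity, ⟨fun I => ?_, fun Y hY s hs => ?_⟩⟩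
  · have := Ideal.absNorm_ne_zero_of_nonZeroDivisors I
    exact_mod_cast Nat.one_le_iff_ne_zero.2 this
  · have hY1 : 1 ≤ Y₁ := le_max_left _ _
    have hm : Y₁ ≤ max Y Y₁ := le_max_right _ _
    have h3 := hcard (max Y Y₁) s fun I hI => (hs I hI).trans (le_max_left _ _)
    have h4 := hY₀ (max Y Y₁) ((le_max_right _ _).trans hm)
    rw [div_lt_iff₀ (by linarith)] at h4
    have h5 : max Y Y₁ ≤ Y₁ * Y := max_le (by nlinarith) (by nlinarith)
    nlinarith

variable {K}

/-- The norm of a product of distinct primes. -/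
def setNorm (A : Finset (HeightOneSpectrum (𝓞 K))) : ℝ :=
  ∏ p ∈ A, (Ideal.absNorm p.asIdeal : ℝ)

/-- A product of distinct primes. -/
def setProd (A : Finset (HeightOneSpectrum (𝓞 K))) : Ideal (𝓞 K) := ∏ p ∈ A, p.asIdeal

theorem absNorm_setProd (A : Finset (HeightOneSpectrum (𝓞 K))) :
    (Ideal.absNorm (setProd A) : ℝ) = setNorm A := by
  simp [setProd, setNorm, map_prod]

omit [NumberField K] in
theorem setProd_ne_bot (A : Finset (HeightOneSpectrum (𝓞 K))) : setProd A ≠ ⊥ := by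
  rw [setProd, ← Ideal.zero_eq_bot, Finset.prod_ne_zero_iff]
  exact fun p _ => p.ne_bot

theorem setProd_dvd_iff (A : Finset (HeightOneSpectrum (𝓞 K))) (I : Ideal (𝓞 K)) :
    setProd A ∣ I ↔ ∀ p ∈ A, p.asIdeal ∣ I := by
  refine ⟨fun h p hp => (Finset.dvd_prod_of_mem _ hp).trans h, fun h => ?_⟩
  refine Finset.prod_dvd_of_coprime (fun p _ q _ hpq => ?_) h
  rw [Function.onFun, Ideal.isCoprime_iff_sup_eq]
  exact p.isMaximal.coprime_of_ne q.isMaximal fun h => hpq (HeightOneSpectrum.ext h)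

theorem mem_iff_dvd_setProd (A : Finset (HeightOneSpectrum (𝓞 K))) (p : HeightOneSpectrum (𝓞 K)) :
    p ∈ A ↔ p.asIdeal ∣ setProd A := by
  refine ⟨fun h => Finset.dvd_prod_of_mem _ h, fun h => ?_⟩
  obtain ⟨q, hq, hpq⟩ := (Prime.dvd_finsetProd_iff p.prime _).1 h
  have : p = q := HeightOneSpectrum.ext ((q.isMaximal.eq_of_le p.isPrime.ne_top
    (Ideal.dvd_iff_le.1 hpq)).symm)
  rwa [this]

theorem setProd_injective :
    Function.Injective (setProd : Finset (HeightOneSpectrum (𝓞 K)) → Ideal (𝓞 K)) := by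
  intro A B h
  ext p
  rw [mem_iff_dvd_setProd, h, ← mem_iff_dvd_setProd]

variable (K) in
theorem exists_linearGrowth_setNorm :
    ∃ A : ℝ, 0 ≤ A ∧ LinearGrowth (setNorm (K := K)) A := by
  obtain ⟨A, hA, h⟩ := exists_linearGrowth_absNorm K
  refine ⟨A, hA, ?_⟩
  have := h.comp (fun B : Finset (HeightOneSpectrum (𝓞 K)) =>
    (⟨setProd B, mem_nonZeroDivisors_of_ne_zero (setProd_ne_bot B)⟩ : (Ideal (𝓞 K))⁰))
    fun B C hBC => setProd_injective (Subtype.mk.inj hBC)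
  simpa only [absNorm_setProd] using this

theorem one_lt_absNorm (p : HeightOneSpectrum (𝓞 K)) : (1 : ℝ) < Ideal.absNorm p.asIdeal := by
  exact_mod_cast HeightOneSpectrum.one_lt_absNorm p

theorem setNorm_pos (A : Finset (HeightOneSpectrum (𝓞 K))) : 0 < setNorm A :=
  Finset.prod_pos fun p _ => by linarith [one_lt_absNorm p]

theorem setNorm_ge_one (A : Finset (HeightOneSpectrum (𝓞 K))) : 1 ≤ setNorm A :=
  Finset.one_le_prod fun p _ => (one_lt_absNorm p).le

/-- The primes dividing a nonzero ideal. -/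
def primeFactors (J : (Ideal (𝓞 K))⁰) : Finset (HeightOneSpectrum (𝓞 K)) :=
  (Ideal.finite_factors (nonZeroDivisors.coe_ne_zero J)).toFinset

theorem mem_primeFactors (J : (Ideal (𝓞 K))⁰) (p : HeightOneSpectrum (𝓞 K)) :
    p ∈ primeFactors J ↔ p.asIdeal ∣ (J : Ideal (𝓞 K)) := by
  simp [primeFactors]

theorem primeFactors_eq_empty_iff (J : (Ideal (𝓞 K))⁰) : primeFactors J = ∅ ↔ J = 1 := by
  constructor
  · intro h
    by_contra hJ
    have hJ' : (J : Ideal (𝓞 K)) ≠ ⊤ := fun h => hJ (Subtype.ext (by simpa using h))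
    obtain ⟨P, hP, hJP⟩ := Ideal.exists_le_maximal _ hJ'
    have hP0 : P ≠ ⊥ := fun h0 => nonZeroDivisors.coe_ne_zero J (by
      rw [h0, le_bot_iff] at hJP; exact hJP)
    have : (⟨P, hP.isPrime, hP0⟩ : HeightOneSpectrum (𝓞 K)) ∈ primeFactors J :=
      (mem_primeFactors _ _).2 (Ideal.dvd_iff_le.2 hJP)
    rw [h] at this
    simp at this
  · rintro rfl
    ext p
    simp only [mem_primeFactors, Finset.notMem_empty, iff_false]
    intro h
    exact p.isPrime.ne_top (by simpa [Ideal.dvd_iff_le] using h)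

-- Grouping ideals by norm turns the sum into the Dirichlet series; its terms are real, so taking
-- real parts loses nothing.
variable (K) in
theorem hasSum_dedekindZeta {s : ℕ} (hs : 2 ≤ s) :
    HasSum (fun I : (Ideal (𝓞 K))⁰ => ((Ideal.absNorm (I : Ideal (𝓞 K)) : ℝ) ^ s)⁻¹)
      (dedekindZeta K s).re := by
  obtain ⟨A, hA, h⟩ := exists_linearGrowth_absNorm K
  have hsum : Summable fun I : (Ideal (𝓞 K))⁰ => ((Ideal.absNorm (I : Ideal (𝓞 K)) : ℝ) ^ s)⁻¹ := by
    have := h.summable hA (σ := s) (by exact_mod_cast hs)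
    refine this.congr fun I => ?_
    rw [Real.rpow_neg (by positivity), Real.rpow_natCast]
  have h1 := hsum.hasSum.tsum_fiberwise fun I => Ideal.absNorm (I : Ideal (𝓞 K))
  have h2 : ∀ k : ℕ, (∑' b : (fun I : (Ideal (𝓞 K))⁰ => Ideal.absNorm (I : Ideal (𝓞 K))) ⁻¹' {k},
      ((Ideal.absNorm (b.1 : Ideal (𝓞 K)) : ℝ) ^ s)⁻¹) =
      (LSeries.term (fun n ↦ (Nat.card {I : Ideal (𝓞 K) // Ideal.absNorm I = n} : ℂ)) s k).re := by
    intro k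
    rcases eq_or_ne k 0 with rfl | hk
    · have : IsEmpty ((fun I : (Ideal (𝓞 K))⁰ => Ideal.absNorm (I : Ideal (𝓞 K))) ⁻¹' {0}) :=
        ⟨fun I => Ideal.absNorm_ne_zero_of_nonZeroDivisors I.1 I.2⟩
      simp
    · rw [LSeries.term_of_ne_zero hk]
      have e : ((fun I : (Ideal (𝓞 K))⁰ => Ideal.absNorm (I : Ideal (𝓞 K))) ⁻¹' {k}) ≃
          {I : Ideal (𝓞 K) // Ideal.absNorm I = k} :=
        { toFun := fun I => ⟨I.1.1, I.2⟩
          invFun := fun I => ⟨⟨I.1, mem_nonZeroDivisors_of_ne_zero (by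
            rintro h; apply hk; rw [← I.2, h]; simp)⟩, I.2⟩
          left_inv := fun I => rfl
          right_inv := fun I => rfl }
      have h3 : ∀ b : (fun I : (Ideal (𝓞 K))⁰ => Ideal.absNorm (I : Ideal (𝓞 K))) ⁻¹' {k},
          ((Ideal.absNorm (b.1 : Ideal (𝓞 K)) : ℝ) ^ s)⁻¹ = ((k : ℝ) ^ s)⁻¹ := by
        intro b
        rw [show Ideal.absNorm (b.1 : Ideal (𝓞 K)) = k from b.2]
      simp only [h3]
      rw [tsum_const, Nat.card_congr e, Complex.cpow_natCast, nsmul_eq_mul, ← div_eq_mul_inv]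
      rw [← Nat.cast_pow, ← Nat.cast_pow, ← Complex.ofReal_natCast, ← Complex.ofReal_natCast (k ^ s),
        ← Complex.ofReal_div, Complex.ofReal_re]
  simp only [h2] at h1
  have hterm : ∀ k : ℕ, (LSeries.term (fun n ↦ (Nat.card {I : Ideal (𝓞 K) // Ideal.absNorm I = n} : ℂ)) s k)
      = ((LSeries.term (fun n ↦ (Nat.card {I : Ideal (𝓞 K) // Ideal.absNorm I = n} : ℂ)) s k).re : ℂ) := by
    intro k
    rcases eq_or_ne k 0 with rfl | hk
    · simp
    · rw [LSeries.term_of_ne_zero hk, Complex.cpow_natCast]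
      rw [← Nat.cast_pow, ← Complex.ofReal_natCast, ← Complex.ofReal_natCast (k ^ s),
        ← Complex.ofReal_div, Complex.ofReal_re]
  have h4 : (dedekindZeta K s).re = ∑' I : (Ideal (𝓞 K))⁰, ((Ideal.absNorm (I : Ideal (𝓞 K)) : ℝ) ^ s)⁻¹ := by
    rw [← h1.tsum_eq, dedekindZeta, LSeries]
    rw [tsum_congr hterm, ← Complex.ofReal_tsum, Complex.ofReal_re]
  rw [h4]
  exact hsum.hasSum

variable (K) in
theorem summable_setNorm {s : ℕ} (hs : 2 ≤ s) :
    Summable fun A : Finset (HeightOneSpectrum (𝓞 K)) => (setNorm A ^ s)⁻¹ := by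
  obtain ⟨A, hA, h⟩ := exists_linearGrowth_setNorm K
  refine (h.summable hA (σ := s) (by exact_mod_cast hs)).congr fun B => ?_
  rw [Real.rpow_neg (setNorm_pos B).le, Real.rpow_natCast]

-- In the Cauchy product, collect the pairs (set of primes `A`, ideal `I`) with the same product
-- ideal `J`. Such pairs correspond to the sets of prime divisors of `J`, and the alternating sum
-- over them vanishes unless `J = 1`.
variable (K) in
theorem tsum_moebius_mul_dedekindZeta {s : ℕ} (hs : 2 ≤ s) :
    (∑' A : Finset (HeightOneSpectrum (𝓞 K)), (-1) ^ A.card * (setNorm A ^ s)⁻¹) *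
      (dedekindZeta K s).re = 1 := by
  classical
  have hf : Summable fun A : Finset (HeightOneSpectrum (𝓞 K)) =>
      ‖(-1 : ℝ) ^ A.card * (setNorm A ^ s)⁻¹‖ := by
    refine (summable_setNorm K hs).congr fun A => ?_
    rw [norm_mul, norm_pow, norm_neg, norm_one, one_pow, one_mul, Real.norm_of_nonneg]
    have := setNorm_pos A
    positivity
  have hz := hasSum_dedekindZeta K hs
  have hg : Summable fun I : (Ideal (𝓞 K))⁰ => ‖((Ideal.absNorm (I : Ideal (𝓞 K)) : ℝ) ^ s)⁻¹‖ :=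
    hz.summable.norm
  rw [← hz.tsum_eq, tsum_mul_tsum_of_summable_norm hf hg]
  have hprod := summable_mul_of_summable_norm hf hg
  let G : Finset (HeightOneSpectrum (𝓞 K)) × (Ideal (𝓞 K))⁰ → (Ideal (𝓞 K))⁰ := fun x =>
    ⟨setProd x.1, mem_nonZeroDivisors_of_ne_zero (setProd_ne_bot x.1)⟩ * x.2
  have h1 := hprod.hasSum.tsum_fiberwise G
  rw [← h1.tsum_eq]
  have h2 : ∀ J : (Ideal (𝓞 K))⁰, (∑' x : G ⁻¹' {J}, (-1 : ℝ) ^ x.1.1.card *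
      (setNorm x.1.1 ^ s)⁻¹ * ((Ideal.absNorm (x.1.2 : Ideal (𝓞 K)) : ℝ) ^ s)⁻¹) =
      if J = 1 then 1 else 0 := by
    intro J
    -- The set `A` determines the pair, because the cofactor of `setProd A` in `J` is unique.
    let e : G ⁻¹' {J} ≃ {A // A ∈ (primeFactors J).powerset} :=
      { toFun := fun x => ⟨x.1.1, by
          rw [Finset.mem_powerset]
          intro p hp
          rw [mem_primeFactors]
          have hx : setProd x.1.1 * (x.1.2 : Ideal (𝓞 K)) = J := congrArg Subtype.val x.2
          rw [← hx]
          exact ((mem_iff_dvd_setProd _ _).1 hp).mul_right _⟩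
        invFun := fun A => ⟨(A.1, by
          have hd : setProd A.1 ∣ (J : Ideal (𝓞 K)) := (setProd_dvd_iff _ _).2 fun p hp =>
            (mem_primeFactors _ _).1 (Finset.mem_powerset.1 A.2 hp)
          exact ⟨hd.choose, mem_nonZeroDivisors_of_ne_zero fun h0 => by
            have := hd.choose_spec
            rw [h0, mul_zero] at this
            exact nonZeroDivisors.coe_ne_zero J this⟩), by
          have hd : setProd A.1 ∣ (J : Ideal (𝓞 K)) := (setProd_dvd_iff _ _).2 fun p hp =>
            (mem_primeFactors _ _).1 (Finset.mem_powerset.1 A.2 hp)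
          exact Subtype.ext hd.choose_spec.symm⟩
        left_inv := by
          rintro ⟨⟨A, I⟩, hx⟩
          apply Subtype.ext
          refine Prod.ext rfl ?_
          apply Subtype.ext
          have hx' : setProd A * (I : Ideal (𝓞 K)) = J := congrArg Subtype.val hx
          have hd : setProd A ∣ (J : Ideal (𝓞 K)) := ⟨_, hx'.symm⟩
          have h3 := hd.choose_spec
          change hd.choose = _
          exact (mul_left_cancel₀ (setProd_ne_bot A) (hx'.trans h3)).symm
        right_inv := fun A => rfl }
    have h3 : ∀ x : G ⁻¹' {J}, (-1 : ℝ) ^ x.1.1.card *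
      (setNorm x.1.1 ^ s)⁻¹ * ((Ideal.absNorm (x.1.2 : Ideal (𝓞 K)) : ℝ) ^ s)⁻¹ =
      (-1 : ℝ) ^ (e x).1.card * ((Ideal.absNorm (J : Ideal (𝓞 K)) : ℝ) ^ s)⁻¹ := by
      intro x
      have hx : setProd x.1.1 * (x.1.2 : Ideal (𝓞 K)) = J := congrArg Subtype.val x.2
      rw [← hx, map_mul, Nat.cast_mul, absNorm_setProd, mul_pow, mul_inv, ← mul_assoc]
      rfl
    rw [tsum_congr h3, e.tsum_eq (fun A => (-1 : ℝ) ^ A.1.card *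
      ((Ideal.absNorm (J : Ideal (𝓞 K)) : ℝ) ^ s)⁻¹),
      Finset.tsum_subtype (primeFactors J).powerset (fun A => (-1 : ℝ) ^ A.card *
      ((Ideal.absNorm (J : Ideal (𝓞 K)) : ℝ) ^ s)⁻¹), ← Finset.sum_mul]
    have h4 : ∑ A ∈ (primeFactors J).powerset, (-1 : ℝ) ^ A.card =
        if primeFactors J = ∅ then 1 else 0 := by
      have := Finset.sum_powerset_neg_one_pow_card (x := primeFactors J)
      exact_mod_cast this
    rw [h4]
    simp only [primeFactors_eq_empty_iff]
    split_ifs with hJ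
    · subst hJ; simp
    · simp
  simp only [h2]
  exact tsum_ite_eq 1 _

variable (K) in
open scoped Classical in
/-- Inclusion-exclusion sums over the primes outside a finite set `S`. -/
theorem tsum_moebius_compl_mul {s : ℕ} (hs : 2 ≤ s) (S : Finset (HeightOneSpectrum (𝓞 K))) :
    (∑' A : Finset (HeightOneSpectrum (𝓞 K)),
        if Disjoint A S then (-1) ^ A.card * (setNorm A ^ s)⁻¹ else 0) *
      (∏ p ∈ S, (1 - ((Ideal.absNorm p.asIdeal : ℝ) ^ s)⁻¹)) * (dedekindZeta K s).re = 1 := by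
  classical
  -- Products of `f` are the Möbius terms, and setting `f` to zero on `S` selects the sets disjoint
  -- from `S`. Expanding `∏ (1 + f p)` and `∏ (1 + g p)`, the two sums differ by the Euler factors
  -- at `S`.
  let f : HeightOneSpectrum (𝓞 K) → ℝ := fun p => -((Ideal.absNorm p.asIdeal : ℝ) ^ s)⁻¹
  let g : HeightOneSpectrum (𝓞 K) → ℝ := fun p => if p ∈ S then 0 else f p
  have hprodf : ∀ A : Finset (HeightOneSpectrum (𝓞 K)), ∏ p ∈ A, f p =
      (-1) ^ A.card * (setNorm A ^ s)⁻¹ := by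
    intro A
    simp only [f, setNorm]
    rw [Finset.prod_neg, Finset.prod_inv_distrib, Finset.prod_pow]
  have hprodg : ∀ A : Finset (HeightOneSpectrum (𝓞 K)), ∏ p ∈ A, g p =
      if Disjoint A S then (-1) ^ A.card * (setNorm A ^ s)⁻¹ else 0 := by
    intro A
    split_ifs with h
    · rw [← hprodf]
      refine Finset.prod_congr rfl fun p hp => ?_
      simp [g, Finset.disjoint_left.1 h hp]
    · rw [Finset.not_disjoint_iff] at h
      obtain ⟨p, hpA, hpS⟩ := h
      exact Finset.prod_eq_zero hpA (by simp [g, hpS])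
  have hsf : Summable fun A : Finset (HeightOneSpectrum (𝓞 K)) => ∏ p ∈ A, f p := by
    refine (summable_setNorm K hs).of_norm_bounded fun A => ?_
    rw [hprodf, norm_mul, norm_pow, norm_neg, norm_one, one_pow, one_mul, Real.norm_of_nonneg]
    have := setNorm_pos A
    positivity
  have hsg : Summable fun A : Finset (HeightOneSpectrum (𝓞 K)) => ∏ p ∈ A, g p := by
    refine (summable_setNorm K hs).of_norm_bounded fun A => ?_
    have := setNorm_pos A
    rw [hprodg]
    split_ifs
    · rw [norm_mul, norm_pow, norm_neg, norm_one, one_pow, one_mul, Real.norm_of_nonneg]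
      positivity
    · rw [norm_zero]; positivity
  have h1 := hasProd_one_add_of_hasSum_prod hsf.hasSum
  have h2 := hasProd_one_add_of_hasSum_prod hsg.hasSum
  have h3 : HasProd (fun p => if p ∈ S then 1 + f p else 1) (∏ p ∈ S, (1 + f p)) := by
    have := hasProd_prod_of_ne_finset_one (L := .unconditional _)
      (f := fun p => if p ∈ S then 1 + f p else 1) (s := S)
      fun p hp => by simp [hp]
    rwa [Finset.prod_congr rfl (g := fun p => 1 + f p) fun p hp => by simp [hp]] at this
  have h4 := h2.mul h3
  have h5 : (fun p => (1 + g p) * if p ∈ S then 1 + f p else 1) = fun p => 1 + f p := by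
    funext p
    by_cases hp : p ∈ S <;> simp [g, hp]
  rw [h5] at h4
  have h6 := h4.unique h1
  simp only [hprodf, hprodg] at h6
  have h7 : ∏ p ∈ S, (1 + f p) = ∏ p ∈ S, (1 - ((Ideal.absNorm p.asIdeal : ℝ) ^ s)⁻¹) := by
    simp [f, sub_eq_add_neg]
  rw [← h7, h6]
  exact tsum_moebius_mul_dedekindZeta K hs

end IdealSums

end SchanuelMorphism

namespace SchanuelMorphism

set_option linter.unusedSectionVars false

/-! ### Gauges on the mixed space and the volume of the associated cone -/

section Shuffle

variable (ι A B : Type*) [Fintype ι] [Fintype A] [Fintype B]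

/-- Grouping the coordinates of a tuple of elements of `ℝ ^ A × ℂ ^ B` according to `A` and `B`. -/
def shuffle : (ι → (A → ℝ) × (B → ℂ)) ≃ₗ[ℝ] (A → ι → ℝ) × (B → ι → ℂ) where
  toFun z := (fun a i => (z i).1 a, fun b i => (z i).2 b)
  invFun y := fun i => (fun a => y.1 a i, fun b => y.2 b i)
  map_add' _ _ := rfl
  map_smul' _ _ := rfl
  left_inv _ := rfl
  right_inv _ := rfl

theorem shuffle_preimage_closedBall :
    shuffle ι A B ⁻¹' Metric.closedBall 0 1 = Metric.closedBall 0 1 := by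
  ext z
  simp only [Set.mem_preimage, mem_closedBall_zero_iff, Prod.norm_def, max_le_iff,
    pi_norm_le_iff_of_nonneg zero_le_one, shuffle, LinearEquiv.coe_mk, LinearMap.coe_mk,
    AddHom.coe_mk]
  constructor
  · exact fun h i => ⟨fun a => h.1 a i, fun b => h.2 b i⟩
  · exact fun h => ⟨fun a i => (h i).1 a, fun b i => (h i).2 b⟩

instance : (volume : Measure ((A → ℝ) × (B → ℂ))).IsAddHaarMeasure :=
  Measure.prod.instIsAddHaarMeasure volume volume

theorem isAddHaarMeasure_volume_pi_const {X : Type*} [AddGroup X] [TopologicalSpace X]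
    [IsTopologicalAddGroup X] [MeasureSpace X] [BorelSpace X] [SecondCountableTopology X]
    [SigmaFinite (volume : Measure X)] [(volume : Measure X).IsAddHaarMeasure] :
    (volume : Measure (ι → X)).IsAddHaarMeasure :=
  inferInstanceAs (Measure.pi fun _ : ι => (volume : Measure X)).IsAddHaarMeasure

instance : (volume : Measure (A → ι → ℝ)).IsAddHaarMeasure := isAddHaarMeasure_volume_pi_const A

instance : (volume : Measure (A → ι → ℂ)).IsAddHaarMeasure := isAddHaarMeasure_volume_pi_const A

instance : (volume : Measure ((A → ι → ℝ) × (B → ι → ℂ))).IsAddHaarMeasure :=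
  Measure.prod.instIsAddHaarMeasure volume volume

instance : SigmaFinite (volume : Measure ((A → ℝ) × (B → ℂ))) :=
  inferInstanceAs (SigmaFinite ((volume : Measure (A → ℝ)).prod (volume : Measure (B → ℂ))))

instance : (volume : Measure (ι → (A → ℝ) × (B → ℂ))).IsAddHaarMeasure :=
  isAddHaarMeasure_volume_pi_const ι

theorem volume_closedBall_pi_zero_one {α X : Type*} [Fintype α] [MeasureSpace X]
    [SigmaFinite (volume : Measure X)] [MetricSpace X] [Zero X] :
    volume (Metric.closedBall (0 : α → X) 1) =
      volume (Metric.closedBall (0 : X) 1) ^ Fintype.card α := by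
  rw [volume_pi, Measure.pi_closedBall _ _ zero_le_one]
  simp

theorem volume_closedBall_prod_zero_one {X Y : Type*} [MeasureSpace X] [MeasureSpace Y]
    [SigmaFinite (volume : Measure Y)] [MetricSpace X] [Zero X] [MetricSpace Y] [Zero Y] :
    volume (Metric.closedBall (0 : X × Y) 1) =
      volume (Metric.closedBall (0 : X) 1) * volume (Metric.closedBall (0 : Y) 1) := by
  rw [Prod.zero_eq_mk, ← closedBall_prod_same, Measure.volume_eq_prod, Measure.prod_prod]

/-- The image of a Haar measure under a linear isomorphism is Haar. The factor is `1`, because the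
sup-norm unit balls correspond and have equal volume. -/
theorem measurePreserving_shuffle : MeasurePreserving (shuffle ι A B) volume volume := by
  have hc : Continuous (shuffle ι A B) := (shuffle ι A B).toLinearMap.continuous_of_finiteDimensional
  refine ⟨hc.measurable, ?_⟩
  have : (Measure.map (shuffle ι A B) volume).IsAddHaarMeasure :=
    (shuffle ι A B).toContinuousLinearEquiv.isAddHaarMeasure_map volume
  have h1 := Measure.isAddLeftInvariant_eq_smul (Measure.map (shuffle ι A B) volume) volume
  have h2 : volume (Metric.closedBall (0 : ι → (A → ℝ) × (B → ℂ)) 1) =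
      volume (Metric.closedBall (0 : (A → ι → ℝ) × (B → ι → ℂ)) 1) := by
    rw [volume_closedBall_pi_zero_one]
    iterate 2 rw [volume_closedBall_prod_zero_one]
    iterate 6 rw [volume_closedBall_pi_zero_one]
    simp only [mul_pow, ← pow_mul, mul_comm]
  have h3 : Measure.map (shuffle ι A B) volume (Metric.closedBall 0 1) =
      volume (Metric.closedBall (0 : (A → ι → ℝ) × (B → ι → ℂ)) 1) := by
    rw [Measure.map_apply hc.measurable Metric.isClosed_closedBall.measurableSet,
      shuffle_preimage_closedBall, h2]
  have h4 : volume (Metric.closedBall (0 : (A → ι → ℝ) × (B → ι → ℂ)) 1) ≠ 0 :=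
    (Metric.measure_closedBall_pos _ _ one_pos).ne'
  have h5 : volume (Metric.closedBall (0 : (A → ι → ℝ) × (B → ι → ℂ)) 1) ≠ ⊤ :=
    measure_closedBall_lt_top.ne
  rw [h1, Measure.smul_apply, ENNReal.smul_def, smul_eq_mul] at h3
  have h6 := (ENNReal.mul_eq_right h4 h5).1 h3
  rw [h1, ENNReal.coe_eq_one.1 h6, one_smul]

end Shuffle

open NumberField.InfinitePlace NumberField.mixedEmbedding
  NumberField.mixedEmbedding.fundamentalCone NumberField.Units
  NumberField.Units.dirichletUnitTheorem

open scoped Classical Pointwise ENNReal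

section Volume

variable {K : Type*} [Field K] [NumberField K] {ι : Type*} [Fintype ι]

/-- The component at an infinite place of a tuple in the mixed space, seen as a complex tuple. -/
def vecAt (w : InfinitePlace K) (z : ι → mixedSpace K) : ι → ℂ := fun i =>
  if h : w.IsReal then ((z i).1 ⟨w, h⟩ : ℂ) else (z i).2 ⟨w, not_isReal_iff_isComplex.1 h⟩

theorem vecAt_real {w : InfinitePlace K} (h : w.IsReal) (z : ι → mixedSpace K) :
    vecAt w z = fun i => ((z i).1 ⟨w, h⟩ : ℂ) := by
  funext i; simp [vecAt, h]

theorem vecAt_complex {w : InfinitePlace K} (h : w.IsComplex) (z : ι → mixedSpace K) :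
    vecAt w z = fun i => (z i).2 ⟨w, h⟩ := by
  funext i; simp [vecAt, not_isReal_iff_isComplex.2 h]

theorem continuous_vecAt (w : InfinitePlace K) :
    Continuous (vecAt w : (ι → mixedSpace K) → ι → ℂ) := by
  by_cases h : w.IsReal
  · simp_rw [funext (vecAt_real h)]; fun_prop
  · simp_rw [funext (vecAt_complex (ι := ι) (not_isReal_iff_isComplex.1 h))]; fun_prop

/-- The image of Lebesgue measure on `K_w ^ ι` under a function. -/
def localLaw (w : InfinitePlace K) (h : (ι → ℂ) → ℝ) : Measure ℝ :=
  if w.IsReal then Measure.map (fun x : ι → ℝ => h fun i => (x i : ℂ)) volume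
  else Measure.map h volume

/-- Each condition involves one place only, so grouping the coordinates by place turns the set into
a product. -/
theorem volume_vecAt_mem {h : InfinitePlace K → (ι → ℂ) → ℝ} (hh : ∀ w, Measurable (h w))
    {s : InfinitePlace K → Set ℝ} (hs : ∀ w, MeasurableSet (s w)) :
    volume {z : ι → mixedSpace K | ∀ w, h w (vecAt w z) ∈ s w} = ∏ w, localLaw w (h w) (s w) := by
  have h1 : {z : ι → mixedSpace K | ∀ w, h w (vecAt w z) ∈ s w} = shuffle ι _ _ ⁻¹'
      ((Set.univ.pi fun w : {w : InfinitePlace K // IsReal w} =>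
          (fun x : ι → ℝ => h w.1 fun i => (x i : ℂ)) ⁻¹' s w.1) ×ˢ
        (Set.univ.pi fun w : {w : InfinitePlace K // IsComplex w} => h w.1 ⁻¹' s w.1)) := by
    ext z
    simp only [Set.mem_ofPred_eq, Set.mem_preimage, Set.mem_prod, Set.mem_univ_pi, shuffle,
      LinearEquiv.coe_mk, LinearMap.coe_mk, AddHom.coe_mk, Subtype.forall]
    constructor
    · refine fun H => ⟨fun w hw => ?_, fun w hw => ?_⟩
      · simpa only [vecAt_real hw] using H w
      · simpa only [vecAt_complex hw] using H w
    · intro H w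
      by_cases hw : w.IsReal
      · simpa only [vecAt_real hw] using H.1 w hw
      · have hw' := not_isReal_iff_isComplex.1 hw
        simpa only [vecAt_complex hw'] using H.2 w hw'
  have hm : Measurable fun x : ι → ℝ => fun i => (x i : ℂ) := by fun_prop
  rw [h1, (measurePreserving_shuffle ι _ _).measure_preimage, Measure.volume_eq_prod,
    Measure.prod_prod, volume_pi_pi, volume_pi_pi,
    ← Fintype.prod_subtype_mul_prod_subtype (fun w : InfinitePlace K => w.IsReal)]
  · congr 1
    · refine Finset.prod_congr rfl fun w _ => ?_
      rw [localLaw, if_pos w.2]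
      exact (Measure.map_apply ((hh _).comp hm) (hs _)).symm
    · refine Fintype.prod_equiv (Equiv.subtypeEquivRight fun w => not_isReal_iff_isComplex.symm)
        _ _ fun w => ?_
      rw [Equiv.subtypeEquivRight_apply_coe, localLaw, if_neg (not_isReal_iff_isComplex.2 w.2)]
      exact (Measure.map_apply (hh _) (hs _)).symm
  · refine ((MeasurableSet.univ_pi fun w => ?_).prod
      (MeasurableSet.univ_pi fun w => ?_)).nullMeasurableSet
    · exact ((hh _).comp hm) (hs _)
    · exact hh _ (hs _)

variable (K ι) in
/-- A family of gauges, one for each infinite place. -/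
structure Gauge where
  toFun : InfinitePlace K → (ι → ℂ) → ℝ
  continuous : ∀ w, Continuous (toFun w)
  nonneg : ∀ w z, 0 ≤ toFun w z
  map_smul : ∀ w (c : ℂ) z, toFun w (c • z) = ‖c‖ * toFun w z
  eq_zero : ∀ w z, toFun w z = 0 → z = 0

namespace Gauge

variable (g : Gauge K ι)

/-- The values of all gauges. -/
def vec (z : ι → mixedSpace K) : realSpace K := fun w => g.toFun w (vecAt w z)

/-- The volume of the unit ball of a gauge. -/
def localVol (w : InfinitePlace K) : ℝ≥0∞ :=
  if w.IsReal then volume {x : ι → ℝ | g.toFun w (fun i => (x i : ℂ)) ≤ 1}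
  else volume {x : ι → ℂ | g.toFun w x ≤ 1}

theorem map_zero (w : InfinitePlace K) : g.toFun w 0 = 0 := by
  simpa using g.map_smul w 0 0

theorem setOf_le_eq_smul {V : Type*} [AddCommGroup V] [Module ℝ V] (f : V → ℝ)
    (h0 : ∀ x, f x = 0 → x = 0) (hn : ∀ x, 0 ≤ f x) (hs : ∀ (c : ℝ) x, f (c • x) = |c| * f x)
    {r : ℝ} (hr : 0 ≤ r) : {x | f x ≤ r} = r • {x | f x ≤ 1} := by
  rcases hr.eq_or_lt with rfl | hr
  · have hf0 : f 0 = 0 := by simpa using hs 0 0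
    have : {x | f x ≤ 1}.Nonempty := ⟨0, by simp [hf0]⟩
    rw [Set.zero_smul_set this]
    ext x
    simp only [Set.mem_ofPred_eq, Set.mem_zero]
    exact ⟨fun h => h0 x (le_antisymm h (hn x)), fun h => by rw [h, hf0]⟩
  · ext x
    rw [Set.mem_smul_set_iff_inv_smul_mem₀ hr.ne']
    simp only [Set.mem_ofPred_eq, hs, abs_inv, abs_of_pos hr]
    rw [inv_mul_le_iff₀ hr, mul_one]

/-- By homogeneity `{g ≤ s}` is the dilate by `s` of the unit ball, in real dimension `w.mult * card
ι`. Taking the `card ι`-th power makes the growth in `t` independent of `ι`, which is what allows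
the comparison with one variable. -/
theorem localLaw_Iic [Nonempty ι] (w : InfinitePlace K) (t : ℝ) :
    localLaw w (fun z => g.toFun w z ^ Fintype.card ι) (Set.Iic t) =
      g.localVol w * ENNReal.ofReal t ^ w.mult := by
  have hk : Fintype.card ι ≠ 0 := Fintype.card_ne_zero
  have hgm := (g.continuous w).measurable
  have hm : Measurable fun x : ι → ℝ => fun i => (x i : ℂ) := by fun_prop
  have hgm' : Measurable fun x : ι → ℝ =>
      (fun z => g.toFun w z ^ Fintype.card ι) fun i => (x i : ℂ) := (hgm.pow_const _).comp hm
  rcases lt_or_ge t 0 with ht | ht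
  · rw [ENNReal.ofReal_of_nonpos ht.le, zero_pow mult_ne_zero, mul_zero]
    unfold localLaw
    split_ifs
    · rw [Measure.map_apply hgm' measurableSet_Iic]
      convert measure_empty (μ := (volume : Measure (ι → ℝ)))
      refine Set.eq_empty_of_forall_notMem fun x hx => ?_
      exact absurd (pow_nonneg (g.nonneg w _) _) (not_le.2 (lt_of_le_of_lt hx ht))
    · rw [Measure.map_apply (hgm.pow_const _) measurableSet_Iic]
      convert measure_empty (μ := (volume : Measure (ι → ℂ)))
      refine Set.eq_empty_of_forall_notMem fun x hx => ?_
      exact absurd (pow_nonneg (g.nonneg w _) _) (not_le.2 (lt_of_le_of_lt hx ht))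
  · obtain ⟨s, hs0, rfl⟩ : ∃ s : ℝ, 0 ≤ s ∧ s ^ Fintype.card ι = t :=
      ⟨t ^ ((Fintype.card ι : ℝ)⁻¹), Real.rpow_nonneg ht _, Real.rpow_inv_natCast_pow ht hk⟩
    have hs' (z : ι → ℂ) : g.toFun w z ^ Fintype.card ι ≤ s ^ Fintype.card ι ↔ g.toFun w z ≤ s :=
      pow_le_pow_iff_left₀ (g.nonneg w z) hs0 hk
    unfold localLaw localVol
    split_ifs with hw
    · rw [Measure.map_apply hgm' measurableSet_Iic]
      have h1 : (fun x : ι → ℝ => g.toFun w (fun i => (x i : ℂ)) ^ Fintype.card ι) ⁻¹'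
          Set.Iic (s ^ Fintype.card ι) = s • {x : ι → ℝ | g.toFun w (fun i => (x i : ℂ)) ≤ 1} := by
        rw [← setOf_le_eq_smul _ _ (fun _ => g.nonneg _ _) _ hs0]
        · ext x; simp only [Set.mem_preimage, Set.mem_Iic, Set.mem_ofPred_eq, hs']
        · intro x hx
          funext i
          simpa using congrFun (g.eq_zero w _ hx) i
        · intro c x
          have := g.map_smul w c fun i => (x i : ℂ)
          rw [Complex.norm_real, Real.norm_eq_abs] at this
          rw [← this]
          congr 1
          funext i; simp
      rw [h1, Measure.addHaar_smul, abs_of_nonneg (by positivity), mul_comm,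
        Module.finrank_fintype_fun_eq_card, mult_isReal ⟨w, hw⟩, pow_one]
    · have hwc := not_isReal_iff_isComplex.1 hw
      rw [Measure.map_apply (hgm.pow_const _) measurableSet_Iic]
      have h1 : (fun x : ι → ℂ => g.toFun w x ^ Fintype.card ι) ⁻¹'
          Set.Iic (s ^ Fintype.card ι) = s • {x : ι → ℂ | g.toFun w x ≤ 1} := by
        rw [← setOf_le_eq_smul _ (g.eq_zero w) (fun _ => g.nonneg _ _) _ hs0]
        · ext x; simp only [Set.mem_preimage, Set.mem_Iic, Set.mem_ofPred_eq, hs']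
        · intro c x
          have := g.map_smul w c x
          rw [Complex.norm_real, Real.norm_eq_abs] at this
          rw [← this]
          congr 1
      rw [h1, Measure.addHaar_smul, abs_of_nonneg (by positivity), mul_comm, mult_isComplex ⟨w, hwc⟩,
        ← ENNReal.ofReal_pow (by positivity), ← pow_mul, Module.finrank_pi_fintype]
      simp

end Gauge

theorem measure_ext_of_Iic {μ ν : Measure ℝ} (hμ : ∀ t, μ (Set.Iic t) ≠ ⊤)
    (h : ∀ t, μ (Set.Iic t) = ν (Set.Iic t)) : μ = ν := by
  have key (ρ : Measure ℝ) (hρ : ∀ t, ρ (Set.Iic t) ≠ ⊤) {a b : ℝ} (hab : a < b) :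
      ρ (Set.Ioc a b) = ρ (Set.Iic b) - ρ (Set.Iic a) := by
    rw [← measure_sdiff (Set.Iic_subset_Iic.2 hab.le) measurableSet_Iic.nullMeasurableSet (hρ a)]
    congr 1
    ext x; simp [and_comm]
  refine Measure.ext_of_Ioc' _ _ (fun a b hab => ?_) fun a b hab => ?_
  · exact ne_top_of_le_ne_top (hμ b) (measure_mono Set.Ioc_subset_Iic_self)
  · rw [key μ hμ hab, key ν (fun t => h t ▸ hμ t) hab, h, h]

namespace Gauge

/-- The absolute values, as gauges in one variable. -/
def abs (K : Type*) [Field K] [NumberField K] : Gauge K Unit where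
  toFun _ z := ‖z ()‖
  continuous _ := by fun_prop
  nonneg _ _ := norm_nonneg _
  map_smul _ c z := by simp
  eq_zero _ z h := by funext i; exact norm_eq_zero.1 h

theorem localVol_abs (w : InfinitePlace K) :
    (abs K).localVol w = if w.IsReal then 2 else (NNReal.pi : ℝ≥0∞) := by
  unfold localVol
  split_ifs with h
  · have : {x : Unit → ℝ | (abs K).toFun w (fun i => (x i : ℂ)) ≤ 1} = Metric.closedBall 0 1 := by
      ext x
      simp [abs, pi_norm_le_iff_of_nonneg, Real.norm_eq_abs, Unique.forall_iff]
    rw [this, volume_closedBall_pi_zero_one]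
    simp
  · have : {x : Unit → ℂ | (abs K).toFun w x ≤ 1} = Metric.closedBall 0 1 := by
      ext x
      simp [abs, pi_norm_le_iff_of_nonneg, Unique.forall_iff]
    rw [this, volume_closedBall_pi_zero_one]
    simp

theorem abs_vec (z : Unit → mixedSpace K) : (abs K).vec z = normAtAllPlaces (z ()) := by
  funext w
  simp only [vec, abs, normAtAllPlaces_apply]
  by_cases hw : w.IsReal
  · rw [normAtPlace_apply_of_isReal hw, vecAt_real hw, Complex.norm_real]
  · have hw' := not_isReal_iff_isComplex.1 hw
    rw [normAtPlace_apply_of_isComplex hw', vecAt_complex hw']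

theorem continuous_vec (g : Gauge K ι) : Continuous g.vec :=
  continuous_pi fun w => (g.continuous w).comp (continuous_vecAt w)

variable [Nonempty ι] (g : Gauge K ι) (hg : ∀ w, g.localVol w ≠ ⊤)

-- The two distribution functions are proportional, so the power of the gauge has the same law as
-- the absolute value in one variable, up to the quotient of the volumes of the unit balls.
include hg in
theorem localLaw_eq_smul (w : InfinitePlace K) :
    localLaw w (fun z => g.toFun w z ^ Fintype.card ι) =
      (g.localVol w / (abs K).localVol w) •
        localLaw w (fun z => (abs K).toFun w z ^ Fintype.card Unit) := by
  have h0 : (abs K).localVol w ≠ 0 := by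
    rw [localVol_abs]; split_ifs <;> simp [NNReal.pi_ne_zero]
  have h1 : (abs K).localVol w ≠ ⊤ := by
    rw [localVol_abs]; split_ifs <;> simp
  refine measure_ext_of_Iic (fun t => ?_) fun t => ?_
  · rw [localLaw_Iic]
    exact ENNReal.mul_ne_top (hg w) (by simp)
  · rw [Measure.smul_apply, localLaw_Iic, localLaw_Iic, smul_eq_mul, ← mul_assoc,
      ENNReal.div_mul_cancel h0 h1]

-- Required to form and characterize the product measure over all places in `map_vec_pow`.
include hg in
theorem sigmaFinite_localLaw (w : InfinitePlace K) :
    SigmaFinite (localLaw w (fun z => g.toFun w z ^ Fintype.card ι)) := by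
  have : IsFiniteMeasureOnCompacts
      (localLaw w (fun z => g.toFun w z ^ Fintype.card ι)) := by
    refine ⟨fun s hs => ?_⟩
    obtain ⟨t, ht⟩ := hs.bddAbove
    have hst : s ⊆ Set.Iic t := fun x hx => ht hx
    refine lt_of_le_of_lt (measure_mono hst) ?_
    rw [localLaw_Iic]
    exact ENNReal.mul_lt_top (hg w).lt_top (by simp)
  infer_instance

-- Both sides are product measures over the places with proportional factors. Volumes of sets
-- defined by a gauge thereby become volumes in the mixed space itself.
include hg in
theorem map_vec_pow :
    Measure.map (fun z : ι → mixedSpace K => g.vec z ^ Fintype.card ι) volume =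
      (∏ w, (g.localVol w / (abs K).localVol w)) •
        Measure.map (normAtAllPlaces (K := K)) volume := by
  have hσ := sigmaFinite_localLaw (abs K) fun w => by rw [localVol_abs]; split_ifs <;> simp
  have hσ' := sigmaFinite_localLaw g hg
  have hm (w : InfinitePlace K) := ((g.continuous w).measurable.pow_const (Fintype.card ι))
  have hma (w : InfinitePlace K) := (((abs K).continuous w).measurable.pow_const (Fintype.card Unit))
  have hpi : Measure.map (normAtAllPlaces (K := K)) volume = Measure.pi fun w =>
      localLaw w (fun z => (abs K).toFun w z ^ Fintype.card Unit) := by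
    symm
    refine Measure.pi_eq fun s hs => ?_
    rw [← volume_vecAt_mem hma hs, Measure.map_apply (continuous_normAtAllPlaces K).measurable
      (MeasurableSet.univ_pi hs), ← (volume_preserving_funUnique Unit (mixedSpace K)).measure_preimage
      ((MeasurableSet.univ_pi hs).preimage
        (continuous_normAtAllPlaces K).measurable).nullMeasurableSet]
    congr 1
    ext z
    simp only [Set.mem_preimage, Set.mem_univ_pi, Set.mem_ofPred_eq]
    refine forall_congr' fun w => ?_
    have := congrFun (abs_vec z) w
    simp only [vec] at this
    rw [this]
    simp [MeasurableEquiv.funUnique]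
  have h1 : Measure.map (fun z : ι → mixedSpace K => g.vec z ^ Fintype.card ι) volume =
      Measure.pi fun w => localLaw w (fun z => g.toFun w z ^ Fintype.card ι) := by
    symm
    refine Measure.pi_eq fun s hs => ?_
    have hvm : Measurable fun z : ι → mixedSpace K => g.vec z ^ Fintype.card ι :=
      (g.continuous_vec.pow _).measurable
    rw [← volume_vecAt_mem hm hs, Measure.map_apply hvm (MeasurableSet.univ_pi hs)]
    congr 1
    ext z
    simp only [Set.mem_preimage, Set.mem_univ_pi, Set.mem_ofPred_eq, Pi.pow_apply, vec]
  rw [h1, hpi]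
  refine Measure.pi_eq fun s hs => ?_
  rw [Measure.smul_apply, Measure.pi_pi, smul_eq_mul, ← Finset.prod_mul_distrib]
  refine Finset.prod_congr rfl fun w _ => ?_
  rw [localLaw_eq_smul g hg w, Measure.smul_apply, smul_eq_mul]

end Gauge

variable (K) in
/-- The box of logarithmic coordinates with side `k` in the directions of the units. -/
def paramBox (k : ℝ) : Set (realSpace K) :=
  Set.univ.pi fun w => if w = w₀ then Set.Iic 0 else Set.Ico 0 k

theorem measurableSet_paramBox (k : ℝ) : MeasurableSet (paramBox K k) := by
  refine MeasurableSet.univ_pi fun _ => ?_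
  split_ifs
  · exact measurableSet_Iic
  · exact measurableSet_Ico

/-- The exponential integrated along `w₀` gives `1/n`, and each of the `rank K` remaining
coordinates contributes its side `k`. -/
theorem setLIntegral_paramBox_exp {n k : ℕ} (hn : 0 < n) :
    ∫⁻ x : realSpace K in paramBox K k, .ofReal (Real.exp (x w₀ * n)) =
      (n : ℝ≥0∞)⁻¹ * (k : ℝ≥0∞) ^ rank K := by
  have hn : 0 < (n : ℝ) := Nat.cast_pos.mpr hn
  rw [volume_pi, paramBox, Measure.restrict_pi_pi, lintegral_eq_lmarginal_univ 0,
    lmarginal_erase' _ (by fun_prop) (Finset.mem_univ w₀), if_pos rfl]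
  simp_rw [Function.update_self, lmarginal, lintegral_const, Measure.pi_univ, if_neg
    (Finset.ne_of_mem_erase (Subtype.prop _)), Measure.restrict_apply_univ, Real.volume_Ico,
    sub_zero, ENNReal.ofReal_natCast, Finset.prod_const, mul_comm _ (n : ℝ)]
  rw [← ofReal_integral_eq_lintegral_ofReal (integrableOn_exp_mul_Iic hn _), integral_exp_mul_Iic
    hn, mul_zero, Real.exp_zero, ENNReal.ofReal_div_of_pos hn, ENNReal.ofReal_one,
    ENNReal.ofReal_natCast, one_div]
  · congr 2
    simp [rank]
  · filter_upwards with _ using Real.exp_nonneg _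

/-- In polar and logarithmic coordinates the product over the complex places coming from the polar
density cancels against the Jacobian of `expMapBasis`, leaving the exponential integral over the
box. -/
theorem volume_normAtAllPlaces_preimage_paramBox (k : ℕ) :
    volume (normAtAllPlaces (K := K) ⁻¹' (expMapBasis '' paramBox K k)) =
      2 ^ nrRealPlaces K * NNReal.pi ^ nrComplexPlaces K * .ofReal (regulator K) *
        (k : ℝ≥0∞) ^ rank K := by
  have hmeas : MeasurableSet (expMapBasis '' paramBox K k) :=
    (measurableSet_paramBox _).image_of_continuousOn_injOn (continuous_expMapBasis K).continuousOn
      (injective_expMapBasis K).injOn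
  rw [volume_eq_two_pow_mul_two_pi_pow_mul_integral Set.preimage_image_preimage
    (hmeas.preimage (continuous_normAtAllPlaces K).measurable),
    normAtAllPlaces_image_preimage_expMapBasis,
    setLIntegral_expMapBasis_image (measurableSet_paramBox _) (by fun_prop)]
  simp_rw [ENNReal.inv_mul_cancel_right
    (Finset.prod_ne_zero_iff.mpr fun _ _ => ENNReal.ofReal_ne_zero_iff.mpr (expMapBasis_pos _ _))
    (ENNReal.prod_ne_top fun _ _ => ENNReal.ofReal_ne_top)]
  rw [setLIntegral_paramBox_exp Module.finrank_pos, ENNReal.ofReal_mul zero_le_two, mul_pow,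
    ENNReal.ofReal_ofNat, ← mul_assoc _ ((Module.finrank ℚ K : ℝ≥0∞)⁻¹), ← mul_assoc,
    mul_assoc (2⁻¹ ^ _ * _),
    ENNReal.mul_inv_cancel (Nat.cast_ne_zero.mpr Module.finrank_pos.ne')
    (ENNReal.natCast_ne_top _), mul_one, ENNReal.coe_nnreal_eq, NNReal.coe_real_pi,
    ← mul_assoc, ← mul_assoc]
  congr 2
  have h2 : (2 : ℝ≥0∞) ^ nrComplexPlaces K * 2⁻¹ ^ nrComplexPlaces K = 1 := by
    rw [← mul_pow, ENNReal.mul_inv_cancel two_ne_zero ENNReal.ofNat_ne_top, one_pow]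
  rw [mul_right_comm, mul_assoc (2 ^ nrRealPlaces K), h2, mul_one]

theorem expMapBasis_smul (c : ℝ) (x : realSpace K) (w : InfinitePlace K) :
    expMapBasis (c • x) w = expMapBasis x w ^ c := by
  rw [expMapBasis_apply, expMapBasis_apply, _root_.map_smul, expMap_smul, Pi.pow_apply]

/-- Raising the gauges to the power `card ι` multiplies logarithmic coordinates by `card ι`:
`paramSet` becomes the box of side `card ι`, whence the factor `card ι ^ rank K`. By `map_vec_pow`
the volume is then computed in one variable. -/
theorem Gauge.volume_cone [Nonempty ι] (g : Gauge K ι) (hg : ∀ w, g.localVol w ≠ ⊤) :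
    volume {z : ι → mixedSpace K | g.vec z ∈ expMapBasis '' paramSet K} =
      .ofReal (regulator K) * (Fintype.card ι : ℝ≥0∞) ^ rank K * ∏ w, g.localVol w := by
  have hk : Fintype.card ι ≠ 0 := Fintype.card_ne_zero
  have hmeas : MeasurableSet (expMapBasis '' paramBox K (Fintype.card ι)) :=
    (measurableSet_paramBox _).image_of_continuousOn_injOn (continuous_expMapBasis K).continuousOn
      (injective_expMapBasis K).injOn
  have h1 : {z : ι → mixedSpace K | g.vec z ∈ expMapBasis '' paramSet K} =
      (fun z => g.vec z ^ Fintype.card ι) ⁻¹' (expMapBasis '' paramBox K (Fintype.card ι)) := by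
    have hkr : (0 : ℝ) < Fintype.card ι := by positivity
    ext z
    constructor
    · rintro ⟨x, hx, hxz⟩
      refine ⟨(Fintype.card ι : ℝ) • x, ?_, ?_⟩
      · intro w _
        have := hx w (Set.mem_univ w)
        beta_reduce at this ⊢
        split_ifs at this ⊢ with h
        · exact mul_nonpos_of_nonneg_of_nonpos hkr.le this
        · exact ⟨mul_nonneg hkr.le this.1, by
            simpa using mul_lt_mul_of_pos_left this.2 hkr⟩
      · funext w
        rw [expMapBasis_smul, hxz, Real.rpow_natCast]; rfl
    · rintro ⟨y, hy, hyz⟩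
      refine ⟨(Fintype.card ι : ℝ)⁻¹ • y, ?_, ?_⟩
      · intro w _
        have := hy w (Set.mem_univ w)
        beta_reduce at this ⊢
        split_ifs at this ⊢ with h
        · exact mul_nonpos_of_nonneg_of_nonpos (inv_nonneg.2 hkr.le) this
        · refine ⟨mul_nonneg (inv_nonneg.2 hkr.le) this.1, ?_⟩
          rw [Pi.smul_apply, smul_eq_mul, inv_mul_lt_iff₀ hkr, mul_one]
          exact this.2
      · funext w
        rw [expMapBasis_smul, hyz]
        exact Real.pow_rpow_inv_natCast (g.nonneg _ _) hk
  have hvm : Measurable fun z : ι → mixedSpace K => g.vec z ^ Fintype.card ι :=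
    (g.continuous_vec.pow _).measurable
  rw [h1, ← Measure.map_apply hvm hmeas, map_vec_pow g hg, Measure.smul_apply,
    Measure.map_apply (continuous_normAtAllPlaces K).measurable hmeas,
    volume_normAtAllPlaces_preimage_paramBox, smul_eq_mul]
  have h2 : ∏ w, (abs K).localVol w = 2 ^ nrRealPlaces K * NNReal.pi ^ nrComplexPlaces K := by
    simp_rw [localVol_abs]
    rw [Finset.prod_ite, Finset.prod_const, Finset.prod_const, nrRealPlaces, nrComplexPlaces,
      Fintype.card_subtype, Fintype.card_subtype]
    simp_rw [not_isReal_iff_isComplex]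
  have h3 : ∏ w, (abs K).localVol w ≠ 0 := by
    rw [h2]; simp [NNReal.pi_ne_zero]
  have h4 : ∏ w, (abs K).localVol w ≠ ⊤ := by
    rw [h2]; exact ENNReal.mul_ne_top (by simp) (by simp)
  have h5 : (∏ w, (g.localVol w / (abs K).localVol w)) * ∏ w, (abs K).localVol w =
      ∏ w, g.localVol w := by
    rw [← Finset.prod_mul_distrib]
    refine Finset.prod_congr rfl fun w _ => ENNReal.div_mul_cancel ?_ ?_
    · rw [localVol_abs]; split_ifs <;> simp [NNReal.pi_ne_zero]
    · rw [localVol_abs]; split_ifs <;> simp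
  rw [← h5, ← h2]
  ring

end Volume

end SchanuelMorphism

namespace SchanuelMorphism

open NumberField.InfinitePlace NumberField.mixedEmbedding
  NumberField.mixedEmbedding.fundamentalCone NumberField.Units
  NumberField.Units.dirichletUnitTheorem

open scoped Classical Pointwise ENNReal

set_option linter.unusedSectionVars false

/-! ### Parametrization of the boundary of the cone -/

section Faces

variable {K : Type*} [Field K] [NumberField K]

theorem contDiff_expMapBasis_apply (w : InfinitePlace K) :
    ContDiff ℝ 1 fun x : realSpace K => expMapBasis x w := by
  have h : (fun x : realSpace K => expMapBasis x w) = fun x =>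
      Real.exp ((w.mult : ℝ)⁻¹ * ((completeBasis K).equivFunL.symm x) w) := rfl
  rw [h]
  refine Real.contDiff_exp.comp (contDiff_const.mul ?_)
  exact (contDiff_apply ℝ ℝ w).comp ((completeBasis K).equivFunL.symm).contDiff

/-- Inserting the coordinate `0` at `w₀`. -/
def insertZero (p : {w : InfinitePlace K // w ≠ w₀} → ℝ) : realSpace K :=
  fun w => if h : w = w₀ then 0 else p ⟨w, h⟩

theorem norm_insertZero_sub_le (p q : {w : InfinitePlace K // w ≠ w₀} → ℝ) :
    ‖insertZero p - insertZero q‖ ≤ ‖p - q‖ := by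
  refine (pi_norm_le_iff_of_nonneg (norm_nonneg _)).2 fun w => ?_
  by_cases h : w = w₀
  · simp [insertZero, h]
  · simpa [insertZero, h] using norm_le_pi_norm (p - q) ⟨w, h⟩

theorem insertZero_mem_Icc {p : {w : InfinitePlace K // w ≠ w₀} → ℝ} (hp : p ∈ Set.Icc 0 1) :
    insertZero p ∈ Set.Icc (0 : realSpace K) 1 := by
  constructor <;> intro w <;> by_cases h : w = w₀ <;> simp [insertZero, h]
  · exact hp.1 ⟨w, h⟩
  · exact hp.2 ⟨w, h⟩

-- The map is smooth and positive, the cube is compact and there are finitely many places, so one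
-- constant serves for all three bounds.
variable (K) in
theorem exists_expMapBasis_bounds : ∃ A : ℝ, 1 ≤ A ∧
    (∀ x ∈ Set.Icc (0 : realSpace K) 1, ∀ w, A⁻¹ ≤ expMapBasis x w ∧ expMapBasis x w ≤ A) ∧
    ∀ x ∈ Set.Icc (0 : realSpace K) 1, ∀ y ∈ Set.Icc (0 : realSpace K) 1, ∀ w,
      |expMapBasis x w - expMapBasis y w| ≤ A * ‖x - y‖ := by
  have hc : IsCompact (Set.Icc (0 : realSpace K) 1) := isCompact_Icc
  have h1 (w : InfinitePlace K) : ∃ A : ℝ, ∀ x ∈ Set.Icc (0 : realSpace K) 1, expMapBasis x w ≤ A := by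
    obtain ⟨A, hA⟩ := (hc.image (contDiff_expMapBasis_apply w).continuous).bddAbove
    exact ⟨A, fun x hx => hA ⟨x, hx, rfl⟩⟩
  have h2 (w : InfinitePlace K) : ∃ A : ℝ, ∀ x ∈ Set.Icc (0 : realSpace K) 1,
      (expMapBasis x w)⁻¹ ≤ A := by
    obtain ⟨A, hA⟩ := (hc.image ((contDiff_expMapBasis_apply w).continuous.inv₀
      fun x => (expMapBasis_pos x w).ne')).bddAbove
    exact ⟨A, fun x hx => hA ⟨x, hx, rfl⟩⟩
  have h3 (w : InfinitePlace K) : ∃ A : ℝ, ∀ x ∈ Set.Icc (0 : realSpace K) 1,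
      ∀ y ∈ Set.Icc (0 : realSpace K) 1, |expMapBasis x w - expMapBasis y w| ≤ A * ‖x - y‖ := by
    obtain ⟨A, hA⟩ := LocallyLipschitzOn.exists_lipschitzOnWith_of_compact hc
      ((contDiff_expMapBasis_apply w).locallyLipschitz.locallyLipschitzOn)
    exact ⟨A, fun x hx y hy => by simpa [dist_eq_norm] using hA.dist_le_mul x hx y hy⟩
  choose A1 hA1 using h1
  choose A2 hA2 using h2
  choose A3 hA3 using h3
  have hle1 (w : InfinitePlace K) : |A1 w| ≤ ∑ w, |A1 w| :=
    Finset.single_le_sum (f := fun w => |A1 w|) (fun _ _ => abs_nonneg _) (Finset.mem_univ w)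
  have hle2 (w : InfinitePlace K) : |A2 w| ≤ ∑ w, |A2 w| :=
    Finset.single_le_sum (f := fun w => |A2 w|) (fun _ _ => abs_nonneg _) (Finset.mem_univ w)
  have hle3 (w : InfinitePlace K) : |A3 w| ≤ ∑ w, |A3 w| :=
    Finset.single_le_sum (f := fun w => |A3 w|) (fun _ _ => abs_nonneg _) (Finset.mem_univ w)
  have hn1 : 0 ≤ ∑ w, |A1 w| := Finset.sum_nonneg fun _ _ => abs_nonneg _
  have hn2 : 0 ≤ ∑ w, |A2 w| := Finset.sum_nonneg fun _ _ => abs_nonneg _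
  have hn3 : 0 ≤ ∑ w, |A3 w| := Finset.sum_nonneg fun _ _ => abs_nonneg _
  refine ⟨1 + ∑ w, |A1 w| + ∑ w, |A2 w| + ∑ w, |A3 w|, by linarith, fun x hx w => ⟨?_, ?_⟩,
    fun x hx y hy w => (hA3 w x hx y hy).trans (mul_le_mul_of_nonneg_right ?_ (norm_nonneg _))⟩
  · rw [inv_le_comm₀ (by linarith) (expMapBasis_pos x w)]
    linarith [hA2 w x hx, le_abs_self (A2 w), hle2 w]
  · linarith [hA1 w x hx, le_abs_self (A1 w), hle1 w]
  · linarith [le_abs_self (A3 w), hle3 w]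

/-- The faces of the logarithmic box, parametrized by the unit cube. -/
def faceMap : Option ({w : InfinitePlace K // w ≠ w₀} × Bool) →
    ({w : InfinitePlace K // w ≠ w₀} → ℝ) → realSpace K
  | none, p => expMapBasis (insertZero p)
  | some (k, ε), p => p k • expMapBasis (insertZero (Function.update p k (if ε then 1 else 0)))

theorem update_mem_Icc {p : {w : InfinitePlace K // w ≠ w₀} → ℝ} (hp : p ∈ Set.Icc 0 1)
    (k : {w : InfinitePlace K // w ≠ w₀}) {a : ℝ} (ha : a ∈ Set.Icc (0 : ℝ) 1) :
    Function.update p k a ∈ Set.Icc 0 1 := by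
  constructor <;> intro i <;> by_cases h : i = k
  · subst h; simpa using ha.1
  · simpa [h] using hp.1 i
  · subst h; simpa using ha.2
  · simpa [h] using hp.2 i

-- A lateral face is a coordinate in `[0, 1]` times a bounded Lipschitz map; the product rule has
-- two terms, hence the constant `2 * A`.
variable (K) in
theorem exists_faceMap_bounds : ∃ A : ℝ, 1 ≤ A ∧
    (∀ j, ∀ p ∈ Set.Icc (0 : {w : InfinitePlace K // w ≠ w₀} → ℝ) 1, ∀ w, |faceMap j p w| ≤ A) ∧
    ∀ j, ∀ p ∈ Set.Icc (0 : {w : InfinitePlace K // w ≠ w₀} → ℝ) 1, ∀ q ∈ Set.Icc 0 1, ∀ w,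
      |faceMap j p w - faceMap j q w| ≤ A * ‖p - q‖ := by
  obtain ⟨A, hA1, hA, hL⟩ := exists_expMapBasis_bounds K
  have hε (ε : Bool) : (if ε then 1 else 0 : ℝ) ∈ Set.Icc (0 : ℝ) 1 := by split_ifs <;> simp
  refine ⟨2 * A, by linarith, fun j p hp w => ?_, fun j p hp q hq w => ?_⟩
  · rcases j with _ | ⟨k, ε⟩
    · have := hA _ (insertZero_mem_Icc hp) w
      simp only [faceMap]
      rw [abs_of_pos (expMapBasis_pos _ _)]
      linarith
    · have := hA _ (insertZero_mem_Icc (update_mem_Icc hp k (hε ε))) w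
      simp only [faceMap, Pi.smul_apply, smul_eq_mul, abs_mul]
      rw [abs_of_pos (expMapBasis_pos _ _), abs_of_nonneg (hp.1 k)]
      have h1 : p k ≤ 1 := hp.2 k
      have h0 : 0 ≤ p k := hp.1 k
      nlinarith [expMapBasis_pos (insertZero (Function.update p k (if ε then 1 else 0))) w]
  · rcases j with _ | ⟨k, ε⟩
    · have := hL _ (insertZero_mem_Icc hp) _ (insertZero_mem_Icc hq) w
      simp only [faceMap]
      have h2 := mul_le_mul_of_nonneg_left (norm_insertZero_sub_le p q) (zero_le_one.trans hA1)
      nlinarith [norm_nonneg (p - q)]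
    · set p' := Function.update p k (if ε then 1 else 0 : ℝ) with hp'
      set q' := Function.update q k (if ε then 1 else 0 : ℝ) with hq'
      have hpm := insertZero_mem_Icc (update_mem_Icc hp k (hε ε))
      have hqm := insertZero_mem_Icc (update_mem_Icc hq k (hε ε))
      have h1 := hL _ hpm _ hqm w
      have h2 : ‖p' - q'‖ ≤ ‖p - q‖ := by
        refine (pi_norm_le_iff_of_nonneg (norm_nonneg _)).2 fun i => ?_
        by_cases h : i = k
        · subst h; simp [hp', hq']
        · simpa [hp', hq', h] using norm_le_pi_norm (p - q) i
      have h3 := mul_le_mul_of_nonneg_left ((norm_insertZero_sub_le p' q').trans h2)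
        (zero_le_one.trans hA1)
      have h4 := (hA _ hpm w).2
      have h5 : |p k - q k| ≤ ‖p - q‖ := norm_le_pi_norm (p - q) k
      simp only [faceMap, Pi.smul_apply, smul_eq_mul]
      have h6 : p k * expMapBasis (insertZero p') w - q k * expMapBasis (insertZero q') w =
          (p k - q k) * expMapBasis (insertZero p') w +
            q k * (expMapBasis (insertZero p') w - expMapBasis (insertZero q') w) := by ring
      rw [h6]
      refine (abs_add_le _ _).trans ?_
      rw [abs_mul, abs_mul, abs_of_pos (expMapBasis_pos _ _), abs_of_nonneg (hq.1 k)]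
      have h7 : |p k - q k| * expMapBasis (insertZero p') w ≤ ‖p - q‖ * A :=
        mul_le_mul h5 h4 (expMapBasis_pos _ _).le (norm_nonneg _)
      have h8 : q k * |expMapBasis (insertZero p') w - expMapBasis (insertZero q') w| ≤
          1 * (A * ‖p - q‖) :=
        mul_le_mul (hq.2 k) (h1.trans h3) (abs_nonneg _) zero_le_one
      linarith

/-- A boundary point has `y w₀ = 0` (top face) or some other coordinate equal to `0` or `1` (lateral
face). On a lateral face the slot of the fixed coordinate is free and stores the radial factor `exp
(y w₀)`, so the unbounded direction is also parametrized by `[0, 1]`. -/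
theorem exists_faceMap_eq {y : realSpace K} (hy : y ∈ closure (paramSet K))
    (hy' : y ∉ interior (paramSet K)) :
    ∃ j, ∃ p ∈ Set.Icc (0 : {w : InfinitePlace K // w ≠ w₀} → ℝ) 1,
      faceMap j p = expMapBasis y := by
  rw [closure_paramSet, Set.mem_univ_pi] at hy
  rw [interior_paramSet, Set.mem_univ_pi] at hy'
  push Not at hy'
  obtain ⟨k, hk⟩ := hy'
  have hy0 : y w₀ ≤ 0 := by simpa using hy w₀
  have hyw (w : {w : InfinitePlace K // w ≠ w₀}) : y w ∈ Set.Icc (0 : ℝ) 1 := by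
    simpa [w.2] using hy w.1
  by_cases h : k = w₀
  · subst h
    refine ⟨none, fun w => y w, ⟨fun w => (hyw w).1, fun w => (hyw w).2⟩, ?_⟩
    simp only [faceMap]
    congr 1
    funext w
    by_cases hw : w = w₀
    · subst hw
      simp only [if_true, Set.mem_Iio, not_lt] at hk
      simp [insertZero, le_antisymm hy0 hk]
    · simp [insertZero, hw]
  · have hk2 : y k = 0 ∨ y k = 1 := by
      simp only [h, if_false, Set.mem_Ioo, not_and_or, not_lt] at hk
      exact hk.imp (fun h' => le_antisymm h' (hyw ⟨k, h⟩).1) fun h' => le_antisymm (hyw ⟨k, h⟩).2 h'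
    have hp : (fun w : {w : InfinitePlace K // w ≠ w₀} => y w) ∈ Set.Icc 0 1 :=
      ⟨fun w => (hyw w).1, fun w => (hyw w).2⟩
    refine ⟨some (⟨k, h⟩, decide (y k = 1)), Function.update (fun w => y w) ⟨k, h⟩ (Real.exp (y w₀)),
      update_mem_Icc hp _ ⟨(Real.exp_pos _).le, Real.exp_le_one_iff.2 hy0⟩, ?_⟩
    simp only [faceMap, Function.update_self, Function.update_idem, decide_eq_true_eq]
    rw [expMapBasis_apply'' y]
    congr 2
    funext w
    by_cases hw : w = w₀
    · simp [insertZero, hw]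
    · simp only [insertZero, hw, dif_neg, not_false_eq_true, if_false]
      by_cases hwk : w = k
      · subst hwk
        rw [Function.update_self]
        rcases hk2 with h0 | h0 <;> simp [h0]
      · rw [Function.update_of_ne (fun H => hwk (congrArg Subtype.val H))]

end Faces

end SchanuelMorphism

namespace SchanuelMorphism

open NumberField.InfinitePlace NumberField.mixedEmbedding
  NumberField.mixedEmbedding.fundamentalCone NumberField.Units
  NumberField.Units.dirichletUnitTheorem

open scoped Classical Pointwise ENNReal nonZeroDivisors

set_option linter.unusedSectionVars false

/-! ### The gauge cone: boundedness and Lipschitz parametrization of its frontier. -/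

section Cone

variable {K : Type*} [Field K] [NumberField K] {ι : Type*} [Fintype ι]

/-- The tuple in the mixed space with given components at the infinite places. -/
def assemble (y : InfinitePlace K → ι → ℂ) : ι → mixedSpace K :=
  fun i => (fun w => (y w.1 i).re, fun w => y w.1 i)

theorem assemble_vecAt (z : ι → mixedSpace K) : assemble (fun w => vecAt w z) = z := by
  funext i
  refine Prod.ext ?_ ?_ <;> funext w
  · simp [assemble, vecAt_real w.2]
  · simp [assemble, vecAt_complex w.2]

theorem norm_assemble_sub_le {y y' : InfinitePlace K → ι → ℂ} {c : ℝ} (hc : 0 ≤ c)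
    (h : ∀ w, ‖y w - y' w‖ ≤ c) : ‖assemble y - assemble y'‖ ≤ c := by
  refine (pi_norm_le_iff_of_nonneg hc).2 fun i => ?_
  have hi (w) : ‖y w i - y' w i‖ ≤ c := (norm_le_pi_norm (y w - y' w) i).trans (h w)
  refine max_le ((pi_norm_le_iff_of_nonneg hc).2 fun w => ?_)
    ((pi_norm_le_iff_of_nonneg hc).2 fun w => ?_)
  · refine le_trans ?_ (hi w.1)
    simpa [assemble] using Complex.abs_re_le_norm (y w.1 i - y' w.1 i)
  · exact hi w.1

theorem im_vecAt_eq_zero {w : InfinitePlace K} (hw : w.IsReal) (z : ι → mixedSpace K) (i : ι) :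
    (vecAt w z i).im = 0 := by
  simp [vecAt_real hw]

theorem vecAt_smul (w : InfinitePlace K) (c : ℝ) (z : ι → mixedSpace K) :
    vecAt w (c • z) = (c : ℂ) • vecAt w z := by
  by_cases h : w.IsReal
  · rw [vecAt_real h, vecAt_real h]; funext i; simp
  · have h' := not_isReal_iff_isComplex.1 h
    rw [vecAt_complex h', vecAt_complex h']; funext i; simp

namespace Gauge

variable (g : Gauge K ι)

theorem vec_smul {c : ℝ} (hc : 0 ≤ c) (z : ι → mixedSpace K) : g.vec (c • z) = c • g.vec z := by
  funext w
  simp only [vec, Pi.smul_apply, smul_eq_mul]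
  rw [vecAt_smul, g.map_smul, Complex.norm_real, Real.norm_of_nonneg hc]

theorem eq_zero_of_vec_eq_zero {z : ι → mixedSpace K} (h : g.vec z = 0) : z = 0 := by
  rw [← assemble_vecAt z]
  have (w : InfinitePlace K) : vecAt w z = 0 := g.eq_zero w _ (congrFun h w)
  simp_rw [this]
  rfl

/-- The cone of tuples of gauge in the logarithmic box. -/
def cone : Set (ι → mixedSpace K) := {z | g.vec z ∈ expMapBasis '' paramSet K}

theorem mem_smul_cone {T : ℝ} (hT : 0 < T) {z : ι → mixedSpace K} :
    z ∈ T • g.cone ↔ g.vec z ∈ T • (expMapBasis '' paramSet K) := by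
  rw [Set.mem_smul_set_iff_inv_smul_mem₀ hT.ne', Set.mem_smul_set_iff_inv_smul_mem₀ hT.ne', cone,
    Set.mem_ofPred_eq, vec_smul g (inv_nonneg.2 hT.le)]

/-- The gauge vector is continuous and `expMapBasis` is open, so the gauge vector of a frontier
point avoids the image of the interior of `paramSet`. The origin is exceptional because `paramSet`
is unbounded in the direction of `w₀`, so that its image accumulates at `0`. -/
theorem vec_mem_of_mem_frontier_cone {z : ι → mixedSpace K} (hz : z ∈ frontier g.cone) :
    z = 0 ∨ (∀ w, 0 < g.vec z w) ∧ ∃ j, ∃ p ∈ Set.Icc (0 : {w : InfinitePlace K // w ≠ w₀} → ℝ) 1,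
      faceMap j p = g.vec z := by
  have h1 : g.vec z ∈ compactSet K := by
    have : closure g.cone ⊆ g.vec ⁻¹' compactSet K := by
      refine (g.continuous_vec.closure_preimage_subset _).trans (Set.preimage_mono ?_)
      refine (isCompact_compactSet K).isClosed.closure_subset_iff.mpr ?_
      exact (Set.image_mono subset_closure).trans (expMapBasis_closure_subset_compactSet _)
    exact this hz.1
  have h2 : g.vec z ∉ expMapBasis '' interior (paramSet K) := by
    intro h
    refine hz.2 (mem_interior.2 ⟨g.vec ⁻¹' (expMapBasis '' interior (paramSet K)),
      Set.preimage_mono (Set.image_mono interior_subset), ?_, h⟩)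
    refine IsOpen.preimage g.continuous_vec ?_
    exact expMapBasis.isOpen_image_of_subset_source isOpen_interior (by simp [expMapBasis_source])
  rw [compactSet_eq_union] at h1
  rcases h1 with ⟨y, hy, hyz⟩ | h1
  · right
    obtain ⟨j, p, hp, hj⟩ := exists_faceMap_eq hy fun h => h2 ⟨y, h, hyz⟩
    exact ⟨fun w => hyz ▸ expMapBasis_pos y w, j, p, hp, hj.trans hyz⟩
  · exact Or.inl (g.eq_zero_of_vec_eq_zero h1)

/-- The unit spheres of the gauges are covered by the images of `N` maps with Lipschitz constant
at most `B`. -/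
def HasLipschitzSpheres (N : ℕ) (B : ℝ) : Prop :=
  ∀ w : InfinitePlace K, ∃ φ : Fin N → (Fin (w.mult * Fintype.card ι - 1) → ℝ) → ι → ℂ,
    (∀ i, ∀ s ∈ Set.Icc 0 1, ∀ t ∈ Set.Icc 0 1, ‖φ i s - φ i t‖ ≤ B * ‖s - t‖) ∧
    ∀ z : ι → ℂ, (w.IsReal → ∀ i, (z i).im = 0) → g.toFun w z = 1 →
      ∃ i, ∃ s ∈ Set.Icc 0 1, φ i s = z

/-- A bound for tuples over the completions in terms of the gauges. -/
def IsBoundedBy (C : ℝ) : Prop :=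
  ∀ (w : InfinitePlace K) (z : ι → ℂ), (w.IsReal → ∀ i, (z i).im = 0) → ‖z‖ ≤ C * g.toFun w z

theorem isBounded_cone {C : ℝ} (hC : 0 ≤ C) (h : g.IsBoundedBy C) : Bornology.IsBounded g.cone := by
  obtain ⟨R, hR⟩ := isBounded_iff_forall_norm_le.1 (isCompact_compactSet K).isBounded
  refine isBounded_iff_forall_norm_le.2 ⟨C * max R 0, fun z hz => ?_⟩
  have hz' : g.vec z ∈ compactSet K :=
    ((Set.image_mono subset_closure).trans (expMapBasis_closure_subset_compactSet K)) hz
  have h1 := norm_assemble_sub_le (y := fun w => vecAt w z) (y' := fun _ => 0)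
    (c := C * max R 0) (by positivity) fun w => by
      rw [sub_zero]
      refine (h w _ fun hw i => im_vecAt_eq_zero hw z i).trans (mul_le_mul_of_nonneg_left ?_ hC)
      refine le_trans ?_ (le_max_left _ _)
      exact (le_abs_self _).trans ((norm_le_pi_norm (g.vec z) w).trans (hR _ hz'))
  have h0 : assemble (fun _ : InfinitePlace K => (0 : ι → ℂ)) = 0 := rfl
  rwa [assemble_vecAt, h0, sub_zero] at h1

/-- Parameters for the boundary of the cone. -/
abbrev FaceIndex (K : Type*) [Field K] [NumberField K] (k : ℕ) : Type _ :=
  {w : InfinitePlace K // w ≠ w₀} ⊕ (Σ w : InfinitePlace K, Fin (w.mult * k - 1))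

/-- A dimension count: the spheres lose one dimension at each place and the faces restore one at
each place but `w₀`, so the parameter cube has codimension one. -/
theorem card_faceIndex {k : ℕ} (hk : 0 < k) :
    Fintype.card (FaceIndex K k) = Module.finrank ℚ K * k - 1 := by
  rw [Fintype.card_sum, Fintype.card_sigma]
  simp_rw [Fintype.card_fin]
  have h1 : ∑ w : InfinitePlace K, (w.mult * k - 1) + Fintype.card (InfinitePlace K) =
      Module.finrank ℚ K * k := by
    rw [← sum_mult_eq, Finset.sum_mul, ← Finset.card_univ, Finset.card_eq_sum_ones,
      ← Finset.sum_add_distrib]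
    refine Finset.sum_congr rfl fun w _ => ?_
    have : 0 < w.mult * k := Nat.mul_pos mult_pos hk
    omega
  have h2 : Fintype.card {w : InfinitePlace K // w ≠ w₀} = Fintype.card (InfinitePlace K) - 1 := by
    simp
  have h3 : 0 < Fintype.card (InfinitePlace K) := Fintype.card_pos
  omega

/-- At each place a nonzero frontier point is its gauge value times a point of the unit sphere;
`faceMap` supplies the values and `φ` the sphere points. By the product rule the Lipschitz constant
involves a bound `C + B` for the sphere points, multiplied by the variation of the faces. For unit
rank `0` there is no place besides `w₀`, the face maps do not vary, and `C` disappears. -/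
theorem exists_frontier_param {A : ℝ} (hA : 1 ≤ A)
    (hA1 : ∀ j, ∀ p ∈ Set.Icc (0 : {w : InfinitePlace K // w ≠ w₀} → ℝ) 1, ∀ w, |faceMap j p w| ≤ A)
    (hA2 : ∀ j, ∀ p ∈ Set.Icc (0 : {w : InfinitePlace K // w ≠ w₀} → ℝ) 1, ∀ q ∈ Set.Icc 0 1, ∀ w,
      |faceMap j p w - faceMap j q w| ≤ A * ‖p - q‖)
    {N : ℕ} {B C : ℝ} (hB : 0 ≤ B) (hC : 0 ≤ C) (hg : g.HasLipschitzSpheres N B)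
    (hgC : g.IsBoundedBy C) :
    ∃ ψ : Option (Option ({w : InfinitePlace K // w ≠ w₀} × Bool) × (InfinitePlace K → Fin N)) →
        (FaceIndex K (Fintype.card ι) → ℝ) → ι → mixedSpace K,
      (∀ j, ∀ s ∈ Set.Icc (0 : FaceIndex K (Fintype.card ι) → ℝ) 1, ∀ t ∈ Set.Icc 0 1,
        dist (ψ j s) (ψ j t) ≤ 2 * A * (B + if rank K = 0 then 0 else C) * dist s t) ∧
      ∀ z ∈ frontier g.cone, ∃ j, ∃ s ∈ Set.Icc 0 1, ψ j s = z := by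
  choose φ hφL hφ using hg
  -- maps that do not meet the unit sphere are replaced by a constant
  let φ' (w : InfinitePlace K) (i : Fin N) (s : Fin (w.mult * Fintype.card ι - 1) → ℝ) : ι → ℂ :=
    if ∃ s ∈ Set.Icc 0 1, (w.IsReal → ∀ l, (φ w i s l).im = 0) ∧ g.toFun w (φ w i s) = 1
      then φ w i s else 0
  have hL (w i s) (hs : s ∈ Set.Icc 0 1) (t) (ht : t ∈ Set.Icc 0 1) :
      ‖φ' w i s - φ' w i t‖ ≤ B * ‖s - t‖ := by
    simp only [φ']
    split_ifs with h
    · exact hφL w i s hs t ht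
    · simpa using by positivity
  have hcov (w) (z : ι → ℂ) (hz : w.IsReal → ∀ i, (z i).im = 0) (hz1 : g.toFun w z = 1) :
      ∃ i, ∃ s ∈ Set.Icc 0 1, φ' w i s = z := by
    obtain ⟨i, s, hs, rfl⟩ := hφ w z hz hz1
    exact ⟨i, s, hs, if_pos ⟨s, hs, hz, hz1⟩⟩
  -- A retained map passes through a point of the sphere, of norm at most `C`, and the cube has
  -- sup-diameter at most `1`.
  have hbd (w i s) (hs : s ∈ Set.Icc 0 1) : ‖φ' w i s‖ ≤ C + B := by
    simp only [φ']
    split_ifs with h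
    · obtain ⟨t, ht, htr, ht1⟩ := h
      have h1 := hφL w i s hs t ht
      have h2 : ‖s - t‖ ≤ 1 := by
        refine (pi_norm_le_iff_of_nonneg zero_le_one).2 fun l => ?_
        rw [Real.norm_eq_abs, abs_le]
        constructor <;> simp only [Pi.sub_apply] <;>
          linarith [show (0 : ℝ) ≤ s l from hs.1 l, show s l ≤ (1 : ℝ) from hs.2 l,
            show (0 : ℝ) ≤ t l from ht.1 l, show t l ≤ (1 : ℝ) from ht.2 l]
      have h3 := hgC w _ htr
      rw [ht1, mul_one] at h3
      have h4 := norm_le_norm_add_norm_sub' (φ w i s) (φ w i t)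
      nlinarith
    · simpa using by positivity
  refine ⟨fun j s => match j with
    -- The extra index covers the vertex of the cone.
    | none => 0
    | some (j, i) => assemble fun w => (faceMap j (fun k => s (Sum.inl k)) w : ℂ) •
        φ' w (i w) fun l => s (Sum.inr ⟨w, l⟩), ?_, ?_⟩
  · intro j s hs t ht
    have hC' : 0 ≤ (if rank K = 0 then 0 else C) := by split_ifs <;> simp [hC]
    have hS0 : 0 ≤ 2 * A * (B + if rank K = 0 then 0 else C) * dist s t := by positivity
    rcases j with _ | ⟨j, i⟩
    · simpa using hS0
    rw [dist_eq_norm]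
    refine norm_assemble_sub_le hS0 fun w => ?_
    have hs1 : (fun k => s (Sum.inl k)) ∈ Set.Icc (0 : {w : InfinitePlace K // w ≠ w₀} → ℝ) 1 :=
      ⟨fun k => hs.1 _, fun k => hs.2 _⟩
    have ht1 : (fun k => t (Sum.inl k)) ∈ Set.Icc (0 : {w : InfinitePlace K // w ≠ w₀} → ℝ) 1 :=
      ⟨fun k => ht.1 _, fun k => ht.2 _⟩
    have hs2 : (fun l => s (Sum.inr ⟨w, l⟩)) ∈
      Set.Icc (0 : Fin (w.mult * Fintype.card ι - 1) → ℝ) 1 := ⟨fun k => hs.1 _, fun k => hs.2 _⟩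
    have ht2 : (fun l => t (Sum.inr ⟨w, l⟩)) ∈
      Set.Icc (0 : Fin (w.mult * Fintype.card ι - 1) → ℝ) 1 := ⟨fun k => ht.1 _, fun k => ht.2 _⟩
    have hd1 : ‖(fun k => s (Sum.inl k)) - (fun k : {w : InfinitePlace K // w ≠ w₀} =>
        t (Sum.inl k))‖ ≤ dist s t := by
      rw [dist_eq_norm]
      exact (pi_norm_le_iff_of_nonneg (norm_nonneg _)).2 fun k => norm_le_pi_norm (s - t) (Sum.inl k)
    have hd2 : ‖(fun l => s (Sum.inr ⟨w, l⟩)) - (fun l : Fin (w.mult * Fintype.card ι - 1) =>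
        t (Sum.inr ⟨w, l⟩))‖ ≤ dist s t := by
      rw [dist_eq_norm]
      exact (pi_norm_le_iff_of_nonneg (norm_nonneg _)).2 fun l =>
        norm_le_pi_norm (s - t) (Sum.inr ⟨w, l⟩)
    set a := faceMap j (fun k => s (Sum.inl k)) w with ha
    set b := faceMap j (fun k => t (Sum.inl k)) w with hb
    set x := φ' w (i w) fun l => s (Sum.inr ⟨w, l⟩) with hx
    set y := φ' w (i w) fun l => t (Sum.inr ⟨w, l⟩) with hy
    have e1 : (a : ℂ) • x - (b : ℂ) • y = ((a - b : ℝ) : ℂ) • x + (b : ℂ) • (x - y) := by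
      rw [Complex.ofReal_sub, sub_smul, smul_sub]; abel
    rw [e1]
    refine (norm_add_le _ _).trans ?_
    rw [_root_.norm_smul, _root_.norm_smul, Complex.norm_real, Complex.norm_real, Real.norm_eq_abs,
      Real.norm_eq_abs]
    have e2 : |b| * ‖x - y‖ ≤ A * (B * dist s t) :=
      mul_le_mul (hA1 _ _ ht1 _) ((hL _ _ _ hs2 _ ht2).trans
        (mul_le_mul_of_nonneg_left hd2 hB)) (norm_nonneg _) (zero_le_one.trans hA)
    have e3 : |a - b| * ‖x‖ ≤ A * dist s t * (B + if rank K = 0 then 0 else C) := by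
      split_ifs with hr
      · have : IsEmpty {w : InfinitePlace K // w ≠ w₀} :=
          ⟨fun k => by have i := equivFinRank.symm k; rw [hr] at i; exact i.elim0⟩
        have : a = b := by rw [ha, hb]; congr 1; exact Subsingleton.elim _ _
        rw [this, sub_self, abs_zero, zero_mul]
        positivity
      · rw [add_comm B]
        exact mul_le_mul ((hA2 _ _ hs1 _ ht1 _).trans (mul_le_mul_of_nonneg_left hd1
          (zero_le_one.trans hA))) (hbd _ _ _ hs2) (norm_nonneg _) (by positivity)
    have e4 : A * (B * dist s t) ≤ A * dist s t * (B + if rank K = 0 then 0 else C) := by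
      rw [mul_comm B, ← mul_assoc]
      exact mul_le_mul_of_nonneg_left (by linarith) (by positivity)
    linarith
  · intro z hz
    rcases g.vec_mem_of_mem_frontier_cone hz with rfl | ⟨hpos, j, p, hp, hj⟩
    · exact ⟨none, 0, ⟨le_rfl, zero_le_one⟩, rfl⟩
    have hw (w : InfinitePlace K) : ∃ i, ∃ s ∈ Set.Icc 0 1,
        φ' w i s = ((g.vec z w)⁻¹ : ℂ) • vecAt w z := by
      refine hcov w _ (fun hr l => ?_) ?_
      · have := im_vecAt_eq_zero hr z l
        rw [← Complex.ofReal_inv, Pi.smul_apply, smul_eq_mul, Complex.im_ofReal_mul, this, mul_zero]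
      · rw [g.map_smul, ← Complex.ofReal_inv, Complex.norm_real,
          Real.norm_of_nonneg (inv_nonneg.2 (hpos w).le)]
        exact inv_mul_cancel₀ (hpos w).ne'
    choose i s hs his using hw
    refine ⟨some (j, i), Sum.elim p fun x => s x.1 x.2, ⟨?_, ?_⟩, ?_⟩
    · rintro (k | ⟨w, l⟩)
      · exact hp.1 k
      · exact (hs w).1 l
    · rintro (k | ⟨w, l⟩)
      · exact hp.2 k
      · exact (hs w).2 l
    · refine Eq.trans ?_ (assemble_vecAt z)
      simp only [Sum.elim_inl, Sum.elim_inr]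
      congr 1
      funext w
      rw [his w, hj, smul_smul, mul_inv_cancel₀ (Complex.ofReal_ne_zero.2 (hpos w).ne'), one_smul]

end Gauge

end Cone

end SchanuelMorphism

namespace SchanuelMorphism

open NumberField.InfinitePlace NumberField.mixedEmbedding
  NumberField.mixedEmbedding.fundamentalCone NumberField.Units
  NumberField.Units.dirichletUnitTheorem

open scoped Classical Pointwise ENNReal nonZeroDivisors

set_option linter.unusedSectionVars false

/-! ### Counting points of ideals in the cone -/

section Balanced

variable (K : Type*) [Field K] [NumberField K]

/-- A unit moves `α` into the fundamental cone. After scaling to norm `1` its logarithmic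
coordinates lie in a compact cube, where all absolute values are bounded below. -/
theorem exists_unit_mul_balanced : ∃ A : ℝ, 0 < A ∧ ∀ α : K, α ≠ 0 → ∃ u : (𝓞 K)ˣ,
    ∀ w : InfinitePlace K,
      A⁻¹ * (|Algebra.norm ℚ α| : ℚ) ^ ((Module.finrank ℚ K : ℝ)⁻¹) ≤ w (u * α) := by
  obtain ⟨A, hA1, hA, -⟩ := exists_expMapBasis_bounds K
  refine ⟨A, by linarith, fun α hα => ?_⟩
  have hn : Module.finrank ℚ K ≠ 0 := Module.finrank_pos.ne'
  have hν0 : mixedEmbedding.norm (mixedEmbedding K α) ≠ 0 := by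
    rw [norm_eq_norm]; exact_mod_cast abs_ne_zero.2 (Algebra.norm_ne_zero_iff.2 hα)
  obtain ⟨u, hu⟩ := exists_unit_smul_mem hν0
  refine ⟨u, fun w => ?_⟩
  set ν : ℝ := ((|Algebra.norm ℚ α| : ℚ) : ℝ) with hν
  have hνpos : 0 < ν := by
    rw [hν]; exact_mod_cast abs_pos.2 (Algebra.norm_ne_zero_iff.2 hα)
  set c : ℝ := ν ^ ((Module.finrank ℚ K : ℝ)⁻¹) with hc
  have hcpos : 0 < c := Real.rpow_pos_of_pos hνpos _
  have hcn : c ^ Module.finrank ℚ K = ν := Real.rpow_inv_natCast_pow hνpos.le hn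
  set x : mixedSpace K := c⁻¹ • u • mixedEmbedding K α with hx
  have hxc : x ∈ fundamentalCone K := smul_mem_of_mem hu (inv_ne_zero hcpos.ne')
  have hux : u • mixedEmbedding K α = mixedEmbedding K (u * α) := by
    rw [unitSMul_smul, map_mul]
  have hxn : mixedEmbedding.norm x = 1 := by
    rw [hx, mixedEmbedding.norm_smul, hux, norm_eq_norm, map_mul, abs_mul, Units.norm, one_mul,
      abs_inv, abs_of_pos hcpos, inv_pow, hcn]
    exact inv_mul_cancel₀ hνpos.ne'
  have hx1 : x ∈ normLeOne K := ⟨hxc, hxn.le⟩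
  rw [normLeOne_eq_preimage] at hx1
  obtain ⟨y, hy, hyx⟩ := hx1
  -- The coordinate at `w₀` records the norm, here equal to `1`.
  have hy0 : y w₀ = 0 := by
    have h1 := prod_expMapBasis_pow y
    have h2 : ∏ w : InfinitePlace K, expMapBasis y w ^ w.mult = mixedEmbedding.norm x := by
      rw [mixedEmbedding.norm_apply, hyx]
    rw [h2, hxn, ← Real.exp_nat_mul, eq_comm, Real.exp_eq_one_iff] at h1
    exact (mul_eq_zero.1 h1).resolve_left (by exact_mod_cast hn)
  have hyI : y ∈ Set.Icc (0 : realSpace K) 1 := by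
    have key (w) : y w ∈ Set.Icc (0 : ℝ) 1 := by
      have := hy w (Set.mem_univ w)
      beta_reduce at this
      split_ifs at this with hw
      · rw [hw, hy0]; simp
      · exact ⟨this.1, this.2.le⟩
    exact ⟨fun w => (key w).1, fun w => (key w).2⟩
  have h3 := (hA y hyI w).1
  have h4 : normAtAllPlaces x w = c⁻¹ * w (u * α) := by
    rw [normAtAllPlaces_apply, hx, normAtPlace_smul, hux, normAtPlace_apply, abs_inv,
      abs_of_pos hcpos]
  rw [hyx, h4, le_inv_mul_iff₀ hcpos] at h3
  linarith [mul_comm c A⁻¹]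

/-- Multiplication by a nonzero element of `K` on the mixed space. -/
def mulMixed {K : Type*} [Field K] {α : K} (hα : α ≠ 0) : mixedSpace K ≃ₗ[ℝ] mixedSpace K where
  toFun x := mixedEmbedding K α * x
  invFun x := mixedEmbedding K α⁻¹ * x
  map_add' := mul_add _
  map_smul' c x := by simp
  left_inv x := by beta_reduce; rw [← mul_assoc, ← map_mul, inv_mul_cancel₀ hα, map_one, one_mul]
  right_inv x := by beta_reduce; rw [← mul_assoc, ← map_mul, mul_inv_cancel₀ hα, map_one, one_mul]

/-- Fix a basis for one ideal `J c` in each class and write `I = α (J c)` with `α` balanced by a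
unit. All absolute values of `α⁻¹` are then at most a constant times `(Nm (J c) / Nm I)^(1/n)`, and
the finiteness of the class group makes the constants uniform. -/
theorem exists_balanced_basis : ∃ A : ℝ, 0 < A ∧ ∀ I : (Ideal (𝓞 K))⁰,
    ∃ b : Module.Basis (Fin (Module.finrank ℚ K)) ℝ (mixedSpace K),
      (Submodule.span ℤ (Set.range b) = idealLattice K (FractionalIdeal.mk0 K I)) ∧
      ∀ x, ‖b.equivFun x‖ ≤
        A * (Ideal.absNorm I.1 : ℝ) ^ (-(Module.finrank ℚ K : ℝ)⁻¹) * ‖x‖ := by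
  obtain ⟨A, hA, hu⟩ := exists_unit_mul_balanced K
  have hrep := ClassGroup.mk0_surjective (R := 𝓞 K)
  choose J hJ using hrep
  have hcard (I : (Ideal (𝓞 K))⁰) :
      Fintype.card (Module.Free.ChooseBasisIndex ℤ (FractionalIdeal.mk0 K I)) =
        Module.finrank ℚ K := by
    rw [← mixedEmbedding.finrank K, Module.finrank_eq_card_basis
      (fractionalIdealLatticeBasis K (FractionalIdeal.mk0 K I))]
  let b₀ (c : ClassGroup (𝓞 K)) : Module.Basis (Fin (Module.finrank ℚ K)) ℝ (mixedSpace K) :=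
    (fractionalIdealLatticeBasis K (FractionalIdeal.mk0 K (J c))).reindex
      (Fintype.equivFinOfCardEq (hcard _))
  have hb₀ (c) : Submodule.span ℤ (Set.range (b₀ c)) =
      idealLattice K (FractionalIdeal.mk0 K (J c)) := by
    rw [← span_idealLatticeBasis, Module.Basis.range_reindex]
  have hM (c) : ∃ M : ℝ, 0 ≤ M ∧ ∀ x, ‖(b₀ c).equivFun x‖ ≤ M * ‖x‖ := by
    exact ⟨_, norm_nonneg _, fun x => (b₀ c).equivFunL.toContinuousLinearMap.le_opNorm x⟩
  choose M hM0 hM using hM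
  -- The contribution of the class `c`; the sum over all classes dominates every single one.
  let M' : ClassGroup (𝓞 K) → ℝ := fun c => M c * (A *
    (Ideal.absNorm (J c).1 : ℝ) ^ ((Module.finrank ℚ K : ℝ)⁻¹))
  have hM'0 (c) : 0 ≤ M' c := mul_nonneg (hM0 c) (mul_nonneg hA.le (by positivity))
  have hM'1 : 0 ≤ ∑ c, M' c := Finset.sum_nonneg fun c _ => hM'0 c
  refine ⟨1 + ∑ c, M' c, by linarith, fun I => ?_⟩
  set c := ClassGroup.mk0 I with hc
  have hcI : ClassGroup.mk0 (J c) = ClassGroup.mk0 I := by rw [hJ]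
  obtain ⟨α₀, hα₀, hspan₀⟩ := (ClassGroup.mk0_eq_mk0_iff_exists_fraction_ring K).1 hcI
  obtain ⟨u, hu⟩ := hu α₀ hα₀
  set α : K := u * α₀ with hα
  have hα0 : α ≠ 0 := mul_ne_zero (coe_ne_zero u) hα₀
  have hmem (y : K) : y ∈ (I.1 : FractionalIdeal (𝓞 K)⁰ K) ↔
      α⁻¹ * y ∈ ((J c).1 : FractionalIdeal (𝓞 K)⁰ K) := by
    rw [← hspan₀, FractionalIdeal.mem_singleton_mul]
    constructor
    · rintro ⟨z, hz, rfl⟩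
      have : α⁻¹ * (α₀ * z) = ((u⁻¹ : (𝓞 K)ˣ) : 𝓞 K) • z := by
        rw [Algebra.smul_def, hα, mul_inv, ← mul_assoc, mul_assoc _ _ α₀, inv_mul_cancel₀ hα₀,
          mul_one]
        congr 1
        exact inv_eq_of_mul_eq_one_right (by
          change ((u : 𝓞 K) : K) * (((u⁻¹ : (𝓞 K)ˣ) : 𝓞 K) : K) = 1
          rw [← map_mul, Units.mul_inv, map_one])
      rw [this]
      exact Submodule.smul_mem _ _ hz
    · intro h
      refine ⟨(u : 𝓞 K) • (α⁻¹ * y), Submodule.smul_mem _ _ h, ?_⟩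
      rw [Algebra.smul_def, ← mul_assoc, ← mul_assoc]
      have : α₀ * (algebraMap (𝓞 K) K u) = α := mul_comm _ _
      rw [this, mul_inv_cancel₀ hα0, one_mul]
  refine ⟨(b₀ c).map (mulMixed hα0), ?_, fun x => ?_⟩
  · have : Set.range ((b₀ c).map (mulMixed hα0)) =
        ((mulMixed hα0).toLinearMap.restrictScalars ℤ) '' Set.range (b₀ c) := by
      rw [← Set.range_comp]; rfl
    rw [this, ← Submodule.map_span, hb₀]
    ext x
    simp only [Submodule.mem_map, mem_idealLattice]
    constructor
    · rintro ⟨_, ⟨y, hy, rfl⟩, rfl⟩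
      refine ⟨α * y, ?_, map_mul _ _ _⟩
      refine (hmem _).2 ?_
      rwa [← mul_assoc, inv_mul_cancel₀ hα0, one_mul]
    · rintro ⟨y, hy, rfl⟩
      refine ⟨mixedEmbedding K (α⁻¹ * y), ⟨α⁻¹ * y, (hmem y).1 hy, rfl⟩, ?_⟩
      change mixedEmbedding K α * mixedEmbedding K (α⁻¹ * y) = _
      rw [← map_mul, ← mul_assoc, mul_inv_cancel₀ hα0, one_mul]
  · have h1 : ((b₀ c).map (mulMixed hα0)).equivFun x =
        (b₀ c).equivFun (mixedEmbedding K α⁻¹ * x) := rfl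
    rw [h1]
    have hNJ : (0 : ℝ) < Ideal.absNorm (J c).1 := by
      exact_mod_cast Nat.pos_of_ne_zero (Ideal.absNorm_ne_zero_of_nonZeroDivisors _)
    have hNI : (0 : ℝ) < Ideal.absNorm I.1 := by
      exact_mod_cast Nat.pos_of_ne_zero (Ideal.absNorm_ne_zero_of_nonZeroDivisors _)
    have hnorm : ((|Algebra.norm ℚ α₀| : ℚ) : ℝ) * Ideal.absNorm (J c).1 = Ideal.absNorm I.1 := by
      have := congrArg FractionalIdeal.absNorm hspan₀
      rw [map_mul, FractionalIdeal.absNorm_span_singleton, FractionalIdeal.coeIdeal_absNorm,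
        FractionalIdeal.coeIdeal_absNorm] at this
      exact_mod_cast this
    set e := (Module.finrank ℚ K : ℝ)⁻¹ with he
    have hν : ((|Algebra.norm ℚ α₀| : ℚ) : ℝ) ^ e * (Ideal.absNorm (J c).1 : ℝ) ^ e =
        (Ideal.absNorm I.1 : ℝ) ^ e := by
      rw [← Real.mul_rpow (by positivity) hNJ.le, hnorm]
    have hνpos : 0 < ((|Algebra.norm ℚ α₀| : ℚ) : ℝ) ^ e := by
      refine Real.rpow_pos_of_pos ?_ _
      exact_mod_cast abs_pos.2 (Algebra.norm_ne_zero_iff.2 hα₀)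
    have h2 : ‖mixedEmbedding K α⁻¹‖ ≤
        A * ((Ideal.absNorm (J c).1 : ℝ) ^ e * (Ideal.absNorm I.1 : ℝ) ^ (-e)) := by
      rw [norm_eq_sup'_normAtPlace]
      refine Finset.sup'_le _ _ fun w _ => ?_
      rw [normAtPlace_apply, map_inv₀]
      have h3 := hu w
      rw [inv_le_comm₀ (lt_of_lt_of_le (mul_pos (inv_pos.2 hA) hνpos) h3)
        (by positivity)]
      refine le_trans (le_of_eq ?_) h3
      rw [Real.rpow_neg hNI.le, ← hν]
      have := (Real.rpow_pos_of_pos hNJ e).ne'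
      field_simp
    have h4 : ‖mixedEmbedding K α⁻¹ * x‖ ≤
        A * ((Ideal.absNorm (J c).1 : ℝ) ^ e * (Ideal.absNorm I.1 : ℝ) ^ (-e)) * ‖x‖ :=
      (norm_mul_le _ _).trans (mul_le_mul_of_nonneg_right h2 (norm_nonneg _))
    calc _ ≤ M c * ‖mixedEmbedding K α⁻¹ * x‖ := hM c _
      _ ≤ M c * (A * ((Ideal.absNorm (J c).1 : ℝ) ^ e * (Ideal.absNorm I.1 : ℝ) ^ (-e)) * ‖x‖) :=
        mul_le_mul_of_nonneg_left h4 (hM0 c)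
      _ = M' c * (Ideal.absNorm I.1 : ℝ) ^ (-e) * ‖x‖ := by simp only [M', he]; ring
      _ ≤ (1 + ∑ c, M' c) * (Ideal.absNorm I.1 : ℝ) ^ (-e) * ‖x‖ := by
        have := Finset.single_le_sum (fun c _ => hM'0 c) (Finset.mem_univ c)
        gcongr
        linarith

end Balanced

/-! ### Lattice points in dilates of the gauge cone. -/

section Count

variable {K : Type*} [Field K] [NumberField K] {ι : Type*} [Fintype ι]

namespace Gauge

variable (g : Gauge K ι)

theorem localVol_ne_top {C : ℝ} (h : g.IsBoundedBy C) (w : InfinitePlace K) :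
    g.localVol w ≠ ⊤ := by
  have hC0 {z : ι → ℂ} (hz : w.IsReal → ∀ i, (z i).im = 0) (h1 : g.toFun w z ≤ 1) :
      ‖z‖ ≤ |C| := by
    refine (h w z hz).trans ?_
    have := mul_le_mul_of_nonneg_right (le_abs_self C) (g.nonneg w z)
    nlinarith [abs_nonneg C]
  unfold localVol
  split_ifs with hw
  · refine (Bornology.IsBounded.measure_lt_top (isBounded_iff_forall_norm_le.2
      ⟨|C|, fun x hx => ?_⟩)).ne
    have := hC0 (z := fun i => (x i : ℂ)) (fun _ i => Complex.ofReal_im _) hx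
    rw [pi_norm_le_iff_of_nonneg (abs_nonneg C)] at this ⊢
    simpa using this
  · exact (Bornology.IsBounded.measure_lt_top (isBounded_iff_forall_norm_le.2
      ⟨|C|, fun x hx => hC0 (fun H => absurd H hw) hx⟩)).ne

/-- The volume of the cone. -/
def coneVol : ℝ := regulator K * (Fintype.card ι : ℝ) ^ rank K * ∏ w, (g.localVol w).toReal

theorem volume_cone_toReal [Nonempty ι] {C : ℝ} (h : g.IsBoundedBy C) :
    (volume g.cone).toReal = g.coneVol := by
  rw [cone, g.volume_cone (g.localVol_ne_top h), ENNReal.toReal_mul, ENNReal.toReal_mul,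
    ENNReal.toReal_ofReal (regulator_pos K).le, ENNReal.toReal_pow, ENNReal.toReal_natCast,
    ENNReal.toReal_prod, coneVol]

end Gauge

variable (K) in
/-- The covolume of the ring of integers. -/
def covol : ℝ := (2⁻¹ : ℝ) ^ nrComplexPlaces K * √|(discr K : ℝ)|

theorem covol_pos : 0 < covol K := by
  have : (discr K : ℝ) ≠ 0 := by exact_mod_cast discr_ne_zero K
  exact mul_pos (by positivity) (Real.sqrt_pos.2 (abs_pos.2 this))

theorem volume_fundamentalDomain_of_span_eq {β : Type*} [Fintype β]
    (b : Module.Basis β ℝ (mixedSpace K))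
    (I : (Ideal (𝓞 K))⁰)
    (hb : Submodule.span ℤ (Set.range b) = idealLattice K (FractionalIdeal.mk0 K I)) :
    (volume (ZSpan.fundamentalDomain b)).toReal = Ideal.absNorm I.1 * covol K := by
  have h1 := ZSpan.isAddFundamentalDomain' b (volume : Measure (mixedSpace K))
  rw [hb] at h1
  have h2 := ZLattice.covolume_eq_measure_fundamentalDomain _ _ h1
  have h3 := covolume_idealLattice K (FractionalIdeal.mk0 K I)
  rw [Measure.real] at h2
  rw [← h2, covol, ← mul_assoc]
  refine h3.trans ?_
  rw [FractionalIdeal.coe_mk0, FractionalIdeal.coeIdeal_absNorm]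
  simp

theorem volume_fundamentalDomain_pi {β : Type*} [Fintype β]
    (b : Module.Basis β ℝ (mixedSpace K)) :
    volume (ZSpan.fundamentalDomain (Pi.basis fun _ : ι => b)) =
      volume (ZSpan.fundamentalDomain b) ^ Fintype.card ι := by
  have : ZSpan.fundamentalDomain (Pi.basis fun _ : ι => b) =
      Set.univ.pi fun _ => ZSpan.fundamentalDomain b := by
    ext z
    simp only [ZSpan.mem_fundamentalDomain, Pi.basis_repr, Set.mem_univ_pi, Sigma.forall]
  rw [this, volume_pi_pi, Finset.prod_const, Finset.card_univ]

theorem mem_span_pi_basis_iff {β : Type*} [Fintype β] (b : Module.Basis β ℝ (mixedSpace K))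
    (z : ι → mixedSpace K) : z ∈ Submodule.span ℤ (Set.range (Pi.basis fun _ : ι => b)) ↔
      ∀ i, z i ∈ Submodule.span ℤ (Set.range b) := by
  simp only [Module.Basis.mem_span_iff_repr_mem ℤ, Pi.basis_repr, Sigma.forall]

-- The general lattice count is applied to `T • g.cone` with a balanced basis in each coordinate.
-- The constant is uniform in the gauge and the ideal: the gauge enters only through `N`, `B`, `C`
-- and its volume, and the ideal only through its norm.
variable (K ι) in
theorem exists_count_cone [Nonempty ι] : ∃ A : ℝ, 0 < A ∧ ∀ (g : Gauge K ι) (N : ℕ) (B C : ℝ),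
    0 < N → 0 ≤ B → 0 ≤ C → g.HasLipschitzSpheres N B → g.IsBoundedBy C →
    ∀ (I : (Ideal (𝓞 K))⁰) (x₀ : ι → 𝓞 K) (T : ℝ), 0 < T →
      {z : ι → 𝓞 K | (∀ i, z i - x₀ i ∈ I.1) ∧ g.vec (fun i => mixedEmbedding K (z i)) ∈
        T • (expMapBasis '' paramSet K)}.Finite ∧
      |({z : ι → 𝓞 K | (∀ i, z i - x₀ i ∈ I.1) ∧ g.vec (fun i => mixedEmbedding K (z i)) ∈
          T • (expMapBasis '' paramSet K)}.ncard : ℝ) -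
          T ^ (Module.finrank ℚ K * Fintype.card ι) * g.coneVol /
            (Ideal.absNorm I.1 * covol K) ^ Fintype.card ι| ≤
        A * (N : ℝ) ^ Module.finrank ℚ K * (1 + (B + if rank K = 0 then 0 else C) * T *
          (Ideal.absNorm I.1 : ℝ) ^ (-(Module.finrank ℚ K : ℝ)⁻¹)) ^
            (Module.finrank ℚ K * Fintype.card ι - 1) := by
  obtain ⟨A₁, hA₁, hA₁b, hA₁L⟩ := exists_faceMap_bounds K
  obtain ⟨A₂, hA₂, hbasis⟩ := exists_balanced_basis K
  set n := Module.finrank ℚ K with hn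
  set k := Fintype.card ι with hk
  set J := Option ({w : InfinitePlace K // w ≠ w₀} × Bool)
  -- The first factor counts faces and the vertex, the second collects Lipschitz and basis
  -- constants, and `4 ^ (k * n)` is the number of cells met by a set of diameter at most `1`.
  refine ⟨(1 + Fintype.card J) * ((2 + 2 * A₁ * A₂) ^ (n * k - 1) * 4 ^ (k * n)), by positivity, ?_⟩
  intro g N B C hN hB hC hgL hgC I x₀ T hT
  have hC' : 0 ≤ (if rank K = 0 then 0 else C) := by split_ifs <;> simp [hC]
  obtain ⟨b, hbI, hbM⟩ := hbasis I
  obtain ⟨ψ, hψL, hψc⟩ := g.exists_frontier_param hA₁ hA₁b hA₁L hB hC hgL hgC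
  set M := A₂ * (Ideal.absNorm I.1 : ℝ) ^ (-(n : ℝ)⁻¹) with hM
  have hM0 : 0 ≤ M := by positivity
  set L := 2 * A₁ * (B + if rank K = 0 then 0 else C) with hL
  have hL0 : 0 ≤ L := by positivity
  have hborel : BorelSpace (mixedSpace K) := Prod.borelSpace
  have hborel' : BorelSpace (ι → mixedSpace K) := Pi.borelSpace
  have hmain := abs_ncard_lattice_sub_le (Pi.basis fun _ : ι => b) volume (T • g.cone)
    ((g.isBounded_cone hC hgC).smul₀ T) M hM0 (fun x => by
      refine (pi_norm_le_iff_of_nonneg (by positivity)).2 fun ji => ?_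
      refine le_trans ?_ ((hbM (x ji.1)).trans
        (mul_le_mul_of_nonneg_left (norm_le_pi_norm x ji.1) hM0))
      exact norm_le_pi_norm (b.equivFun (x ji.1)) ji.2)
    (fun j s => T • ψ j s) (T * L) (by positivity) (fun j s hs t ht => by
      rw [dist_smul₀, Real.norm_of_nonneg hT.le, mul_assoc]
      exact mul_le_mul_of_nonneg_left (hψL j s hs t ht) hT.le) (fun z hz => by
      have : frontier (T • g.cone) = T • frontier g.cone :=
        ((Homeomorph.smulOfNeZero T hT.ne').image_frontier g.cone).symm
      rw [this] at hz
      obtain ⟨y, hy, rfl⟩ := hz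
      obtain ⟨j, s, hs, h⟩ := hψc y hy
      exact ⟨j, s, hs, by rw [h]⟩) (fun i => mixedEmbedding K (x₀ i))
  set s := {z : ι → 𝓞 K | (∀ i, z i - x₀ i ∈ I.1) ∧ g.vec (fun i => mixedEmbedding K (z i)) ∈
        T • (expMapBasis '' paramSet K)} with hs
  set f : (ι → 𝓞 K) → ι → mixedSpace K := fun z i => mixedEmbedding K (z i) with hf
  have hfinj : Function.Injective f := fun z z' h => by
    funext i
    exact RingOfIntegers.coe_injective (mixedEmbedding_injective K (congrFun h i))
  have himage : {z | z - (fun i => mixedEmbedding K (x₀ i)) ∈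
      Submodule.span ℤ (Set.range (Pi.basis fun _ : ι => b)) ∧ z ∈ T • g.cone} = f '' s := by
    ext z
    simp only [Set.mem_ofPred_eq, mem_span_pi_basis_iff, hbI, mem_idealLattice, g.mem_smul_cone hT,
      Set.mem_image, hs]
    constructor
    · rintro ⟨h1, h2⟩
      have h3 (i : ι) : ∃ y : 𝓞 K, y ∈ I.1 ∧ mixedEmbedding K y = z i - mixedEmbedding K (x₀ i) := by
        obtain ⟨y, hy, hyz⟩ := h1 i
        obtain ⟨y', hy', rfl⟩ := (FractionalIdeal.mem_coeIdeal _).1 hy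
        exact ⟨y', hy', hyz⟩
      choose y hyI hy using h3
      have hz : f (fun i => y i + x₀ i) = z := by
        funext i
        simp only [hf, map_add, hy, sub_add_cancel]
      refine ⟨fun i => y i + x₀ i, ⟨fun i => by simpa using hyI i, ?_⟩, hz⟩
      change g.vec (f fun i => y i + x₀ i) ∈ _
      rwa [hz]
    · rintro ⟨y, ⟨hy1, hy2⟩, rfl⟩
      refine ⟨fun i => ⟨algebraMap (𝓞 K) K (y i - x₀ i), ?_, ?_⟩, hy2⟩
      · exact FractionalIdeal.mem_coeIdeal_of_mem _ (hy1 i)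
      · simp [hf]
  rw [himage] at hmain
  obtain ⟨hfin, hmain⟩ := hmain
  refine ⟨Set.Finite.of_finite_image hfin hfinj.injOn, ?_⟩
  rw [Set.ncard_image_of_injective _ hfinj, volume_fundamentalDomain_pi, ENNReal.toReal_pow,
    volume_fundamentalDomain_of_span_eq b I hbI, Measure.addHaar_smul, ENNReal.toReal_mul,
    g.volume_cone_toReal hgC, ENNReal.toReal_ofReal (abs_nonneg _), abs_of_nonneg (pow_nonneg hT.le _),
    Module.finrank_pi_fintype, Finset.sum_const, mixedEmbedding.finrank, Finset.card_univ,
    smul_eq_mul, mul_comm (Fintype.card ι), Gauge.card_faceIndex Fintype.card_pos] at hmain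
  refine hmain.trans ?_
  have hNI : 0 ≤ (Ideal.absNorm I.1 : ℝ) ^ (-(n : ℝ)⁻¹) := by positivity
  have hNr : (1 : ℝ) ≤ N := by exact_mod_cast hN
  have hcJ : (Fintype.card (Option (J × (InfinitePlace K → Fin N))) : ℝ) ≤
      (1 + Fintype.card J) * (N : ℝ) ^ n := by
    rw [Fintype.card_option, Fintype.card_prod, Fintype.card_fun, Fintype.card_fin]
    push_cast
    -- One parametrization is chosen at each place, and there are at most `n` places.
    have h1 : (N : ℝ) ^ Fintype.card (InfinitePlace K) ≤ (N : ℝ) ^ n := by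
      refine pow_le_pow_right₀ hNr ?_
      rw [hn, ← sum_mult_eq, ← Finset.card_univ, Finset.card_eq_sum_ones]
      exact Finset.sum_le_sum fun w _ => mult_pos
    have h2 : (1 : ℝ) ≤ (N : ℝ) ^ n := one_le_pow₀ hNr
    nlinarith [Nat.cast_nonneg (α := ℝ) (Fintype.card J)]
  have hcb : Fintype.card (Σ _ : ι, Fin n) = k * n := by simp [hk]
  rw [hcb]
  have hpow : (M * (T * L) + 2) ^ (n * k - 1) ≤ (2 + 2 * A₁ * A₂) ^ (n * k - 1) *
      (1 + (B + if rank K = 0 then 0 else C) * T *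
          (Ideal.absNorm I.1 : ℝ) ^ (-(n : ℝ)⁻¹)) ^ (n * k - 1) := by
    rw [← mul_pow]
    refine pow_le_pow_left₀ (by positivity) ?_ _
    rw [hM, hL]
    have : 0 ≤ (B + if rank K = 0 then 0 else C) * T * (Ideal.absNorm I.1 : ℝ) ^ (-(n : ℝ)⁻¹) := by
      positivity
    have hAA : 0 ≤ A₁ * A₂ := by positivity
    nlinarith
  calc _ ≤ ((1 + Fintype.card J) * (N : ℝ) ^ n) * (((2 + 2 * A₁ * A₂) ^ (n * k - 1) *
      (1 + (B + if rank K = 0 then 0 else C) * T *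
          (Ideal.absNorm I.1 : ℝ) ^ (-(n : ℝ)⁻¹)) ^ (n * k - 1)) * 4 ^ (k * n)) := by
        refine mul_le_mul hcJ (mul_le_mul_of_nonneg_right hpow (by positivity)) (by positivity)
          (by positivity)
    _ = _ := by ring

end Count

end SchanuelMorphism

namespace SchanuelMorphism

/-! ### Bounds for forms over normed fields -/

section NormedBounds

variable {K : Type*} [Field K] {m M d : ℕ} (F : MorphismLift K m M d)

theorem maxAbs_norm_eq {ι L : Type*} [Fintype ι] [Nonempty ι] [NormedField L] (z : ι → L) :
    maxAbs (fun x : L => ‖x‖) z = ‖z‖ := by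
  refine le_antisymm (ciSup_le fun i => norm_le_pi_norm z i) ?_
  refine (pi_norm_le_iff_of_nonempty _).2 fun i => ?_
  exact le_ciSup (f := fun i => ‖z i‖) (Set.finite_range _).bddAbove i

theorem exists_norm_eq_norm {ι L : Type*} [Fintype ι] [Nonempty ι] [NormedField L] (z : ι → L) :
    ∃ i, ‖z i‖ = ‖z‖ := by
  obtain ⟨i, hi⟩ := exists_eq_ciSup_of_finite (f := fun i => ‖z i‖)
  exact ⟨i, hi.trans (maxAbs_norm_eq z)⟩

instance nonempty_coeffIndex : Nonempty (CoeffIndex m M d) :=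
  ⟨(0, ⟨Finsupp.single 0 d, by
    rw [Finset.mem_finsuppAntidiag]
    exact ⟨by simp [Finsupp.single_apply], Finset.subset_univ _⟩⟩)⟩

namespace MorphismLift

/-- The Nullstellensatz: the only common zero over the algebraic closure is the origin, so every
variable lies in the radical of the ideal of the forms. The sum of the individual exponents serves
all variables at once. -/
theorem exists_pow_eq_sum : ∃ (e : ℕ) (A : Fin (m + 1) → Fin (M + 1) → MvPolynomial (Fin (m + 1)) K),
    ∀ i, (MvPolynomial.X i) ^ e = ∑ j, A i j * F.form j := by
  have h1 (i : Fin (m + 1)) : ∃ e : ℕ, (MvPolynomial.X i : MvPolynomial (Fin (m + 1)) K) ^ e ∈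
      Ideal.span (Set.range F.form) := by
    have h2 : (MvPolynomial.X i : MvPolynomial (Fin (m + 1)) K) ∈
        (Ideal.span (Set.range F.form)).radical := by
      rw [← MvPolynomial.vanishingIdeal_zeroLocus_eq_radical (K := AlgebraicClosure K),
        MvPolynomial.mem_vanishingIdeal_iff]
      intro z hz
      have h3 := F.eq_zero_of_common_zero z fun j =>
        hz _ (Ideal.subset_span (Set.mem_range_self j))
      simp [h3]
    exact h2
  choose e he using h1
  have h2 (i : Fin (m + 1)) : ∃ A : Fin (M + 1) → MvPolynomial (Fin (m + 1)) K,
      ∑ j, A j * F.form j = (MvPolynomial.X i) ^ (∑ i, e i) := by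
    have : (MvPolynomial.X i : MvPolynomial (Fin (m + 1)) K) ^ (∑ i, e i) ∈
        Ideal.span (Set.range F.form) :=
      Ideal.pow_mem_of_pow_mem _ (he i) (Finset.single_le_sum (fun _ _ => Nat.zero_le _)
        (Finset.mem_univ i))
    simpa using (Ideal.mem_span_range_iff_exists_fun).1 this
  choose A hA using h2
  exact ⟨∑ i, e i, A, fun i => (hA i).symm⟩

variable {L : Type*} [NormedField L] [Algebra K L]

/-- The norm of the tuple of coefficients. -/
def coeffNorm (L : Type*) [NormedField L] [Algebra K L] : ℝ :=
  ‖fun p : CoeffIndex m M d => algebraMap K L (F.coeffs p)‖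

omit F in
theorem norm_aeval_le_sum (P : MvPolynomial (Fin (m + 1)) K) {z : Fin (m + 1) → L} (hz : ‖z‖ ≤ 1) :
    ‖MvPolynomial.aeval z P‖ ≤ ∑ α ∈ P.support, ‖algebraMap K L (P.coeff α)‖ := by
  rw [MvPolynomial.aeval_def, MvPolynomial.eval₂_eq']
  refine (norm_sum_le _ _).trans (Finset.sum_le_sum fun α _ => ?_)
  rw [norm_mul, norm_prod]
  refine mul_le_of_le_one_right (norm_nonneg _) (Finset.prod_le_one (fun _ _ => norm_nonneg _)
    fun i _ => ?_)
  rw [norm_pow]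
  exact pow_le_one₀ (norm_nonneg _) ((norm_le_pi_norm z i).trans hz)

/-- Reduction of a lower bound for the forms to tuples of norm one. -/
theorem le_norm_eval_of_forall_norm_eq_one {c : ℝ}
    (h : ∀ z : Fin (m + 1) → L, ‖z‖ = 1 → c ≤ ‖F.eval z‖) {z : Fin (m + 1) → L} (hz : z ≠ 0) :
    c * ‖z‖ ^ d ≤ ‖F.eval z‖ := by
  obtain ⟨i, hi⟩ := exists_norm_eq_norm z
  have hzi : z i ≠ 0 := by
    rw [← norm_ne_zero_iff, hi]; exact norm_ne_zero_iff.2 hz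
  have h1 := h ((z i)⁻¹ • z) (by
    rw [norm_smul, norm_inv, hi, inv_mul_cancel₀ (norm_ne_zero_iff.2 hz)])
  rw [F.eval_smul, norm_smul, norm_pow, norm_inv, hi, inv_pow] at h1
  have h2 : 0 < ‖z‖ ^ d := by have := norm_pos_iff.2 hz; positivity
  rwa [inv_mul_eq_div, le_div_iff₀ h2] at h1

theorem pow_eq_sum_eval {e : ℕ} {A : Fin (m + 1) → Fin (M + 1) → MvPolynomial (Fin (m + 1)) K}
    (hA : ∀ i, (MvPolynomial.X i) ^ e = ∑ j, A i j * F.form j) (z : Fin (m + 1) → L)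
    (i : Fin (m + 1)) : z i ^ e = ∑ j, MvPolynomial.aeval z (A i j) * F.eval z j := by
  have := congrArg (MvPolynomial.aeval z) (hA i)
  simpa [eval] using this

-- Evaluate the Nullstellensatz identity at the variable of largest norm, scaled to `1`. No
-- compactness is involved, so archimedean and nonarchimedean completions are treated alike.
variable (L) in
theorem exists_le_norm_eval : ∃ c : ℝ, 0 < c ∧ ∀ z : Fin (m + 1) → L, z ≠ 0 →
    c * ‖z‖ ^ d ≤ ‖F.eval z‖ := by
  obtain ⟨e, A, hA⟩ := F.exists_pow_eq_sum
  set s : ℝ := ∑ i, ∑ j, ∑ α ∈ (A i j).support, ‖algebraMap K L ((A i j).coeff α)‖ with hs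
  have hs0 : 0 ≤ s := Finset.sum_nonneg fun i _ => Finset.sum_nonneg fun j _ =>
    Finset.sum_nonneg fun α _ => norm_nonneg _
  refine ⟨(1 + s)⁻¹, by positivity, fun z hz => F.le_norm_eval_of_forall_norm_eq_one ?_ hz⟩
  intro z hz
  obtain ⟨i, hi⟩ := exists_norm_eq_norm z
  have h1 : (1 : ℝ) ≤ s * ‖F.eval z‖ := by
    calc (1 : ℝ) = ‖z i ^ e‖ := by rw [norm_pow, hi, hz, one_pow]
      _ ≤ ∑ j, ‖MvPolynomial.aeval z (A i j) * F.eval z j‖ := by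
        rw [F.pow_eq_sum_eval hA]; exact norm_sum_le _ _
      _ ≤ ∑ j, (∑ α ∈ (A i j).support, ‖algebraMap K L ((A i j).coeff α)‖) * ‖F.eval z‖ := by
        refine Finset.sum_le_sum fun j _ => ?_
        rw [norm_mul]
        exact mul_le_mul (norm_aeval_le_sum _ hz.le) (norm_le_pi_norm (F.eval z) j) (norm_nonneg _)
          (Finset.sum_nonneg fun _ _ => norm_nonneg _)
      _ ≤ s * ‖F.eval z‖ := by
        rw [← Finset.sum_mul, hs]
        refine mul_le_mul_of_nonneg_right ?_ (norm_nonneg _)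
        exact Finset.single_le_sum (f := fun i => ∑ j, ∑ α ∈ (A i j).support,
          ‖algebraMap K L ((A i j).coeff α)‖) (fun i _ => Finset.sum_nonneg fun j _ =>
            Finset.sum_nonneg fun α _ => norm_nonneg _) (Finset.mem_univ i)
  rw [inv_le_iff_one_le_mul₀ (by positivity)]
  nlinarith [norm_nonneg (F.eval z)]

theorem eval_ne_zero' {z : Fin (m + 1) → L} (hz : z ≠ 0) : F.eval z ≠ 0 := by
  obtain ⟨c, hc, h⟩ := F.exists_le_norm_eval L
  rw [← norm_pos_iff]
  have := norm_pos_iff.2 hz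
  exact lt_of_lt_of_le (by positivity) (h z hz)

theorem coeff_eq_coeffs (j : Fin (M + 1)) {α : Fin (m + 1) →₀ ℕ} (hα : α ∈ (F.form j).support) :
    ∃ p : CoeffIndex m M d, F.coeffs p = (F.form j).coeff α := by
  have h := F.isHomogeneous j (MvPolynomial.mem_support_iff.1 hα)
  have h' : ∑ i, α i = d := by
    rw [← h, Finsupp.weight_apply, Finsupp.sum_fintype] <;> simp
  exact ⟨(j, ⟨α, Finset.mem_finsuppAntidiag.2 ⟨h', Finset.subset_univ _⟩⟩), rfl⟩

theorem sum_eq_of_mem_support {j : Fin (M + 1)} {α : Fin (m + 1) →₀ ℕ}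
    (hα : α ∈ (F.form j).support) : ∑ i, α i = d := by
  have h := F.isHomogeneous j (MvPolynomial.mem_support_iff.1 hα)
  rw [← h, Finsupp.weight_apply, Finsupp.sum_fintype] <;> simp

theorem norm_coeff_le (j : Fin (M + 1)) {α : Fin (m + 1) →₀ ℕ} (hα : α ∈ (F.form j).support) :
    ‖algebraMap K L ((F.form j).coeff α)‖ ≤ F.coeffNorm L := by
  obtain ⟨p, hp⟩ := F.coeff_eq_coeffs j hα
  rw [← hp]
  exact norm_le_pi_norm (fun p : CoeffIndex m M d => algebraMap K L (F.coeffs p)) p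

theorem coeffNorm_nonneg : 0 ≤ F.coeffNorm L := norm_nonneg _

theorem coeffs_ne_zero : F.coeffs ≠ 0 := by
  intro h
  have h0 (j) : F.form j = 0 := by
    ext α
    by_cases hα : α ∈ (F.form j).support
    · obtain ⟨p, hp⟩ := F.coeff_eq_coeffs j hα
      rw [← hp, h]; simp
    · simpa [MvPolynomial.mem_support_iff] using hα
  have := F.eq_zero_of_common_zero (fun _ => 1) fun j => by simp [h0]
  exact one_ne_zero (congrFun this 0)

theorem coeffNorm_pos : 0 < F.coeffNorm L := by
  refine norm_pos_iff.2 fun h => F.coeffs_ne_zero ?_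
  funext p
  exact (algebraMap K L).injective (by simpa using congrFun h p)

section Ultrametric

variable [IsUltrametricDist L]

-- In the ultrametric case monomials are `1`-Lipschitz on the unit polydisc, by induction with `a b
-- - a' b' = (a - a') b + a' (b - b')`.
omit F in
theorem norm_monomial_sub_le {z z' : Fin (m + 1) → L} (hz : ‖z‖ ≤ 1) (hz' : ‖z'‖ ≤ 1)
    (α : Fin (m + 1) →₀ ℕ) : ‖∏ i, z i ^ α i - ∏ i, z' i ^ α i‖ ≤ ‖z - z'‖ := by
  have hmul {a b a' b' : L} {δ : ℝ} (hb : ‖b‖ ≤ 1) (ha' : ‖a'‖ ≤ 1) (h1 : ‖a - a'‖ ≤ δ)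
      (h2 : ‖b - b'‖ ≤ δ) : ‖a * b - a' * b'‖ ≤ δ := by
    have : a * b - a' * b' = (a - a') * b + a' * (b - b') := by ring
    rw [this]
    refine (IsUltrametricDist.norm_add_le_max _ _).trans (max_le ?_ ?_)
    · rw [norm_mul]
      exact (mul_le_of_le_one_right (norm_nonneg _) hb).trans h1
    · rw [norm_mul]
      exact (mul_le_of_le_one_left (norm_nonneg _) ha').trans h2
  have hi (i) : ‖z i‖ ≤ 1 := (norm_le_pi_norm z i).trans hz
  have hi' (i) : ‖z' i‖ ≤ 1 := (norm_le_pi_norm z' i).trans hz'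
  have hpow (i) (k : ℕ) : ‖z i ^ k - z' i ^ k‖ ≤ ‖z - z'‖ := by
    induction k with
    | zero => simp
    | succ k ih =>
      rw [pow_succ, pow_succ]
      exact hmul (hi i) (by rw [norm_pow]; exact pow_le_one₀ (norm_nonneg _) (hi' i)) ih
        (norm_le_pi_norm (z - z') i)
  have key (s : Finset (Fin (m + 1))) :
      ‖∏ i ∈ s, z i ^ α i - ∏ i ∈ s, z' i ^ α i‖ ≤ ‖z - z'‖ := by
    classical
    induction s using Finset.induction_on with
    | empty => simp
    | insert a s ha ih =>
      rw [Finset.prod_insert ha, Finset.prod_insert ha]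
      refine hmul ?_ ?_ (hpow a _) ih
      · rw [norm_prod]
        refine Finset.prod_le_one (fun _ _ => norm_nonneg _) fun i _ => ?_
        rw [norm_pow]; exact pow_le_one₀ (norm_nonneg _) (hi i)
      · rw [norm_pow]; exact pow_le_one₀ (norm_nonneg _) (hi' a)
  exact key _

theorem norm_eval_sub_le {z z' : Fin (m + 1) → L} (hz : ‖z‖ ≤ 1) (hz' : ‖z'‖ ≤ 1) :
    ‖F.eval z - F.eval z'‖ ≤ F.coeffNorm L * ‖z - z'‖ := by
  refine (pi_norm_le_iff_of_nonneg (mul_nonneg F.coeffNorm_nonneg (norm_nonneg _))).2 fun j => ?_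
  simp only [Pi.sub_apply, eval, MvPolynomial.aeval_def, MvPolynomial.eval₂_eq',
    ← Finset.sum_sub_distrib, ← mul_sub]
  refine IsUltrametricDist.norm_sum_le_of_forall_le_of_nonneg
    (mul_nonneg F.coeffNorm_nonneg (norm_nonneg _)) fun α hα => ?_
  rw [norm_mul]
  exact mul_le_mul (F.norm_coeff_le j hα) (norm_monomial_sub_le hz hz' α) (norm_nonneg _)
    F.coeffNorm_nonneg

theorem norm_eval_le (z : Fin (m + 1) → L) : ‖F.eval z‖ ≤ F.coeffNorm L * ‖z‖ ^ d := by
  have h0 : 0 ≤ F.coeffNorm L * ‖z‖ ^ d := mul_nonneg F.coeffNorm_nonneg (by positivity)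
  refine (pi_norm_le_iff_of_nonneg h0).2 fun j => ?_
  simp only [eval, MvPolynomial.aeval_def, MvPolynomial.eval₂_eq']
  refine IsUltrametricDist.norm_sum_le_of_forall_le_of_nonneg h0 fun α hα => ?_
  rw [norm_mul, norm_prod]
  refine mul_le_mul (F.norm_coeff_le j hα) ?_ (by positivity) F.coeffNorm_nonneg
  rw [← F.sum_eq_of_mem_support hα, ← Finset.prod_pow_eq_pow_sum]
  refine Finset.prod_le_prod (fun _ _ => norm_nonneg _) fun i _ => ?_
  rw [norm_pow]
  exact pow_le_pow_left₀ (norm_nonneg _) (norm_le_pi_norm z i) _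

/-- With integral coefficients in the Nullstellensatz identity the ultrametric inequality yields the
lower bound with constant exactly `1`; this is the situation at almost all primes. -/
theorem norm_pow_le_norm_eval {e : ℕ}
    {A : Fin (m + 1) → Fin (M + 1) → MvPolynomial (Fin (m + 1)) K}
    (hA : ∀ i, (MvPolynomial.X i) ^ e = ∑ j, A i j * F.form j)
    (hA1 : ∀ i j, ∀ α ∈ (A i j).support, ‖algebraMap K L ((A i j).coeff α)‖ ≤ 1)
    {z : Fin (m + 1) → L} (hz : z ≠ 0) : ‖z‖ ^ d ≤ ‖F.eval z‖ := by
  rw [← one_mul (‖z‖ ^ d)]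
  refine F.le_norm_eval_of_forall_norm_eq_one (fun z hz => ?_) hz
  obtain ⟨i, hi⟩ := exists_norm_eq_norm z
  have h1 : (1 : ℝ) = ‖z i ^ e‖ := by rw [norm_pow, hi, hz, one_pow]
  rw [h1, F.pow_eq_sum_eval hA]
  refine IsUltrametricDist.norm_sum_le_of_forall_le_of_nonneg (norm_nonneg _) fun j _ => ?_
  rw [norm_mul]
  refine (mul_le_of_le_one_left (norm_nonneg _) ?_).trans (norm_le_pi_norm _ j)
  rw [MvPolynomial.aeval_def, MvPolynomial.eval₂_eq']
  refine IsUltrametricDist.norm_sum_le_of_forall_le_of_nonneg zero_le_one fun α hα => ?_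
  rw [norm_mul, norm_prod]
  refine mul_le_one₀ (hA1 i j α hα) (by positivity) (Finset.prod_le_one (fun _ _ => norm_nonneg _)
    fun i _ => ?_)
  rw [norm_pow]
  exact pow_le_one₀ (norm_nonneg _) ((norm_le_pi_norm z i).trans hz.le)

end Ultrametric

/-- `|z|^d |F| / |F(z)|`. -/
def distortion (z : Fin (m + 1) → L) : ℝ := ‖z‖ ^ d * F.coeffNorm L / ‖F.eval z‖

theorem distortion_smul {c : L} (hc : c ≠ 0) (z : Fin (m + 1) → L) :
    F.distortion (c • z) = F.distortion z := by
  have h : ‖c‖ ^ d ≠ 0 := pow_ne_zero _ (norm_ne_zero_iff.2 hc)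
  rw [distortion, distortion, F.eval_smul, norm_smul, norm_smul, norm_pow, mul_pow, mul_assoc,
    mul_div_mul_left _ _ h]

theorem distortion_pos {z : Fin (m + 1) → L} (hz : z ≠ 0) : 0 < F.distortion z := by
  have h1 := norm_pos_iff.2 hz
  have h2 := norm_pos_iff.2 (F.eval_ne_zero' hz)
  have h3 := F.coeffNorm_pos (L := L)
  unfold distortion
  positivity

theorem one_le_distortion [IsUltrametricDist L] {z : Fin (m + 1) → L} (hz : z ≠ 0) :
    1 ≤ F.distortion z := by
  have h2 := norm_pos_iff.2 (F.eval_ne_zero' hz)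
  rw [distortion, one_le_div h2, mul_comm]
  exact F.norm_eval_le z

/-- Distortion at most `D` means `|F(z')| ≥ |F| / D`, while `|F(z) - F(z')| ≤ |F| |z - z'| ≤ |F| /
D`. The ultrametric inequality gives `|F(z)| ≤ |F(z')|`, and by symmetry equality. Hence the
distortion of a primitive tuple is a function of a residue class. -/
theorem distortion_eq_of_norm_sub_le [IsUltrametricDist L] {D : ℝ}
    (hD : ∀ z : Fin (m + 1) → L, z ≠ 0 → F.distortion z ≤ D) {z z' : Fin (m + 1) → L}
    (hz : ‖z‖ = 1) (hz' : ‖z'‖ = 1) (h : ‖z - z'‖ ≤ D⁻¹) : F.distortion z = F.distortion z' := by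
  have key (z z' : Fin (m + 1) → L) (hz : ‖z‖ = 1) (hz' : ‖z'‖ = 1) (h : ‖z - z'‖ ≤ D⁻¹) :
      ‖F.eval z‖ ≤ ‖F.eval z'‖ := by
    have hz0' : z' ≠ 0 := by rw [← norm_pos_iff, hz']; exact one_pos
    have h1 := hD z' hz0'
    have hD0 : 0 < D := (F.distortion_pos hz0').trans_le h1
    have h2 := norm_pos_iff.2 (F.eval_ne_zero' hz0')
    rw [distortion, hz', one_pow, one_mul, div_le_iff₀ h2] at h1
    have h3 := (F.norm_eval_sub_le hz.le hz'.le).trans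
      (mul_le_mul_of_nonneg_left h F.coeffNorm_nonneg)
    have h4 : F.coeffNorm L * D⁻¹ ≤ ‖F.eval z'‖ := by
      rw [← div_eq_mul_inv, div_le_iff₀ hD0, mul_comm]; exact h1
    have h5 := IsUltrametricDist.norm_add_le_max (F.eval z - F.eval z') (F.eval z')
    rw [sub_add_cancel] at h5
    exact h5.trans (max_le (h3.trans h4) le_rfl)
  have : ‖F.eval z‖ = ‖F.eval z'‖ := le_antisymm (key z z' hz hz' h)
    (key z' z hz' hz (by rwa [norm_sub_rev]))
  rw [distortion, distortion, hz, hz', this]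

end MorphismLift

end NormedBounds

end SchanuelMorphism

namespace SchanuelMorphism

set_option linter.unusedSectionVars false

/-! ### Nonarchimedean completions -/

theorem norm_sub_le_max {E : Type*} [SeminormedAddCommGroup E] [IsUltrametricDist E] (x y : E) :
    ‖x - y‖ ≤ max ‖x‖ ‖y‖ := by
  rw [sub_eq_add_neg, ← norm_neg y]
  exact IsUltrametricDist.norm_add_le_max _ _

section FinitePlaces

variable {K : Type*} [Field K] [NumberField K] (v : HeightOneSpectrum (𝓞 K))

/-- The norm of a prime, as a real number. -/
def primeNorm : ℝ := Ideal.absNorm v.asIdeal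

theorem one_lt_primeNorm : 1 < primeNorm v := by
  have := NumberField.HeightOneSpectrum.one_lt_absNorm v
  unfold primeNorm
  exact_mod_cast this

theorem primeNorm_pos : 0 < primeNorm v := zero_lt_one.trans (one_lt_primeNorm v)

theorem exists_norm_eq_zpow {x : v.adicCompletion K} (hx : x ≠ 0) :
    ∃ j : ℤ, ‖x‖ = primeNorm v ^ j := by
  have h : Valued.v x ≠ 0 := (Valuation.ne_zero_iff _).2 hx
  exact ⟨_, by rw [FinitePlace.norm_def, WithZeroMulInt.toNNReal_neg_apply _ h]; push_cast; rfl⟩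

theorem toNNReal_exp (j : ℤ) :
    (WithZeroMulInt.toNNReal (NumberField.HeightOneSpectrum.absNorm_ne_zero v)
      (WithZero.exp j) : ℝ) = primeNorm v ^ j := by
  rw [WithZeroMulInt.toNNReal_neg_apply _ WithZero.exp_ne_zero]
  push_cast
  rfl

theorem norm_le_zpow_iff (x : v.adicCompletion K) (j : ℤ) :
    ‖x‖ ≤ primeNorm v ^ j ↔ Valued.v x ≤ WithZero.exp j := by
  rw [FinitePlace.norm_def, ← toNNReal_exp, NNReal.coe_le_coe]
  exact (WithZeroMulInt.toNNReal_strictMono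
    (NumberField.HeightOneSpectrum.one_lt_absNorm_nnreal v)).le_iff_le

/-- The embedding of tuples of integers in the completion. -/
def intVec {ι : Type*} (z : ι → 𝓞 K) : ι → v.adicCompletion K :=
  fun i => algebraMap K (v.adicCompletion K) (algebraMap (𝓞 K) K (z i))

theorem norm_int_le_pow_iff (x : 𝓞 K) (k : ℕ) :
    ‖algebraMap K (v.adicCompletion K) (algebraMap (𝓞 K) K x)‖ ≤ primeNorm v ^ (-(k : ℤ)) ↔
      x ∈ v.asIdeal ^ k := by
  rw [norm_le_zpow_iff, ← v.intValuation_le_pow_iff_mem, ← v.valuation_of_algebraMap (K := K)]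
  rw [← HeightOneSpectrum.valuedAdicCompletion_eq_valuation' v]
  rfl

theorem norm_intVec_sub_le_iff {ι : Type*} [Fintype ι] (z z' : ι → 𝓞 K) (k : ℕ) :
    ‖intVec v z - intVec v z'‖ ≤ primeNorm v ^ (-(k : ℤ)) ↔
      ∀ i, z i - z' i ∈ v.asIdeal ^ k := by
  rw [pi_norm_le_iff_of_nonneg (zpow_nonneg (primeNorm_pos v).le _)]
  refine forall_congr' fun i => ?_
  rw [← norm_int_le_pow_iff v, map_sub, map_sub]
  rfl

theorem norm_intVec_le_one {ι : Type*} [Fintype ι] (z : ι → 𝓞 K) : ‖intVec v z‖ ≤ 1 :=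
  (pi_norm_le_iff_of_nonneg zero_le_one).2 fun i => FinitePlace.norm_le_one K v (z i)

theorem norm_intVec_eq_one_iff {ι : Type*} [Fintype ι] [Nonempty ι] (z : ι → 𝓞 K) :
    ‖intVec v z‖ = 1 ↔ ∃ i, z i ∉ v.asIdeal := by
  constructor
  · intro h
    obtain ⟨i, hi⟩ := exists_norm_eq_norm (intVec v z)
    exact ⟨i, (FinitePlace.norm_eq_one_iff_notMem K v (z i)).1 (hi.trans h)⟩
  · rintro ⟨i, hi⟩
    refine le_antisymm (norm_intVec_le_one v z) ?_
    have := norm_le_pi_norm (intVec v z) i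
    exact ((FinitePlace.norm_eq_one_iff_notMem K v (z i)).2 hi).symm.le.trans this

/-- Approximate first by an element of the field, using density. It is integral at `v`, and can then
be approximated by a global integer. -/
theorem exists_integer_norm_sub_le {x : v.adicCompletion K} (hx : ‖x‖ ≤ 1) (k : ℕ) :
    ∃ r : 𝓞 K, ‖x - algebraMap K (v.adicCompletion K) (algebraMap (𝓞 K) K r)‖ ≤
      primeNorm v ^ (-(k : ℤ)) := by
  have hp : 0 < primeNorm v ^ (-(k : ℤ)) := zpow_pos (primeNorm_pos v) _
  have hp1 : primeNorm v ^ (-(k : ℤ)) ≤ 1 := by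
    rw [zpow_neg, zpow_natCast]
    exact inv_le_one_of_one_le₀ (one_le_pow₀ (one_lt_primeNorm v).le)
  obtain ⟨y, hy⟩ := (HeightOneSpectrum.denseRange_algebraMap (R := 𝓞 K) (K := K) v).exists_dist_lt
    x hp
  rw [dist_eq_norm] at hy
  have hy1 : ‖algebraMap K (v.adicCompletion K) y‖ ≤ 1 := by
    have := norm_sub_le_max x (x - algebraMap K (v.adicCompletion K) y)
    rw [sub_sub_cancel] at this
    exact this.trans (max_le hx (hy.le.trans hp1))
  have hy2 : v.valuation K y ≤ 1 := by
    rw [← zpow_zero (primeNorm v), norm_le_zpow_iff] at hy1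
    rw [← HeightOneSpectrum.valuedAdicCompletion_eq_valuation' v]
    exact hy1
  obtain ⟨r, hr⟩ := v.exists_valuation_sub_lt_of_integer hy2
    (Units.mk0 (WithZero.exp (-(k : ℤ))) WithZero.exp_ne_zero)
  refine ⟨r, ?_⟩
  have h2 : ‖algebraMap K (v.adicCompletion K) (algebraMap (𝓞 K) K r - y)‖ ≤
      primeNorm v ^ (-(k : ℤ)) := by
    rw [norm_le_zpow_iff]
    exact (HeightOneSpectrum.valuedAdicCompletion_eq_valuation' v
      (algebraMap (𝓞 K) K r - y)).trans_le hr.le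
  have h3 : x - algebraMap K (v.adicCompletion K) (algebraMap (𝓞 K) K r) =
      (x - algebraMap K (v.adicCompletion K) y) -
        algebraMap K (v.adicCompletion K) (algebraMap (𝓞 K) K r - y) := by
    rw [map_sub]; ring
  rw [h3]
  exact (norm_sub_le_max _ _).trans (max_le hy.le h2)

theorem norm_le_inv_of_lt_one {ι : Type*} [Fintype ι] [Nonempty ι] {z : ι → v.adicCompletion K}
    (hz : ‖z‖ < 1) : ‖z‖ ≤ primeNorm v ^ (-((1 : ℕ) : ℤ)) := by
  obtain ⟨i, hi⟩ := exists_norm_eq_norm z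
  rw [← hi] at hz ⊢
  by_cases h0 : z i = 0
  · rw [h0, norm_zero]; exact zpow_nonneg (primeNorm_pos v).le _
  obtain ⟨j, hj⟩ := exists_norm_eq_zpow v h0
  rw [hj] at hz ⊢
  have : j < 0 := by
    by_contra h
    exact absurd hz (not_lt.2 (one_le_zpow₀ (one_lt_primeNorm v).le (not_lt.1 h)))
  exact zpow_le_zpow_right₀ (one_lt_primeNorm v).le (by push_cast; omega)

end FinitePlaces

/-! ### Integrals over the unit polydisc -/

section Polydisc

variable {K : Type*} [Field K] [NumberField K] (m : ℕ) (v : HeightOneSpectrum (𝓞 K))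

theorem mem_unitPolydisc_iff (z : Fin (m + 1) → v.adicCompletion K) :
    z ∈ (unitPolydisc m v : Set (Fin (m + 1) → v.adicCompletion K)) ↔ ‖z‖ ≤ 1 := by
  rw [pi_norm_le_iff_of_nonneg zero_le_one]
  refine forall_congr' fun i => ?_
  rw [← zpow_zero (primeNorm v), norm_le_zpow_iff]
  rfl

instance : (finHaar m v).IsAddHaarMeasure := by unfold finHaar; infer_instance

theorem finHaar_unitPolydisc :
    finHaar m v (unitPolydisc m v : Set (Fin (m + 1) → v.adicCompletion K)) = 1 :=
  Measure.addHaarMeasure_self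

instance : SecondCountableTopology (v.adicCompletion K) := by
  have : Countable K := (Module.finBasis ℚ K).equivFun.toEquiv.countable_iff.2 inferInstance
  have : TopologicalSpace.SeparableSpace (v.adicCompletion K) :=
    ⟨_, Set.countable_range _, HeightOneSpectrum.denseRange_algebraMap (R := 𝓞 K) (K := K) v⟩
  exact UniformSpace.secondCountable_of_separable _

/-- The polydisc of radius `Nm v ^ (-k)` around a point. -/
def residueDisc (k : ℕ) (y : Fin (m + 1) → v.adicCompletion K) :
    Set (Fin (m + 1) → v.adicCompletion K) := {z | ‖z - y‖ ≤ primeNorm v ^ (-(k : ℤ))}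

theorem measurableSet_residueDisc (k : ℕ) (y : Fin (m + 1) → v.adicCompletion K) :
    MeasurableSet (residueDisc m v k y) :=
  (isClosed_le (by fun_prop) (by fun_prop)).measurableSet

theorem finHaar_residueDisc_eq (k : ℕ) (y : Fin (m + 1) → v.adicCompletion K) :
    finHaar m v (residueDisc m v k y) = finHaar m v (residueDisc m v k 0) := by
  have : residueDisc m v k y = (fun z => -y + z) ⁻¹' residueDisc m v k 0 := by
    ext z; simp [residueDisc, neg_add_eq_sub]
  rw [this, measure_preimage_add]

/-- A lift of a tuple of residues. -/
def residueLift (I : Ideal (𝓞 K)) (y : Fin (m + 1) → 𝓞 K ⧸ I) : Fin (m + 1) → 𝓞 K :=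
  fun i => (y i).out

theorem mk_residueLift (I : Ideal (𝓞 K)) (y : Fin (m + 1) → 𝓞 K ⧸ I) (i : Fin (m + 1)) :
    Ideal.Quotient.mk I (residueLift m I y i) = y i := Quotient.out_eq _

theorem iUnion_residueDisc (k : ℕ) :
    ⋃ y : Fin (m + 1) → 𝓞 K ⧸ v.asIdeal ^ k,
      residueDisc m v k (intVec v (residueLift m _ y)) = unitPolydisc m v := by
  have hp1 : primeNorm v ^ (-(k : ℤ)) ≤ 1 := by
    rw [zpow_neg, zpow_natCast]
    exact inv_le_one_of_one_le₀ (one_le_pow₀ (one_lt_primeNorm v).le)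
  ext z
  rw [Set.mem_iUnion, mem_unitPolydisc_iff]
  constructor
  · rintro ⟨y, hy⟩
    have := IsUltrametricDist.norm_add_le_max (z - intVec v (residueLift m _ y))
      (intVec v (residueLift m _ y))
    rw [sub_add_cancel] at this
    exact this.trans (max_le (le_trans hy hp1) (norm_intVec_le_one v _))
  · intro hz
    choose r hr using fun i => exists_integer_norm_sub_le v ((norm_le_pi_norm z i).trans hz) k
    refine ⟨fun i => Ideal.Quotient.mk _ (r i), ?_⟩
    have h1 : ‖z - intVec v r‖ ≤ primeNorm v ^ (-(k : ℤ)) :=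
      (pi_norm_le_iff_of_nonneg (zpow_nonneg (primeNorm_pos v).le _)).2 hr
    have h2 : ‖intVec v r - intVec v (residueLift m _ fun i =>
        Ideal.Quotient.mk (v.asIdeal ^ k) (r i))‖ ≤ primeNorm v ^ (-(k : ℤ)) := by
      rw [norm_intVec_sub_le_iff]
      intro i
      rw [← Ideal.Quotient.eq, mk_residueLift]
    have := IsUltrametricDist.norm_add_le_max (z - intVec v r) (intVec v r -
      intVec v (residueLift m _ fun i => Ideal.Quotient.mk (v.asIdeal ^ k) (r i)))
    rw [sub_add_sub_cancel] at this
    exact this.trans (max_le h1 h2)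

theorem disjoint_residueDisc (k : ℕ) : Pairwise (Function.onFun Disjoint
    fun y : Fin (m + 1) → 𝓞 K ⧸ v.asIdeal ^ k =>
      residueDisc m v k (intVec v (residueLift m _ y))) := by
  intro y y' hne
  refine Set.disjoint_left.2 fun z hz hz' => hne ?_
  have h1 : ‖intVec v (residueLift m _ y) - intVec v (residueLift m _ y')‖ ≤
      primeNorm v ^ (-(k : ℤ)) := by
    have := norm_sub_le_max (z - intVec v (residueLift m _ y'))
      (z - intVec v (residueLift m _ y))
    rw [sub_sub_sub_cancel_left] at this
    exact this.trans (max_le hz' hz)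
  rw [norm_intVec_sub_le_iff] at h1
  funext i
  rw [← mk_residueLift m _ y, ← mk_residueLift m _ y', Ideal.Quotient.eq]
  exact h1 i

instance (k : ℕ) : Finite (𝓞 K ⧸ v.asIdeal ^ k) :=
  Ideal.finiteQuotientOfFreeOfNeBot _ (pow_ne_zero _ v.ne_bot)

theorem card_residues (k : ℕ) :
    (Nat.card (Fin (m + 1) → 𝓞 K ⧸ v.asIdeal ^ k) : ℝ) = primeNorm v ^ (k * (m + 1)) := by
  rw [Nat.card_fun, Nat.card_fin, ← Submodule.cardQuot_apply, ← Ideal.absNorm_apply, map_pow,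
    primeNorm, pow_mul]
  push_cast
  rfl

/-- The discs around lifts of the `Nm v ^ (k (m+1))` residue tuples are translates of each other and
partition the polydisc, which has measure `1`. -/
theorem finHaar_residueDisc (k : ℕ) (y : Fin (m + 1) → v.adicCompletion K) :
    finHaar m v (residueDisc m v k y) = ENNReal.ofReal ((primeNorm v ^ (k * (m + 1)))⁻¹) := by
  have : Fintype (Fin (m + 1) → 𝓞 K ⧸ v.asIdeal ^ k) := Fintype.ofFinite _
  have h1 := finHaar_unitPolydisc m v
  rw [← iUnion_residueDisc m v k, measure_iUnion (disjoint_residueDisc m v k)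
    fun y => measurableSet_residueDisc m v k _] at h1
  simp_rw [finHaar_residueDisc_eq m v k (intVec v _)] at h1
  rw [tsum_fintype, Finset.sum_const, Finset.card_univ, ← Nat.card_eq_fintype_card, nsmul_eq_mul,
    ← ENNReal.ofReal_natCast, card_residues] at h1
  rw [finHaar_residueDisc_eq, ENNReal.ofReal_inv_of_pos (by have := primeNorm_pos v; positivity)]
  exact ENNReal.eq_inv_of_mul_eq_one_left (by rwa [mul_comm])

theorem residueDisc_zero_eq_smul {π : v.adicCompletion K}
    (hπ : ‖π‖ = primeNorm v ^ (-((1 : ℕ) : ℤ))) (z : Fin (m + 1) → v.adicCompletion K) :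
    π • z ∈ residueDisc m v 1 0 ↔ z ∈ (unitPolydisc m v : Set (Fin (m + 1) → v.adicCompletion K)) := by
  rw [mem_unitPolydisc_iff, residueDisc, Set.mem_ofPred_eq, sub_zero, norm_smul, hπ]
  exact mul_le_iff_le_one_right (zpow_pos (primeNorm_pos v) _)

theorem exists_uniformizer : ∃ π : v.adicCompletion K, π ≠ 0 ∧
    ‖π‖ = primeNorm v ^ (-((1 : ℕ) : ℤ)) := by
  obtain ⟨π, hπ⟩ := v.valuation_exists_uniformizer K
  have h : ‖algebraMap K (v.adicCompletion K) π‖ = primeNorm v ^ (-((1 : ℕ) : ℤ)) := by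
    rw [FinitePlace.norm_def, ← toNNReal_exp]
    congr 2
    exact (HeightOneSpectrum.valuedAdicCompletion_eq_valuation' v π).trans hπ
  refine ⟨_, ?_, h⟩
  rw [← norm_pos_iff, h]
  exact zpow_pos (primeNorm_pos v) _

/-- Multiplication by a uniformizer carries the polydisc to the smaller disc and fixes `Φ`; only the
scaling of the measure remains. -/
theorem setIntegral_residueDisc_one {Φ : (Fin (m + 1) → v.adicCompletion K) → ℝ}
    (hΦ : ∀ c : v.adicCompletion K, c ≠ 0 → ∀ z, Φ (c • z) = Φ z) :
    ∫ z in residueDisc m v 1 0, Φ z ∂(finHaar m v) = (primeNorm v ^ (m + 1))⁻¹ *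
      ∫ z in (unitPolydisc m v : Set (Fin (m + 1) → v.adicCompletion K)), Φ z ∂(finHaar m v) := by
  obtain ⟨π, hπ0, hπ⟩ := exists_uniformizer v
  have : LocallyCompactSpace (Fin (m + 1) → v.adicCompletion K) :=
    (unitPolydisc m v).locallyCompactSpace_of_addGroup
  let e : (Fin (m + 1) → v.adicCompletion K) ≃ₜ+ (Fin (m + 1) → v.adicCompletion K) :=
    { DistribMulAction.toAddEquiv₀ _ π hπ0, Homeomorph.smulOfNeZero π hπ0 with }
  have he (z) : e z = π • z := rfl
  have hem : MeasurableEmbedding e := e.toHomeomorph.measurableEmbedding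
  have hν : (Measure.map e (finHaar m v)).IsAddHaarMeasure := e.isAddHaarMeasure_map _
  have h1 := Measure.isAddLeftInvariant_eq_smul (Measure.map e (finHaar m v)) (finHaar m v)
  set c := Measure.addHaarScalarFactor (Measure.map e (finHaar m v)) (finHaar m v) with hc
  have hpre : e ⁻¹' residueDisc m v 1 0 = unitPolydisc m v := by
    ext z
    rw [Set.mem_preimage, he, residueDisc_zero_eq_smul m v hπ]
  have hp := primeNorm_pos v
  -- The scaling factor is found by comparing the measures of the smaller disc and its preimage, the
  -- polydisc.
  have h2 : (c : ℝ) * (primeNorm v ^ (m + 1))⁻¹ = 1 := by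
    have h3 : Measure.map e (finHaar m v) (residueDisc m v 1 0) = 1 := by
      rw [hem.map_apply, hpre, finHaar_unitPolydisc]
    rw [h1, Measure.smul_apply, finHaar_residueDisc, one_mul, ENNReal.smul_def, smul_eq_mul] at h3
    have := congrArg ENNReal.toReal h3
    rwa [ENNReal.toReal_mul, ENNReal.toReal_ofReal (by positivity), ENNReal.coe_toReal,
      ENNReal.toReal_one] at this
  have h3 : ∫ z in residueDisc m v 1 0, Φ z ∂(Measure.map e (finHaar m v)) =
      ∫ z in (unitPolydisc m v : Set (Fin (m + 1) → v.adicCompletion K)), Φ z ∂(finHaar m v) := by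
    rw [hem.setIntegral_map, hpre]
    simp_rw [he, hΦ π hπ0]
  rw [h1, Measure.restrict_smul, integral_smul_nnreal_measure] at h3
  rw [← h3, NNReal.smul_def, smul_eq_mul, ← mul_assoc, mul_comm _ (c : ℝ), h2, one_mul]

end Polydisc

end SchanuelMorphism

namespace SchanuelMorphism

set_option linter.unusedSectionVars false

/-! ### The nonarchimedean factors -/

namespace MorphismLift

section FinFactor

variable {K : Type*} [Field K] [NumberField K] {m M d : ℕ} (F : MorphismLift K m M d)
  (v : HeightOneSpectrum (𝓞 K))

theorem _root_.SchanuelMorphism.localDegree_pos : 0 < localDegree v := by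
  refine Nat.mul_pos ?_ ?_
  · exact Ideal.ramificationIdx_pos v.asIdeal ℤ
  · exact Ideal.inertiaDeg_pos v.asIdeal ℤ

theorem _root_.SchanuelMorphism.maxAbs_finAbs {ι : Type*} [Fintype ι] [Nonempty ι]
    (z : ι → v.adicCompletion K) :
    maxAbs (finAbs v) z = ‖z‖ ^ (1 / (localDegree v : ℝ)) := by
  refine le_antisymm (ciSup_le fun i => ?_) ?_
  · exact Real.rpow_le_rpow (norm_nonneg _) (norm_le_pi_norm z i) (by positivity)
  · obtain ⟨i, hi⟩ := exists_norm_eq_norm z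
    rw [← hi]
    exact le_ciSup (f := fun i => finAbs v (z i)) (Set.finite_range _).bddAbove i

variable {F} in
theorem distortion_nonneg {L : Type*} [NormedField L] [Algebra K L] (z : Fin (m + 1) → L) :
    0 ≤ F.distortion z := by
  have := F.coeffNorm_nonneg (L := L)
  unfold distortion
  positivity

theorem ratio_finAbs (hd : 1 ≤ d) (z : Fin (m + 1) → v.adicCompletion K) :
    F.ratio (finAbs v) z = F.distortion z ^ (1 / (d * localDegree v : ℝ)) := by
  have hd0 : (d : ℝ) ≠ 0 := by positivity
  have hl := localDegree_pos v
  have hc := F.coeffNorm_nonneg (L := v.adicCompletion K)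
  have h1 : F.coeffAbs (finAbs v) = F.coeffNorm (v.adicCompletion K) ^ (1 / (localDegree v : ℝ)) :=
    maxAbs_finAbs v _
  rw [ratio, h1, maxAbs_finAbs, maxAbs_finAbs, distortion, ← Real.rpow_mul hc,
    ← Real.rpow_mul (norm_nonneg _), Real.div_rpow (by positivity) (norm_nonneg _),
    Real.mul_rpow (by positivity) hc, ← Real.rpow_natCast_mul (norm_nonneg _)]
  have e1 : (1 / (localDegree v : ℝ)) * (1 / (d : ℝ)) = 1 / (d * localDegree v : ℝ) := by
    rw [one_div_mul_one_div, mul_comm]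
  have e2 : (d : ℝ) * (1 / (d * localDegree v : ℝ)) = 1 / (localDegree v : ℝ) := by
    field_simp
  rw [e1, e2]

/-- The local degree in the exponent cancels the root in `finAbs`, so only the unnormalised norm of
the completion remains. -/
theorem finIntegrand_eq (hd : 1 ≤ d) (z : Fin (m + 1) → v.adicCompletion K) :
    F.finIntegrand v z = F.distortion z ^ ((m + 1 : ℝ) / d) := by
  have hl := localDegree_pos v
  rw [finIntegrand, F.ratio_finAbs v hd, ← Real.rpow_mul_natCast (distortion_nonneg z)]
  congr 1
  push_cast
  field_simp

variable {L : Type*} [NormedField L] [Algebra K L]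

variable (L) in
theorem exists_distortion_le : ∃ D : ℝ, 1 ≤ D ∧ ∀ z : Fin (m + 1) → L, z ≠ 0 →
    F.distortion z ≤ D := by
  obtain ⟨c, hc, h⟩ := F.exists_le_norm_eval L
  refine ⟨max 1 (F.coeffNorm L / c), le_max_left _ _, fun z hz => le_max_of_le_right ?_⟩
  have h1 := norm_pos_iff.2 (F.eval_ne_zero' hz)
  rw [distortion, div_le_div_iff₀ h1 hc]
  nlinarith [h z hz, F.coeffNorm_nonneg (L := L)]

theorem continuous_eval : Continuous (F.eval : (Fin (m + 1) → L) → Fin (M + 1) → L) := by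
  refine continuous_pi fun j => ?_
  simp only [eval, MvPolynomial.aeval_def, MvPolynomial.eval₂_eq']
  fun_prop

theorem measurable_finIntegrand (hd : 1 ≤ d) : Measurable (F.finIntegrand v) := by
  have h : F.finIntegrand v = fun z => F.distortion z ^ ((m + 1 : ℝ) / d) :=
    funext (F.finIntegrand_eq v hd)
  have hc : Continuous fun z : Fin (m + 1) → v.adicCompletion K => ‖F.eval z‖ :=
    F.continuous_eval.norm
  have hc' : Continuous fun z : Fin (m + 1) → v.adicCompletion K =>
    ‖z‖ ^ d * F.coeffNorm (v.adicCompletion K) := by fun_prop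
  rw [h]
  exact (hc'.measurable.div hc.measurable).pow_const _

theorem distortion_zero (hd : 1 ≤ d) : F.distortion (0 : Fin (m + 1) → L) = 0 := by
  rw [distortion, norm_zero, zero_pow (by omega), zero_mul, zero_div]

theorem integrableOn_finIntegrand (hd : 1 ≤ d) :
    IntegrableOn (F.finIntegrand v) (unitPolydisc m v) (finHaar m v) := by
  obtain ⟨D, hD1, hD⟩ := F.exists_distortion_le (v.adicCompletion K)
  refine Measure.integrableOn_of_bounded (M := D ^ ((m + 1 : ℝ) / d)) ?_
    (F.measurable_finIntegrand v hd).aestronglyMeasurable ?_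
  · rw [finHaar_unitPolydisc]; exact ENNReal.one_ne_top
  · refine Filter.Eventually.of_forall fun z => ?_
    rw [F.finIntegrand_eq v hd, Real.norm_of_nonneg (Real.rpow_nonneg (distortion_nonneg z) _)]
    refine Real.rpow_le_rpow (distortion_nonneg z) ?_ (by positivity)
    by_cases hz : z = 0
    · rw [hz, F.distortion_zero hd]; linarith
    · exact hD z hz

theorem finFactor_nonneg : 0 ≤ F.finFactor v := by
  refine integral_nonneg fun z => ?_
  refine pow_nonneg ?_ _
  have h {ι : Type} (z : ι → v.adicCompletion K) : 0 ≤ maxAbs (finAbs v) z :=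
    Real.iSup_nonneg fun i => Real.rpow_nonneg (norm_nonneg _) _
  unfold ratio
  have h1 := h z
  have h2 := h (F.eval z)
  have h3 : 0 ≤ F.coeffAbs (finAbs v) := h _
  positivity

/-- The contribution of a tuple of residues modulo `v ^ k` to the local factor. -/
def residueWeight (k : ℕ) (y : Fin (m + 1) → 𝓞 K ⧸ v.asIdeal ^ k) : ℝ :=
  open scoped Classical in
  if ∃ i, residueLift m _ y i ∉ v.asIdeal then
    F.distortion (intVec v (residueLift m _ y)) ^ ((m + 1 : ℝ) / d) else 0

/-- Split the polydisc into primitive tuples and multiples of a uniformizer. The latter reproduce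
the whole integral times `Nm v ^ (-(m+1))`, which gives the factor on the left. On primitive tuples
the integrand is constant on residue discs modulo `v ^ k`. -/
theorem finFactor_eq_sum (hd : 1 ≤ d) {k : ℕ} (hk : 1 ≤ k)
    (hD : ∀ z : Fin (m + 1) → v.adicCompletion K, z ≠ 0 → F.distortion z ≤ primeNorm v ^ k)
    [Fintype (Fin (m + 1) → 𝓞 K ⧸ v.asIdeal ^ k)] :
    (1 - (primeNorm v ^ (m + 1))⁻¹) * F.finFactor v =
      (primeNorm v ^ (k * (m + 1)))⁻¹ * ∑ y, F.residueWeight v k y := by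
  classical
  have hp := primeNorm_pos v
  set Φ := F.finIntegrand v with hΦ
  have hΦi := F.integrableOn_finIntegrand v hd
  have hΦs (c : v.adicCompletion K) (hc : c ≠ 0) (z) : Φ (c • z) = Φ z := by
    rw [hΦ, F.finIntegrand_eq v hd, F.finIntegrand_eq v hd, F.distortion_smul hc]
  set O := (unitPolydisc m v : Set (Fin (m + 1) → v.adicCompletion K)) with hO
  set P : Set (Fin (m + 1) → v.adicCompletion K) := {z | ‖z‖ = 1} with hP
  have hPm : MeasurableSet P := (isClosed_eq (by fun_prop) (by fun_prop)).measurableSet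
  have hinv1 : primeNorm v ^ (-((1 : ℕ) : ℤ)) < 1 := by
    rw [zpow_neg, zpow_natCast, pow_one]
    exact inv_lt_one_of_one_lt₀ (one_lt_primeNorm v)
  have hinvk : primeNorm v ^ (-(k : ℤ)) ≤ primeNorm v ^ (-((1 : ℕ) : ℤ)) :=
    zpow_le_zpow_right₀ (one_lt_primeNorm v).le (by omega)
  have hOP : O = P ∪ residueDisc m v 1 0 := by
    ext z
    rw [hO, mem_unitPolydisc_iff, Set.mem_union, hP, residueDisc, Set.mem_ofPred_eq,
      Set.mem_ofPred_eq, sub_zero]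
    constructor
    · intro h
      rcases h.lt_or_eq with h | h
      · exact Or.inr (norm_le_inv_of_lt_one v h)
      · exact Or.inl h
    · rintro (h | h)
      · exact h.le
      · exact h.trans hinv1.le
  have hdisj : Disjoint P (residueDisc m v 1 0) := by
    refine Set.disjoint_left.2 fun z h1 h2 => ?_
    rw [hP, Set.mem_ofPred_eq] at h1
    rw [residueDisc, Set.mem_ofPred_eq, sub_zero, h1] at h2
    exact absurd h2 (not_le.2 hinv1)
  have e1 : F.finFactor v = ∫ z in P, Φ z ∂(finHaar m v) +
      (primeNorm v ^ (m + 1))⁻¹ * F.finFactor v := by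
    have := setIntegral_union hdisj (measurableSet_residueDisc m v 1 0)
      (hΦi.mono_set (hOP ▸ Set.subset_union_left)) (hΦi.mono_set (hOP ▸ Set.subset_union_right))
    rw [← hOP, setIntegral_residueDisc_one m v hΦs] at this
    exact this
  have e2 : ∫ z in P, Φ z ∂(finHaar m v) = ∫ z in O, P.indicator Φ z ∂(finHaar m v) := by
    rw [setIntegral_indicator hPm, Set.inter_eq_right.2 (hOP ▸ Set.subset_union_left)]
  have e3 : ∫ z in O, P.indicator Φ z ∂(finHaar m v) = ∑ y : Fin (m + 1) → 𝓞 K ⧸ v.asIdeal ^ k,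
      ∫ z in residueDisc m v k (intVec v (residueLift m _ y)), P.indicator Φ z ∂(finHaar m v) := by
    rw [hO, ← iUnion_residueDisc m v k]
    refine integral_iUnion_fintype (fun y => measurableSet_residueDisc m v k _)
      (disjoint_residueDisc m v k) fun y => ?_
    have : IntegrableOn (P.indicator Φ) O (finHaar m v) := hΦi.indicator hPm
    refine this.mono_set ?_
    rw [hO, ← iUnion_residueDisc m v k]
    exact Set.subset_iUnion (fun y => residueDisc m v k (intVec v (residueLift m _ y))) y
  have e4 (y : Fin (m + 1) → 𝓞 K ⧸ v.asIdeal ^ k) :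
      ∫ z in residueDisc m v k (intVec v (residueLift m _ y)), P.indicator Φ z ∂(finHaar m v) =
        (primeNorm v ^ (k * (m + 1)))⁻¹ * F.residueWeight v k y := by
    set u := intVec v (residueLift m _ y) with hu
    -- Since `k ≥ 1`, points of the disc satisfy `‖z - u‖ < 1`, so `z` is primitive exactly when `u`
    -- is.
    have hcong : ∀ z ∈ residueDisc m v k u, P.indicator Φ z = F.residueWeight v k y := by
      intro z hz
      rw [residueDisc, Set.mem_ofPred_eq] at hz
      rw [residueWeight]
      split_ifs with h
      · have hu1 : ‖u‖ = 1 := (norm_intVec_eq_one_iff v _).2 h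
        have hz1 : ‖z‖ = 1 := by
          have a1 := IsUltrametricDist.norm_add_le_max (z - u) u
          rw [sub_add_cancel, hu1] at a1
          have a2 := norm_sub_le_max z (z - u)
          rw [sub_sub_cancel, hu1] at a2
          have a3 : ‖z - u‖ < 1 := (hz.trans hinvk).trans_lt hinv1
          rcases le_max_iff.1 a2 with a4 | a4
          · exact le_antisymm (a1.trans (max_le a3.le le_rfl)) a4
          · exact absurd a4 (not_le.2 a3)
        rw [Set.indicator_of_mem (show z ∈ P from hz1), hΦ, F.finIntegrand_eq v hd, F.distortion_eq_of_norm_sub_le hD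
          hz1 hu1 (by rwa [zpow_neg, zpow_natCast] at hz)]
      · refine Set.indicator_of_notMem (fun hz1 => h ?_) _
        rw [hP, Set.mem_ofPred_eq] at hz1
        rw [← norm_intVec_eq_one_iff, ← hu]
        refine le_antisymm (norm_intVec_le_one v _) ?_
        have a2 := IsUltrametricDist.norm_add_le_max (z - u) u
        rw [sub_add_cancel, hz1] at a2
        rcases le_max_iff.1 a2 with a4 | a4
        · exact absurd a4 (not_le.2 ((hz.trans hinvk).trans_lt hinv1))
        · exact a4
    rw [setIntegral_congr_fun (measurableSet_residueDisc m v k u) hcong, setIntegral_const,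
      Measure.real, finHaar_residueDisc, ENNReal.toReal_ofReal (by positivity), smul_eq_mul]
  rw [e2, e3, Finset.sum_congr rfl fun y _ => e4 y, ← Finset.mul_sum] at e1
  linear_combination e1

/-- Distortions are always at least `1` off the origin, so here the integrand is `1` almost
everywhere. -/
theorem finFactor_eq_one (hd : 1 ≤ d)
    (hD : ∀ z : Fin (m + 1) → v.adicCompletion K, z ≠ 0 → F.distortion z ≤ 1) :
    F.finFactor v = 1 := by
  have h1 : ∀ᵐ z ∂((finHaar m v).restrict (unitPolydisc m v)), F.finIntegrand v z = 1 := by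
    have h2 : ∀ᵐ z ∂(finHaar m v), z ≠ 0 := by
      -- The origin lies in discs of arbitrarily small measure. It has to be excluded because the
      -- integrand vanishes there.
      have h0 : finHaar m v {0} = 0 := by
        have hle (k : ℕ) : finHaar m v {0} ≤ ENNReal.ofReal ((primeNorm v)⁻¹ ^ k) := by
          refine (measure_mono (t := residueDisc m v k 0) ?_).trans ?_
          · rintro _ rfl
            rw [residueDisc, Set.mem_ofPred_eq, sub_zero, norm_zero]
            exact zpow_nonneg (primeNorm_pos v).le _
          · rw [finHaar_residueDisc, inv_pow]
            refine ENNReal.ofReal_le_ofReal (inv_anti₀ (pow_pos (primeNorm_pos v) _)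
              (pow_le_pow_right₀ (one_lt_primeNorm v).le ?_))
            exact Nat.le_mul_of_pos_right k (Nat.succ_pos m)
        have hlim := ENNReal.tendsto_ofReal (tendsto_pow_atTop_nhds_zero_of_lt_one
          (inv_nonneg.2 (primeNorm_pos v).le) (inv_lt_one_of_one_lt₀ (one_lt_primeNorm v)))
        rw [ENNReal.ofReal_zero] at hlim
        exact le_antisymm (ge_of_tendsto' hlim hle) zero_le
      rw [ae_iff]
      simpa using h0
    filter_upwards [ae_restrict_of_ae h2] with z hz
    rw [F.finIntegrand_eq v hd, le_antisymm (hD z hz) (F.one_le_distortion hz), Real.one_rpow]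
  rw [finFactor, integral_congr_ae h1, integral_const, smul_eq_mul, mul_one, Measure.real,
    Measure.restrict_apply_univ, finHaar_unitPolydisc, ENNReal.toReal_one]

end FinFactor

/-! ### Residue data at the bad primes -/

section ResidueData

variable {K : Type*} [Field K] [NumberField K] {m M d : ℕ}

theorem finite_exists_norm_ne_one {ι : Type*} [Finite ι] (x : ι → K) :
    {v : HeightOneSpectrum (𝓞 K) | ∃ i, x i ≠ 0 ∧
      ‖algebraMap K (v.adicCompletion K) (x i)‖ ≠ 1}.Finite := by
  have h (i : ι) : {v : HeightOneSpectrum (𝓞 K) | x i ≠ 0 ∧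
      ‖algebraMap K (v.adicCompletion K) (x i)‖ ≠ 1}.Finite := by
    by_cases hx : x i = 0
    · simp [hx]
    · have h1 := FinitePlace.hasFiniteMulSupport hx
      have h2 := h1.preimage (f := fun v : HeightOneSpectrum (𝓞 K) => FinitePlace.mk v)
        (FinitePlace.equivHeightOneSpectrum (K := K)).symm.injective.injOn
      refine h2.subset ?_
      rintro v ⟨-, hv⟩
      exact hv
  exact (Set.finite_iUnion h).subset fun v ⟨i, hi⟩ => Set.mem_iUnion.2 ⟨i, hi⟩

variable (F : MorphismLift K m M d)

/-- Outside the finitely many primes where a nonzero coefficient of the forms or of a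
Nullstellensatz identity is not a unit, the lower bound for `|F(z)|` holds with constant `1`. -/
theorem finite_distortion : {v : HeightOneSpectrum (𝓞 K) |
    ¬ ∀ z : Fin (m + 1) → v.adicCompletion K, z ≠ 0 → F.distortion z ≤ 1}.Finite := by
  obtain ⟨e, A, hA⟩ := F.exists_pow_eq_sum
  let x : (Σ p : Fin (m + 1) × Fin (M + 1), (A p.1 p.2).support) → K :=
    fun q => (A q.1.1 q.1.2).coeff q.2.1
  refine ((finite_exists_norm_ne_one x).union (finite_exists_norm_ne_one F.coeffs)).subset ?_
  intro v hv
  rw [Set.mem_ofPred_eq] at hv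
  by_contra hcon
  rw [Set.mem_union, not_or, Set.mem_ofPred_eq, Set.mem_ofPred_eq] at hcon
  push Not at hcon
  apply hv
  intro z hz
  have h1 := F.norm_pow_le_norm_eval (L := v.adicCompletion K) hA (fun i j α hα =>
    (hcon.1 ⟨(i, j), ⟨α, hα⟩⟩ (MvPolynomial.mem_support_iff.1 hα)).le) hz
  have h2 : F.coeffNorm (v.adicCompletion K) ≤ 1 := by
    refine (pi_norm_le_iff_of_nonneg zero_le_one).2 fun p => ?_
    by_cases hp : F.coeffs p = 0
    · rw [hp, map_zero, norm_zero]; exact zero_le_one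
    · exact (hcon.2 p hp).le
  rw [distortion, div_le_one (norm_pos_iff.2 (F.eval_ne_zero' hz))]
  exact (mul_le_of_le_one_right (by positivity) h2).trans h1

theorem finite_finFactor_ne_one (hd : 1 ≤ d) :
    {v : HeightOneSpectrum (𝓞 K) | F.finFactor v ≠ 1}.Finite :=
  F.finite_distortion.subset fun v hv h => hv (F.finFactor_eq_one v hd h)

theorem ratio_archAbs (hd : 1 ≤ d) (v : InfinitePlace K) (z : Fin (m + 1) → v.Completion) :
    F.ratio (archAbs v) z = F.distortion z ^ (1 / (d : ℝ)) := by
  have hc := F.coeffNorm_nonneg (L := v.Completion)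
  have h1 : F.coeffAbs (archAbs v) = F.coeffNorm v.Completion := maxAbs_norm_eq _
  have h2 {ι : Type} [Fintype ι] [Nonempty ι] (z : ι → v.Completion) :
    maxAbs (archAbs v) z = ‖z‖ := maxAbs_norm_eq _
  rw [ratio, h1, h2, h2, distortion, Real.div_rpow (by positivity) (norm_nonneg _),
    Real.mul_rpow (by positivity) hc, one_div, Real.pow_rpow_inv_natCast (norm_nonneg _) (by omega)]

theorem nonempty_errorConstants (hd : 1 ≤ d) : Nonempty F.ErrorConstants := by
  classical
  choose Da hDa1 hDa using fun v : InfinitePlace K => F.exists_distortion_le v.Completion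
  choose Df hDf1 hDf using fun v : HeightOneSpectrum (𝓞 K) =>
    F.exists_distortion_le (v.adicCompletion K)
  let good (v : HeightOneSpectrum (𝓞 K)) : Prop :=
    ∀ z : Fin (m + 1) → v.adicCompletion K, z ≠ 0 → F.distortion z ≤ 1
  refine ⟨⟨fun v => Da v ^ (1 / (d : ℝ)), fun v => if good v then 1 else
    Df v ^ (1 / (d * localDegree v : ℝ)), fun v z hz => ?_, fun v z hz => ?_, ?_⟩⟩
  · rw [F.ratio_archAbs hd]
    exact Real.rpow_le_rpow (distortion_nonneg z) (hDa v z hz) (by positivity)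
  · rw [F.ratio_finAbs v hd]
    split_ifs with h
    · exact Real.rpow_le_one (distortion_nonneg z) (h z hz) (by positivity)
    · exact Real.rpow_le_rpow (distortion_nonneg z) (hDf v z hz) (by positivity)
  · refine F.finite_distortion.subset fun v hv h => hv ?_
    exact if_pos h

/-- Finitely many primes with exponents controlling the distortion of the forms. -/
structure ResidueData where
  bad : Finset (HeightOneSpectrum (𝓞 K))
  exponent : HeightOneSpectrum (𝓞 K) → ℕ
  exponent_pos : ∀ v ∈ bad, 1 ≤ exponent v
  distortion_le : ∀ v ∈ bad, ∀ z : Fin (m + 1) → v.adicCompletion K, z ≠ 0 →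
    F.distortion z ≤ primeNorm v ^ exponent v
  distortion_le_one : ∀ v ∉ bad, ∀ z : Fin (m + 1) → v.adicCompletion K, z ≠ 0 →
    F.distortion z ≤ 1

variable {F}

theorem exists_distortion_eq_zpow (v : HeightOneSpectrum (𝓞 K)) {z : Fin (m + 1) → v.adicCompletion K}
    (hz : z ≠ 0) : ∃ j : ℤ, F.distortion z = primeNorm v ^ j := by
  have hn {ι : Type} [Fintype ι] [Nonempty ι] {u : ι → v.adicCompletion K} (hu : u ≠ 0) :
      ∃ j : ℤ, ‖u‖ = primeNorm v ^ j := by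
    obtain ⟨i, hi⟩ := exists_norm_eq_norm u
    have : u i ≠ 0 := by rw [← norm_pos_iff, hi]; exact norm_pos_iff.2 hu
    rw [← hi]
    exact exists_norm_eq_zpow v this
  obtain ⟨a, ha⟩ := hn hz
  obtain ⟨b, hb⟩ := hn (F.eval_ne_zero' hz)
  obtain ⟨c, hc⟩ := hn (u := fun p => algebraMap K (v.adicCompletion K) (F.coeffs p)) (by
    rw [← norm_pos_iff]; exact F.coeffNorm_pos)
  have hp := (primeNorm_pos v).ne'
  refine ⟨a * d + c - b, ?_⟩
  rw [distortion, ha, hb, coeffNorm, hc, zpow_sub₀ hp, zpow_add₀ hp, zpow_mul, zpow_natCast]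

namespace ErrorConstants

variable (C : F.ErrorConstants)

theorem one_le_fin (hd : 1 ≤ d) (v : HeightOneSpectrum (𝓞 K)) : 1 ≤ C.fin v := by
  have hz : (fun _ => 1 : Fin (m + 1) → v.adicCompletion K) ≠ 0 := fun h =>
    one_ne_zero (congrFun h 0)
  refine le_trans ?_ (C.ratio_le_fin v _ hz)
  rw [F.ratio_finAbs v hd]
  exact Real.one_le_rpow (F.one_le_distortion hz) (by positivity)

theorem distortion_le_fin (hd : 1 ≤ d) (v : HeightOneSpectrum (𝓞 K))
    {z : Fin (m + 1) → v.adicCompletion K} (hz : z ≠ 0) :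
    F.distortion z ≤ C.fin v ^ (localDegree v * d) := by
  have h := C.ratio_le_fin v z hz
  rw [F.ratio_finAbs v hd] at h
  have hl := localDegree_pos v
  have h2 := pow_le_pow_left₀ (Real.rpow_nonneg (distortion_nonneg z) _) h (localDegree v * d)
  refine le_trans (le_of_eq ?_) h2
  rw [← Real.rpow_mul_natCast (distortion_nonneg z)]
  have : (1 / (d * localDegree v : ℝ)) * ((localDegree v * d : ℕ) : ℝ) = 1 := by
    push_cast
    field_simp
  rw [this, Real.rpow_one]

/-- Let `Nm v ^ k` be the largest power not exceeding `C_v ^ (n_v d)`. Distortions are integral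
powers of `Nm v` below `Nm v ^ (k+1)`, hence at most `Nm v ^ k`. This discreteness is why the
modulus has norm at most `(C_f^0)^d`. -/
theorem exists_residueData (hd : 1 ≤ d) : ∃ R : F.ResidueData,
    ∏ v ∈ R.bad, primeNorm v ^ R.exponent v ≤ C.zero ^ d := by
  classical
  have h1 (v : HeightOneSpectrum (𝓞 K)) : 1 ≤ C.fin v ^ (localDegree v * d) :=
    one_le_pow₀ (C.one_le_fin hd v)
  choose k hk1 hk2 using fun v => exists_nat_pow_near (h1 v) (one_lt_primeNorm v)
  have hD (v : HeightOneSpectrum (𝓞 K)) (z : Fin (m + 1) → v.adicCompletion K) (hz : z ≠ 0) :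
      F.distortion z ≤ primeNorm v ^ k v := by
    have h := (C.distortion_le_fin hd v hz).trans_lt (hk2 v)
    obtain ⟨j, hj⟩ := exists_distortion_eq_zpow (F := F) v hz
    rw [hj] at h ⊢
    rw [← zpow_natCast] at h ⊢
    have := (zpow_lt_zpow_iff_right₀ (one_lt_primeNorm v)).1 h
    exact zpow_le_zpow_right₀ (one_lt_primeNorm v).le (by push_cast at this; omega)
  set S₀ := C.finite_fin_ne_one.toFinset with hS₀
  -- Primes with exponent `0` have distortion at most `1` and are not bad, even if `C_v ≠ 1`.
  refine ⟨⟨S₀.filter fun v => k v ≠ 0, k, fun v hv => ?_, fun v _ => hD v, fun v hv z hz => ?_⟩, ?_⟩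
  · exact Nat.one_le_iff_ne_zero.2 (Finset.mem_filter.1 hv).2
  · rw [Finset.mem_filter, not_and_or] at hv
    rcases hv with hv | hv
    · have : C.fin v = 1 := by simpa [hS₀] using hv
      have := C.distortion_le_fin hd v hz
      rwa [‹C.fin v = 1›, one_pow] at this
    · have := hD v z hz
      rwa [not_not.1 hv, pow_zero] at this
  · have hz : C.zero = ∏ v ∈ S₀, C.fin v ^ localDegree v := by
      refine finprod_eq_prod_of_mulSupport_subset _ fun v hv => ?_
      rw [hS₀, Set.Finite.coe_toFinset]
      intro h
      exact hv (by simp only [h, one_pow])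
    rw [hz, ← Finset.prod_pow]
    rw [Finset.prod_filter]
    refine Finset.prod_le_prod (fun v _ => ?_) fun v _ => ?_
    · split_ifs
      exacts [pow_nonneg (primeNorm_pos v).le _, zero_le_one]
    · rw [← pow_mul]
      split_ifs
      exacts [hk1 v, h1 v]

end ErrorConstants

end ResidueData

end MorphismLift

end SchanuelMorphism

namespace SchanuelMorphism

set_option linter.unusedSectionVars false

namespace MorphismLift

/-! ### Residues modulo the product of the bad prime powers. -/

section CRT

variable {K : Type*} [Field K] [NumberField K] {m M d : ℕ} {F : MorphismLift K m M d}

namespace ResidueData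

variable (R : F.ResidueData)

/-- The modulus determining the distortion of primitive tuples. -/
def modulus : Ideal (𝓞 K) := ∏ v ∈ R.bad, v.asIdeal ^ R.exponent v

theorem modulus_ne_bot : R.modulus ≠ ⊥ :=
  Finset.prod_ne_zero_iff.2 fun v _ => pow_ne_zero _ v.ne_bot

theorem absNorm_modulus :
    (Ideal.absNorm R.modulus : ℝ) = ∏ v ∈ R.bad, primeNorm v ^ R.exponent v := by
  rw [modulus, map_prod, Nat.cast_prod]
  exact Finset.prod_congr rfl fun v _ => by rw [map_pow, Nat.cast_pow, primeNorm]

theorem modulus_le_pow {v : HeightOneSpectrum (𝓞 K)} (hv : v ∈ R.bad) :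
    R.modulus ≤ v.asIdeal ^ R.exponent v :=
  Ideal.le_of_dvd (Finset.dvd_prod_of_mem _ hv)

theorem modulus_le {v : HeightOneSpectrum (𝓞 K)} (hv : v ∈ R.bad) :
    R.modulus ≤ v.asIdeal :=
  (R.modulus_le_pow hv).trans (Ideal.pow_le_self (by have := R.exponent_pos v hv; omega))

/-- The tuples primitive at all bad primes. -/
def IsPrimitive (z : Fin (m + 1) → 𝓞 K) : Prop := ∀ v ∈ R.bad, ∃ i, z i ∉ v.asIdeal

/-- The product of the distortions at all bad primes. -/
def total (z : Fin (m + 1) → 𝓞 K) : ℝ := ∏ v ∈ R.bad, F.distortion (intVec v z)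

variable {R}

theorem exists_notMem_congr {v : HeightOneSpectrum (𝓞 K)} {z z' : Fin (m + 1) → 𝓞 K}
    (h : ∀ i, z i - z' i ∈ v.asIdeal) : (∃ i, z i ∉ v.asIdeal) ↔ ∃ i, z' i ∉ v.asIdeal := by
  refine exists_congr fun i => not_congr ?_
  have := h i
  constructor
  · intro h1
    simpa using sub_mem h1 this
  · intro h1
    simpa using add_mem this h1

theorem distortion_congr {v : HeightOneSpectrum (𝓞 K)} (hv : v ∈ R.bad)
    {z z' : Fin (m + 1) → 𝓞 K} (hz : ∃ i, z i ∉ v.asIdeal)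
    (h : ∀ i, z i - z' i ∈ v.asIdeal ^ R.exponent v) :
    F.distortion (intVec v z) = F.distortion (intVec v z') := by
  have h1 : ∀ i, z i - z' i ∈ v.asIdeal := fun i =>
    Ideal.pow_le_self (by have := R.exponent_pos v hv; omega) (h i)
  refine F.distortion_eq_of_norm_sub_le (R.distortion_le v hv)
    ((norm_intVec_eq_one_iff v z).2 hz)
    ((norm_intVec_eq_one_iff v z').2 ((exists_notMem_congr h1).1 hz)) ?_
  rw [← zpow_natCast, ← zpow_neg]
  exact (norm_intVec_sub_le_iff v z z' _).2 h

theorem isPrimitive_congr {z z' : Fin (m + 1) → 𝓞 K} (h : ∀ i, z i - z' i ∈ R.modulus) :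
    R.IsPrimitive z ↔ R.IsPrimitive z' :=
  forall₂_congr fun _ hv => exists_notMem_congr fun i => R.modulus_le hv (h i)

theorem total_congr {z z' : Fin (m + 1) → 𝓞 K} (h : ∀ i, z i - z' i ∈ R.modulus)
    (hz : R.IsPrimitive z) : R.total z = R.total z' :=
  Finset.prod_congr rfl fun v hv =>
    distortion_congr hv (hz v hv) fun i => R.modulus_le_pow hv (h i)

theorem intVec_ne_zero {v : HeightOneSpectrum (𝓞 K)} {z : Fin (m + 1) → 𝓞 K} (hz : z ≠ 0) :
    intVec v z ≠ 0 := by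
  intro h
  refine hz (funext fun i => ?_)
  have := congrFun h i
  simpa [intVec] using this

theorem one_le_total {z : Fin (m + 1) → 𝓞 K} (hz : z ≠ 0) : 1 ≤ R.total z := by
  refine (Finset.prod_const_one (s := R.bad)).symm.le.trans
    (Finset.prod_le_prod (fun _ _ => zero_le_one) fun v _ => ?_)
  exact F.one_le_distortion (intVec_ne_zero hz)

variable (R)

instance finite_quotient_modulus : Finite (𝓞 K ⧸ R.modulus) :=
  Ideal.finiteQuotientOfFreeOfNeBot _ R.modulus_ne_bot

/-- The contribution of a tuple of residues. -/
def weight (z : Fin (m + 1) → 𝓞 K) : ℝ :=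
  open scoped Classical in
  if R.IsPrimitive z then R.total z ^ ((m + 1 : ℝ) / d) else 0

/-- By the Chinese remainder theorem the sum factors over the bad primes, and `finFactor_eq_sum`
evaluates each factor. The remaining primes contribute `1` to `cZero`. -/
theorem sum_weight (hd : 1 ≤ d) [Fintype (Fin (m + 1) → 𝓞 K ⧸ R.modulus)] :
    ∑ y : Fin (m + 1) → 𝓞 K ⧸ R.modulus, R.weight (residueLift m _ y) =
      (Ideal.absNorm R.modulus : ℝ) ^ (m + 1) *
        (F.cZero * ∏ v ∈ R.bad, (1 - (primeNorm v ^ (m + 1))⁻¹)) := by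
  classical
  have (v : HeightOneSpectrum (𝓞 K)) : Fintype (Fin (m + 1) → 𝓞 K ⧸ v.asIdeal ^ R.exponent v) :=
    Fintype.ofFinite _
  let e : (𝓞 K ⧸ R.modulus) ≃+* ∀ v : R.bad, 𝓞 K ⧸ v.1.asIdeal ^ R.exponent v.1 :=
    HeightOneSpectrum.quotientEquivPiOfProdEq R.modulus (fun v : R.bad => v.1)
      (fun v => R.exponent v.1) (fun _ _ h => Subtype.coe_injective.ne h)
      (Finset.prod_coe_sort R.bad fun v => v.asIdeal ^ R.exponent v)
  have he (x : 𝓞 K) (v : R.bad) : e (Ideal.Quotient.mk _ x) v = Ideal.Quotient.mk _ x := rfl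
  let E : (Fin (m + 1) → 𝓞 K ⧸ R.modulus) ≃
      ((v : R.bad) → Fin (m + 1) → 𝓞 K ⧸ v.1.asIdeal ^ R.exponent v.1) :=
    (Equiv.piCongrRight fun _ => e.toEquiv).trans (Equiv.piComm _)
  have hE (y) (v : R.bad) (i) : E y v i = Ideal.Quotient.mk _ (residueLift m _ y i) := by
    rw [← he (residueLift m R.modulus y i) v, mk_residueLift]
    rfl
  have hw (y : Fin (m + 1) → 𝓞 K ⧸ R.modulus) : R.weight (residueLift m _ y) =
      ∏ v : R.bad, F.residueWeight v.1 (R.exponent v.1) (E y v) := by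
    -- The lifts modulo the full modulus and modulo the prime power differ, but they are congruent,
    -- and the weights only see the residue class.
    have hdiff (v : R.bad) (i) : residueLift m _ y i - residueLift m _ (E y v) i ∈
        v.1.asIdeal ^ R.exponent v.1 := by
      rw [← Ideal.Quotient.eq, mk_residueLift, hE]
    have hdiff' (v : R.bad) (i) : residueLift m _ y i - residueLift m _ (E y v) i ∈
        v.1.asIdeal :=
      Ideal.pow_le_self (by have := R.exponent_pos v.1 v.2; omega) (hdiff v i)
    rw [weight]
    split_ifs with hp
    · rw [total, ← Real.finsetProd_rpow _ _ fun v _ => distortion_nonneg _, ← Finset.prod_coe_sort]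
      refine Finset.prod_congr rfl fun v _ => ?_
      rw [residueWeight, if_pos ((exists_notMem_congr (hdiff' v)).1 (hp v.1 v.2)),
        distortion_congr v.2 (hp v.1 v.2) (hdiff v)]
    · rw [IsPrimitive] at hp
      push Not at hp
      obtain ⟨v, hv, h⟩ := hp
      refine (Finset.prod_eq_zero (Finset.mem_univ (⟨v, hv⟩ : R.bad)) ?_).symm
      rw [residueWeight, if_neg]
      rw [← exists_notMem_congr (hdiff' ⟨v, hv⟩)]
      push Not
      exact h
  have hc : F.cZero = ∏ v : R.bad, F.finFactor v.1 := by
    rw [Finset.prod_coe_sort R.bad F.finFactor]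
    refine finprod_eq_prod_of_mulSupport_subset _ fun v hv => ?_
    by_contra h
    exact hv (F.finFactor_eq_one v hd (R.distortion_le_one v h))
  rw [Fintype.sum_congr _ _ hw, E.sum_comp fun Y => ∏ v : R.bad,
    F.residueWeight v.1 (R.exponent v.1) (Y v), ← Fintype.prod_sum, hc, R.absNorm_modulus,
    ← Finset.prod_coe_sort R.bad, ← Finset.prod_coe_sort R.bad, ← Finset.prod_pow,
    ← Finset.prod_mul_distrib, ← Finset.prod_mul_distrib]
  refine Finset.prod_congr rfl fun v _ => ?_
  have h := F.finFactor_eq_sum v.1 hd (R.exponent_pos v.1 v.2) (R.distortion_le v.1 v.2)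
  have hp := primeNorm_pos v.1
  rw [mul_comm (F.finFactor v.1), h, ← pow_mul, mul_inv_cancel_left₀ (by positivity)]

end ResidueData

end CRT

/-! ### The archimedean gauge of a morphism -/

section Gauge

variable {K : Type*} [Field K] [NumberField K] {m M d : ℕ} (F : MorphismLift K m M d)

/-- The values of the forms at a complex point, at an infinite place. -/
def archEval (w : InfinitePlace K) (z : Fin (m + 1) → ℂ) : Fin (M + 1) → ℂ :=
  letI : Algebra K ℂ := w.embedding.toAlgebra
  F.eval z

/-- The maximum of the coefficients at an infinite place. -/
def archCoeff (w : InfinitePlace K) : ℝ :=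
  letI : Algebra K ℂ := w.embedding.toAlgebra
  F.coeffNorm ℂ

theorem archCoeff_pos (w : InfinitePlace K) : 0 < F.archCoeff w :=
  letI : Algebra K ℂ := w.embedding.toAlgebra
  F.coeffNorm_pos

theorem continuous_archEval (w : InfinitePlace K) : Continuous (F.archEval w) :=
  letI : Algebra K ℂ := w.embedding.toAlgebra
  F.continuous_eval

theorem archEval_smul (w : InfinitePlace K) (c : ℂ) (z : Fin (m + 1) → ℂ) :
    F.archEval w (c • z) = c ^ d • F.archEval w z :=
  letI : Algebra K ℂ := w.embedding.toAlgebra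
  F.eval_smul c z

theorem archEval_eq_zero (w : InfinitePlace K) {z : Fin (m + 1) → ℂ} (h : F.archEval w z = 0) :
    z = 0 := by
  let : Algebra K ℂ := w.embedding.toAlgebra
  by_contra hz
  exact F.eval_ne_zero' hz h

/-- The gauge `(|F(z)| / |F|) ^ (1 / d)`. -/
def gauge (hd : 1 ≤ d) : Gauge K (Fin (m + 1)) where
  toFun w z := (‖F.archEval w z‖ / F.archCoeff w) ^ (1 / (d : ℝ))
  continuous w := ((F.continuous_archEval w).norm.div_const _).rpow_const fun _ =>
    Or.inr (by positivity)
  nonneg w z := Real.rpow_nonneg (div_nonneg (norm_nonneg _) (F.archCoeff_pos w).le) _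
  map_smul w c z := by
    rw [F.archEval_smul, norm_smul, norm_pow, mul_div_assoc, Real.mul_rpow (by positivity)
      (div_nonneg (norm_nonneg _) (F.archCoeff_pos w).le), one_div,
      Real.pow_rpow_inv_natCast (norm_nonneg _) (by omega)]
  eq_zero w z h := by
    rw [Real.rpow_eq_zero (div_nonneg (norm_nonneg _) (F.archCoeff_pos w).le) (by positivity),
      div_eq_zero_iff, or_iff_left (F.archCoeff_pos w).ne', norm_eq_zero] at h
    exact F.archEval_eq_zero w h

theorem gauge_pow (hd : 1 ≤ d) (w : InfinitePlace K) (z : Fin (m + 1) → ℂ) :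
    (F.gauge hd).toFun w z ^ d * F.archCoeff w = ‖F.archEval w z‖ := by
  have : (F.gauge hd).toFun w z ^ d = ‖F.archEval w z‖ / F.archCoeff w := by
    change ((‖F.archEval w z‖ / F.archCoeff w) ^ (1 / (d : ℝ))) ^ d = _
    rw [one_div, Real.rpow_inv_natCast_pow (div_nonneg (norm_nonneg _) (F.archCoeff_pos w).le)
      (by omega)]
  rw [this, div_mul_cancel₀ _ (F.archCoeff_pos w).ne']

theorem eval_algebraMap {L : Type*} [Field L] [Algebra K L] (x : Fin (m + 1) → K) :
    F.eval (fun i => algebraMap K L (x i)) = fun j => algebraMap K L (F.eval x j) := by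
  funext j
  simp only [eval]
  rw [← MvPolynomial.aeval_algebraMap_apply]
  rfl

theorem iSup_infinitePlace {ι : Type*} [Fintype ι] [Nonempty ι] (w : InfinitePlace K) (x : ι → K) :
    ⨆ i, w (x i) = ‖fun i => w.embedding (x i)‖ := by
  rw [← maxAbs_norm_eq]
  refine iSup_congr fun i => ?_
  exact (InfinitePlace.norm_embedding_eq w _).symm

theorem iSup_eval_infinitePlace (hd : 1 ≤ d) (w : InfinitePlace K) (x : Fin (m + 1) → K) :
    ⨆ j, w (F.eval x j) =
      (F.gauge hd).toFun w (fun i => w.embedding (x i)) ^ d * ⨆ p, w (F.coeffs p) := by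
  let : Algebra K ℂ := w.embedding.toAlgebra
  have h1 : ⨆ p, w (F.coeffs p) = F.archCoeff w := iSup_infinitePlace w _
  have h2 : (fun j => w.embedding (F.eval x j)) = F.archEval w (fun i => w.embedding (x i)) :=
    (F.eval_algebraMap (L := ℂ) x).symm
  rw [h1, F.gauge_pow, iSup_infinitePlace, h2]

theorem finprod_finitePlace_eq {ι : Type*} [Fintype ι] [Nonempty ι] (x : ι → K) :
    ∏ᶠ v : FinitePlace K, ⨆ i, v (x i) = ∏ᶠ v : HeightOneSpectrum (𝓞 K),
      ‖fun i => algebraMap K (v.adicCompletion K) (x i)‖ := by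
  rw [← finprod_comp_equiv FinitePlace.equivHeightOneSpectrum.symm]
  refine finprod_congr fun v => ?_
  rw [← maxAbs_norm_eq]
  rfl

theorem hasFiniteMulSupport_norm {ι : Type*} [Fintype ι] [Nonempty ι] {x : ι → K} (hx : x ≠ 0) :
    (Function.mulSupport fun v : HeightOneSpectrum (𝓞 K) =>
      ‖fun i => algebraMap K (v.adicCompletion K) (x i)‖).Finite := by
  refine (finite_exists_norm_ne_one x).subset fun v hv => ?_
  by_contra hcon
  rw [Set.mem_ofPred_eq] at hcon
  push Not at hcon
  apply hv
  obtain ⟨i, hi⟩ := Function.ne_iff.1 hx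
  refine le_antisymm ((pi_norm_le_iff_of_nonneg zero_le_one).2 fun j => ?_) ?_
  · by_cases hj : x j = 0
    · rw [hj, map_zero, norm_zero]; exact zero_le_one
    · exact (hcon j hj).le
  · rw [← hcon i hi]
    exact norm_le_pi_norm (fun i => algebraMap K (v.adicCompletion K) (x i)) i

/-- Multiply the local identities `|F(z)| · distortion = |z|^d |F|` over all primes; the product of
the `|z|_v` is the inverse norm of the ideal generated by the entries. -/
theorem finprod_finitePlace_eval (R : F.ResidueData) {z : Fin (m + 1) → 𝓞 K} (hz : z ≠ 0) :
    (∏ᶠ v : FinitePlace K, ⨆ j, v (F.eval (fun i => (z i : K)) j)) * (R.total z *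
      (Ideal.absNorm (Ideal.span (Set.range z)) : ℝ) ^ d) =
        ∏ᶠ v : FinitePlace K, ⨆ p, v (F.coeffs p) := by
  have hx0 : (fun i => (z i : K)) ≠ 0 := fun h => hz (funext fun i => by simpa using congrFun h i)
  have hF0 := F.eval_ne_zero hx0
  have hloc (v : HeightOneSpectrum (𝓞 K)) :
      ‖fun j => algebraMap K (v.adicCompletion K) (F.eval (fun i => (z i : K)) j)‖ *
        F.distortion (intVec v z) =
        ‖intVec v z‖ ^ d * F.coeffNorm (v.adicCompletion K) := by
    rw [← F.eval_algebraMap]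
    have := norm_pos_iff.2 (F.eval_ne_zero' (ResidueData.intVec_ne_zero (v := v) hz))
    exact mul_div_cancel₀ _ this.ne'
  have hdsub : (Function.mulSupport fun v : HeightOneSpectrum (𝓞 K) =>
      F.distortion (intVec v z)) ⊆ R.bad := fun v hv => by
    by_contra h
    exact hv (le_antisymm (R.distortion_le_one v h _ (ResidueData.intVec_ne_zero (v := v) hz))
      (F.one_le_distortion (ResidueData.intVec_ne_zero (v := v) hz)))
  have hfs1 := hasFiniteMulSupport_norm hF0
  have hfs2 : (Function.mulSupport fun v : HeightOneSpectrum (𝓞 K) =>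
      F.distortion (intVec v z)).Finite := R.bad.finite_toSet.subset hdsub
  have hfs3 : (Function.mulSupport fun v : HeightOneSpectrum (𝓞 K) => ‖intVec v z‖).Finite :=
    hasFiniteMulSupport_norm hx0
  have hfs4 : (Function.mulSupport fun v : HeightOneSpectrum (𝓞 K) =>
      F.coeffNorm (v.adicCompletion K)).Finite := hasFiniteMulSupport_norm F.coeffs_ne_zero
  have hfs3' : (Function.mulSupport fun v : HeightOneSpectrum (𝓞 K) => ‖intVec v z‖ ^ d).Finite :=
    hfs3.subset fun v hv h => hv (by simp only at h; simp only [h, one_pow])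
  have hglob := finprod_congr hloc
  rw [finprod_mul_distrib hfs1 hfs2, finprod_mul_distrib hfs3' hfs4, ← finprod_pow hfs3,
    finprod_eq_prod_of_mulSupport_subset _ hdsub, ← finprod_finitePlace_eq] at hglob
  have hN : (Ideal.absNorm (Ideal.span (Set.range z)) : ℝ) *
      ∏ᶠ v : HeightOneSpectrum (𝓞 K), ‖intVec v z‖ = 1 := by
    have := NumberField.absNorm_mul_finprod_finitePlace_eq_one hz
    rw [finprod_finitePlace_eq] at this
    exact this
  have hcoef : ∏ᶠ v : HeightOneSpectrum (𝓞 K), F.coeffNorm (v.adicCompletion K) =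
      ∏ᶠ v : FinitePlace K, ⨆ p, v (F.coeffs p) := (finprod_finitePlace_eq F.coeffs).symm
  rw [hcoef] at hglob
  have hN' : (Ideal.absNorm (Ideal.span (Set.range z)) : ℝ) ^ d *
      (∏ᶠ v : HeightOneSpectrum (𝓞 K), ‖intVec v z‖) ^ d = 1 := by
    rw [← mul_pow, hN, one_pow]
  rw [ResidueData.total]
  generalize (∏ᶠ v : FinitePlace K, ⨆ p, v (F.coeffs p)) = c at *
  generalize (∏ v ∈ R.bad, F.distortion (intVec v z)) = q at *
  rw [← mul_assoc, hglob, mul_right_comm, mul_comm (_ ^ d), hN', one_mul]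

/-- The height formula of the proof: combined with the definition of the gauges at the infinite
places, it turns a bound for the height into one for the product of the gauges, once ideal and
residue class are fixed. -/
theorem mulHeight_eval (hd : 1 ≤ d) (R : F.ResidueData) {z : Fin (m + 1) → 𝓞 K} (hz : z ≠ 0) :
    Height.mulHeight (F.eval fun i => (z i : K)) * (R.total z *
      (Ideal.absNorm (Ideal.span (Set.range z)) : ℝ) ^ d) = Height.mulHeight F.coeffs *
        (∏ w : InfinitePlace K, (F.gauge hd).toFun w (fun i => w.embedding (z i)) ^ w.mult) ^ d := by
  have hx0 : (fun i => (z i : K)) ≠ 0 := fun h => hz (funext fun i => by simpa using congrFun h i)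
  have hinf : ∏ w : InfinitePlace K, (⨆ j, w (F.eval (fun i => (z i : K)) j)) ^ w.mult =
      (∏ w : InfinitePlace K, (F.gauge hd).toFun w (fun i => w.embedding (z i)) ^ w.mult) ^ d *
        ∏ w : InfinitePlace K, (⨆ p, w (F.coeffs p)) ^ w.mult := by
    rw [← Finset.prod_pow, ← Finset.prod_mul_distrib]
    refine Finset.prod_congr rfl fun w _ => ?_
    rw [F.iSup_eval_infinitePlace hd, mul_pow, ← pow_mul, ← pow_mul, mul_comm d]
  rw [NumberField.mulHeight_eq (F.eval_ne_zero hx0), NumberField.mulHeight_eq F.coeffs_ne_zero,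
    mul_assoc, F.finprod_finitePlace_eval R hz, hinf]
  ring

end Gauge

end MorphismLift

end SchanuelMorphism

namespace SchanuelMorphism

set_option linter.unusedSectionVars false

/-! ### Units and the gauge cone -/

section UnitAction

open NumberField.InfinitePlace NumberField.mixedEmbedding NumberField.mixedEmbedding.fundamentalCone
  NumberField.Units NumberField.Units.dirichletUnitTheorem
open scoped Classical Pointwise nonZeroDivisors

variable {K : Type*} [Field K] [NumberField K] {ι : Type*} [Fintype ι]

/-- The image of a tuple of integers in the mixed space. -/
abbrev mixedVec (z : ι → 𝓞 K) : ι → mixedSpace K := fun i => mixedEmbedding K (z i)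

theorem vecAt_mixedVec (w : InfinitePlace K) (z : ι → 𝓞 K) :
    vecAt w (mixedVec z) = fun i => w.embedding (z i) := by
  funext i
  by_cases h : w.IsReal
  · rw [vecAt_real h]
    simp [mixedEmbedding_apply_isReal, embedding_of_isReal_apply]
  · rw [vecAt_complex (not_isReal_iff_isComplex.1 h)]
    simp [mixedEmbedding_apply_isComplex]

namespace Gauge

variable (g : Gauge K ι)

theorem vec_nonneg (z : ι → mixedSpace K) (w : InfinitePlace K) : 0 ≤ g.vec z w := g.nonneg w _

/-- The product of the local gauges. -/
def size (z : ι → 𝓞 K) : ℝ := ∏ w, g.vec (mixedVec z) w ^ w.mult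

/-- The condition that the gauges lie in the fundamental cone. -/
def InCone (z : ι → 𝓞 K) : Prop :=
  mixedSpaceOfRealSpace (g.vec (mixedVec z)) ∈ fundamentalCone K

theorem size_nonneg (z : ι → 𝓞 K) : 0 ≤ g.size z :=
  Finset.prod_nonneg fun w _ => pow_nonneg (g.vec_nonneg _ w) _

theorem norm_mixedSpaceOfRealSpace_vec (z : ι → 𝓞 K) :
    mixedEmbedding.norm (mixedSpaceOfRealSpace (g.vec (mixedVec z))) = g.size z := by
  rw [mixedEmbedding.norm_apply]
  exact Finset.prod_congr rfl fun w _ => by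
    rw [normAtPlace_mixedSpaceOfRealSpace (g.vec_nonneg _ w)]

/-- Regarded as an element of the mixed space, the gauge vector divided by `T` lies in `normLeOne`.
That set is the intersection of the fundamental cone, which is stable under scaling, with a norm
condition. -/
theorem vec_mem_smul_iff (z : ι → 𝓞 K) {T : ℝ} (hT : 0 < T) :
    g.vec (mixedVec z) ∈ T • (expMapBasis '' paramSet K) ↔
      g.InCone z ∧ g.size z ≤ T ^ Module.finrank ℚ K := by
  set r := g.vec (mixedVec z) with hr
  have hr0 : ∀ w, 0 ≤ (T⁻¹ • r) w := fun w =>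
    mul_nonneg (inv_nonneg.2 hT.le) (g.vec_nonneg _ w)
  have h1 : normAtAllPlaces (mixedSpaceOfRealSpace (T⁻¹ • r)) = T⁻¹ • r := by
    funext w
    rw [normAtAllPlaces_apply, normAtPlace_mixedSpaceOfRealSpace (hr0 w)]
  rw [Set.mem_smul_set_iff_inv_smul_mem₀ hT.ne', ← h1, ← Set.mem_preimage,
    ← normLeOne_eq_preimage, mem_normLeOne]
  have h2 : mixedSpaceOfRealSpace (T⁻¹ • r) = T⁻¹ • mixedSpaceOfRealSpace r := by
    rw [_root_.map_smul]
  rw [h2, smul_mem_iff_mem (inv_ne_zero hT.ne'), mixedEmbedding.norm_smul,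
    norm_mixedSpaceOfRealSpace_vec, abs_inv, abs_of_pos hT, inv_pow,
    inv_mul_le_iff₀ (pow_pos hT _), mul_one]
  rfl

theorem vec_ne_zero {z : ι → 𝓞 K} (hz : z ≠ 0) (w : InfinitePlace K) :
    g.vec (mixedVec z) w ≠ 0 := by
  intro h
  have h1 := g.eq_zero w _ h
  rw [vecAt_mixedVec] at h1
  refine hz (funext fun i => ?_)
  have := congrFun h1 i
  simpa using this

theorem size_pos {z : ι → 𝓞 K} (hz : z ≠ 0) : 0 < g.size z :=
  Finset.prod_pos fun w _ => pow_pos (lt_of_le_of_ne (g.vec_nonneg _ w) (g.vec_ne_zero hz w).symm) _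

theorem InCone.ne_zero [Nonempty ι] {g : Gauge K ι} {z : ι → 𝓞 K} (h : g.InCone z) : z ≠ 0 := by
  rintro rfl
  refine h.2 ?_
  rw [Set.mem_ofPred_eq, norm_mixedSpaceOfRealSpace_vec]
  refine Finset.prod_eq_zero (Finset.mem_univ (Classical.arbitrary (InfinitePlace K))) ?_
  have : g.vec (mixedVec (0 : ι → 𝓞 K)) (Classical.arbitrary (InfinitePlace K)) = 0 := by
    rw [vec, vecAt_mixedVec]
    simpa using! g.map_zero _
  rw [this, zero_pow mult_ne_zero]

theorem vec_smul_int (a : 𝓞 K) (z : ι → 𝓞 K) (w : InfinitePlace K) :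
    g.vec (mixedVec (a • z)) w = w a * g.vec (mixedVec z) w := by
  have h : (fun i => w.embedding ((a • z) i : 𝓞 K)) =
      (w.embedding a) • fun i => w.embedding (z i) := by
    funext i
    simp
  rw [vec, vec, vecAt_mixedVec, vecAt_mixedVec, h, g.map_smul, InfinitePlace.norm_embedding_eq]

/-- A unit multiplies each gauge by its absolute value there, and membership in the fundamental cone
depends on absolute values only. -/
theorem inCone_unit_smul_iff (u : (𝓞 K)ˣ) (z : ι → 𝓞 K) :
    g.InCone ((u : 𝓞 K) • z) ↔
      u • mixedSpaceOfRealSpace (g.vec (mixedVec z)) ∈ fundamentalCone K := by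
  have key (w : InfinitePlace K) :
      normAtPlace w (mixedSpaceOfRealSpace (g.vec (mixedVec ((u : 𝓞 K) • z)))) =
        normAtPlace w (u • mixedSpaceOfRealSpace (g.vec (mixedVec z))) := by
    rw [normAtPlace_mixedSpaceOfRealSpace (g.vec_nonneg _ w), unitSMul_smul, map_mul,
      normAtPlace_mixedSpaceOfRealSpace (g.vec_nonneg _ w), normAtPlace_apply, vec_smul_int]
  exact ⟨fun h => mem_of_normAtPlace_eq h fun w => (key w).symm,
    fun h => mem_of_normAtPlace_eq h key⟩

theorem exists_unit_inCone {z : ι → 𝓞 K} (hz : z ≠ 0) : ∃ u : (𝓞 K)ˣ, g.InCone ((u : 𝓞 K) • z) := by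
  obtain ⟨u, hu⟩ := exists_unit_smul_mem (x := mixedSpaceOfRealSpace (g.vec (mixedVec z)))
    (by rw [norm_mixedSpaceOfRealSpace_vec]; exact (g.size_pos hz).ne')
  exact ⟨u, (g.inCone_unit_smul_iff u z).2 hu⟩

theorem inCone_unit_smul_iff_mem_torsion {z : ι → 𝓞 K} (hz : g.InCone z) (u : (𝓞 K)ˣ) :
    g.InCone ((u : 𝓞 K) • z) ↔ u ∈ torsion K := by
  rw [inCone_unit_smul_iff]
  exact unit_smul_mem_iff_mem_torsion hz u

end Gauge

end UnitAction

/-! ### Ideal classes and projective points -/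

section Points

open scoped nonZeroDivisors
open NumberField.Units

variable {K : Type*} [Field K] [NumberField K]

/-- Take `b` in the inverse class and `α` with `q b + (α) = b`; the cofactor `a` in `(α) = b a` has
class `c`, and cancelling `b` shows that it is prime to `q`. -/
theorem exists_coprime_rep {q : Ideal (𝓞 K)} (hq : q ≠ ⊥) (c : ClassGroup (𝓞 K)) :
    ∃ a : (Ideal (𝓞 K))⁰, ClassGroup.mk0 a = c ∧ a.1 ⊔ q = ⊤ := by
  obtain ⟨b, hb⟩ := ClassGroup.mk0_surjective c⁻¹
  have hb0 : b.1 ≠ 0 := nonZeroDivisors.coe_ne_zero b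
  by_cases hq1 : q = ⊤
  · obtain ⟨a, ha⟩ := ClassGroup.mk0_surjective c
    exact ⟨a, ha, by rw [hq1, sup_top_eq]⟩
  obtain ⟨α, hα⟩ := IsDedekindDomain.exists_sup_span_eq (I := q * b.1) (J := b.1)
    Ideal.mul_le_right (mul_ne_zero hq hb0)
  have hα0 : α ≠ 0 := by
    rintro rfl
    rw [Ideal.span_singleton_eq_bot.2 rfl, sup_bot_eq] at hα
    exact hq1 (by simpa using (mul_eq_right₀ hb0).1 hα)
  obtain ⟨a, ha⟩ : b.1 ∣ Ideal.span {α} := Ideal.dvd_iff_le.2 (hα ▸ le_sup_right)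
  have ha0 : a ≠ 0 := by
    rintro rfl
    rw [mul_zero] at ha
    exact hα0 (Ideal.span_singleton_eq_bot.1 ha)
  refine ⟨⟨a, mem_nonZeroDivisors_of_ne_zero ha0⟩, ?_, ?_⟩
  · have h1 : ClassGroup.mk0 (b * ⟨a, mem_nonZeroDivisors_of_ne_zero ha0⟩) = 1 := by
      rw [ClassGroup.mk0_eq_one_iff]
      exact ⟨α, ha.symm⟩
    rw [map_mul, hb] at h1
    exact (inv_mul_eq_one.1 h1).symm
  · rw [ha, mul_comm b.1, ← Ideal.add_eq_sup, ← add_mul] at hα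
    have := (mul_eq_right₀ hb0).1 hα
    rw [sup_comm, ← Ideal.add_eq_sup, this, Ideal.one_eq_top]

variable {ι : Type*} [Fintype ι]

theorem span_range_smul (a : 𝓞 K) (z : ι → 𝓞 K) :
    Ideal.span (Set.range (a • z)) = Ideal.span {a} * Ideal.span (Set.range z) := by
  rw [Ideal.span_mul_span', Set.singleton_mul, ← Set.range_comp]
  rfl

theorem span_range_ne_bot {z : ι → 𝓞 K} (hz : z ≠ 0) : Ideal.span (Set.range z) ≠ ⊥ := by
  rw [Ne, Ideal.span_eq_bot]
  push Not
  obtain ⟨i, hi⟩ := Function.ne_iff.1 hz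
  exact ⟨z i, ⟨i, rfl⟩, hi⟩

/-- Regarding a tuple of integers as a tuple of elements of the field. -/
abbrev fieldVec (z : ι → 𝓞 K) : ι → K := fun i => (z i : K)

theorem fieldVec_ne_zero {z : ι → 𝓞 K} (hz : z ≠ 0) : fieldVec z ≠ 0 := fun h =>
  hz (funext fun i => by simpa using congrFun h i)

theorem fieldVec_injective : Function.Injective (fieldVec : (ι → 𝓞 K) → ι → K) := fun _ _ h =>
  funext fun i => RingOfIntegers.coe_injective (congrFun h i)

/-- Every point is represented by integers generating the chosen ideal of some class. -/
theorem exists_integral_rep (a : ClassGroup (𝓞 K) → (Ideal (𝓞 K))⁰)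
    (ha : ∀ c, ClassGroup.mk0 (a c) = c) (P : Projectivization K (ι → K)) :
    ∃ (z : ι → 𝓞 K) (hz : z ≠ 0) (c : ClassGroup (𝓞 K)),
      Projectivization.mk K (fieldVec z) (fieldVec_ne_zero hz) = P ∧
        Ideal.span (Set.range z) = (a c).1 := by
  induction P using Projectivization.ind with
  | h x hx =>
  obtain ⟨b, hb⟩ := IsLocalization.exist_integer_multiples_of_finite (𝓞 K)⁰ x
  choose z hz using hb
  have hb0 : ((b : 𝓞 K) : K) ≠ 0 := by
    simp
  have hzx : fieldVec z = ((b : 𝓞 K) : K) • x := by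
    funext i
    have := hz i
    rw [Algebra.smul_def] at this
    exact this
  have hz0 : z ≠ 0 := by
    rintro rfl
    have h0 : ((b : 𝓞 K) : K) • x = 0 := by rw [← hzx]; funext i; simp
    exact hx ((smul_eq_zero.1 h0).resolve_left hb0)
  set J : (Ideal (𝓞 K))⁰ := ⟨Ideal.span (Set.range z),
    mem_nonZeroDivisors_of_ne_zero (span_range_ne_bot hz0)⟩ with hJ
  -- The integral tuple `z` generates some ideal `J`; rescaling it by `α / β` replaces `J` by the
  -- chosen ideal of its class.
  obtain ⟨α, β, hα, hβ, h⟩ := ClassGroup.mk0_eq_mk0_iff.1 (ha (ClassGroup.mk0 J)).symm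
  have hdvd (i) : ∃ y, α * z i = β * y := by
    have h1 : α * z i ∈ Ideal.span {β} * (a (ClassGroup.mk0 J)).1 := by
      rw [← h]
      exact Ideal.mul_mem_mul (Ideal.mem_span_singleton_self α)
        (Ideal.subset_span (Set.mem_range_self i))
    obtain ⟨y, hy⟩ := Ideal.mem_span_singleton.1 (Ideal.mul_le_left h1)
    exact ⟨y, hy⟩
  choose y hy using hdvd
  have hy' : α • z = β • y := funext hy
  have hy0 : y ≠ 0 := by
    rintro rfl
    rw [smul_zero] at hy'
    exact hz0 ((smul_eq_zero.1 hy').resolve_left hα)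
  refine ⟨y, hy0, ClassGroup.mk0 J, ?_, ?_⟩
  · rw [Projectivization.mk_eq_mk_iff']
    refine ⟨(β : K)⁻¹ * (α : K) * ((b : 𝓞 K) : K), ?_⟩
    have hβ' : (β : K) ≠ 0 := by simpa using hβ
    rw [mul_smul, mul_smul, ← hzx, inv_smul_eq_iff₀ hβ']
    funext i
    have := congrArg (fun t : 𝓞 K => (t : K)) (hy i)
    simpa using this
  · have h2 : Ideal.span {β} * Ideal.span (Set.range y) =
        Ideal.span {β} * (a (ClassGroup.mk0 J)).1 := by
      rw [← span_range_smul, ← hy', span_range_smul, ← h]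
    exact mul_left_cancel₀ (by simpa using hβ) h2

/-- Two such representatives of a point differ by a unit. -/
theorem exists_unit_of_mk_eq (a : ClassGroup (𝓞 K) → (Ideal (𝓞 K))⁰)
    (ha : ∀ c, ClassGroup.mk0 (a c) = c) {z z' : ι → 𝓞 K} (hz : z ≠ 0) (hz' : z' ≠ 0)
    (h : Projectivization.mk K (fieldVec z) (fieldVec_ne_zero hz) =
      Projectivization.mk K (fieldVec z') (fieldVec_ne_zero hz'))
    (hc : ∃ c, Ideal.span (Set.range z) = (a c).1) (hc' : ∃ c, Ideal.span (Set.range z') = (a c).1) :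
    ∃ u : (𝓞 K)ˣ, z = (u : 𝓞 K) • z' := by
  obtain ⟨c, hc⟩ := hc
  obtain ⟨c', hc'⟩ := hc'
  obtain ⟨t, ht⟩ := (Projectivization.mk_eq_mk_iff' K _ _ _ _).1 h
  obtain ⟨α, β, hβ, rfl⟩ := IsFractionRing.div_surjective (A := 𝓞 K) t
  have hβ0 : β ≠ 0 := nonZeroDivisors.ne_zero hβ
  have h1 : β • z = α • z' := by
    apply fieldVec_injective
    funext i
    have := congrFun ht i
    simp only [Pi.smul_apply, smul_eq_mul] at this
    simp only [fieldVec, Pi.smul_apply, smul_eq_mul, map_mul, ← this]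
    have hβ' : algebraMap (𝓞 K) K β ≠ 0 := by simpa using hβ0
    field_simp
  have hα0 : α ≠ 0 := by
    rintro rfl
    rw [zero_smul] at h1
    exact hz ((smul_eq_zero.1 h1).resolve_left hβ0)
  have h2 : Ideal.span {β} * (a c).1 = Ideal.span {α} * (a c').1 := by
    rw [← hc, ← hc', ← span_range_smul, ← span_range_smul, h1]
  have h3 : c = c' := by
    rw [← ha c, ← ha c']
    exact ClassGroup.mk0_eq_mk0_iff.2 ⟨β, α, hβ0, hα0, h2⟩
  subst h3
  have h4 := mul_right_cancel₀ (nonZeroDivisors.coe_ne_zero (a c)) h2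
  obtain ⟨u, hu⟩ := Ideal.span_singleton_eq_span_singleton.1 h4
  refine ⟨u, ?_⟩
  have h5 : β • z = β • ((u : 𝓞 K) • z') := by rw [h1, ← hu, mul_smul]
  exact smul_right_injective _ hβ0 h5

/-- The integral tuples representing the points of a set, normalised by the gauge cone. -/
def repSet (g : Gauge K ι) (a : ClassGroup (𝓞 K) → (Ideal (𝓞 K))⁰)
    (S : Set (Projectivization K (ι → K))) : Set (ι → 𝓞 K) :=
  {z | g.InCone z ∧ (∃ c, Ideal.span (Set.range z) = (a c).1) ∧
    ∃ hz : z ≠ 0, Projectivization.mk K (fieldVec z) (fieldVec_ne_zero hz) ∈ S}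

/-- Representatives generating a chosen ideal form one orbit of the units; the cone condition keeps
exactly one orbit of the roots of unity, on which they act freely. -/
theorem card_repSet [Nonempty ι] (g : Gauge K ι) (a : ClassGroup (𝓞 K) → (Ideal (𝓞 K))⁰)
    (ha : ∀ c, ClassGroup.mk0 (a c) = c) (S : Set (Projectivization K (ι → K))) :
    Nonempty (S × torsion K ≃ repSet g a S) := by
  have hrep (P : Projectivization K (ι → K)) : ∃ (z : ι → 𝓞 K) (hz : z ≠ 0),
      g.InCone z ∧ (∃ c, Ideal.span (Set.range z) = (a c).1) ∧
        Projectivization.mk K (fieldVec z) (fieldVec_ne_zero hz) = P := by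
    obtain ⟨z, hz, c, hP, hspan⟩ := exists_integral_rep a ha P
    obtain ⟨u, hu⟩ := g.exists_unit_inCone hz
    have huz : (u : 𝓞 K) • z ≠ 0 := smul_ne_zero u.ne_zero hz
    refine ⟨(u : 𝓞 K) • z, huz, hu, ⟨c, ?_⟩, ?_⟩
    · rw [span_range_smul, Ideal.span_singleton_eq_top.2 u.isUnit, Ideal.top_mul, hspan]
    · rw [← hP, Projectivization.mk_eq_mk_iff']
      exact ⟨((u : 𝓞 K) : K), by funext i; simp [fieldVec]⟩
  choose rep hrep0 hcone hspan hmk using hrep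
  have hsmul (ζ : torsion K) (P) : ((ζ : (𝓞 K)ˣ) : 𝓞 K) • rep P ≠ 0 :=
    smul_ne_zero (ζ : (𝓞 K)ˣ).ne_zero (hrep0 P)
  have hmk' (ζ : torsion K) (P) :
      Projectivization.mk K (fieldVec (((ζ : (𝓞 K)ˣ) : 𝓞 K) • rep P))
        (fieldVec_ne_zero (hsmul ζ P)) = P := by
    conv_rhs => rw [← hmk P]
    rw [Projectivization.mk_eq_mk_iff']
    exact ⟨(((ζ : (𝓞 K)ˣ) : 𝓞 K) : K), by funext i; simp [fieldVec]⟩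
  refine ⟨Equiv.ofBijective (fun p => ⟨((p.2 : (𝓞 K)ˣ) : 𝓞 K) • rep p.1, ?_, ?_, ?_⟩) ⟨?_, ?_⟩⟩
  · exact (g.inCone_unit_smul_iff_mem_torsion (hcone _) _).2 p.2.2
  · obtain ⟨c, hc⟩ := hspan p.1
    refine ⟨c, ?_⟩
    rw [span_range_smul, Ideal.span_singleton_eq_top.2 (p.2 : (𝓞 K)ˣ).isUnit, Ideal.top_mul, hc]
  · exact ⟨hsmul _ _, by rw [hmk']; exact p.1.2⟩
  · rintro ⟨⟨P, hP⟩, ζ⟩ ⟨⟨P', hP'⟩, ζ'⟩ h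
    have h1 : ((ζ : (𝓞 K)ˣ) : 𝓞 K) • rep P = ((ζ' : (𝓞 K)ˣ) : 𝓞 K) • rep P' :=
      congrArg Subtype.val h
    have h2 : P = P' := by
      rw [← hmk' ζ P, ← hmk' ζ' P']
      congr 1
      rw [h1]
    subst h2
    have h3 : ((ζ : (𝓞 K)ˣ) : 𝓞 K) = ((ζ' : (𝓞 K)ˣ) : 𝓞 K) := smul_left_injective _ (hrep0 P) h1
    have h4 : ζ = ζ' := Subtype.ext (Units.ext h3)
    rw [h4]
  · rintro ⟨z, hz, hzc, hz0, hzS⟩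
    set P := Projectivization.mk K (fieldVec z) (fieldVec_ne_zero hz0) with hP
    obtain ⟨u, hu⟩ := exists_unit_of_mk_eq a ha hz0 (hrep0 P) (hP.symm.trans (hmk P).symm) hzc
      (hspan P)
    have hut : u ∈ torsion K := by
      rw [← g.inCone_unit_smul_iff_mem_torsion (hcone P), ← hu]
      exact hz
    exact ⟨⟨⟨P, hzS⟩, ⟨u, hut⟩⟩, Subtype.ext hu.symm⟩

end Points

end SchanuelMorphism

namespace SchanuelMorphism

set_option linter.unusedSectionVars false

/-! ### Points of bounded height as lattice points -/

theorem ncard_eq_sum_fiber {α κ : Type*} [Fintype κ] {Z : Set α} (hZ : Z.Finite) (f : α → κ) :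
    Z.ncard = ∑ k, {z | z ∈ Z ∧ f z = k}.ncard := by
  classical
  rw [Set.ncard_eq_toFinset_card Z hZ, Finset.card_eq_sum_card_fiberwise (f := f)
    (t := Finset.univ) fun _ _ => Finset.mem_coe.2 (Finset.mem_univ _)]
  refine Finset.sum_congr rfl fun k _ => ?_
  rw [← Set.ncard_coe_finset]
  congr 1
  ext z
  simp

namespace MorphismLift

open scoped nonZeroDivisors

variable {K : Type*} [Field K] [NumberField K] {m M d : ℕ} (F : MorphismLift K m M d)

theorem height_pos : 0 < F.height := Real.rpow_pos_of_pos (Height.mulHeight_pos _) _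

theorem height_pow : F.height ^ Module.finrank ℚ K = Height.mulHeight F.coeffs := by
  rw [height, one_div, Real.rpow_inv_natCast_pow (Height.mulHeight_pos _).le
    Module.finrank_pos.ne']

/-- The `n`-th power of the radius of the region containing the lattice points of height at most
`X` in an ideal of norm `N` with distortion `t`. -/
def bound (X N t : ℝ) : ℝ :=
  X ^ ((Module.finrank ℚ K : ℝ) / d) * t ^ (1 / (d : ℝ)) * N /
    F.height ^ ((Module.finrank ℚ K : ℝ) / d)

theorem bound_pos {X N t : ℝ} (hX : 0 < X) (hN : 0 < N) (ht : 0 < t) : 0 < F.bound X N t := by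
  have := F.height_pos
  unfold bound
  positivity

theorem bound_pow (hd : 1 ≤ d) {X N t : ℝ} (hX : 0 ≤ X) (ht : 0 ≤ t) :
    F.bound X N t ^ d * Height.mulHeight F.coeffs = X ^ Module.finrank ℚ K * t * N ^ d := by
  have hd0 : (d : ℝ) ≠ 0 := by positivity
  have h1 {x : ℝ} (hx : 0 ≤ x) :
      (x ^ ((Module.finrank ℚ K : ℝ) / d)) ^ d = x ^ Module.finrank ℚ K := by
    rw [← Real.rpow_mul_natCast hx, div_mul_cancel₀ _ hd0, Real.rpow_natCast]
  have h2 : (t ^ (1 / (d : ℝ))) ^ d = t := by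
    rw [one_div, Real.rpow_inv_natCast_pow ht (by omega)]
  have hH : Height.mulHeight F.coeffs ≠ 0 := Height.mulHeight_ne_zero _
  rw [bound, div_pow, mul_pow, mul_pow, h1 hX, h1 F.height_pos.le, h2, F.height_pow,
    div_mul_cancel₀ _ hH]

theorem absHeight_map_mk {z : Fin (m + 1) → 𝓞 K} (hz : z ≠ 0) :
    absHeight (F.map (Projectivization.mk K (fieldVec z) (fieldVec_ne_zero hz))) =
      Height.mulHeight (F.eval fun i => (z i : K)) ^ (1 / (Module.finrank ℚ K : ℝ)) := by
  rw [absHeight, map, Projectivization.lift_mk]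
  rfl

theorem mulHeight_eval_size (hd : 1 ≤ d) (R : F.ResidueData) {z : Fin (m + 1) → 𝓞 K}
    (hz : z ≠ 0) :
    Height.mulHeight (F.eval fun i => (z i : K)) * (R.total z *
      (Ideal.absNorm (Ideal.span (Set.range z)) : ℝ) ^ d) =
        Height.mulHeight F.coeffs * (F.gauge hd).size z ^ d := by
  rw [F.mulHeight_eval hd R hz, Gauge.size]
  congr 2
  refine Finset.prod_congr rfl fun w _ => ?_
  rw [Gauge.vec, vecAt_mixedVec]

theorem absHeight_le_iff (hd : 1 ≤ d) (R : F.ResidueData) {z : Fin (m + 1) → 𝓞 K} (hz : z ≠ 0)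
    {X : ℝ} (hX : 0 < X) :
    absHeight (F.map (Projectivization.mk K (fieldVec z) (fieldVec_ne_zero hz))) ≤ X ↔
      (F.gauge hd).size z ≤
        F.bound X (Ideal.absNorm (Ideal.span (Set.range z))) (R.total z) := by
  have ht : 0 < R.total z := zero_lt_one.trans_le (ResidueData.one_le_total hz)
  have hN : 0 < (Ideal.absNorm (Ideal.span (Set.range z)) : ℝ) := by
    have : Ideal.absNorm (Ideal.span (Set.range z)) ≠ 0 :=
      fun h => span_range_ne_bot hz (Ideal.absNorm_eq_zero_iff.1 h)
    positivity
  have hH : 0 < Height.mulHeight F.coeffs := Height.mulHeight_pos _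
  have hn : 0 < (Module.finrank ℚ K : ℝ) := by exact_mod_cast Module.finrank_pos
  rw [F.absHeight_map_mk hz, one_div, Real.rpow_inv_le_iff_of_pos (Height.mulHeight_pos _).le hX.le
    hn, Real.rpow_natCast, ← pow_le_pow_iff_left₀ ((F.gauge hd).size_nonneg z)
    (F.bound_pos hX hN ht).le (by omega : d ≠ 0),
    ← mul_le_mul_iff_right₀ (b := (F.gauge hd).size z ^ d) hH,
    ← F.mulHeight_eval_size hd R hz, mul_comm (Height.mulHeight F.coeffs), F.bound_pow hd hX.le ht.le,
    mul_assoc, mul_le_mul_iff_left₀ (by positivity)]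

/-- Since heights are at least `1`, the height formula bounds the cofactor of the fixed ideal in the
ideal generated by `z`. This truncates the Möbius sum. -/
theorem norm_le_of_size_le (hd : 1 ≤ d) (R : F.ResidueData) {z : Fin (m + 1) → 𝓞 K} (hz : z ≠ 0)
    {X : ℝ} (hX : 0 < X) {N N' : ℝ} (hN : 0 < N) (hN' : 0 ≤ N')
    (hspan : (Ideal.absNorm (Ideal.span (Set.range z)) : ℝ) = N * N')
    (h : (F.gauge hd).size z ≤ F.bound X N (R.total z)) :
    N' ≤ X ^ ((Module.finrank ℚ K : ℝ) / d) := by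
  have hd0 : (d : ℝ) ≠ 0 := by positivity
  have ht : 0 < R.total z := zero_lt_one.trans_le (ResidueData.one_le_total hz)
  have h1 := F.mulHeight_eval_size hd R hz
  have h2 := pow_le_pow_left₀ ((F.gauge hd).size_nonneg z) h d
  have h3 := F.bound_pow hd (N := N) hX.le ht.le
  have hH : 0 < Height.mulHeight F.coeffs := Height.mulHeight_pos _
  have hH1 := Height.one_le_mulHeight (F.eval fun i => (z i : K))
  rw [hspan, mul_pow] at h1
  have h4 : R.total z * N ^ d * N' ^ d ≤ R.total z * N ^ d * X ^ Module.finrank ℚ K := by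
    calc R.total z * N ^ d * N' ^ d ≤
        Height.mulHeight (F.eval fun i => (z i : K)) * (R.total z * (N ^ d * N' ^ d)) := by
          rw [mul_assoc]
          exact le_mul_of_one_le_left (by positivity) hH1
      _ = Height.mulHeight F.coeffs * (F.gauge hd).size z ^ d := h1
      _ ≤ Height.mulHeight F.coeffs * F.bound X N (R.total z) ^ d :=
          mul_le_mul_of_nonneg_left h2 hH.le
      _ = _ := by rw [mul_comm, h3]; ring
  have h5 := le_of_mul_le_mul_left h4 (by positivity)
  refine (pow_le_pow_iff_left₀ hN' (by positivity) (by omega : d ≠ 0)).1 (h5.trans_eq ?_)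
  rw [← Real.rpow_mul_natCast hX.le, div_mul_cancel₀ _ hd0, Real.rpow_natCast]

/-- Lattice points in an ideal, congruent to a given tuple, in a region of the gauge cone. -/
def latticePoints (g : Gauge K (Fin (m + 1))) (q I : Ideal (𝓞 K)) (y : Fin (m + 1) → 𝓞 K) (r : ℝ) :
    Set (Fin (m + 1) → 𝓞 K) :=
  {z | (∀ i, z i ∈ I) ∧ (∀ i, z i - y i ∈ q) ∧ g.InCone z ∧ g.size z ≤ r}

omit F in
theorem mem_ideal_iff_dvd_span {I : Ideal (𝓞 K)} {z : Fin (m + 1) → 𝓞 K} :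
    (∀ i, z i ∈ I) ↔ I ∣ Ideal.span (Set.range z) := by
  rw [Ideal.dvd_iff_le, Ideal.span_le]
  exact ⟨fun h => by rintro _ ⟨i, rfl⟩; exact h i, fun h i => h ⟨i, rfl⟩⟩

-- The Möbius identity `∑_{s ∣ b} μ(s) = [b = 1]`, over any finite family containing the squarefree
-- divisors of `b`.
omit F in
theorem sum_sign_dvd (b : (Ideal (𝓞 K))⁰) {𝒜 : Finset (Finset (HeightOneSpectrum (𝓞 K)))}
    (h𝒜 : ∀ A, setProd A ∣ b.1 → A ∈ 𝒜) :
    open scoped Classical in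
    (∑ A ∈ 𝒜, (-1 : ℝ) ^ A.card * if setProd A ∣ b.1 then 1 else 0) = if b = 1 then 1 else 0 := by
  classical
  have h1 : 𝒜.filter (fun A => setProd A ∣ b.1) = (primeFactors b).powerset := by
    ext A
    rw [Finset.mem_filter, Finset.mem_powerset]
    constructor
    · intro h p hp
      exact (mem_primeFactors b p).2 ((setProd_dvd_iff A _).1 h.2 p hp)
    · intro h
      have h2 : setProd A ∣ b.1 :=
        (setProd_dvd_iff A _).2 fun p hp => (mem_primeFactors b p).1 (h hp)
      exact ⟨h𝒜 A h2, h2⟩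
  simp_rw [mul_ite, mul_one, mul_zero]
  rw [← Finset.sum_filter, h1]
  have h3 := Finset.sum_powerset_neg_one_pow_card (x := primeFactors b)
  have h4 : (∑ A ∈ (primeFactors b).powerset, (-1 : ℝ) ^ A.card) =
      ((if primeFactors b = ∅ then 1 else 0 : ℤ) : ℝ) := by
    rw [← h3]; push_cast; rfl
  rw [h4]
  simp only [primeFactors_eq_empty_iff]
  split_ifs <;> simp

/-- Every `z` counted in `a` generates `a b` for some `b`, and the Möbius sum over divisors of `b`
detects `b = 1`. The divisors that occur are prime to the bad primes because `z` is primitive there,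
and of bounded norm by `norm_le_of_size_le`. -/
theorem ncard_span_eq (hd : 1 ≤ d) (R : F.ResidueData) (a : (Ideal (𝓞 K))⁰)
    {y : Fin (m + 1) → 𝓞 K} (hy : R.IsPrimitive y) {X : ℝ} (hX : 0 < X)
    (hfin : (latticePoints (F.gauge hd) R.modulus a.1 y
      (F.bound X (Ideal.absNorm a.1) (R.total y))).Finite)
    {𝒜 : Finset (Finset (HeightOneSpectrum (𝓞 K)))}
    (h𝒜 : ∀ A, Disjoint A R.bad → setNorm A ≤ X ^ ((Module.finrank ℚ K : ℝ) / d) → A ∈ 𝒜) :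
    ({z | Ideal.span (Set.range z) = a.1 ∧ (∀ i, z i - y i ∈ R.modulus) ∧ (F.gauge hd).InCone z ∧
      (F.gauge hd).size z ≤ F.bound X (Ideal.absNorm a.1) (R.total y)}.ncard : ℝ) =
      ∑ A ∈ 𝒜, (-1 : ℝ) ^ A.card * ((latticePoints (F.gauge hd) R.modulus (a.1 * setProd A) y
        (F.bound X (Ideal.absNorm a.1) (R.total y))).ncard : ℝ) := by
  classical
  set g := F.gauge hd
  set r := F.bound X (Ideal.absNorm a.1) (R.total y) with hr
  set G := hfin.toFinset with hG
  have hGmem (z) : z ∈ G ↔ z ∈ latticePoints g R.modulus a.1 y r := Set.Finite.mem_toFinset hfin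
  have ha0 : a.1 ≠ 0 := nonZeroDivisors.coe_ne_zero a
  have h1 (P : Set (Fin (m + 1) → 𝓞 K)) (hP : P ⊆ latticePoints g R.modulus a.1 y r) :
      (P.ncard : ℝ) = ∑ z ∈ G, if z ∈ P then 1 else 0 := by
    rw [Finset.sum_boole, ← Set.ncard_coe_finset]
    congr 2
    ext z
    rw [Finset.mem_coe, Finset.mem_filter, hGmem]
    exact ⟨fun h => ⟨hP h, h⟩, fun h => h.2⟩
  have hmemA (A) : latticePoints g R.modulus (a.1 * setProd A) y r ⊆
      latticePoints g R.modulus a.1 y r :=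
    fun z hz => ⟨fun i => Ideal.mul_le_left (hz.1 i), hz.2⟩
  have hsub : {z | Ideal.span (Set.range z) = a.1 ∧ (∀ i, z i - y i ∈ R.modulus) ∧
      g.InCone z ∧ g.size z ≤ r} ⊆ latticePoints g R.modulus a.1 y r := by
    rintro z ⟨hz1, hz2⟩
    exact ⟨fun i => hz1 ▸ Ideal.subset_span ⟨i, rfl⟩, hz2⟩
  rw [h1 _ hsub]
  simp_rw [fun A => h1 _ (hmemA A), Finset.mul_sum]
  rw [Finset.sum_comm]
  refine Finset.sum_congr rfl fun z hz => ?_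
  rw [hGmem] at hz
  obtain ⟨hza, hzy, hzc, hzr⟩ := hz
  have hz0 : z ≠ 0 := hzc.ne_zero
  obtain ⟨b, hb⟩ := mem_ideal_iff_dvd_span.1 hza
  have hb0 : b ≠ 0 := by
    rintro rfl
    rw [mul_zero] at hb
    exact span_range_ne_bot hz0 hb
  have hzp : R.IsPrimitive z := (ResidueData.isPrimitive_congr hzy).2 hy
  have htot : R.total z = R.total y := ResidueData.total_congr hzy hzp
  have hmem (A : Finset (HeightOneSpectrum (𝓞 K))) :
      z ∈ latticePoints g R.modulus (a.1 * setProd A) y r ↔ setProd A ∣ b := by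
    have : z ∈ latticePoints g R.modulus (a.1 * setProd A) y r ↔ ∀ i, z i ∈ a.1 * setProd A :=
      ⟨fun h => h.1, fun h => ⟨h, hzy, hzc, hzr⟩⟩
    rw [this, mem_ideal_iff_dvd_span, hb, mul_dvd_mul_iff_left ha0]
  have hspan : z ∈ {z | Ideal.span (Set.range z) = a.1 ∧ (∀ i, z i - y i ∈ R.modulus) ∧
      g.InCone z ∧ g.size z ≤ r} ↔ (⟨b, mem_nonZeroDivisors_of_ne_zero hb0⟩ : (Ideal (𝓞 K))⁰) = 1 := by
    have : z ∈ {z | Ideal.span (Set.range z) = a.1 ∧ (∀ i, z i - y i ∈ R.modulus) ∧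
      g.InCone z ∧ g.size z ≤ r} ↔ Ideal.span (Set.range z) = a.1 :=
      ⟨fun h => h.1, fun h => ⟨h, hzy, hzc, hzr⟩⟩
    rw [this, hb, mul_eq_left₀ ha0, Subtype.ext_iff]
    rfl
  simp_rw [hmem, hspan]
  refine (sum_sign_dvd ⟨b, mem_nonZeroDivisors_of_ne_zero hb0⟩ fun A hA => ?_).symm
  have hNa : 0 < (Ideal.absNorm a.1 : ℝ) := by
    have : Ideal.absNorm a.1 ≠ 0 := fun h => ha0 (Ideal.absNorm_eq_zero_iff.1 h)
    positivity
  refine h𝒜 A ?_ ?_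
  · refine Finset.disjoint_left.2 fun v hvA hv => ?_
    obtain ⟨i, hi⟩ := hzp v hv
    refine hi ?_
    have h2 : v.asIdeal ∣ Ideal.span (Set.range z) := by
      rw [hb]
      exact (((mem_iff_dvd_setProd A v).1 hvA).trans hA).mul_left _
    exact mem_ideal_iff_dvd_span.2 h2 i
  · have h3 : (setNorm A : ℝ) ≤ Ideal.absNorm b := by
      rw [← absNorm_setProd]
      have : Ideal.absNorm (setProd A) ≤ Ideal.absNorm b :=
        Nat.le_of_dvd (Nat.pos_of_ne_zero fun h => hb0 (Ideal.absNorm_eq_zero_iff.1 h))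
          (map_dvd Ideal.absNorm hA)
      exact_mod_cast this
    refine h3.trans (F.norm_le_of_size_le hd R hz0 hX hNa (Nat.cast_nonneg _) ?_ (htot ▸ hzr))
    rw [hb, map_mul, Nat.cast_mul]

end MorphismLift

end SchanuelMorphism

namespace SchanuelMorphism

set_option linter.unusedSectionVars false

/-! ### The point count as a sum over classes, residues and squarefree ideals. -/

section Count

open NumberField.mixedEmbedding NumberField.mixedEmbedding.fundamentalCone
open scoped nonZeroDivisors Pointwise Classical

variable {K : Type*} [Field K] [NumberField K] {m M d : ℕ}

theorem absNorm_pos_real (I : (Ideal (𝓞 K))⁰) : 0 < (Ideal.absNorm I.1 : ℝ) := by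
  have : Ideal.absNorm I.1 ≠ 0 := fun h =>
    nonZeroDivisors.coe_ne_zero I (Ideal.absNorm_eq_zero_iff.1 h)
  positivity

/-- Lattice points congruent to a given tuple form a translate of a lattice. -/
theorem exists_latticePoints_eq (g : Gauge K (Fin (m + 1))) {q I : Ideal (𝓞 K)} (hqI : I ⊔ q = ⊤)
    (y : Fin (m + 1) → 𝓞 K) : ∃ x₀ : Fin (m + 1) → 𝓞 K, ∀ T : ℝ, 0 < T →
      MorphismLift.latticePoints g q I y (T ^ Module.finrank ℚ K) =
        {z | (∀ i, z i - x₀ i ∈ I * q) ∧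
          g.vec (fun i => mixedEmbedding K (z i)) ∈ T • (expMapBasis '' paramSet K)} := by
  -- As `I` and `q` are coprime, the two conditions are solved simultaneously and amount to a
  -- congruence modulo `I * q`.
  have h1 (i) : ∃ x, x ∈ I ∧ x - y i ∈ q := by
    obtain ⟨s, hs, t, ht, hst⟩ := Submodule.mem_sup.1 (hqI ▸ Submodule.mem_top : y i ∈ I ⊔ q)
    exact ⟨s, hs, by rw [← hst, sub_add_cancel_left]; exact neg_mem ht⟩
  choose x₀ hx1 hx2 using h1
  refine ⟨x₀, fun T hT => ?_⟩
  ext z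
  rw [Set.mem_ofPred_eq, g.vec_mem_smul_iff z hT]
  have h2 : (∀ i, z i - x₀ i ∈ I * q) ↔ (∀ i, z i ∈ I) ∧ ∀ i, z i - y i ∈ q := by
    rw [← forall_and]
    refine forall_congr' fun i => ?_
    rw [Ideal.mul_eq_inf_of_isCoprime (Ideal.isCoprime_iff_sup_eq.2 hqI), Submodule.mem_inf]
    refine and_congr ?_ ?_
    · exact ⟨fun h => by simpa using add_mem h (hx1 i), fun h => sub_mem h (hx1 i)⟩
    · have e : z i - y i = (z i - x₀ i) + (x₀ i - y i) := by ring
      rw [e]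
      exact ⟨fun h => add_mem h (hx2 i), fun h => by simpa using sub_mem h (hx2 i)⟩
  rw [h2, and_assoc]
  rfl

variable (K m) in
theorem exists_count_latticePoints : ∃ A : ℝ, 0 < A ∧
    ∀ (g : Gauge K (Fin (m + 1))) (N : ℕ) (B C : ℝ),
    0 < N → 0 ≤ B → 0 ≤ C → g.HasLipschitzSpheres N B → g.IsBoundedBy C →
    ∀ (I q : (Ideal (𝓞 K))⁰) (y : Fin (m + 1) → 𝓞 K) (r : ℝ), I.1 ⊔ q.1 = ⊤ → 0 < r →
      (MorphismLift.latticePoints g q.1 I.1 y r).Finite ∧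
      |((MorphismLift.latticePoints g q.1 I.1 y r).ncard : ℝ) -
          r ^ (m + 1) * g.coneVol / (Ideal.absNorm I.1 * Ideal.absNorm q.1 * covol K) ^ (m + 1)| ≤
        A * (N : ℝ) ^ Module.finrank ℚ K * (1 + (B + if Units.rank K = 0 then 0 else C) *
          (r / (Ideal.absNorm I.1 * Ideal.absNorm q.1)) ^ (Module.finrank ℚ K : ℝ)⁻¹) ^
            (Module.finrank ℚ K * (m + 1) - 1) := by
  obtain ⟨A, hA, h⟩ := exists_count_cone K (Fin (m + 1))
  refine ⟨A, hA, fun g N B C hN hB hC hgL hgC I q y r hIq hr => ?_⟩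
  have hn : Module.finrank ℚ K ≠ 0 := Module.finrank_pos.ne'
  set T : ℝ := r ^ (Module.finrank ℚ K : ℝ)⁻¹ with hTdef
  have hT : 0 < T := Real.rpow_pos_of_pos hr _
  have hTn : T ^ Module.finrank ℚ K = r := Real.rpow_inv_natCast_pow hr.le hn
  obtain ⟨x₀, hx₀⟩ := exists_latticePoints_eq g hIq y
  have h1 := h g N B C hN hB hC hgL hgC (I * q) x₀ T hT
  have h2 := hx₀ T hT
  rw [hTn] at h2
  have h3 : (Ideal.absNorm (I * q : (Ideal (𝓞 K))⁰).1 : ℝ) =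
      Ideal.absNorm I.1 * Ideal.absNorm q.1 := by
    rw [Submonoid.coe_mul, map_mul, Nat.cast_mul]
  rw [h3, Fintype.card_fin, pow_mul, hTn] at h1
  have h4 : T * (Ideal.absNorm I.1 * Ideal.absNorm q.1 : ℝ) ^ (-(Module.finrank ℚ K : ℝ)⁻¹) =
      (r / (Ideal.absNorm I.1 * Ideal.absNorm q.1)) ^ (Module.finrank ℚ K : ℝ)⁻¹ := by
    have hp : 0 < (Ideal.absNorm I.1 * Ideal.absNorm q.1 : ℝ) :=
      mul_pos (absNorm_pos_real I) (absNorm_pos_real q)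
    rw [Real.rpow_neg hp.le, Real.div_rpow hr.le hp.le, div_eq_mul_inv]
  rw [mul_assoc _ T, h4] at h1
  rw [h2]
  exact h1

namespace MorphismLift

variable (F : MorphismLift K m M d)

/-- The sum over residues and squarefree ideals which counts points. -/
theorem points_count (hd : 1 ≤ d) (R : F.ResidueData)
    [Fintype (Fin (m + 1) → 𝓞 K ⧸ R.modulus)] {a : ClassGroup (𝓞 K) → (Ideal (𝓞 K))⁰}
    (ha : ∀ c, ClassGroup.mk0 (a c) = c) (haq : ∀ c, (a c).1 ⊔ R.modulus = ⊤) {X : ℝ} (hX : 0 < X)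
    (hfin : ∀ c y, R.IsPrimitive y → (latticePoints (F.gauge hd) R.modulus (a c).1 y
      (F.bound X (Ideal.absNorm (a c).1) (R.total y))).Finite)
    {𝒜 : Finset (Finset (HeightOneSpectrum (𝓞 K)))}
    (h𝒜 : ∀ A, Disjoint A R.bad → setNorm A ≤ X ^ ((Module.finrank ℚ K : ℝ) / d) → A ∈ 𝒜) :
    (F.points X).Finite ∧ (Units.torsionOrder K : ℝ) * (F.points X).ncard =
      ∑ c : ClassGroup (𝓞 K), ∑ y : Fin (m + 1) → 𝓞 K ⧸ R.modulus,
        if R.IsPrimitive (residueLift m _ y) then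
          ∑ A ∈ 𝒜, (-1 : ℝ) ^ A.card *
            ((latticePoints (F.gauge hd) R.modulus ((a c).1 * setProd A) (residueLift m _ y)
              (F.bound X (Ideal.absNorm (a c).1) (R.total (residueLift m _ y)))).ncard : ℝ)
        else 0 := by
  set g := F.gauge hd
  set Z := repSet g a (F.points X) with hZ
  obtain ⟨e⟩ := card_repSet g a ha (F.points X)
  have hZmem (z : Fin (m + 1) → 𝓞 K) (c) (hc : Ideal.span (Set.range z) = (a c).1)
      (hz : g.InCone z) : z ∈ Z ↔ g.size z ≤ F.bound X (Ideal.absNorm (a c).1) (R.total z) := by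
    have hz0 := hz.ne_zero
    rw [← hc, ← F.absHeight_le_iff hd R hz0 hX]
    exact ⟨fun h => h.2.2.2, fun h => ⟨hz, ⟨c, hc⟩, hz0, h⟩⟩
  -- This is why the class representatives are chosen prime to the modulus.
  have hprim (z : Fin (m + 1) → 𝓞 K) (c) (hc : Ideal.span (Set.range z) = (a c).1) :
      R.IsPrimitive z := by
    intro v hv
    by_contra hcon
    push Not at hcon
    have h1 : (a c).1 ≤ v.asIdeal := by
      rw [← hc, Ideal.span_le]
      rintro _ ⟨i, rfl⟩
      exact hcon i
    have h2 := sup_le h1 (R.modulus_le hv)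
    rw [haq, top_le_iff] at h2
    exact v.isPrime.ne_top h2
  have hfib (z : Fin (m + 1) → 𝓞 K) (c) (y : Fin (m + 1) → 𝓞 K ⧸ R.modulus)
      (hc : Ideal.span (Set.range z) = (a c).1) (hz : g.InCone z)
      (hy : ∀ i, z i - residueLift m _ y i ∈ R.modulus) :
      z ∈ Z ↔ g.size z ≤ F.bound X (Ideal.absNorm (a c).1) (R.total (residueLift m _ y)) := by
    rw [hZmem z c hc hz, ResidueData.total_congr hy (hprim z c hc)]
  have hres (z : Fin (m + 1) → 𝓞 K) (i) : z i -
      residueLift m R.modulus (fun i => Ideal.Quotient.mk R.modulus (z i)) i ∈ R.modulus := by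
    rw [← Ideal.Quotient.eq, mk_residueLift]
  have hZfin : Z.Finite := by
    have h1 (p : ClassGroup (𝓞 K) × (Fin (m + 1) → 𝓞 K ⧸ R.modulus)) :
        {z | R.IsPrimitive (residueLift m _ p.2) ∧ z ∈ latticePoints g R.modulus (a p.1).1
          (residueLift m _ p.2) (F.bound X (Ideal.absNorm (a p.1).1)
            (R.total (residueLift m _ p.2)))}.Finite := by
      by_cases hp : R.IsPrimitive (residueLift m _ p.2)
      · exact (hfin p.1 _ hp).subset fun z hz => hz.2
      · exact Set.finite_empty.subset fun z hz => hp hz.1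
    refine (Set.finite_iUnion h1).subset fun z hz => ?_
    obtain ⟨hz1, ⟨c, hc⟩, -⟩ := id hz
    refine Set.mem_iUnion.2 ⟨(c, fun i => Ideal.Quotient.mk _ (z i)),
      (ResidueData.isPrimitive_congr (hres z)).1 (hprim z c hc), fun i => ?_, hres z, hz1,
      (hfib z c _ hc hz1 (hres z)).1 hz⟩
    exact hc ▸ Ideal.subset_span ⟨i, rfl⟩
  have hfinite : (F.points X).Finite := by
    have : Finite Z := hZfin
    have h1 : Finite (F.points X × Units.torsion K) := Finite.of_equiv _ e.symm
    have h2 : Finite (F.points X) := Finite.of_injective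
      (fun P => (P, (1 : Units.torsion K))) fun P P' h => congrArg Prod.fst h
    exact Set.toFinite _
  refine ⟨hfinite, ?_⟩
  have hcard : (Units.torsionOrder K : ℝ) * (F.points X).ncard = Z.ncard := by
    have h1 := Nat.card_congr e
    rw [Nat.card_prod, Nat.card_coe_set_eq, Nat.card_coe_set_eq] at h1
    rw [← h1, Nat.cast_mul, mul_comm]
    congr 2
  -- The default class `1` is never used on `Z`, where the span is always one of the chosen ideals.
  let lab (z : Fin (m + 1) → 𝓞 K) : ClassGroup (𝓞 K) × (Fin (m + 1) → 𝓞 K ⧸ R.modulus) :=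
    (if h : ∃ c, Ideal.span (Set.range z) = (a c).1 then h.choose else 1,
      fun i => Ideal.Quotient.mk _ (z i))
  have hainj (c c') (h : (a c).1 = (a c').1) : c = c' := by
    rw [← ha c, ← ha c', Subtype.ext h]
  have hlab (z : Fin (m + 1) → 𝓞 K) (c) (hc : Ideal.span (Set.range z) = (a c).1) :
      (lab z).1 = c := by
    have h : ∃ c, Ideal.span (Set.range z) = (a c).1 := ⟨c, hc⟩
    simp only [lab, dif_pos h]
    exact hainj _ _ (h.choose_spec.symm.trans hc)
  rw [hcard, ncard_eq_sum_fiber hZfin lab, Nat.cast_sum, Fintype.sum_prod_type]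
  refine Finset.sum_congr rfl fun c _ => Finset.sum_congr rfl fun y _ => ?_
  have hres' (z : Fin (m + 1) → 𝓞 K) :
      (∀ i, z i - residueLift m _ y i ∈ R.modulus) ↔ (fun i => Ideal.Quotient.mk _ (z i)) = y := by
    rw [funext_iff]
    refine forall_congr' fun i => ?_
    rw [← Ideal.Quotient.eq, mk_residueLift]
  split_ifs with hp
  · rw [← F.ncard_span_eq hd R (a c) hp hX (hfin c _ hp) h𝒜]
    congr 2
    ext z
    rw [Set.mem_ofPred_eq, Set.mem_ofPred_eq]
    constructor
    · rintro ⟨hz, hl⟩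
      obtain ⟨hz1, ⟨c', hc'⟩, -⟩ := id hz
      have h1 : c' = c := by rw [← hlab z c' hc', hl]
      subst h1
      have h2 := (hres' z).2 (congrArg Prod.snd hl)
      exact ⟨hc', h2, hz1, (hfib z c' y hc' hz1 h2).1 hz⟩
    · rintro ⟨h1, h2, h3, h4⟩
      exact ⟨(hfib z c y h1 h3 h2).2 h4, Prod.ext (hlab z c h1) ((hres' z).1 h2)⟩
  · rw [Nat.cast_eq_zero, Set.ncard_eq_zero (hZfin.subset fun z hz => hz.1)]
    refine Set.eq_empty_of_forall_notMem fun z hz => hp ?_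
    obtain ⟨hz, hl⟩ := hz
    obtain ⟨hz1, ⟨c', hc'⟩, -⟩ := id hz
    exact (ResidueData.isPrimitive_congr ((hres' z).2 (congrArg Prod.snd hl))).1 (hprim z c' hc')

end MorphismLift

end Count

end SchanuelMorphism

namespace SchanuelMorphism

set_option linter.unusedSectionVars false

/-! ### Summation of the main and error terms -/

section Summation

open scoped nonZeroDivisors Classical

variable (K : Type*) [Field K] [NumberField K]

theorem one_le_dedekindZeta {s : ℕ} (hs : 2 ≤ s) : 1 ≤ (dedekindZeta K s).re := by
  have h := hasSum_dedekindZeta K hs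
  have := le_hasSum h 1 fun I _ => by positivity
  simpa using this

/-- Squarefree ideals prime to a finite set of primes, of bounded norm. -/
theorem exists_sqfreeSet (S : Finset (HeightOneSpectrum (𝓞 K))) (Y : ℝ) :
    ∃ 𝒜 : Finset (Finset (HeightOneSpectrum (𝓞 K))),
      ∀ A, A ∈ 𝒜 ↔ Disjoint A S ∧ setNorm A ≤ Y := by
  obtain ⟨A, -, h⟩ := exists_linearGrowth_setNorm K
  exact ⟨(h.finite_le Y).toFinset.filter fun A => Disjoint A S, fun A => by
    rw [Finset.mem_filter, Set.Finite.mem_toFinset, and_comm]; rfl⟩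

/-- All three bounds follow from linear growth, uniformly in `S`. The exponent `m + 1 - 1/n` exceeds
`1` exactly when `n m > 1`; otherwise `n = m = 1` and the harmonic sum produces a logarithm. -/
theorem exists_sqfree_bounds {m : ℕ} (hm : 1 ≤ m) {n : ℕ} (hn : 1 ≤ n) : ∃ A₁ : ℝ, 0 < A₁ ∧
    ∀ (S : Finset (HeightOneSpectrum (𝓞 K))) (Y : ℝ), 1 ≤ Y →
    ∀ 𝒜 : Finset (Finset (HeightOneSpectrum (𝓞 K))),
      (∀ A, A ∈ 𝒜 ↔ Disjoint A S ∧ setNorm A ≤ Y) →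
      (𝒜.card : ℝ) ≤ A₁ * Y ∧
      ∑ A ∈ 𝒜, setNorm A ^ (-((m + 1 : ℝ) - (n : ℝ)⁻¹)) ≤
        A₁ * (1 + if 1 < n * m then 0 else Real.log Y) ∧
      |∑ A ∈ 𝒜, (-1 : ℝ) ^ A.card * (setNorm A ^ (m + 1))⁻¹ -
        ∑' A : Finset (HeightOneSpectrum (𝓞 K)),
          if Disjoint A S then (-1) ^ A.card * (setNorm A ^ (m + 1))⁻¹ else 0| ≤
        A₁ * (Y ^ m)⁻¹ := by
  obtain ⟨A, hA, h⟩ := exists_linearGrowth_setNorm K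
  set e : ℝ := (m + 1 : ℝ) - (n : ℝ)⁻¹ with he
  -- The absolute values keep the final constant positive in all cases; when `e = 1` the denominator
  -- is zero and `T₁` is not used.
  set T₁ := |2 * A / (1 - (2 : ℝ) ^ (1 - e))|
  set T₂ := |2 * A / (1 - (2 : ℝ) ^ (1 - (m + 1 : ℕ) : ℝ))|
  refine ⟨1 + A + T₁ + 4 * A + T₂, by positivity, fun S Y hY 𝒜 h𝒜 => ⟨?_, ?_, ?_⟩⟩
  · refine (h.card_le Y hY 𝒜 fun B hB => ((h𝒜 B).1 hB).2).trans ?_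
    have hT₁ : 0 ≤ T₁ := abs_nonneg _
    have hT₂ : 0 ≤ T₂ := abs_nonneg _
    exact mul_le_mul_of_nonneg_right (by linarith) (by linarith)
  · have hT₁ : 0 ≤ T₁ := abs_nonneg _
    have hT₂ : 0 ≤ T₂ := abs_nonneg _
    have hn0 : (0 : ℝ) < n := by positivity
    split_ifs with hnm
    · have he1 : 1 < e := by
        have : (1 : ℝ) < n * m := by exact_mod_cast hnm
        have h2 : (n : ℝ)⁻¹ < m := by
          rw [inv_lt_iff_one_lt_mul₀ hn0, mul_comm]; linarith
        linarith
      have h3 := h.sum_tail_le hA he1 (Y := 1) le_rfl 𝒜 fun B _ => setNorm_ge_one B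
      rw [Real.one_rpow, mul_one] at h3
      refine h3.trans ((le_abs_self _).trans ?_)
      change T₁ ≤ _
      linarith
    · have hn1 : n = 1 ∧ m = 1 := by
        have h1 : n * m ≤ 1 := not_lt.1 hnm
        exact ⟨le_antisymm (by nlinarith) hn, le_antisymm (by nlinarith) hm⟩
      have he1 : e = 1 := by rw [he, hn1.1, hn1.2]; norm_num
      have h3 := h.sum_inv_le hA hY 𝒜 fun B hB => ((h𝒜 B).1 hB).2
      rw [he1]
      simp_rw [Real.rpow_neg_one]
      refine h3.trans (mul_le_mul_of_nonneg_right ?_ (by linarith [Real.log_nonneg hY]))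
      linarith
  · set f : Finset (HeightOneSpectrum (𝓞 K)) → ℝ := fun A =>
      if Disjoint A S then (-1) ^ A.card * (setNorm A ^ (m + 1))⁻¹ else 0 with hf
    have hfb (B) : |f B| ≤ (setNorm B ^ (m + 1))⁻¹ := by
      have := setNorm_pos B
      rw [hf]
      beta_reduce
      split_ifs
      · rw [abs_mul, abs_pow, abs_neg, abs_one, one_pow, one_mul, abs_of_pos (by positivity)]
      · rw [abs_zero]; positivity
    have hs := summable_setNorm K (s := m + 1) (by omega)
    have hfs : Summable f := Summable.of_norm_bounded hs fun B => by
      rw [Real.norm_eq_abs]; exact hfb B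
    have h1 : ∑ B ∈ 𝒜, (-1 : ℝ) ^ B.card * (setNorm B ^ (m + 1))⁻¹ = ∑ B ∈ 𝒜, f B :=
      Finset.sum_congr rfl fun B hB => by
        rw [hf]; beta_reduce; rw [if_pos ((h𝒜 B).1 hB).1]
    rw [h1, ← hfs.sum_add_tsum_compl (s := 𝒜), sub_add_cancel_left, abs_neg]
    have hbound : ∀ t : Finset {B // B ∉ 𝒜}, ∑ B ∈ t, |f B| ≤ T₂ * (Y ^ m)⁻¹ := by
      intro t
      have h2 : ∑ B ∈ t, |f B| = ∑ B ∈ (t.map (Function.Embedding.subtype _)).filter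
          (fun B => Disjoint B S), |f B| := by
        rw [Finset.sum_filter, Finset.sum_map]
        refine Finset.sum_congr rfl fun B _ => ?_
        split_ifs with hB
        · rfl
        · have : f B.1 = 0 := by rw [hf]; exact if_neg hB
          rw [this, abs_zero]
      rw [h2]
      have hσ : (1 : ℝ) < (m + 1 : ℕ) := by exact_mod_cast Nat.lt_succ_of_le hm
      have h3 := h.sum_tail_le hA hσ hY ((t.map (Function.Embedding.subtype _)).filter
          (fun B => Disjoint B S)) fun B hB => by
        obtain ⟨hB1, hB2⟩ := Finset.mem_filter.1 hB
        obtain ⟨B', -, rfl⟩ := Finset.mem_map.1 hB1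
        by_contra hlt
        exact B'.2 ((h𝒜 _).2 ⟨hB2, (not_le.1 hlt).le⟩)
      refine (Finset.sum_le_sum fun B _ => ?_).trans (h3.trans ?_)
      · rw [Real.rpow_neg (setNorm_pos B).le, Real.rpow_natCast]
        exact hfb B
      · have e1 : Y ^ (1 - ((m + 1 : ℕ) : ℝ)) = (Y ^ m)⁻¹ := by
          rw [← Real.rpow_natCast, ← Real.rpow_neg (by linarith)]
          congr 1
          push_cast; ring
        rw [e1]
        exact mul_le_mul_of_nonneg_right (le_abs_self _) (by positivity)
    have hsub : Summable fun B : {B // B ∉ 𝒜} => |f B| := by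
      have := hfs.abs
      exact this.comp_injective Subtype.val_injective
    have h4 : |∑' B : {B // B ∉ 𝒜}, f B| ≤ T₂ * (Y ^ m)⁻¹ := by
      refine le_trans ?_ (hsub.tsum_le_of_sum_le hbound)
      have := norm_tsum_le_tsum_norm (f := fun B : {B // B ∉ 𝒜} => f B)
        (by simpa only [Real.norm_eq_abs] using hsub)
      simpa only [Real.norm_eq_abs] using this
    refine h4.trans (mul_le_mul_of_nonneg_right ?_ (by positivity))
    have hT₁ : 0 ≤ T₁ := abs_nonneg _
    linarith

/-- Separation of the variables in the error term. -/
theorem error_term_le {n k : ℕ} (hn : 1 ≤ n) (hk : 2 ≤ n * k) {E u t N q : ℝ} (hE : 0 ≤ E)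
    (hu : 0 < u) (ht : 0 < t) (hN : 0 < N) (hq : 0 < q) :
    (1 + E * (u * t / (N * q)) ^ (n : ℝ)⁻¹) ^ (n * k - 1) ≤
      2 ^ (n * k) * (1 + (E * u ^ (n : ℝ)⁻¹) ^ (n * k - 1) * (t ^ ((k : ℝ) - (n : ℝ)⁻¹) *
        q ^ (-((k : ℝ) - (n : ℝ)⁻¹))) * N ^ (-((k : ℝ) - (n : ℝ)⁻¹))) := by
  have hn0 : (n : ℝ) ≠ 0 := by positivity
  have hpow {x : ℝ} (hx : 0 < x) :
      (x ^ (n : ℝ)⁻¹) ^ (n * k - 1) = x ^ ((k : ℝ) - (n : ℝ)⁻¹) := by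
    rw [← Real.rpow_mul_natCast hx.le]
    congr 1
    rw [Nat.cast_sub (by omega)]
    push_cast
    field_simp
  have h1 : (E * (u * t / (N * q)) ^ (n : ℝ)⁻¹) ^ (n * k - 1) =
      (E * u ^ (n : ℝ)⁻¹) ^ (n * k - 1) * (t ^ ((k : ℝ) - (n : ℝ)⁻¹) *
        q ^ (-((k : ℝ) - (n : ℝ)⁻¹))) * N ^ (-((k : ℝ) - (n : ℝ)⁻¹)) := by
    rw [mul_pow, mul_pow, hpow (by positivity), hpow hu, Real.div_rpow (by positivity)
      (by positivity), Real.mul_rpow hu.le ht.le, Real.mul_rpow hN.le hq.le, Real.rpow_neg hq.le,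
      Real.rpow_neg hN.le]
    field_simp
  rw [← h1]
  set ρ := E * (u * t / (N * q)) ^ (n : ℝ)⁻¹
  have hρ : 0 ≤ ρ := by positivity
  -- Convexity, `(1 + ρ)^j ≤ 2^(j-1) (1 + ρ^j)`; thereafter the powers of the variables separate.
  have h2 := add_pow_le zero_le_one hρ (n * k - 1)
  rw [one_pow] at h2
  refine h2.trans (mul_le_mul_of_nonneg_right ?_ (by positivity))
  exact pow_le_pow_right₀ one_le_two (by omega)

end Summation

end SchanuelMorphism

namespace SchanuelMorphism

set_option linter.unusedSectionVars false

/-! ### The contribution of one class and one residue tuple. -/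

section Asymptotics

open scoped nonZeroDivisors Classical

namespace MorphismLift

variable {K : Type*} [Field K] [NumberField K] {m M d : ℕ} (F : MorphismLift K m M d)

theorem cZero_nonneg : 0 ≤ F.cZero := finprod_nonneg fun v => F.finFactor_nonneg v

namespace ResidueData

variable {F} (R : F.ResidueData)

theorem one_le_total_of_isPrimitive {y : Fin (m + 1) → 𝓞 K} (hy : R.IsPrimitive y) :
    1 ≤ R.total y := by
  refine (Finset.prod_const_one (s := R.bad)).symm.le.trans
    (Finset.prod_le_prod (fun _ _ => zero_le_one) fun v hv => ?_)
  obtain ⟨i, hi⟩ := hy v hv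
  refine F.one_le_distortion (intVec_ne_zero (v := v) fun h => hi ?_)
  rw [h]
  exact zero_mem _

/-- The Euler factors of the bad primes. -/
def euler : ℝ := ∏ v ∈ R.bad, (1 - ((Ideal.absNorm v.asIdeal : ℝ) ^ (m + 1))⁻¹)

theorem euler_mem : 0 ≤ R.euler ∧ R.euler ≤ 1 := by
  have h (v : HeightOneSpectrum (𝓞 K)) : 0 ≤ 1 - ((Ideal.absNorm v.asIdeal : ℝ) ^ (m + 1))⁻¹ := by
    rw [sub_nonneg]
    exact inv_le_one_of_one_le₀ (one_le_pow₀ (one_lt_primeNorm v).le)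
  refine ⟨Finset.prod_nonneg fun v _ => h v, Finset.prod_le_one (fun v _ => h v) fun v _ => ?_⟩
  rw [sub_le_self_iff]
  positivity

theorem coprime_modulus {A : Finset (HeightOneSpectrum (𝓞 K))} (hA : Disjoint A R.bad) :
    setProd A ⊔ R.modulus = ⊤ := by
  rw [← Ideal.isCoprime_iff_sup_eq]
  refine IsCoprime.prod_left fun v hv => IsCoprime.prod_right fun w hw => ?_
  refine IsCoprime.pow_right ?_
  have hne : v ≠ w := fun h => Finset.disjoint_left.1 hA hv (h ▸ hw)
  have := HeightOneSpectrum.isCoprime_pow_of_ne v w hne 1 1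
  rwa [pow_one, pow_one] at this

end ResidueData

/-- The estimate for a given class and tuple of residues. -/
theorem abs_sum_residue_le (hm : 1 ≤ m) (hd : 1 ≤ d) (R : F.ResidueData) {a : (Ideal (𝓞 K))⁰}
    (haq : a.1 ⊔ R.modulus = ⊤) {X : ℝ} (hX : 0 < X) {A₀ E : ℝ} (hA₀ : 0 ≤ A₀) (hE : 0 ≤ E)
    {y : Fin (m + 1) → 𝓞 K}
    (hcount : ∀ (I : (Ideal (𝓞 K))⁰) (r : ℝ), I.1 ⊔ R.modulus = ⊤ → 0 < r →
      |((latticePoints (F.gauge hd) R.modulus I.1 y r).ncard : ℝ) -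
          r ^ (m + 1) * (F.gauge hd).coneVol /
            (Ideal.absNorm I.1 * Ideal.absNorm R.modulus * covol K) ^ (m + 1)| ≤
        A₀ * (1 + E * (r / (Ideal.absNorm I.1 * Ideal.absNorm R.modulus)) ^
          (Module.finrank ℚ K : ℝ)⁻¹) ^ (Module.finrank ℚ K * (m + 1) - 1))
    {𝒜 : Finset (Finset (HeightOneSpectrum (𝓞 K)))} (h𝒜 : ∀ A ∈ 𝒜, Disjoint A R.bad) :
    |(if R.IsPrimitive y then ∑ A ∈ 𝒜, (-1 : ℝ) ^ A.card *
        ((latticePoints (F.gauge hd) R.modulus (a.1 * setProd A) y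
          (F.bound X (Ideal.absNorm a.1) (R.total y))).ncard : ℝ) else 0) -
      (F.gauge hd).coneVol / (covol K) ^ (m + 1) *
        ((X ^ ((Module.finrank ℚ K : ℝ) / d) / F.height ^ ((Module.finrank ℚ K : ℝ) / d)) /
          Ideal.absNorm R.modulus) ^ (m + 1) * R.weight y *
        ∑ A ∈ 𝒜, (-1 : ℝ) ^ A.card * (setNorm A ^ (m + 1))⁻¹| ≤
      A₀ * 2 ^ (Module.finrank ℚ K * (m + 1)) * (𝒜.card +
        (E * (X ^ ((Module.finrank ℚ K : ℝ) / d) / F.height ^ ((Module.finrank ℚ K : ℝ) / d)) ^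
          (Module.finrank ℚ K : ℝ)⁻¹) ^ (Module.finrank ℚ K * (m + 1) - 1) *
          (R.weight y * (Ideal.absNorm R.modulus : ℝ) ^
            (-((m + 1 : ℝ) - (Module.finrank ℚ K : ℝ)⁻¹))) *
          ∑ A ∈ 𝒜, setNorm A ^ (-((m + 1 : ℝ) - (Module.finrank ℚ K : ℝ)⁻¹))) := by
  set n := Module.finrank ℚ K with hn
  have hn1 : 1 ≤ n := Module.finrank_pos
  set u := X ^ ((n : ℝ) / d) / F.height ^ ((n : ℝ) / d) with hu
  have hH := F.height_pos
  have hu0 : 0 < u := by positivity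
  set q := (Ideal.absNorm R.modulus : ℝ) with hq
  have hq0 : 0 < q := absNorm_pos_real ⟨R.modulus, mem_nonZeroDivisors_of_ne_zero R.modulus_ne_bot⟩
  have hc0 := covol_pos (K := K)
  set e : ℝ := (m + 1 : ℝ) - (n : ℝ)⁻¹ with he
  have he0 : 0 ≤ e := by
    have : (n : ℝ)⁻¹ ≤ 1 := inv_le_one_of_one_le₀ (by exact_mod_cast hn1)
    rw [he]
    have : (0 : ℝ) ≤ m := by positivity
    linarith
  by_cases hp : R.IsPrimitive y
  swap
  · have hw : R.weight y = 0 := by rw [ResidueData.weight]; exact if_neg hp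
    rw [if_neg hp, hw, mul_zero, zero_mul, sub_zero, abs_zero, zero_mul, mul_zero, zero_mul,
      add_zero]
    positivity
  have ht1 := R.one_le_total_of_isPrimitive hp
  set t := R.total y with ht
  have ht0 : 0 < t := by linarith
  have hw : R.weight y = t ^ ((m + 1 : ℝ) / d) := by rw [ResidueData.weight]; exact if_pos hp
  rw [if_pos hp, hw, Finset.mul_sum, ← Finset.sum_sub_distrib]
  have hNa := absNorm_pos_real a
  set r := F.bound X (Ideal.absNorm a.1) t with hr
  have hr0 : 0 < r := F.bound_pos hX hNa ht0
  have hru : r = u * t ^ (1 / (d : ℝ)) * Ideal.absNorm a.1 := by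
    rw [hr, bound, hu]; ring
  have htpow : (t ^ (1 / (d : ℝ))) ^ (m + 1) = t ^ ((m + 1 : ℝ) / d) := by
    rw [← Real.rpow_mul_natCast ht0.le]
    congr 1
    push_cast
    ring
  have hterm (A : Finset (HeightOneSpectrum (𝓞 K))) (hA : A ∈ 𝒜) :
      |(-1 : ℝ) ^ A.card * ((latticePoints (F.gauge hd) R.modulus (a.1 * setProd A) y r).ncard : ℝ) -
        (F.gauge hd).coneVol / (covol K) ^ (m + 1) * (u / q) ^ (m + 1) * t ^ ((m + 1 : ℝ) / d) *
          ((-1 : ℝ) ^ A.card * (setNorm A ^ (m + 1))⁻¹)| ≤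
      A₀ * 2 ^ (n * (m + 1)) * (1 + (E * u ^ (n : ℝ)⁻¹) ^ (n * (m + 1) - 1) *
        (t ^ ((m + 1 : ℝ) / d) * q ^ (-e)) * setNorm A ^ (-e)) := by
    have hNA := setNorm_pos A
    have hcop : a.1 * setProd A ⊔ R.modulus = ⊤ := by
      rw [← Ideal.isCoprime_iff_sup_eq]
      exact IsCoprime.mul_left (Ideal.isCoprime_iff_sup_eq.2 haq)
        (Ideal.isCoprime_iff_sup_eq.2 (R.coprime_modulus (h𝒜 A hA)))
    have h1 := hcount ⟨a.1 * setProd A, mem_nonZeroDivisors_of_ne_zero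
      (mul_ne_zero (nonZeroDivisors.coe_ne_zero a) (setProd_ne_bot A))⟩ r hcop hr0
    simp only [map_mul, Nat.cast_mul, absNorm_setProd] at h1
    have e1 : r / (Ideal.absNorm a.1 * setNorm A * q) = u * t ^ (1 / (d : ℝ)) / (setNorm A * q) := by
      rw [hru]; field_simp
    have e2 : r ^ (m + 1) * (F.gauge hd).coneVol /
        (Ideal.absNorm a.1 * setNorm A * q * covol K) ^ (m + 1) =
        (F.gauge hd).coneVol / (covol K) ^ (m + 1) * (u / q) ^ (m + 1) * t ^ ((m + 1 : ℝ) / d) *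
          (setNorm A ^ (m + 1))⁻¹ := by
      rw [← htpow, hru]
      simp only [mul_pow, div_pow]
      field_simp
    rw [e1, e2] at h1
    have e3 : (-1 : ℝ) ^ A.card *
        ((latticePoints (F.gauge hd) R.modulus (a.1 * setProd A) y r).ncard : ℝ) -
        (F.gauge hd).coneVol / (covol K) ^ (m + 1) * (u / q) ^ (m + 1) * t ^ ((m + 1 : ℝ) / d) *
          ((-1 : ℝ) ^ A.card * (setNorm A ^ (m + 1))⁻¹) = (-1 : ℝ) ^ A.card *
          (((latticePoints (F.gauge hd) R.modulus (a.1 * setProd A) y r).ncard : ℝ) -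
          (F.gauge hd).coneVol / (covol K) ^ (m + 1) * (u / q) ^ (m + 1) *
            t ^ ((m + 1 : ℝ) / d) * (setNorm A ^ (m + 1))⁻¹) := by ring
    rw [e3, abs_mul, abs_pow, abs_neg, abs_one, one_pow, one_mul]
    refine h1.trans ?_
    rw [mul_assoc A₀]
    refine mul_le_mul_of_nonneg_left ?_ hA₀
    have h2 := error_term_le hn1 (k := m + 1) (by nlinarith) hE hu0
      (Real.rpow_pos_of_pos ht0 (1 / (d : ℝ))) hNA hq0
    push_cast at h2
    refine h2.trans ?_
    -- As `t ≥ 1`, the exponent may be raised, so that the error term carries the same weight as the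
    -- main term and is also summed by `sum_weight`.
    have h3 : (t ^ (1 / (d : ℝ))) ^ e ≤ t ^ ((m + 1 : ℝ) / d) := by
      rw [← Real.rpow_mul ht0.le]
      refine Real.rpow_le_rpow_of_exponent_le ht1 ?_
      rw [one_div_mul_eq_div]
      have : (0 : ℝ) ≤ (n : ℝ)⁻¹ := by positivity
      exact div_le_div_of_nonneg_right (by linarith) (by positivity)
    gcongr
  refine (Finset.abs_sum_le_sum_abs _ _).trans ((Finset.sum_le_sum hterm).trans_eq ?_)
  rw [← Finset.mul_sum, Finset.sum_add_distrib, Finset.sum_const, nsmul_eq_mul, mul_one,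
    ← Finset.mul_sum]

end MorphismLift

end Asymptotics

end SchanuelMorphism

namespace SchanuelMorphism

set_option linter.unusedSectionVars false

/-! ### Summation over classes and residues. -/

section Asymptotics

open scoped nonZeroDivisors Classical

theorem Gauge.coneVol_nonneg {K : Type*} [Field K] [NumberField K] {ι : Type*} [Fintype ι]
    (g : Gauge K ι) : 0 ≤ g.coneVol := by
  have := Units.regulator_pos K
  unfold Gauge.coneVol
  have h : 0 ≤ ∏ w, (g.localVol w).toReal := Finset.prod_nonneg fun _ _ => ENNReal.toReal_nonneg
  positivity

/-- Real arithmetic combining the main term and the error terms of the count. -/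
theorem abs_sub_le_of_weighted_count {m k j : ℕ} {A₀ A₁ N c h w ζ κ P τ s s' p q t t' a Θ L Y σ V : ℝ}
    (hA₀ : 0 ≤ A₀) (hA₁ : 0 ≤ A₁) (hN : 0 ≤ N) (hc : 0 ≤ c) (hh : 0 ≤ h) (hw : 1 ≤ w) (hζ : 0 ≤ ζ)
    (hκ : 0 ≤ κ) (hP : 0 ≤ P) (hP1 : P ≤ 1) (hq : 0 < q) (ht : 0 ≤ t) (hΘ : 0 ≤ Θ) (hL : 0 ≤ L)
    (hY : 0 < Y) (hs' : 0 ≤ s')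
    (hσ : σ = q ^ (m + 1) * (c * P)) (htt : q ^ (m + 1) * t' = t) (hτ : τ * P * ζ = 1)
    (hV : κ * w * Y ^ (m + 1) * ζ = h * (V * c)) (hcard : a ≤ A₁ * Y) (hsL : s' ≤ A₁ * L)
    (hsτ : |s - τ| ≤ A₁ * (Y ^ m)⁻¹)
    (hsum : |w * p - h * (V / q ^ (m + 1) * σ * s)| ≤
      h * (A₀ * N ^ j * 2 ^ k * (q ^ (m + 1) * a + Θ * (σ * t') * s'))) :
    |p - κ * Y ^ (m + 1)| ≤ (A₁ * ζ + h * A₀ * 2 ^ k * A₁) *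
      (N ^ j * c * t * Θ * L + (N ^ j * q ^ (m + 1) + κ) * Y) := by
  have hw0 : 0 < w := by linarith
  -- The truncated Möbius sum `s` is written as `τ + (s - τ)`; the relation `τ * P * ζ = 1` cancels
  -- the Euler factors in the main part.
  have hmain : h * (V / q ^ (m + 1) * σ * s) =
      κ * w * Y ^ (m + 1) + κ * w * Y ^ (m + 1) * ζ * P * (s - τ) := by
    have h1 : h * (V / q ^ (m + 1) * σ * s) = h * (V * c) * P * s := by
      rw [hσ]; field_simp
    rw [h1, ← hV]
    linear_combination κ * w * Y ^ (m + 1) * hτ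
  have herr : h * (A₀ * N ^ j * 2 ^ k * (q ^ (m + 1) * a + Θ * (σ * t') * s')) ≤
      h * A₀ * 2 ^ k * A₁ * (N ^ j * c * t * Θ * L + N ^ j * q ^ (m + 1) * Y) := by
    have h1 : σ * t' ≤ c * t := by
      have : σ * t' = c * t * P := by rw [hσ, ← htt]; ring
      rw [this]
      exact mul_le_of_le_one_right (by positivity) hP1
    have h2 : q ^ (m + 1) * a + Θ * (σ * t') * s' ≤
        q ^ (m + 1) * (A₁ * Y) + Θ * (c * t) * (A₁ * L) := by
      gcongr
    calc _ ≤ h * (A₀ * N ^ j * 2 ^ k * (q ^ (m + 1) * (A₁ * Y) + Θ * (c * t) * (A₁ * L))) := by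
          gcongr
      _ = _ := by ring
  have htail : |κ * w * Y ^ (m + 1) * ζ * P * (s - τ)| ≤ w * (A₁ * ζ * (κ * Y)) := by
    rw [abs_mul, abs_of_nonneg (by positivity)]
    calc κ * w * Y ^ (m + 1) * ζ * P * |s - τ| ≤ κ * w * Y ^ (m + 1) * ζ * 1 * (A₁ * (Y ^ m)⁻¹) := by
          gcongr
      _ = w * (A₁ * ζ * (κ * Y)) := by
          rw [pow_succ]; field_simp
  have hfinal : w * |p - κ * Y ^ (m + 1)| ≤ w * (A₁ * ζ * (κ * Y)) +
      h * A₀ * 2 ^ k * A₁ * (N ^ j * c * t * Θ * L + N ^ j * q ^ (m + 1) * Y) := by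
    rw [hmain] at hsum
    have h1 : w * |p - κ * Y ^ (m + 1)| = |w * p - (κ * w * Y ^ (m + 1) +
        κ * w * Y ^ (m + 1) * ζ * P * (s - τ)) + κ * w * Y ^ (m + 1) * ζ * P * (s - τ)| := by
      nth_rewrite 1 [← abs_of_nonneg hw0.le]
      rw [← abs_mul]
      congr 1
      ring
    rw [h1]
    refine (abs_add_le _ _).trans ?_
    linarith [hsum.trans herr]
  have hG0 : 0 ≤ N ^ j * c * t * Θ * L := by positivity
  have hq1 : 0 ≤ N ^ j * q ^ (m + 1) * Y := by positivity
  have hc1 : 0 ≤ h * A₀ * 2 ^ k * A₁ := by positivity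
  refine le_of_mul_le_mul_left (hfinal.trans ?_) hw0
  have hκY : 0 ≤ κ * Y := by positivity
  have hz0 : 0 ≤ A₁ * ζ := by positivity
  generalize N ^ j * c * t * Θ * L = G at *
  generalize N ^ j * q ^ (m + 1) = G' at *
  generalize h * A₀ * 2 ^ k * A₁ = B at *
  calc _ ≤ w * (A₁ * ζ * (κ * Y)) + w * (B * (G + G' * Y)) := by
        exact add_le_add le_rfl (le_mul_of_one_le_left (mul_nonneg hc1 (add_nonneg hG0 hq1)) hw)
    _ ≤ _ := by
        rw [← mul_add]
        refine mul_le_mul_of_nonneg_left ?_ hw0.le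
        nlinarith [mul_nonneg hz0 hG0, mul_nonneg hz0 hq1, mul_nonneg hc1 hκY]

namespace MorphismLift

variable {K : Type*} [Field K] [NumberField K] {m M d : ℕ} (F : MorphismLift K m M d)

/-- The leading constant, in terms of the volume of the gauge cone. -/
def coneConstant (hd : 1 ≤ d) : ℝ :=
  classNumber K / Units.torsionOrder K * ((F.gauge hd).coneVol / covol K ^ (m + 1)) * F.cZero /
    ((dedekindZeta K ((m + 1 : ℕ) : ℂ)).re * (F.height ^ ((Module.finrank ℚ K : ℝ) / d)) ^ (m + 1))

/-- The quantity raised to the power `n (m + 1) - 1` in the error term. -/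
def errorScale (E X : ℝ) : ℝ :=
  E * (X ^ ((Module.finrank ℚ K : ℝ) / d) / F.height ^ ((Module.finrank ℚ K : ℝ) / d)) ^
    (Module.finrank ℚ K : ℝ)⁻¹

theorem coneConstant_nonneg (hm : 1 ≤ m) (hd : 1 ≤ d) : 0 ≤ F.coneConstant hd := by
  have h1 := (F.gauge hd).coneVol_nonneg
  have h2 := covol_pos (K := K)
  have h3 := F.cZero_nonneg
  have h4 := one_le_dedekindZeta K (s := m + 1) (by omega)
  have h5 := F.height_pos
  have h6 : 0 < (dedekindZeta K ((m + 1 : ℕ) : ℂ)).re := by linarith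
  unfold coneConstant
  positivity

-- The estimates for single classes and residues are added. Summing the weights produces `cZero` in
-- both the main and the error term, while the constant part of each local error is multiplied by
-- the `Nm q ^ (m+1)` residue tuples and the number of squarefree ideals.
variable (K m) in
theorem exists_asymptotic (hm : 1 ≤ m) : ∃ A : ℝ, 0 < A ∧ ∀ (M d : ℕ) (hd : 1 ≤ d)
    (F : MorphismLift K m M d) (R : F.ResidueData) (N : ℕ) (B C : ℝ), 0 < N → 0 ≤ B → 0 ≤ C →
    (F.gauge hd).HasLipschitzSpheres N B → (F.gauge hd).IsBoundedBy C → ∀ X : ℝ, 1 ≤ X →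
      (F.points X).Finite ∧
      |((F.points X).ncard : ℝ) -
          F.coneConstant hd * (X ^ ((Module.finrank ℚ K : ℝ) / d)) ^ (m + 1)| ≤
        A * ((N : ℝ) ^ Module.finrank ℚ K * F.cZero *
          (Ideal.absNorm R.modulus : ℝ) ^ (Module.finrank ℚ K : ℝ)⁻¹ *
          F.errorScale (B + if Units.rank K = 0 then 0 else C) X ^
            (Module.finrank ℚ K * (m + 1) - 1) *
          (1 + if 1 < Module.finrank ℚ K * m then 0 else
            Real.log (X ^ ((Module.finrank ℚ K : ℝ) / d))) +
          ((N : ℝ) ^ Module.finrank ℚ K * (Ideal.absNorm R.modulus : ℝ) ^ (m + 1) +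
            F.coneConstant hd) * X ^ ((Module.finrank ℚ K : ℝ) / d)) := by
  set n := Module.finrank ℚ K with hn
  have hn1 : 1 ≤ n := Module.finrank_pos
  obtain ⟨A₀, hA₀, hcount⟩ := exists_count_latticePoints K m
  obtain ⟨A₁, hA₁, hsq⟩ := exists_sqfree_bounds K hm hn1
  set ζ := (dedekindZeta K ((m + 1 : ℕ) : ℂ)).re with hζ
  have hζ1 : 1 ≤ ζ := one_le_dedekindZeta K (s := m + 1) (by omega)
  refine ⟨A₁ * ζ + classNumber K * A₀ * 2 ^ (n * (m + 1)) * A₁, by positivity, ?_⟩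
  intro M d hd F R N B C hN hB hC hgL hgC X hX
  have hX0 : 0 < X := by linarith
  have hd0 : (0 : ℝ) < d := by positivity
  set Y := X ^ ((n : ℝ) / d) with hY
  have hY1 : 1 ≤ Y := Real.one_le_rpow hX (by positivity)
  have hY0 : 0 < Y := by linarith
  set E := B + if Units.rank K = 0 then 0 else C with hE
  have hE0 : 0 ≤ E := by rw [hE]; split_ifs <;> linarith
  have hH := F.height_pos
  set u := Y / F.height ^ ((n : ℝ) / d) with hu
  have hu0 : 0 < u := by positivity
  set Q : (Ideal (𝓞 K))⁰ := ⟨R.modulus, mem_nonZeroDivisors_of_ne_zero R.modulus_ne_bot⟩ with hQ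
  set q := (Ideal.absNorm R.modulus : ℝ) with hq
  have hq0 : 0 < q := absNorm_pos_real Q
  choose a ha haq using exists_coprime_rep R.modulus_ne_bot (K := K)
  obtain ⟨𝒜, h𝒜⟩ := exists_sqfreeSet K R.bad Y
  obtain ⟨hs1, hs2, hs3⟩ := hsq R.bad Y hY1 𝒜 h𝒜
  let _ : Fintype (Fin (m + 1) → 𝓞 K ⧸ R.modulus) := Fintype.ofFinite _
  obtain ⟨hfinite, hpoints⟩ := F.points_count hd R ha haq hX0 (𝒜 := 𝒜)
    (fun c y hy => (hcount (F.gauge hd) N B C hN hB hC hgL hgC (a c) Q y _ (haq c)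
      (F.bound_pos hX0 (absNorm_pos_real _)
        (zero_lt_one.trans_le (R.one_le_total_of_isPrimitive hy)))).1)
    (fun A h1 h2 => (h𝒜 A).2 ⟨h1, h2⟩)
  refine ⟨hfinite, ?_⟩
  set V := (F.gauge hd).coneVol / covol K ^ (m + 1) with hV
  have hV0 : 0 ≤ V := div_nonneg (F.gauge hd).coneVol_nonneg (pow_nonneg covol_pos.le _)
  set e : ℝ := (m + 1 : ℝ) - (n : ℝ)⁻¹ with he
  set s := ∑ A ∈ 𝒜, (-1 : ℝ) ^ A.card * (setNorm A ^ (m + 1))⁻¹ with hs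
  set s' := ∑ A ∈ 𝒜, setNorm A ^ (-e) with hs'
  have hs'0 : 0 ≤ s' := Finset.sum_nonneg fun A _ => Real.rpow_nonneg (setNorm_pos A).le _
  set Θ := (E * u ^ (n : ℝ)⁻¹) ^ (n * (m + 1) - 1) with hΘ
  have hΘ0 : 0 ≤ Θ := by positivity
  set A₂ := A₀ * (N : ℝ) ^ n with hA₂
  have hA₂0 : 0 ≤ A₂ := by positivity
  have hcy (c : ClassGroup (𝓞 K)) (y : Fin (m + 1) → 𝓞 K ⧸ R.modulus) :=
    F.abs_sum_residue_le hm hd R (haq c) hX0 hA₂0 hE0 (y := residueLift m _ y)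
      (fun I r hI hr => (hcount (F.gauge hd) N B C hN hB hC hgL hgC I Q _ r hI hr).2)
      (𝒜 := 𝒜) fun A hA => ((h𝒜 A).1 hA).1
  simp only [← hn, ← hY, ← hu, ← hq, ← hV, ← he, ← hs, ← hs', ← hΘ] at hcy
  have hsum := (Finset.abs_sum_le_sum_abs _ _).trans (Finset.sum_le_sum fun c (_ : c ∈ Finset.univ) =>
    (Finset.abs_sum_le_sum_abs _ _).trans (Finset.sum_le_sum fun y (_ : y ∈ Finset.univ) => hcy c y))
  simp only [Finset.sum_sub_distrib] at hsum
  rw [← hpoints] at hsum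
  set σ := ∑ y : Fin (m + 1) → 𝓞 K ⧸ R.modulus, R.weight (residueLift m _ y) with hσ
  have hσ' : σ = q ^ (m + 1) * (F.cZero * R.euler) := R.sum_weight hd
  have hcard : ((Finset.univ : Finset (Fin (m + 1) → 𝓞 K ⧸ R.modulus)).card : ℝ) = q ^ (m + 1) := by
    rw [Finset.card_univ, ← Nat.card_eq_fintype_card, Nat.card_fun, Nat.card_fin,
      ← Submodule.cardQuot_apply, ← Ideal.absNorm_apply, hq]
    push_cast
    rfl
  have hclass : ((Finset.univ : Finset (ClassGroup (𝓞 K))).card : ℝ) = classNumber K := by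
    rw [classNumber, Finset.card_univ]
  have hm1 : ∑ _c : ClassGroup (𝓞 K), ∑ y : Fin (m + 1) → 𝓞 K ⧸ R.modulus,
      V * (u / q) ^ (m + 1) * R.weight (residueLift m _ y) * s =
      classNumber K * (V * (u / q) ^ (m + 1) * σ * s) := by
    rw [Finset.sum_const, nsmul_eq_mul, hclass, ← Finset.sum_mul, ← Finset.mul_sum]
  have hm2 : ∑ _c : ClassGroup (𝓞 K), ∑ y : Fin (m + 1) → 𝓞 K ⧸ R.modulus,
      A₂ * 2 ^ (n * (m + 1)) * ((𝒜.card : ℝ) +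
        Θ * (R.weight (residueLift m _ y) * q ^ (-e)) * s') =
      classNumber K * (A₂ * 2 ^ (n * (m + 1)) * (q ^ (m + 1) * 𝒜.card + Θ * (σ * q ^ (-e)) * s')) := by
    rw [Finset.sum_const, nsmul_eq_mul, hclass, ← Finset.mul_sum, Finset.sum_add_distrib,
      Finset.sum_const, nsmul_eq_mul, hcard, ← Finset.sum_mul, ← Finset.mul_sum, ← Finset.sum_mul]
  rw [hm1, hm2] at hsum
  have hc0 := F.cZero_nonneg
  obtain ⟨hP0, hP1⟩ := R.euler_mem
  set P := R.euler with hP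
  set τ := ∑' A : Finset (HeightOneSpectrum (𝓞 K)),
    if Disjoint A R.bad then (-1 : ℝ) ^ A.card * (setNorm A ^ (m + 1))⁻¹ else 0 with hτ
  have hτP : τ * P * ζ = 1 := tsum_moebius_compl_mul K (s := m + 1) (by omega) R.bad
  set w := (Units.torsionOrder K : ℝ) with hw
  have hw1 : 1 ≤ w := by
    rw [hw]; exact_mod_cast Nat.one_le_iff_ne_zero.2 (Units.torsionOrder_ne_zero K)
  set κ := F.coneConstant hd with hκ
  have hκ0 : 0 ≤ κ := F.coneConstant_nonneg hm hd
  set h := (classNumber K : ℝ) with hh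
  have hh0 : 0 ≤ h := by positivity
  have hκw : κ * w * Y ^ (m + 1) * ζ = h * (V * u ^ (m + 1) * F.cZero) := by
    have hHp : (F.height ^ ((n : ℝ) / d)) ^ (m + 1) ≠ 0 := by positivity
    have hw0 : w ≠ 0 := by linarith
    have hζ0 : ζ ≠ 0 := by linarith
    rw [hκ, coneConstant, ← hn, ← hζ, ← hw, ← hh, ← hV, hu, div_pow]
    field_simp
  -- The sum of the weights over the residues almost compensates the decay of the error in `q`,
  -- leaving only the power `1/n`.
  have hqe : q ^ (m + 1) * q ^ (-e) = q ^ (n : ℝ)⁻¹ := by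
    rw [← Real.rpow_natCast, ← Real.rpow_add hq0]
    congr 1
    rw [he]; push_cast; ring
  set L : ℝ := 1 + if 1 < n * m then 0 else Real.log Y with hL
  have hL0 : 0 ≤ L := by
    rw [hL]
    have := Real.log_nonneg hY1
    split_ifs <;> linarith
  have hq2 : 0 ≤ q ^ (n : ℝ)⁻¹ := by positivity
  rw [div_pow, ← mul_div_assoc] at hsum
  exact abs_sub_le_of_weighted_count hA₀.le hA₁.le (Nat.cast_nonneg N) hc0 hh0 hw1 (by linarith) hκ0
    hP0 hP1 hq0 hq2 hΘ0 hL0 hY0 hs'0 hσ' hqe hτP hκw hs1 hs2 hs3 hsum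

end MorphismLift

end Asymptotics

end SchanuelMorphism

namespace SchanuelMorphism

set_option linter.unusedSectionVars false

/-! ### Archimedean completions -/

section Archimedean

open InfinitePlace InfinitePlace.Completion

namespace MorphismLift

variable {K : Type*} [Field K] [NumberField K] {m M d : ℕ} (F : MorphismLift K m M d)
  (v : InfinitePlace K)

theorem maxAbs_archAbs {ι : Type*} [Fintype ι] [Nonempty ι] (z : ι → v.Completion) :
    maxAbs (archAbs v) z = ‖z‖ := maxAbs_norm_eq _

theorem coeffAbs_archAbs : F.coeffAbs (archAbs v) = F.coeffNorm v.Completion := maxAbs_norm_eq _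

/-- The coordinatewise embedding of tuples over the completion into complex tuples. -/
def archEmbed {ι : Type*} (z : ι → v.Completion) : ι → ℂ := fun i => extensionEmbedding v (z i)

theorem norm_extensionEmbedding (x : v.Completion) : ‖extensionEmbedding v x‖ = ‖x‖ :=
  (isometry_extensionEmbedding v).norm_map_of_map_zero (map_zero _) x

theorem norm_archEmbed {ι : Type*} [Fintype ι] (z : ι → v.Completion) :
    ‖archEmbed v z‖ = ‖z‖ := by
  simp only [Pi.norm_def, archEmbed]
  congr 2
  funext i
  exact NNReal.coe_injective (norm_extensionEmbedding v (z i))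

theorem extensionEmbedding_algebraMap (x : K) :
    extensionEmbedding v (algebraMap K v.Completion x) = v.embedding x := by
  rw [Completion.algebraMap_apply, extensionEmbedding_coe]
  rfl

theorem archEval_archEmbed (z : Fin (m + 1) → v.Completion) :
    F.archEval v (archEmbed v z) = archEmbed v (F.eval z) := by
  let : Algebra K ℂ := v.embedding.toAlgebra
  funext j
  change MvPolynomial.aeval (archEmbed v z) (F.form j) =
    extensionEmbedding v (MvPolynomial.aeval z (F.form j))
  rw [MvPolynomial.map_aeval, MvPolynomial.aeval_def, MvPolynomial.coe_eval₂Hom]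
  congr 1
  ext x
  exact (extensionEmbedding_algebraMap v x).symm

theorem archCoeff_eq : F.archCoeff v = F.coeffNorm v.Completion := by
  let : Algebra K ℂ := v.embedding.toAlgebra
  change ‖fun p => algebraMap K ℂ (F.coeffs p)‖ = ‖fun p => algebraMap K v.Completion (F.coeffs p)‖
  rw [← norm_archEmbed]
  congr 1
  funext p
  exact (extensionEmbedding_algebraMap v _).symm

theorem gauge_archEmbed (hd : 1 ≤ d) (z : Fin (m + 1) → v.Completion) :
    (F.gauge hd).toFun v (archEmbed v z) =
      (‖F.eval z‖ / F.coeffNorm v.Completion) ^ (1 / (d : ℝ)) := by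
  change (‖F.archEval v (archEmbed v z)‖ / F.archCoeff v) ^ (1 / (d : ℝ)) = _
  rw [archEval_archEmbed, norm_archEmbed, archCoeff_eq]

theorem gauge_archEmbed_le_one_iff (hd : 1 ≤ d) (z : Fin (m + 1) → v.Completion) :
    (F.gauge hd).toFun v (archEmbed v z) ≤ 1 ↔ z ∈ F.archDomain v := by
  have hc := F.coeffNorm_pos (L := v.Completion)
  have hd0 : (0 : ℝ) < 1 / d := by positivity
  have h := Real.rpow_le_rpow_iff (by positivity : 0 ≤ ‖F.eval z‖ / F.coeffNorm v.Completion)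
    zero_le_one hd0
  rw [Real.one_rpow] at h
  rw [gauge_archEmbed, h, div_le_one hc]
  change _ ↔ maxAbs (archAbs v) (F.eval z) ≤ F.coeffAbs (archAbs v)
  rw [maxAbs_archAbs, coeffAbs_archAbs]

theorem gauge_archEmbed_eq_one_iff (hd : 1 ≤ d) (z : Fin (m + 1) → v.Completion) :
    (F.gauge hd).toFun v (archEmbed v z) = 1 ↔ z ∈ F.archBoundary v := by
  have hc := F.coeffNorm_pos (L := v.Completion)
  have hd0 : (1 : ℝ) / d ≠ 0 := by positivity
  have h := Real.rpow_left_inj (by positivity : 0 ≤ ‖F.eval z‖ / F.coeffNorm v.Completion)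
    zero_le_one hd0
  rw [Real.one_rpow] at h
  rw [gauge_archEmbed, h, div_eq_one_iff_eq hc.ne']
  change _ ↔ maxAbs (archAbs v) (F.eval z) = F.coeffAbs (archAbs v)
  rw [maxAbs_archAbs, coeffAbs_archAbs]

theorem exists_archEmbed_eq {ι : Type*} {z : ι → ℂ} (hz : v.IsReal → ∀ i, (z i).im = 0) :
    ∃ y : ι → v.Completion, archEmbed v y = z := by
  by_cases hv : v.IsReal
  · choose y hy using fun i => surjective_extensionEmbeddingOfIsReal hv (z i).re
    refine ⟨y, funext fun i => ?_⟩
    rw [archEmbed, ← extensionEmbeddingOfIsReal_apply hv, hy]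
    exact Complex.ext rfl (by simp [hz hv i])
  · choose y hy using fun i => surjective_extensionEmbedding_of_isComplex
      (InfinitePlace.not_isReal_iff_isComplex.1 hv) (z i)
    exact ⟨y, funext hy⟩

theorem archVolume_archDomain (hd : 1 ≤ d) :
    archVolume v (F.archDomain v) = (F.gauge hd).localVol v := by
  unfold archVolume Gauge.localVol
  split_ifs with hv
  · congr 1
    ext x
    simp only [Set.mem_ofPred_eq]
    rw [← F.gauge_archEmbed_le_one_iff v hd]
    have : archEmbed v (fun i => (ringEquivRealOfIsReal hv).symm (x i)) =
        fun i => (x i : ℂ) := by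
      funext i
      rw [archEmbed, ← extensionEmbeddingOfIsReal_apply hv, ← ringEquivRealOfIsReal_apply,
        RingEquiv.apply_symm_apply]
    rw [this]
  · congr 1
    ext x
    simp only [Set.mem_ofPred_eq]
    rw [← F.gauge_archEmbed_le_one_iff v hd]
    have : archEmbed v (fun i => (ringEquivComplexOfIsComplex
        (InfinitePlace.not_isReal_iff_isComplex.1 hv)).symm (x i)) = x := by
      funext i
      rw [archEmbed, ← ringEquivComplexOfIsComplex_apply
        (InfinitePlace.not_isReal_iff_isComplex.1 hv), RingEquiv.apply_symm_apply]
    rw [this]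

/-- One inclusion is continuity. For the other, a point of the level set is the limit of its
multiples by `1 + 1/(k+1)`, which leave the domain by homogeneity. -/
theorem frontier_archDomain (hd : 1 ≤ d) : frontier (F.archDomain v) = F.archBoundary v := by
  have hc := F.coeffNorm_pos (L := v.Completion)
  have hcont : Continuous fun z : Fin (m + 1) → v.Completion => ‖F.eval z‖ := F.continuous_eval.norm
  have hD : F.archDomain v = {z | ‖F.eval z‖ ≤ F.coeffNorm v.Completion} := by
    ext z
    change maxAbs (archAbs v) (F.eval z) ≤ F.coeffAbs (archAbs v) ↔ _
    rw [maxAbs_archAbs, coeffAbs_archAbs]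
    rfl
  have hB : F.archBoundary v = {z | ‖F.eval z‖ = F.coeffNorm v.Completion} := by
    ext z
    change maxAbs (archAbs v) (F.eval z) = F.coeffAbs (archAbs v) ↔ _
    rw [maxAbs_archAbs, coeffAbs_archAbs]
    rfl
  rw [hD, hB]
  refine Set.Subset.antisymm (frontier_le_subset_eq hcont continuous_const) fun z hz => ?_
  have hz' : ‖F.eval z‖ = F.coeffNorm v.Completion := hz
  have hcl : IsClosed {z : Fin (m + 1) → v.Completion | ‖F.eval z‖ ≤ F.coeffNorm v.Completion} :=
    isClosed_le hcont continuous_const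
  rw [hcl.frontier_eq]
  refine ⟨hz'.le, fun hzi => ?_⟩
  let c (k : ℕ) : v.Completion := 1 + ((k : v.Completion) + 1)⁻¹
  have hcn (k : ℕ) : extensionEmbedding v (c k) = ((1 + 1 / ((k : ℝ) + 1) : ℝ) : ℂ) := by
    simp [c]
  have hct : Filter.Tendsto c Filter.atTop (nhds 1) := by
    rw [tendsto_iff_norm_sub_tendsto_zero]
    refine tendsto_one_div_add_atTop_nhds_zero_nat.congr fun k => ?_
    rw [← norm_extensionEmbedding, map_sub, hcn, map_one]
    have : ((1 + 1 / ((k : ℝ) + 1) : ℝ) : ℂ) - 1 = ((1 / ((k : ℝ) + 1) : ℝ) : ℂ) := by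
      push_cast; ring
    rw [this, Complex.norm_real, Real.norm_of_nonneg (by positivity)]
  have ht : Filter.Tendsto (fun k => c k • z) Filter.atTop (nhds z) := by
    simpa using hct.smul_const z
  obtain ⟨k, hk⟩ := (ht.eventually (mem_interior_iff_mem_nhds.1 hzi)).exists
  have hk' : ‖F.eval (c k • z)‖ ≤ F.coeffNorm v.Completion := hk
  rw [F.eval_smul, _root_.norm_smul, norm_pow, hz', ← norm_extensionEmbedding, hcn, Complex.norm_real,
    Real.norm_of_nonneg (by positivity)] at hk'
  have h1 : 1 < (1 + 1 / ((k : ℝ) + 1)) ^ d := one_lt_pow₀ (by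
    have : (0 : ℝ) < 1 / ((k : ℝ) + 1) := by positivity
    linarith) (by omega)
  nlinarith

theorem norm_toLp_le {k : ℕ} (x : Fin k → ℝ) : ‖(WithLp.toLp 2 x : EuclideanSpace ℝ (Fin k))‖ ≤ √k * ‖x‖ := by
  rw [EuclideanSpace.norm_eq, ← Real.sqrt_sq (norm_nonneg x), ← Real.sqrt_mul (by positivity)]
  refine Real.sqrt_le_sqrt ?_
  calc _ ≤ ∑ _i : Fin k, ‖x‖ ^ 2 := Finset.sum_le_sum fun i _ => by
        have := norm_le_pi_norm x i
        gcongr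
    _ = _ := by simp

theorem norm_le_norm_toLp {ι L : Type*} [Fintype ι] [NormedField L] (x : ι → L) :
    ‖x‖ ≤ ‖(WithLp.toLp 2 x : EuclideanSpace L ι)‖ :=
  (pi_norm_le_iff_of_nonneg (norm_nonneg _)).2 fun i => PiLp.norm_apply_le (WithLp.toLp 2 x) i

/-- Euclidean norms are exchanged for sup norms: nothing is lost in the target, and the square root
of the dimension in the source. -/
theorem hasLipschitzSpheres_gauge (hd : 1 ≤ d) {N : ℕ} {B : ℝ} (hB : 0 ≤ B)
    (h : ∀ v : InfinitePlace K, IsLipschitzClass v (F.archBoundary v) N B) :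
    (F.gauge hd).HasLipschitzSpheres N (B * √(Module.finrank ℚ K * (m + 1) : ℕ)) := by
  intro v
  rw [Fintype.card_fin]
  obtain ⟨φ, hφL, hφ⟩ := h v
  have hcube {s : Fin (v.mult * (m + 1) - 1) → ℝ} (hs : s ∈ Set.Icc 0 1) :
      (WithLp.toLp 2 s : EuclideanSpace ℝ _) ∈ unitCube (v.mult * (m + 1) - 1) :=
    fun i => ⟨hs.1 i, hs.2 i⟩
  refine ⟨fun i s => archEmbed v (φ i (WithLp.toLp 2 s)).ofLp, fun i s hs t ht => ?_, fun z hz hgz => ?_⟩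
  · have h1 := hφL i _ (hcube hs) _ (hcube ht)
    rw [dist_eq_norm, dist_eq_norm, ← WithLp.toLp_sub] at h1
    have h2 : archEmbed v (φ i (WithLp.toLp 2 s)).ofLp - archEmbed v (φ i (WithLp.toLp 2 t)).ofLp =
        archEmbed v ((φ i (WithLp.toLp 2 s)) - (φ i (WithLp.toLp 2 t))).ofLp := by
      funext j
      simp [archEmbed]
    rw [h2, norm_archEmbed]
    have hmult : v.mult ≤ Module.finrank ℚ K := by
      rw [← InfinitePlace.sum_mult_eq]
      exact Finset.single_le_sum (f := fun w : InfinitePlace K => w.mult) (fun _ _ => Nat.zero_le _)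
        (Finset.mem_univ v)
    calc _ ≤ ‖(φ i (WithLp.toLp 2 s)) - (φ i (WithLp.toLp 2 t))‖ :=
          norm_le_norm_toLp (φ i (WithLp.toLp 2 s) - φ i (WithLp.toLp 2 t)).ofLp
      _ ≤ _ := h1
      _ ≤ B * (√(v.mult * (m + 1) - 1 : ℕ) * ‖s - t‖) := by
          gcongr
          exact norm_toLp_le _
      _ ≤ B * (√(Module.finrank ℚ K * (m + 1) : ℕ) * ‖s - t‖) := by
          gcongr
          exact (Nat.sub_le _ _).trans (Nat.mul_le_mul_right _ hmult)
      _ = _ := by ring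
  · obtain ⟨y, rfl⟩ := exists_archEmbed_eq v hz
    obtain ⟨i, s, hs, hsi⟩ := hφ y ((F.gauge_archEmbed_eq_one_iff v hd y).1 hgz)
    exact ⟨i, s.ofLp, ⟨fun j => (hs j).1, fun j => (hs j).2⟩, by beta_reduce; rw [WithLp.toLp_ofLp, hsi]⟩

theorem ErrorConstants.infty_nonneg {F : MorphismLift K m M d} (C : F.ErrorConstants) :
    0 ≤ C.infty := by
  obtain ⟨v⟩ : Nonempty (InfinitePlace K) := inferInstance
  have h1 := C.ratio_le_arch v 1 one_ne_zero
  have h0 : 0 ≤ F.ratio (archAbs v) 1 := by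
    rw [ratio, maxAbs_archAbs, maxAbs_archAbs, coeffAbs_archAbs]
    have := F.coeffNorm_nonneg (L := v.Completion)
    positivity
  exact (h0.trans h1).trans (le_ciSup (Set.finite_range C.arch).bddAbove v)

theorem ErrorConstants.isBoundedBy {F : MorphismLift K m M d} (C : F.ErrorConstants) (hd : 1 ≤ d) :
    (F.gauge hd).IsBoundedBy C.infty := by
  intro v z hz
  obtain ⟨y, rfl⟩ := exists_archEmbed_eq v hz
  rw [norm_archEmbed]
  rcases eq_or_ne y 0 with rfl | hy
  · rw [norm_zero]
    exact mul_nonneg C.infty_nonneg ((F.gauge hd).nonneg _ _)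
  have h1 : F.ratio (archAbs v) y ≤ C.infty :=
    (C.ratio_le_arch v y hy).trans (le_ciSup (Set.finite_range C.arch).bddAbove v)
  have hc := F.coeffNorm_pos (L := v.Completion)
  have hev : 0 < ‖F.eval y‖ := norm_pos_iff.2 (F.eval_ne_zero' hy)
  rw [ratio, maxAbs_archAbs, maxAbs_archAbs, coeffAbs_archAbs,
    div_le_iff₀ (Real.rpow_pos_of_pos hev _)] at h1
  rw [gauge_archEmbed, Real.div_rpow hev.le hc.le, ← mul_div_assoc,
    le_div_iff₀ (Real.rpow_pos_of_pos hc _)]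
  exact h1

theorem archVolume_ne_top (hd : 1 ≤ d) : archVolume v (F.archDomain v) ≠ ⊤ := by
  obtain ⟨C⟩ := F.nonempty_errorConstants hd
  rw [F.archVolume_archDomain v hd]
  exact Gauge.localVol_ne_top _ (C.isBoundedBy hd) v

/-- The regulator and `(m+1)^r` come from the volume of the cone, and the powers of `2` and of the
discriminant from the covolume of the integers. -/
theorem mainConstant_eq (hd : 1 ≤ d) : F.mainConstant = F.coneConstant hd := by
  have hvol : F.cInfty = ∏ w, ((F.gauge hd).localVol w).toReal :=
    Finset.prod_congr rfl fun w _ => by rw [archFactor, F.archVolume_archDomain w hd]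
  have hH := F.height_pos
  have hpow : F.height ^ ((Module.finrank ℚ K * (m + 1) : ℝ) / d) =
      (F.height ^ ((Module.finrank ℚ K : ℝ) / d)) ^ (m + 1) := by
    rw [← Real.rpow_natCast, ← Real.rpow_mul hH.le]
    congr 1
    push_cast
    ring
  rw [mainConstant, coneConstant, hpow, hvol, Gauge.coneVol, schanuelConstant, covol, Fintype.card_fin,
    Nat.cast_add, Nat.cast_one]
  push_cast
  have h2 : (2 ^ nrComplexPlaces K / √|(discr K : ℝ)|) ^ (m + 1) =
      1 / (2⁻¹ ^ nrComplexPlaces K * √|(discr K : ℝ)|) ^ (m + 1) := by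
    rw [← one_div_pow]
    congr 1
    rw [inv_pow]
    field_simp
  rw [h2]
  ring

end MorphismLift

end Archimedean

end SchanuelMorphism

namespace SchanuelMorphism

set_option linter.unusedSectionVars false

/-! ### Lipschitz parametrizations of level sets of homogeneous functions -/

section Parametrization

theorem isCompact_unitCube (k : ℕ) : IsCompact (unitCube k) := by
  have h : unitCube k = (WithLp.toLp 2 : (Fin k → ℝ) → EuclideanSpace ℝ (Fin k)) ''
      Set.univ.pi fun _ => Set.Icc 0 1 := by
    ext s
    exact ⟨fun hs => ⟨s.ofLp, fun i _ => hs i, rfl⟩, fun ⟨t, ht, h⟩ i => h ▸ ht i trivial⟩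
  rw [h]
  exact (isCompact_univ_pi fun _ => isCompact_Icc).image (PiLp.continuous_toLp 2 _)

/-- The affine parametrization of a face of the cube `[-1, 1] ^ (k + 1)`. -/
def cubeFace {k : ℕ} (j : Fin (k + 1)) (ε : ℝ) (s : EuclideanSpace ℝ (Fin k)) : Fin (k + 1) → ℝ :=
  j.insertNth (α := fun _ => ℝ) ε fun i => 2 * s i - 1

theorem contDiff_cubeFace {k : ℕ} (j : Fin (k + 1)) (ε : ℝ) : ContDiff ℝ 1 (cubeFace j ε) := by
  refine contDiff_pi.2 fun l => ?_
  rcases Fin.eq_self_or_eq_succAbove j l with rfl | ⟨i, rfl⟩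
  · simpa [cubeFace] using contDiff_const
  · simp only [cubeFace, Fin.insertNth_apply_succAbove]
    fun_prop

/-- A coordinate of maximal absolute value becomes `1` or `-1` after normalisation, which selects
the face. -/
theorem exists_cubeFace_eq {k : ℕ} {y : Fin (k + 1) → ℝ} (hy : y ≠ 0) :
    ∃ (j : Fin (k + 1)) (b : Bool), ∃ s ∈ unitCube k,
      cubeFace j (if b then 1 else -1) s = ‖y‖⁻¹ • y := by
  have hy0 : 0 < ‖y‖ := norm_pos_iff.2 hy
  obtain ⟨j, hj⟩ := exists_norm_eq_norm y
  let s : EuclideanSpace ℝ (Fin k) := WithLp.toLp 2 fun i => (‖y‖⁻¹ * y (j.succAbove i) + 1) / 2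
  have hs : s ∈ unitCube k := fun i => by
    have h1 := norm_le_pi_norm y (j.succAbove i)
    rw [Real.norm_eq_abs, abs_le] at h1
    have h2 : |‖y‖⁻¹ * y (j.succAbove i)| ≤ 1 := by
      rw [abs_mul, abs_of_pos (inv_pos.2 hy0), inv_mul_le_one₀ hy0]
      exact norm_le_pi_norm y _
    rw [abs_le] at h2
    change (‖y‖⁻¹ * y (j.succAbove i) + 1) / 2 ∈ Set.Icc (0 : ℝ) 1
    constructor <;> linarith [h2.1, h2.2]
  have hface (ε : ℝ) (hε : ε = ‖y‖⁻¹ * y j) : cubeFace j ε s = ‖y‖⁻¹ • y := by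
    funext l
    rcases Fin.eq_self_or_eq_succAbove j l with rfl | ⟨i, rfl⟩
    · simp [cubeFace, hε]
    · simp only [cubeFace, Fin.insertNth_apply_succAbove, Pi.smul_apply, smul_eq_mul]
      change 2 * ((‖y‖⁻¹ * y (j.succAbove i) + 1) / 2) - 1 = _
      ring
  rw [Real.norm_eq_abs] at hj
  rcases abs_cases (y j) with ⟨h, _⟩ | ⟨h, _⟩
  · refine ⟨j, true, s, hs, hface _ ?_⟩
    have h' : y j = ‖y‖ := by linarith
    rw [h', inv_mul_cancel₀ hy0.ne', if_pos rfl]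
  · refine ⟨j, false, s, hs, hface _ ?_⟩
    have h' : y j = -‖y‖ := by linarith
    rw [h', mul_neg, inv_mul_cancel₀ hy0.ne', if_neg (by simp)]

theorem cubeFace_ne_zero {k : ℕ} (j : Fin (k + 1)) (b : Bool) (s : EuclideanSpace ℝ (Fin k)) :
    cubeFace j (if b then 1 else -1) s ≠ 0 := fun h => by
  have := congrFun h j
  cases b <;> simp [cubeFace] at this

/-- Project the faces of a cube around the origin radially to the level set by `y ↦ (c / h(y))^(1/d)
y`. This is locally Lipschitz away from the origin, hence Lipschitz on the compact faces. Only a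
locally Lipschitz `h` is assumed, since a maximum of absolute values need not be differentiable. -/
theorem exists_lipschitz_parametrization {E : Type*} [NormedAddCommGroup E] [NormedSpace ℝ E]
    [FiniteDimensional ℝ E] {k d : ℕ} (hk : Module.finrank ℝ E = k + 1) (hd : 1 ≤ d) {h : E → ℝ}
    (hL : LocallyLipschitz h) (hpos : ∀ y, y ≠ 0 → 0 < h y)
    (hsmul : ∀ (t : ℝ) y, 0 ≤ t → h (t • y) = t ^ d * h y) {c : ℝ} (hc : 0 < c) :
    ∃ (N : ℕ) (B : ℝ), 0 < N ∧ ∃ φ : Fin N → EuclideanSpace ℝ (Fin k) → E,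
      (∀ i, ∀ s ∈ unitCube k, ∀ t ∈ unitCube k, dist (φ i s) (φ i t) ≤ B * dist s t) ∧
      ∀ z, h z = c → ∃ i, ∃ s ∈ unitCube k, φ i s = z := by
  let ψ : (Fin (k + 1) → ℝ) ≃L[ℝ] E := ContinuousLinearEquiv.ofFinrankEq (by simp [hk])
  let y (p : Fin (k + 1) × Bool) (s : EuclideanSpace ℝ (Fin k)) : E :=
    ψ (cubeFace p.1 (if p.2 then 1 else -1) s)
  have hy0 (p s) : y p s ≠ 0 := fun h0 =>
    cubeFace_ne_zero p.1 p.2 s ((map_eq_zero_iff ψ ψ.injective).1 h0)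
  have hyL (p) : LocallyLipschitz (y p) :=
    (ψ.contDiff.comp (contDiff_cubeFace p.1 _)).locallyLipschitz
  let g (q : ℝ × E) : E := (c / q.1) ^ (1 / (d : ℝ)) • q.2
  let φ (p : Fin (k + 1) × Bool) (s : EuclideanSpace ℝ (Fin k)) : E := g (h (y p s), y p s)
  have hφL (p) : LocallyLipschitz (φ p) := by
    intro s
    have hq : LocallyLipschitz fun s => (h (y p s), y p s) := (hL.comp (hyL p)).prodMk (hyL p)
    have hgs : ContDiffAt ℝ 1 g (h (y p s), y p s) := by
      have hh := hpos _ (hy0 p s)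
      refine ContDiffAt.smul (ContDiffAt.rpow_const_of_ne ?_ (by positivity)) contDiffAt_snd
      exact contDiffAt_const.div contDiffAt_fst hh.ne'
    obtain ⟨K₁, t₁, ht₁, h₁⟩ := hgs.exists_lipschitzOnWith
    obtain ⟨K₂, t₂, ht₂, h₂⟩ := hq s
    exact ⟨K₁ * K₂, t₂ ∩ (fun s => (h (y p s), y p s)) ⁻¹' t₁,
      Filter.inter_mem ht₂ (hq.continuous.continuousAt ht₁),
      h₁.comp (h₂.mono Set.inter_subset_left)
        ((Set.mapsTo_preimage _ _).mono_left Set.inter_subset_right)⟩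
  choose K hK using fun p => (hφL p).locallyLipschitzOn.exists_lipschitzOnWith_of_compact
    (isCompact_unitCube k)
  obtain ⟨B, hB⟩ := Finite.exists_le K
  let e := Fintype.equivFin (Fin (k + 1) × Bool)
  refine ⟨_, B, Fintype.card_pos, fun i => φ (e.symm i), fun i s hs t ht => ?_, fun z hz => ?_⟩
  · exact ((hK _).dist_le_mul s hs t ht).trans (mul_le_mul_of_nonneg_right (hB _) dist_nonneg)
  · have hz0 : z ≠ 0 := by
      rintro rfl
      have := hsmul 0 0 le_rfl
      rw [zero_smul, zero_pow (by omega), zero_mul] at this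
      linarith
    have hw0 : ψ.symm z ≠ 0 := fun h0 => hz0 ((map_eq_zero_iff ψ.symm ψ.symm.injective).1 h0)
    have hw := norm_pos_iff.2 hw0
    obtain ⟨j, b, s, hs, hjs⟩ := exists_cubeFace_eq hw0
    refine ⟨e (j, b), s, hs, ?_⟩
    have hys : y (j, b) s = ‖ψ.symm z‖⁻¹ • z := by
      change ψ (cubeFace j (if b then 1 else -1) s) = _
      rw [hjs, map_smul, ContinuousLinearEquiv.apply_symm_apply]
    simp only [Equiv.symm_apply_apply]
    change (c / h (y (j, b) s)) ^ (1 / (d : ℝ)) • y (j, b) s = z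
    rw [hys, hsmul _ _ (inv_nonneg.2 hw.le), hz]
    have : c / (‖ψ.symm z‖⁻¹ ^ d * c) = ‖ψ.symm z‖ ^ d := by
      rw [inv_pow]
      field_simp
    rw [this, one_div, Real.pow_rpow_inv_natCast hw.le (by omega), smul_smul,
      mul_inv_cancel₀ hw.ne', one_smul]

end Parametrization

/-! ### Lipschitz data for the archimedean level sets. -/

section LipschitzClass

open InfinitePlace InfinitePlace.Completion

variable {K : Type*} [Field K] [NumberField K] {m M d : ℕ}

theorem IsLipschitzClass.mono {v : InfinitePlace K} {S : Set (Fin (m + 1) → v.Completion)}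
    {N N' : ℕ} {B B' : ℝ} (h : IsLipschitzClass v S N B) (hN : 0 < N) (hNN : N ≤ N') (hB : B ≤ B') :
    IsLipschitzClass v S N' B' := by
  obtain ⟨φ, hφL, hφ⟩ := h
  refine ⟨fun i => φ (if hi : i.1 < N then ⟨i, hi⟩ else ⟨0, hN⟩), fun i s hs t ht =>
    (hφL _ s hs t ht).trans (mul_le_mul_of_nonneg_right hB dist_nonneg), fun z hz => ?_⟩
  obtain ⟨i, s, hs, h⟩ := hφ z hz
  refine ⟨Fin.castLE hNN i, s, hs, ?_⟩
  simp [h]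

/-- Since `m ≥ 1` the parameter cube has positive dimension and thus two distinct points, which
forces a Lipschitz constant to be nonnegative. -/
theorem IsLipschitzClass.nonneg {v : InfinitePlace K} {S : Set (Fin (m + 1) → v.Completion)}
    {N : ℕ} {B : ℝ} (h : IsLipschitzClass v S N B) (hN : 0 < N) (hm : 1 ≤ m) : 0 ≤ B := by
  obtain ⟨φ, hφL, -⟩ := h
  have hk : 0 < v.mult * (m + 1) - 1 := by
    have := Nat.le_mul_of_pos_left (m + 1) (v.mult_pos)
    omega
  let s : EuclideanSpace ℝ (Fin (v.mult * (m + 1) - 1)) := WithLp.toLp 2 fun _ => 1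
  have h1 := hφL ⟨0, hN⟩ s (fun i => by simp [s]) 0 (fun i => by simp)
  have hs : 0 < dist s 0 := dist_pos.2 fun h0 => by
    have := congrArg (fun x : EuclideanSpace ℝ (Fin (v.mult * (m + 1) - 1)) => x ⟨0, hk⟩) h0
    simp [s] at this
  exact nonneg_of_mul_nonneg_left (dist_nonneg.trans h1) hs

namespace MorphismLift

variable (F : MorphismLift K m M d)

theorem contDiff_eval {𝕜 : Type*} [RCLike 𝕜] [Algebra K 𝕜] :
    ContDiff ℝ 1 (F.eval : (Fin (m + 1) → 𝕜) → Fin (M + 1) → 𝕜) := by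
  refine contDiff_pi.2 fun j => ?_
  change ContDiff ℝ 1 fun z : Fin (m + 1) → 𝕜 => MvPolynomial.aeval z (F.form j)
  induction F.form j using MvPolynomial.induction_on with
  | C a => simpa using contDiff_const
  | add p q hp hq => simpa using hp.add hq
  | mul_X p i hp => simpa using hp.mul (contDiff_apply ℝ 𝕜 i)

theorem exists_isLipschitzClass_of_ringEquiv (hd : 1 ≤ d) (v : InfinitePlace K) {𝕜 : Type*} [RCLike 𝕜]
    (e : v.Completion ≃+* 𝕜) (he : Isometry e) (hmult : Module.finrank ℝ 𝕜 = v.mult) :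
    ∃ (N : ℕ) (B : ℝ), 0 < N ∧ IsLipschitzClass v (F.archBoundary v) N B := by
  let : Algebra K 𝕜 := (e.toRingHom.comp (algebraMap K v.Completion)).toAlgebra
  have heval (z : Fin (m + 1) → v.Completion) : F.eval (fun i => e (z i)) = fun j => e (F.eval z j) := by
    funext j
    change MvPolynomial.aeval (fun i => e (z i)) (F.form j) =
      e.toRingHom (MvPolynomial.aeval z (F.form j))
    rw [MvPolynomial.map_aeval, MvPolynomial.aeval_def, MvPolynomial.coe_eval₂Hom]
    rfl
  have hnorm {ι : Type} [Fintype ι] (z : ι → v.Completion) : ‖fun i => e (z i)‖ = ‖z‖ := by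
    simp only [Pi.norm_def]
    congr 2
    funext i
    exact NNReal.coe_injective (he.norm_map_of_map_zero (map_zero e) (z i))
  have hk : v.mult * (m + 1) - 1 + 1 = v.mult * (m + 1) :=
    Nat.sub_add_cancel (Nat.mul_pos v.mult_pos m.succ_pos)
  have hfr : Module.finrank ℝ (EuclideanSpace 𝕜 (Fin (m + 1))) = v.mult * (m + 1) - 1 + 1 := by
    rw [hk, (WithLp.linearEquiv 2 ℝ (Fin (m + 1) → 𝕜)).finrank_eq, Module.finrank_pi_fintype]
    simp [hmult, mul_comm]
  have hfd : FiniteDimensional ℝ (EuclideanSpace 𝕜 (Fin (m + 1))) :=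
    Module.finite_of_finrank_pos (by omega)
  have hcd : ContDiff ℝ 1 fun z : EuclideanSpace 𝕜 (Fin (m + 1)) => F.eval z.ofLp :=
    F.contDiff_eval.comp (PiLp.continuousLinearEquiv 2 ℝ fun _ : Fin (m + 1) => 𝕜).contDiff
  obtain ⟨N, B, hN, φ, hφL, hφ⟩ := exists_lipschitz_parametrization hfr hd
    (h := fun z => ‖F.eval z.ofLp‖)
    (lipschitzWith_one_norm.locallyLipschitz.comp hcd.locallyLipschitz)
    (fun y hy => norm_pos_iff.2 (F.eval_ne_zero' fun h0 => hy (WithLp.ofLp_injective 2 h0)))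
    (fun t y ht => by
      have h1 : (t • y).ofLp = (t : 𝕜) • y.ofLp := by
        ext i
        simp [RCLike.real_smul_eq_coe_mul]
      simp only [h1, F.eval_smul, _root_.norm_smul, norm_pow, RCLike.norm_ofReal, abs_of_nonneg ht])
    (F.coeffNorm_pos (L := v.Completion))
  refine ⟨N, B, hN, fun i s => WithLp.toLp 2 fun l => e.symm (φ i s l), fun i s hs t ht => ?_,
    fun z hz => ?_⟩
  · refine le_of_eq_of_le ?_ (hφL i s hs t ht)
    beta_reduce
    rw [PiLp.dist_eq_of_L2, PiLp.dist_eq_of_L2]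
    congr 1
    refine Finset.sum_congr rfl fun l _ => ?_
    rw [← he.dist_eq]
    simp
  · have hz' : ‖F.eval z‖ = F.coeffNorm v.Completion := by
      have : maxAbs (archAbs v) (F.eval z) = F.coeffAbs (archAbs v) := hz
      rwa [maxAbs_archAbs, coeffAbs_archAbs] at this
    obtain ⟨i, s, hs, his⟩ := hφ (WithLp.toLp 2 fun i => e (z i)) (by
      simp only [heval, hnorm, hz'])
    refine ⟨i, s, hs, ?_⟩
    simp [his]

theorem exists_isLipschitzClass (hd : 1 ≤ d) : ∃ (N : ℕ) (B : ℝ), 0 < N ∧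
    ∀ v : InfinitePlace K, IsLipschitzClass v (F.archBoundary v) N B := by
  have hloc (v : InfinitePlace K) :
      ∃ (N : ℕ) (B : ℝ), 0 < N ∧ IsLipschitzClass v (F.archBoundary v) N B := by
    by_cases hv : v.IsReal
    · exact F.exists_isLipschitzClass_of_ringEquiv hd v (ringEquivRealOfIsReal hv)
        (isometry_extensionEmbeddingOfIsReal hv) (by simp [InfinitePlace.mult, hv])
    · exact F.exists_isLipschitzClass_of_ringEquiv hd v
        (ringEquivComplexOfIsComplex (InfinitePlace.not_isReal_iff_isComplex.1 hv))
        (isometry_extensionEmbedding v) (by simp [InfinitePlace.mult, hv, Complex.finrank_real_complex])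
  choose N B hN hNB using hloc
  obtain ⟨N', hN'⟩ := Finite.exists_le N
  obtain ⟨B', hB'⟩ := Finite.exists_le B
  obtain ⟨v⟩ : Nonempty (InfinitePlace K) := inferInstance
  exact ⟨N', B', (hN v).trans_le (hN' v), fun v => (hNB v).mono (hN v) (hN' v) (hB' v)⟩

end MorphismLift

end LipschitzClass

end SchanuelMorphism

namespace SchanuelMorphism

set_option linter.unusedSectionVars false

/-! ### The asymptotic formula -/

section Main

theorem scaled_error_le {k : ℕ} {A D a c q q' s S L L' b b' κ Y : ℝ} (hA : 0 ≤ A) (hD : 1 ≤ D)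
    (ha : 0 ≤ a) (hc : 0 ≤ c) (hq : 0 ≤ q) (hs : 0 ≤ s) (hL : 0 ≤ L) (hb : 0 ≤ b) (hκ : 0 ≤ κ)
    (hY : 0 ≤ Y) (hqq : q ≤ q') (hsS : s ≤ D * S) (hLL : L ≤ L') (hbb : b ≤ b') :
    A * (a * c * q * s ^ k * L + (a * b + κ) * Y) ≤
      (A * D ^ k + 1) * (a * c * q' * S ^ k * L' + (a * b' + κ) * Y) := by
  have hD0 : 0 < D := by linarith
  have hS : 0 ≤ S := nonneg_of_mul_nonneg_right (hs.trans hsS) hD0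
  have hq' : 0 ≤ q' := hq.trans hqq
  have hL' : 0 ≤ L' := hL.trans hLL
  have hb' : 0 ≤ b' := hb.trans hbb
  have hDk : 1 ≤ D ^ k := one_le_pow₀ hD
  have h1 : a * c * q * s ^ k * L ≤ D ^ k * (a * c * q' * S ^ k * L') := by
    calc _ ≤ a * c * q' * (D * S) ^ k * L' := by gcongr
      _ = _ := by rw [mul_pow]; ring
  have h2 : (a * b + κ) * Y ≤ D ^ k * ((a * b' + κ) * Y) := by
    calc _ ≤ (a * b' + κ) * Y := by gcongr
      _ ≤ _ := le_mul_of_one_le_left (by positivity) hDk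
  calc _ ≤ A * (D ^ k * (a * c * q' * S ^ k * L') + D ^ k * ((a * b' + κ) * Y)) := by gcongr
    _ = A * D ^ k * (a * c * q' * S ^ k * L' + (a * b' + κ) * Y) := by ring
    _ ≤ _ := by
        have : 0 ≤ a * c * q' * S ^ k * L' + (a * b' + κ) * Y := by positivity
        linarith

namespace MorphismLift

variable {K : Type*} [Field K] [NumberField K] {m M d : ℕ} (F : MorphismLift K m M d)

theorem points_eq_empty {X : ℝ} (hX : X < 1) : F.points X = ∅ := by
  refine Set.eq_empty_of_forall_notMem fun P hP => ?_
  have h : absHeight (F.map P) ≤ X := hP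
  have h1 : 1 ≤ absHeight (F.map P) :=
    Real.one_le_rpow (Projectivization.one_le_mulHeight _) (by positivity)
  linarith

theorem errorScale_eq (E : ℝ) {X : ℝ} (hX : 0 ≤ X) :
    F.errorScale E X = E / F.height ^ (1 / (d : ℝ)) * X ^ (1 / (d : ℝ)) := by
  have hH := F.height_pos
  have hn : (Module.finrank ℚ K : ℝ) ≠ 0 := Nat.cast_ne_zero.2 Module.finrank_pos.ne'
  have h {x : ℝ} (hx : 0 ≤ x) : (x ^ ((Module.finrank ℚ K : ℝ) / d)) ^ (Module.finrank ℚ K : ℝ)⁻¹ =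
      x ^ (1 / (d : ℝ)) := by
    rw [← Real.rpow_mul hx]
    congr 1
    field_simp
  rw [errorScale, Real.div_rpow (by positivity) (by positivity), h hX, h hH.le]
  ring

theorem ErrorConstants.zero_nonneg {F : MorphismLift K m M d} (C : F.ErrorConstants) (hd : 1 ≤ d) :
    0 ≤ C.zero :=
  finprod_nonneg fun v => pow_nonneg (zero_le_one.trans (C.one_le_fin hd v)) _

-- For `X < 1` there are no points and the main term is absorbed by `c_K(f) X^(n/d)`. For `X ≥ 1`
-- the asymptotic formula is applied with a modulus of norm at most `(C_f^0)^d`, which converts its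
-- powers into powers of `C_f^0`.
set_option maxHeartbeats 800000 in
variable (K m) in
theorem exists_error_bound (hm : 1 ≤ m) : ∃ A : ℝ, 0 < A ∧ ∀ (M d : ℕ), 1 ≤ d →
    ∀ (F : MorphismLift K m M d) (N : ℕ) (B : ℝ), 0 < N →
    (∀ v : InfinitePlace K, IsLipschitzClass v (F.archBoundary v) N B) →
    ∀ (C : F.ErrorConstants) (X : ℝ), 0 ≤ X → (F.points X).Finite ∧
      |((F.points X).ncard : ℝ) -
          F.mainConstant * X ^ ((Module.finrank ℚ K * (m + 1) : ℝ) / d)| ≤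
        A * ((N : ℝ) ^ Module.finrank ℚ K * F.cZero * C.zero ^ ((d : ℝ) / Module.finrank ℚ K) *
              ((B + if Units.rank K = 0 then 0 else C.infty) / F.height ^ (1 / (d : ℝ)) *
                X ^ (1 / (d : ℝ))) ^ (Module.finrank ℚ K * (m + 1) - 1) *
              (1 + if 1 < Module.finrank ℚ K * m then 0 else Real.posLog (X ^ (1 / (d : ℝ)))) +
            ((N : ℝ) ^ Module.finrank ℚ K * C.zero ^ (d * (m + 1)) + F.mainConstant) *
              X ^ ((Module.finrank ℚ K : ℝ) / d)) := by
  set n := Module.finrank ℚ K with hn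
  have hn1 : 1 ≤ n := Module.finrank_pos
  have hn0 : (0 : ℝ) < n := by positivity
  obtain ⟨A, hA, hasymp⟩ := exists_asymptotic K m hm
  simp only [← hn] at hasymp
  set D : ℝ := √(n * (m + 1) : ℕ) with hD
  have hD1 : 1 ≤ D := by
    rw [hD, Real.one_le_sqrt]
    exact_mod_cast Nat.mul_pos hn1 m.succ_pos
  -- The power of `D` pays for the passage from Euclidean to sup norms, and the summand `1` covers
  -- the range `X < 1`.
  refine ⟨A * D ^ (n * (m + 1) - 1) + 1, by positivity, fun M d hd F N B hN hLip C X hX => ?_⟩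
  have hκ : 0 ≤ F.mainConstant := F.mainConstant_eq hd ▸ F.coneConstant_nonneg hm hd
  obtain ⟨v⟩ : Nonempty (InfinitePlace K) := inferInstance
  have hB := (hLip v).nonneg hN hm
  have hC := C.infty_nonneg
  have hZ := C.zero_nonneg hd
  have hc := F.cZero_nonneg
  have hH := F.height_pos
  have hd0 : (0 : ℝ) < d := by positivity
  set E := if Units.rank K = 0 then 0 else C.infty with hE
  have hE0 : 0 ≤ E := by rw [hE]; split_ifs <;> first | exact le_rfl | exact hC
  set L' : ℝ := 1 + if 1 < n * m then 0 else Real.posLog (X ^ (1 / (d : ℝ))) with hL'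
  have hL'0 : 0 ≤ L' := by
    have := Real.posLog_nonneg (x := X ^ (1 / (d : ℝ)))
    rw [hL']; split_ifs <;> linarith
  set S := (B + E) / F.height ^ (1 / (d : ℝ)) * X ^ (1 / (d : ℝ)) with hS
  have hS0 : 0 ≤ S := by positivity
  have hpow : X ^ ((n * (m + 1) : ℝ) / d) = (X ^ ((n : ℝ) / d)) ^ (m + 1) := by
    rw [← Real.rpow_natCast, ← Real.rpow_mul hX]
    congr 1
    push_cast
    ring
  rcases lt_or_ge X 1 with hX1 | hX1
  · rw [F.points_eq_empty hX1]
    refine ⟨Set.finite_empty, ?_⟩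
    rw [Set.ncard_empty, Nat.cast_zero, zero_sub, abs_neg, abs_of_nonneg (by positivity)]
    have h1 : X ^ ((n * (m + 1) : ℝ) / d) ≤ X ^ ((n : ℝ) / d) := by
      refine Real.rpow_le_rpow_of_exponent_ge' hX hX1.le (by positivity) ?_
      gcongr
      exact le_mul_of_one_le_right hn0.le (by
        have : (0 : ℝ) ≤ m := by positivity
        linarith)
    calc _ ≤ 1 * (0 + (0 + F.mainConstant) * X ^ ((n : ℝ) / d)) := by
          rw [one_mul, zero_add, zero_add]
          gcongr
      _ ≤ _ := by
          gcongr
          · exact le_add_of_nonneg_left (by positivity)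
          · positivity
          · positivity
  · obtain ⟨R, hR⟩ := C.exists_residueData hd
    obtain ⟨hfin, hle⟩ := hasymp M d hd F R N (B * D) C.infty hN (by positivity) hC
      (F.hasLipschitzSpheres_gauge hd hB hLip) (C.isBoundedBy hd) X hX1
    refine ⟨hfin, ?_⟩
    rw [hpow, F.mainConstant_eq hd]
    rw [F.mainConstant_eq hd] at hκ
    refine hle.trans ?_
    have hq : (Ideal.absNorm R.modulus : ℝ) ≤ C.zero ^ d := R.absNorm_modulus ▸ hR
    have hq1 : (Ideal.absNorm R.modulus : ℝ) ^ (n : ℝ)⁻¹ ≤ C.zero ^ ((d : ℝ) / n) := by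
      calc _ ≤ (C.zero ^ d) ^ (n : ℝ)⁻¹ := by gcongr
        _ = _ := by rw [← Real.rpow_natCast, ← Real.rpow_mul hZ, div_eq_mul_inv]
    have hq2 : (Ideal.absNorm R.modulus : ℝ) ^ (m + 1) ≤ C.zero ^ (d * (m + 1)) := by
      rw [pow_mul]
      gcongr
    have hS1 : F.errorScale (B * D + E) X ≤ D * S := by
      rw [F.errorScale_eq _ hX, hS, ← mul_assoc, ← mul_div_assoc]
      gcongr
      nlinarith
    have hS2 : 0 ≤ F.errorScale (B * D + E) X := by
      rw [F.errorScale_eq _ hX]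
      positivity
    have hL : (1 + if 1 < n * m then 0 else Real.log (X ^ ((n : ℝ) / d))) ≤ L' := by
      rw [hL']
      refine add_le_add le_rfl ?_
      split_ifs with hnm
      · exact le_rfl
      -- The logarithm survives only for `n = 1`, where `X^(n/d)` and `X^(1/d)` coincide.
      · have hn1' : n = 1 := le_antisymm
          ((Nat.le_mul_of_pos_right n hm).trans (not_lt.1 hnm)) hn1
        rw [hn1', Nat.cast_one, Real.posLog_def]
        exact le_max_right _ _
    have hLnn : 0 ≤ 1 + if 1 < n * m then 0 else Real.log (X ^ ((n : ℝ) / d)) := by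
      have := Real.log_nonneg (Real.one_le_rpow hX1 (by positivity : 0 ≤ (n : ℝ) / d))
      split_ifs <;> linarith
    exact scaled_error_le hA.le hD1 (by positivity) hc (by positivity) hS2 hLnn (by positivity) hκ
      (by positivity) hq1 hS1 hL hq2

theorem finite_points (hm : 1 ≤ m) (hd : 1 ≤ d) (X : ℝ) : (F.points X).Finite := by
  obtain ⟨A, -, h⟩ := exists_error_bound K m hm
  obtain ⟨N, B, hN, hNB⟩ := F.exists_isLipschitzClass hd
  obtain ⟨C⟩ := F.nonempty_errorConstants hd
  rcases lt_or_ge X 1 with hX | hX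
  · rw [F.points_eq_empty hX]
    exact Set.finite_empty
  · exact (h M d hd F N B hN hNB C X (by linarith)).1

end MorphismLift

end Main

end SchanuelMorphism

end

theorem theorem1 (K : Type*) [Field K] [NumberField K] (n : ℕ) (hn : Module.finrank ℚ K = n)
    (m : ℕ) (hm : 1 ≤ m) :
    -- the implied constant, depending only on `m` and `K`
    ∃ A : ℝ, 0 < A ∧ ∀ (M d : ℕ), 1 ≤ d → ∀ F : MorphismLift K m M d,
      -- the quantities in the formula are well defined
      (∀ X : ℝ, (F.points X).Finite) ∧
      (∀ v : InfinitePlace K, archVolume v (F.archDomain v) ≠ ⊤) ∧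
      (∀ v : HeightOneSpectrum (𝓞 K),
        IntegrableOn (F.finIntegrand v) (unitPolydisc m v) (finHaar m v)) ∧
      {v : HeightOneSpectrum (𝓞 K) | F.finFactor v ≠ 1}.Finite ∧
      Nonempty F.ErrorConstants ∧
      -- the archimedean boundaries are of finite Lipschitz class
      (∀ v : InfinitePlace K, frontier (F.archDomain v) = F.archBoundary v) ∧
      (∃ (N : ℕ) (B : ℝ), 0 < N ∧ ∀ v : InfinitePlace K, IsLipschitzClass v (F.archBoundary v) N B) ∧
      -- the asymptotic formula
      ∀ (N : ℕ) (B : ℝ), 0 < N → (∀ v : InfinitePlace K, IsLipschitzClass v (F.archBoundary v) N B) →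
        ∀ (C : F.ErrorConstants) (X : ℝ), 0 ≤ X →
          |((F.points X).ncard : ℝ) - F.mainConstant * X ^ ((n * (m + 1) : ℝ) / d)| ≤
            A * ((N : ℝ) ^ n * F.cZero * C.zero ^ ((d : ℝ) / n) *
                  ((B + if Units.rank K = 0 then 0 else C.infty) / F.height ^ (1 / (d : ℝ)) *
                    X ^ (1 / (d : ℝ))) ^ (n * (m + 1) - 1) *
                  (1 + if 1 < n * m then 0 else Real.posLog (X ^ (1 / (d : ℝ)))) +
                ((N : ℝ) ^ n * C.zero ^ (d * (m + 1)) + F.mainConstant) *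
                  X ^ ((n : ℝ) / d)) := by
  subst hn
  obtain ⟨A, hA, h⟩ := MorphismLift.exists_error_bound K m hm
  refine ⟨A, hA, fun M d hd F => ⟨F.finite_points hm hd, fun v => F.archVolume_ne_top v hd,
    fun v => F.integrableOn_finIntegrand v hd, F.finite_finFactor_ne_one hd,
    F.nonempty_errorConstants hd, fun v => F.frontier_archDomain v hd, F.exists_isLipschitzClass hd,
    fun N B hN hLip C X hX => (h M d hd F N B hN hLip C X hX).2⟩⟩
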